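/- **Setting.** Let $n\ge 2$ and write points of $\mathbb R^{n+1}$ as $X=(x,t)$, $x\in\mathbb R^n$, $t\in\mathbb R$; $\mathbb R^{n+1}_\pm=\{\pm t>0\}$, $e_{n+1}=(0,\dots,0,1)$, and $B(X,r)$ is the Euclidean ball. Let $A=A(x)$ be an $(n+1)\times(n+1)$ matrix of complex, $L^\infty$, $t$-independent coefficients with $\Lambda^{-1}|\xi|^2\le \mathrm{Re}\sum_{i,j}A_{ij}(x)\xi_j\overline{\xi_i}$ and $\|A\|_\infty\le\Lambda$ for all $\xi\in\mathbb C^{n+1}$ and a.e. $x$. Let $L=-\mathrm{div}A\nabla$, with Hermitian adjoint $L^*=-\mathrm{div}A^*\nabla$. A solution of $Lu=0$ in an open set $\Omega$ is a $u\in L^2_{1,\mathrm{loc}}(\Omega)$ with $\int A\nabla u\cdot\nabla\Phi=0$ for all $\Phi\in C_0^\infty(\Omega)$ (no complex conjugation in the dot product). Assume that $L$ and $L^*$ satisfy the *standard assumptions*: in addition to the above, there are $C_0\in(0,\infty)$ and $\alpha\in(0,1]$ such that every solution $v$, of $Lv=0$ or of $L^*v=0$, in an open set $\Omega$ satisfies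 (for its continuous representative), whenever $B(X,2R)\subset\Omega$ and $Y,Z\in B(X,R)$, $$|v(Y)-v(Z)|\le C_0\Big(\frac{|Y-Z|}{R}\Big)^{\alpha}\Big(\frac{1}{|B(X,2R)|}\int_{B(X,2R)}|v|^2\Big)^{1/2},\qquad |v(Y)|\le C_0\Big(\frac{1}{|B(X,2R)|}\int_{B(X,2R)}|v|^2\Big)^{1/2}.$$ The *standard constants* are $n,\Lambda,C_0,\alpha$. Solutions are identified with their continuous representatives. For such $u$ and each $t$, $\nabla u(\cdot,t)=(\nabla_xu(\cdot,t),\partial_tu(\cdot,t))$, where $\nabla_x u(\cdot,t)$ is the weak gradient of $u(\cdot,t)$ on $\mathbb R^n$. For $x_0\in\mathbb R^n$ put $\Gamma^\pm(x_0)=\{(x,t):|x_0-x|<\pm t\}$ and $$\widetilde N^\pm_*(F)(x_0)=\sup_{(x,t)\in\Gamma^\pm(x_0)}\Big(\frac{1}{|B((x,t),|t|/4)|}\int_{B((x,t),|t|/4)}|F|^2\Big)^{1/2}.$$ We say that $u\to f$ non-tangentially if, for a.e. $x\in\mathbb R^n$, $u(y,t)\to f(x)$ as $(y,t)\to(x,0)$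 within $\Gamma^\pm(x)$. For $1<p<\infty$, $\dot L^p_1(\mathbb R^n)$ is the completion of $C_0^\infty(\mathbb R^n)$ in the norm $\|\nabla f\|_p$, realized in $L^1_{\mathrm{loc}}(\mathbb R^n)/\mathbb C$. For $0<p\le 1$, $H^p_{\mathrm{at}}(\mathbb R^n)\subset\mathbf S'(\mathbb R^n)$ is the classical atomic Hardy space. For $n/(n+1)<p\le1$, a *regular atom* is an $a\in\dot L^2_1(\mathbb R^n)$ supported in a cube $Q$ with sides parallel to the axes and with $\|\nabla a\|_{L^2(Q)}\le|Q|^{1/2-1/p}$, and $\dot H^{1,p}(\mathbb R^n)$ is the space of $f\in\mathbf S'(\mathbb R^n)/\mathbb C$ such that $\nabla f=\sum_j\lambda_j\nabla a_j$ with $(\lambda_j)\in\ell^p$ and regular atoms $a_j$, the series converging in $H^p_{\mathrm{at}}(\mathbb R^n)$. **Lemma 5.2.** There exists $\epsilon>0$, depending only on the standard constants, such that the following holds for each choice of sign $\pm$. Suppose that $L$ and $L^*$ satisfy the standard assumptions, that $Lu=0$ in $\mathbb R^{n+1}_\pm$, and that $\widetilde N^\pm_*(\nabla u)\in L^p(\mathbb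 R^n)$ for some $n/(n+1)<p<\infty$. (a) If $1<p<2+\epsilon$, then $u$ has a variational co-normal derivative $\partial_\nu u(\cdot,0)\in L^p(\mathbb R^n)$, that is, for all $\Phi\in C_0^\infty(\mathbb R^{n+1})$ the left-hand integrand below is integrable and $$\int_{\mathbb R^{n+1}_\pm}A\nabla u\cdot\nabla\Phi\,dX=\pm\int_{\mathbb R^n}\partial_\nu u(x,0)\,\Phi(x,0)\,dx,$$ and a non-tangential trace $u(\cdot,0)\in\dot L^p_1(\mathbb R^n)$, that is, $u\to u(\cdot,0)$ non-tangentially; and $$\sup_{\pm t>0}\|\nabla u(\cdot,t)\|_{L^p(\mathbb R^n)}\le C_p\|\widetilde N^\pm_*(\nabla u)\|_{L^p(\mathbb R^n)},$$ $$-e_{n+1}\cdot A\nabla u(\cdot,t)\to\partial_\nu u(\cdot,0)\quad\text{and}\quad\nabla_xu(\cdot,t)\to\nabla_xu(\cdot,0)\quad\text{weakly in }L^p\text{ as }t\to0^\pm,$$ where $C_p$ depends only on $p$ and the standard constants. (b) If $n/(n+1)<p\le1$ and there exists $h\in\dot H^{1,p}(\mathbb R^n)$ such that $\nabla_xu(\cdot,t)\to\nabla_xh$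 in the sense of tempered distributions as $t\to0^\pm$, then $u(\cdot,0)=h$ in the sense of $\dot H^{1,p}(\mathbb R^n)$; that is, $u$ has a non-tangential limit $u(\cdot,0)$ almost everywhere, which defines an element of $\dot H^{1,p}(\mathbb R^n)$, and this element is $h$ (equality modulo constants). -/

import Mathlib

open MeasureTheory Filter Topology Set
open scoped ENNReal NNReal ContDiff SchwartzMap LineDeriv

noncomputable section

namespace LayerPot

/-! ### Points, balls, half-spaces -/

/-- The boundary `ℝⁿ`, with its Euclidean norm. -/
abbrev Rn (n : ℕ) : Type := EuclideanSpace ℝ (Fin n)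

/-- Points `X = (x, t)` of `ℝⁿ⁺¹ = ℝⁿ × ℝ`, with the product (Lebesgue) measure. The norm that the
product type carries is never used below for balls: these are Euclidean, see `eball`. -/
abbrev Rn1 (n : ℕ) : Type := EuclideanSpace ℝ (Fin n) × ℝ

/-- Complex `m`-vectors with the Hermitian norm. -/
abbrev Cv (m : ℕ) : Type := EuclideanSpace ℂ (Fin m)

/-- Euclidean distance `|X - Y|` in `ℝⁿ⁺¹`. -/
def edst {n : ℕ} (X Y : Rn1 n) : ℝ := Real.sqrt (‖X.1 - Y.1‖ ^ 2 + (X.2 - Y.2) ^ 2)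

/-- Euclidean ball `B(X, r)` in `ℝⁿ⁺¹`. -/
def eball {n : ℕ} (X : Rn1 n) (r : ℝ) : Set (Rn1 n) := {Y | edst X Y < r}

/-- The coordinate direction `e_{i+1}` of `ℝⁿ`. -/
def dirX {n : ℕ} (i : Fin n) : Rn n := EuclideanSpace.single i (1 : ℝ)

/-- The coordinate directions of `ℝⁿ⁺¹`; the last one is the `t` direction. -/
def dir {n : ℕ} (i : Fin (n + 1)) : Rn1 n :=
  Fin.lastCases (motive := fun _ => Rn1 n) ((0 : Rn n), (1 : ℝ)) (fun j => (dirX j, (0 : ℝ))) i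

/-- The half-space `{(x, t) : σ t > 0}`: upper for `σ = 1`, lower for `σ = -1`. -/
def halfSpace (n : ℕ) (σ : ℝ) : Set (Rn1 n) := {X | 0 < σ * X.2}

/-- The cone `Γ^±(x₀) = {(x, t) : |x₀ - x| < ± t}`. -/
def cone {n : ℕ} (σ : ℝ) (x₀ : Rn n) : Set (Rn1 n) := {X | ‖x₀ - X.1‖ < σ * X.2}

/-! ### Weak derivatives and Sobolev spaces -/

/-- `w` is the weak derivative of `u` in the direction `e` in the open set `Ω`, tested against
`C₀^∞(Ω)`. -/
def HasWeakDeriv {E : Type*} [NormedAddCommGroup E] [NormedSpace ℝ E] [MeasureSpace E]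
    (Ω : Set E) (e : E) (u w : E → ℂ) : Prop :=
  ∀ φ : E → ℂ, ContDiff ℝ ∞ φ → HasCompactSupport φ → tsupport φ ⊆ Ω →
    ∫ x, u x * fderiv ℝ φ x e = -∫ x, w x * φ x

/-- `f ∈ L²_loc(Ω)`. -/
def LocL2 {E F : Type*} [TopologicalSpace E] [MeasureSpace E] [NormedAddCommGroup F]
    (Ω : Set E) (f : E → F) : Prop :=
  ∀ K : Set E, IsCompact K → K ⊆ Ω → MemLp f 2 (volume.restrict K)

/-- The (representative) function `f` belongs to the homogeneous Sobolev space `L̇^p_1(ℝⁿ)` and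
`F` is its gradient. The space is the completion of `C₀^∞(ℝⁿ)` for `‖∇φ‖_p`, realized in `L¹_loc`
modulo constants: `f` is locally integrable, has the weak gradient `F ∈ L^p`, and `F` is the limit
in `L^p` of gradients of `C₀^∞` functions. -/
structure HomSobolev {n : ℕ} (p : ℝ≥0∞) (f : Rn n → ℂ) (F : Rn n → Cv n) : Prop where
  locInt : LocallyIntegrable f
  memLp : MemLp F p
  weakGrad : ∀ i, HasWeakDeriv Set.univ (dirX i) f (fun x => F x i)
  approx : ∃ φ : ℕ → Rn n → ℂ, (∀ k, ContDiff ℝ ∞ (φ k) ∧ HasCompactSupport (φ k)) ∧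
    ∀ i, Tendsto (fun k => eLpNorm (fun x => fderiv ℝ (φ k) x (dirX i) - F x i) p volume)
      atTop (𝓝 0)

/-! ### The operator and the standard assumptions -/

/-- Coefficients: `t`-independent complex `(n+1) × (n+1)` matrices. -/
abbrev Coeff (n : ℕ) : Type := Rn n → Matrix (Fin (n + 1)) (Fin (n + 1)) ℂ

/-- `∑ᵢⱼ Aᵢⱼ(x) ξⱼ conj(ηᵢ)`. -/
def sesq {n : ℕ} (M : Matrix (Fin (n + 1)) (Fin (n + 1)) ℂ) (ξ η : Cv (n + 1)) : ℂ :=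
  ∑ i, ∑ j, M i j * ξ j * (starRingEnd ℂ) (η i)

/-- `A ∈ L^∞` is uniformly elliptic with parameter `Λ`. -/
structure Elliptic {n : ℕ} (A : Coeff n) (Λ : ℝ) : Prop where
  meas : ∀ i j, AEStronglyMeasurable (fun x => A x i j) (volume : Measure (Rn n))
  lower : ∀ᵐ x : Rn n, ∀ ξ : Cv (n + 1), Λ⁻¹ * ‖ξ‖ ^ 2 ≤ (sesq (A x) ξ ξ).re
  upper : ∀ᵐ x : Rn n, ∀ ξ η : Cv (n + 1), ‖sesq (A x) ξ η‖ ≤ Λ * ‖ξ‖ * ‖η‖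

/-- The integrand `A ∇u · ∇Φ` (bilinear, no conjugation), where `G = ∇u`. -/
def energy {n : ℕ} (A : Coeff n) (G : Rn1 n → Cv (n + 1)) (Φ : Rn1 n → ℂ) (X : Rn1 n) : ℂ :=
  ∑ i, ∑ j, A X.1 i j * G X j * fderiv ℝ Φ X (dir i)

/-- `u ∈ L²_{1,loc}(Ω)`, with weak gradient `G`, is a weak solution of `-div A∇u = 0` in `Ω`. -/
structure IsSolution {n : ℕ} (A : Coeff n) (Ω : Set (Rn1 n)) (u : Rn1 n → ℂ)
    (G : Rn1 n → Cv (n + 1)) : Prop where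
  locL2 : LocL2 Ω u
  gradLocL2 : LocL2 Ω G
  weakGrad : ∀ i, HasWeakDeriv Ω (dir i) u (fun X => G X i)
  eqn : ∀ Φ : Rn1 n → ℂ, ContDiff ℝ ∞ Φ → HasCompactSupport Φ → tsupport Φ ⊆ Ω →
    ∫ X, energy A G Φ X = 0

/-- `(⨍_B |F|²)^{1/2}`, with value in `[0, ∞]`. -/
def rms {n : ℕ} {V : Type*} [NormedAddCommGroup V] (F : Rn1 n → V) (B : Set (Rn1 n)) : ℝ≥0∞ :=
  (⨍⁻ Y in B, ‖F Y‖ₑ ^ 2 ∂volume) ^ (1 / 2 : ℝ)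

/-- Solutions of `Lu = 0` satisfy the interior De Giorgi/Nash and Moser estimates with constants
`C₀` and `α`. A solution is determined up to a null set; the estimates are about its continuous
representative. -/
def DGNM {n : ℕ} (A : Coeff n) (C₀ α : ℝ) : Prop :=
  ∀ (Ω : Set (Rn1 n)) (u : Rn1 n → ℂ) (G : Rn1 n → Cv (n + 1)), IsOpen Ω → IsSolution A Ω u G →
    ∃ v : Rn1 n → ℂ, v =ᵐ[volume.restrict Ω] u ∧
      ∀ (X : Rn1 n) (R : ℝ), 0 < R → eball X (2 * R) ⊆ Ω →
        (∀ Y ∈ eball X R, ∀ Z ∈ eball X R,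
          ‖v Y - v Z‖ₑ ≤ ENNReal.ofReal (C₀ * (edst Y Z / R) ^ α) * rms v (eball X (2 * R))) ∧
        (∀ Y ∈ eball X R, ‖v Y‖ₑ ≤ ENNReal.ofReal C₀ * rms v (eball X (2 * R)))

/-- `L` satisfies the standard assumptions, with the constants `Λ`, `C₀`, `α`. -/
structure Standard {n : ℕ} (A : Coeff n) (Λ C₀ α : ℝ) : Prop where
  elliptic : Elliptic A Λ
  dgnm : DGNM A C₀ α

/-- The coefficients `A*` of the Hermitian adjoint `L*`. -/
def adjCoeff {n : ℕ} (A : Coeff n) : Coeff n := fun x => (A x).conjTranspose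

/-! ### Non-tangential maximal function, non-tangential convergence, slices -/

/-- `Ñ_*^± F`. -/
def ntMax {n : ℕ} (σ : ℝ) (F : Rn1 n → Cv (n + 1)) (x₀ : Rn n) : ℝ≥0∞ :=
  ⨆ X ∈ cone σ x₀, rms F (eball X (|X.2| / 4))

/-- The `L^p(ℝⁿ)` (quasi-)norm of a `[0, ∞]`-valued function, `0 < p < ∞`. -/
def pNorm {n : ℕ} (p : ℝ) (f : Rn n → ℝ≥0∞) : ℝ≥0∞ := (∫⁻ x, f x ^ p) ^ (1 / p)

/-- `u` converges non-tangentially to `f` from the half-space of sign `σ`. -/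
def NTLimit {n : ℕ} (σ : ℝ) (u : Rn1 n → ℂ) (f : Rn n → ℂ) : Prop :=
  ∀ᵐ x : Rn n, Tendsto u (𝓝[cone σ x] (x, (0 : ℝ))) (𝓝 (f x))

/-- The filter `t → 0^±`. -/
def toZero (σ : ℝ) : Filter ℝ := 𝓝[{t : ℝ | 0 < σ * t}] 0

/-- `v` is the gradient `∇u(·, t)` on the horizontal slice at height `t`, for a continuous `u`:
its first `n` components are the weak gradient of `x ↦ u(x, t)` on `ℝⁿ`, its last component is
`∂ₜu(·, t)`. This determines `v` almost everywhere. -/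
structure IsSliceGrad {n : ℕ} (u : Rn1 n → ℂ) (t : ℝ) (v : Rn n → Cv (n + 1)) : Prop where
  locInt : LocallyIntegrable v
  tangential : ∀ i : Fin n,
    HasWeakDeriv Set.univ (dirX i) (fun x => u (x, t)) (fun x => v x i.castSucc)
  vertical : ∀ᵐ x : Rn n, HasDerivAt (fun s => u (x, s)) (v x (Fin.last n)) t

/-- `-e_{n+1} · A(x) v(x)`. -/
def conormal {n : ℕ} (A : Coeff n) (v : Rn n → Cv (n + 1)) (x : Rn n) : ℂ :=
  -∑ j, A x (Fin.last n) j * v x j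

/-- `g ∈ L^p(ℝⁿ)` is the variational co-normal derivative `∂_ν u(·, 0)`, where `G = ∇u`. -/
structure IsVarConormal {n : ℕ} (A : Coeff n) (σ p : ℝ) (G : Rn1 n → Cv (n + 1))
    (g : Rn n → ℂ) : Prop where
  memLp : MemLp g (ENNReal.ofReal p)
  eqn : ∀ Φ : Rn1 n → ℂ, ContDiff ℝ ∞ Φ → HasCompactSupport Φ →
    IntegrableOn (energy A G Φ) (halfSpace n σ) ∧
      ∫ X in halfSpace n σ, energy A G Φ X = (σ : ℂ) * ∫ x, g x * Φ (x, 0)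

/-- `F t → f` weakly in `L^p(ℝⁿ)` along the filter `l`, for `1 < p < ∞`. -/
structure WeakLp {n : ℕ} (p : ℝ) (F : ℝ → Rn n → ℂ) (l : Filter ℝ) (f : Rn n → ℂ) : Prop where
  memLp : ∀ᶠ t in l, MemLp (F t) (ENNReal.ofReal p)
  memLp_lim : MemLp f (ENNReal.ofReal p)
  tendsto : ∀ ψ : Rn n → ℂ, MemLp ψ (ENNReal.ofReal (p / (p - 1))) →
    Tendsto (fun t => ∫ x, F t x * ψ x) l (𝓝 (∫ x, f x * ψ x))

/-! ### Hardy and Hardy-Sobolev spaces -/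

/-- `H^p` atoms on `ℝⁿ`, `0 < p ≤ 1`. -/
structure IsHardyAtom {n : ℕ} (p : ℝ) (b : Rn n → ℂ) : Prop where
  meas : AEStronglyMeasurable b (volume : Measure (Rn n))
  bound : ∃ (c : Rn n) (r : ℝ), 0 < r ∧ (∀ᵐ x : Rn n, x ∉ Metric.ball c r → b x = 0) ∧
    ∀ᵐ x : Rn n, ‖b x‖ₑ ≤ volume (Metric.ball c r) ^ (-1 / p)
  moments : ∀ β : Fin n → ℕ, ((∑ i, β i : ℕ) : ℝ) ≤ n * (1 / p - 1) →
    ∫ x : Rn n, ((∏ i, x i ^ β i : ℝ) : ℂ) * b x = 0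

/-- The atomic quasi-norm of a functional `D` on Schwartz functions: the infimum of
`(∑ₖ |μₖ|^p)^{1/p}` over all representations `D = ∑ₖ μₖ bₖ` in `S'` with `H^p` atoms `bₖ`; it is
`∞` if there is none. -/
def hardyNorm {n : ℕ} (p : ℝ) (D : 𝓢(Rn n, ℂ) → ℂ) : ℝ≥0∞ :=
  ⨅ (μ : ℕ → ℂ) (b : ℕ → Rn n → ℂ) (_ : ∀ k, IsHardyAtom p (b k))
    (_ : ∀ φ : 𝓢(Rn n, ℂ), HasSum (fun k => μ k * ∫ x, b k x * φ x) (D φ)),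
    (∑' k, ‖μ k‖ₑ ^ p) ^ (1 / p)

/-- The cube with sides parallel to the axes, centre `c` and side length `ℓ`. -/
def cube {n : ℕ} (c : Rn n) (ℓ : ℝ) : Set (Rn n) := {x | ∀ i, |x i - c i| ≤ ℓ / 2}

/-- `a ∈ L̇²_1`, with gradient `F`, is a regular atom for `Ḣ^{1,p}`. -/
structure IsRegularAtom {n : ℕ} (p : ℝ) (a : Rn n → ℂ) (F : Rn n → Cv n) : Prop where
  sobolev : HomSobolev 2 a F
  bound : ∃ (c : Rn n) (ℓ : ℝ), 0 < ℓ ∧ (∀ᵐ x : Rn n, x ∉ cube c ℓ → a x = 0) ∧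
    eLpNorm F 2 (volume.restrict (cube c ℓ)) ≤ volume (cube c ℓ) ^ (1 / 2 - 1 / p)

/-- `h ∈ Ḣ^{1,p}_at(ℝⁿ)`, `n/(n+1) < p ≤ 1`: `∇h = ∑ⱼ λⱼ ∇aⱼ` with regular atoms `aⱼ` and
`(λⱼ) ∈ ℓ^p`, where the series converges in the atomic Hardy space. -/
def HardySobolev {n : ℕ} (p : ℝ) (h : 𝓢'(Rn n, ℂ)) : Prop :=
  ∃ (lam : ℕ → ℂ) (a : ℕ → Rn n → ℂ) (F : ℕ → Rn n → Cv n),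
    Summable (fun j => ‖lam j‖ ^ p) ∧ (∀ j, IsRegularAtom p (a j) (F j)) ∧
    ∀ i : Fin n, Tendsto (fun N : ℕ => hardyNorm p (fun φ =>
      -h (∂_{dirX i} φ) - ∑ j ∈ Finset.range N, lam j * ∫ x, F j x i * φ x)) atTop (𝓝 0)

/-- The tempered distribution `T` is given by the function `f`. -/
def Represents {n : ℕ} (f : Rn n → ℂ) (T : 𝓢'(Rn n, ℂ)) : Prop :=
  ∀ φ : 𝓢(Rn n, ℂ), Integrable (fun x => f x * φ x) ∧ T φ = ∫ x, f x * φ x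

/-- `S` and `T` agree modulo constants, that is, in `S'(ℝⁿ)/ℂ`. -/
def EqModConst {n : ℕ} (S T : 𝓢'(Rn n, ℂ)) : Prop :=
  ∃ c : ℂ, ∀ φ : 𝓢(Rn n, ℂ), S φ = T φ + c * ∫ x, φ x

/-- `∇ₓu(·, t) → ∇h` in the sense of tempered distributions as `t → 0^±`, where
`⟨∂ᵢu(·, t), φ⟩ = -∫ u(x, t) ∂ᵢφ(x) dx`. -/
def SliceGradTendsto {n : ℕ} (σ : ℝ) (u : Rn1 n → ℂ) (h : 𝓢'(Rn n, ℂ)) : Prop :=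
  ∀ (i : Fin n) (φ : 𝓢(Rn n, ℂ)),
    Tendsto (fun t : ℝ => -∫ x, u (x, t) * (∂_{dirX i} φ) x) (toZero σ)
      (𝓝 (-h (∂_{dirX i} φ)))

end LayerPot

end

set_option linter.unusedSectionVars false

noncomputable section

namespace LayerPot

open Metric
open Metric renaming closedBall → cB
open Module (finrank)
open ENNReal (ofReal ofReal_mul ofReal_ne_top ofReal_le_ofReal mul_ne_top coe_ne_top
  rpow_ne_top_of_nonneg rpow_mul rpow_le_rpow mul_rpow_of_nonneg ofReal_pow rpow_one toReal_ofReal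
  ofReal_one coe_rpow_of_nonneg ofReal_toReal toReal_nonneg toReal_mul rpow_natCast
  ofReal_le_ofReal_iff ofReal_div_of_pos ofReal_coe_nnreal)

variable {n : ℕ} {σ Λ : ℝ} {A : Coeff n}
variable {E : Type*} [NormedAddCommGroup E] [NormedSpace ℝ E] [FiniteDimensional ℝ E]
  [MeasureSpace E] [BorelSpace E] [(volume : Measure E).IsAddHaarMeasure]

local notation "volOn" => Measure.restrict volume

/-- Vector fields on `ℝⁿ⁺¹`. -/
abbrev VF (n : ℕ) := Rn1 n → Cv (n + 1)

/-! ### Mollification -/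

lemma vol_cB_ne (X : E) (r : ℝ) : volume (cB X r) ≠ ⊤ := (isCompact_closedBall X r).measure_lt_top.ne

instance isAddHaarMeasure_volume_rn1 (n : ℕ) :
    (volume : Measure (Rn1 n)).IsAddHaarMeasure :=
  inferInstanceAs ((volume : Measure (Rn n)).prod (volume : Measure ℝ)).IsAddHaarMeasure

section

variable {V : Type*} [NormedAddCommGroup V] [NormedSpace ℝ V]

/-- The mollification `φ ⋆ f` by a normalized bump. -/
def moll (φ : ContDiffBump (0 : E)) (f : E → V) : E → V :=
  MeasureTheory.convolution (φ.normed volume) f (ContinuousLinearMap.lsmul ℝ ℝ) volume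

lemma moll_apply (φ : ContDiffBump (0 : E)) (f : E → V) (x : E) :
    moll φ f x = ∫ y, φ.normed volume y • f (x - y) := rfl

lemma moll_apply_swap (φ : ContDiffBump (0 : E)) (f : E → V) (x : E) :
    moll φ f x = ∫ y, φ.normed volume (x - y) • f y := by
  rw [moll, convolution_eq_swap]; rfl

lemma moll_contDiff [CompleteSpace V] (φ : ContDiffBump (0 : E)) {f : E → V}
    (hf : LocallyIntegrable f) : ContDiff ℝ ∞ (moll φ f) :=
  φ.hasCompactSupport_normed.contDiff_convolution_left _ (n := ⊤) φ.contDiff_normed hf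

lemma moll_congr (φ : ContDiffBump (0 : E)) {f g : E → V} (h : f =ᵐ[volume] g) :
    moll φ f = moll φ g := by
  ext x
  rw [moll_apply_swap, moll_apply_swap]
  exact integral_congr_ae (h.mono fun y hy => by simp only [hy])

lemma moll_support_subset (φ : ContDiffBump (0 : E)) {f : E → V} {K : Set E}
    (hf : ∀ x, x ∉ K → f x = 0) : Function.support (moll φ f) ⊆ thickening φ.rOut K := by
  intro x hx
  by_contra hcon
  apply hx
  rw [moll_apply]
  apply integral_eq_zero_of_ae
  refine .of_forall fun y => ?_
  by_cases hy : y ∈ ball (0 : E) φ.rOut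
  · have : x - y ∉ K := fun hK => hcon (mem_thickening_iff.2 ⟨x - y, hK, by
      simpa [dist_eq_norm] using hy⟩)
    simp [hf _ this]
  · have : φ.normed volume y = 0 := by
      have := φ.support_normed_eq (μ := (volume : Measure E))
      by_contra h
      exact hy (this ▸ h)
    simp [this]

lemma moll_tsupport_subset (φ : ContDiffBump (0 : E)) {f : E → V} {K : Set E}
    (hf : ∀ x, x ∉ K → f x = 0) : tsupport (moll φ f) ⊆ cthickening φ.rOut K :=
  closure_minimal ((moll_support_subset φ hf).trans (thickening_subset_cthickening _ _))
    isClosed_cthickening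

lemma moll_hasCompactSupport (φ : ContDiffBump (0 : E)) {f : E → V} {K : Set E}
    (hK : IsCompact K) (hf : ∀ x, x ∉ K → f x = 0) : HasCompactSupport (moll φ f) :=
  IsCompact.of_isClosed_subset hK.cthickening (isClosed_tsupport _) (moll_tsupport_subset φ hf)

lemma moll_fderiv (φ : ContDiffBump (0 : E)) {u w : E → ℂ} {e : E}
    (hu : LocallyIntegrable u) (h : HasWeakDeriv univ e u w) (x : E) :
    fderiv ℝ (moll φ u) x e = moll φ w x := by
  have h1 := (φ.hasCompactSupport_normed (μ := (volume : Measure E))).hasFDerivAt_convolution_left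
    (ContinuousLinearMap.lsmul ℝ ℝ) (φ.contDiff_normed (n := 1)) hu x
  rw [moll, h1.fderiv, convolution_eq_swap, ContinuousLinearMap.integral_apply]
  · have hs : ContDiff ℝ ∞ (fun y => (φ.normed volume (x - y) : ℂ)) :=
      Complex.ofRealCLM.contDiff.comp (φ.contDiff_normed.comp (contDiff_const.sub contDiff_id))
    have hc : HasCompactSupport (fun y => (φ.normed volume (x - y) : ℂ)) := by
      have : HasCompactSupport (fun y => φ.normed volume (x - y)) :=
        φ.hasCompactSupport_normed.comp_homeomorph (Homeomorph.subLeft x)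
      exact this.comp_left (g := fun r : ℝ => (r : ℂ)) (by simp)
    have h2 := h _ hs hc (subset_univ _)
    have hd : ∀ y, fderiv ℝ (fun y => (φ.normed volume (x - y) : ℂ)) y e
        = -((fderiv ℝ (φ.normed volume) (x - y) e : ℝ) : ℂ) := by
      intro y
      have hd1 : HasFDerivAt (φ.normed volume) (fderiv ℝ (φ.normed volume) (x - y)) (x - y) :=
        ((φ.contDiff_normed (n := 1)).differentiable (by simp) _).hasFDerivAt
      have hd2 := Complex.ofRealCLM.hasFDerivAt.comp y (hd1.comp y ((hasFDerivAt_id y).const_sub x))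
      have := hd2.fderiv
      simp only [Function.comp_def, Complex.ofRealCLM_apply] at this
      rw [this]; simp
    simp only [hd] at h2
    rw [moll_apply_swap]
    simp only [ContinuousLinearMap.precompL_apply, ContinuousLinearMap.lsmul_apply]
    rw [← neg_inj, ← integral_neg]
    calc _ = ∫ y, u y * -((fderiv ℝ (φ.normed volume) (x - y) e : ℝ) : ℂ) := by
          congr 1; ext y; simp [mul_comm]
      _ = _ := h2.trans (by congr 2; ext y; simp [mul_comm])
  · have := (φ.hasCompactSupport_normed (μ := (volume : Measure E))).fderiv ℝ
    have h2 := this.convolutionExists_left (ContinuousLinearMap.precompL E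
      (ContinuousLinearMap.lsmul ℝ ℝ : ℝ →L[ℝ] ℂ →L[ℝ] ℂ))
      ((φ.contDiff_normed (n := 1)).continuous_fderiv (by simp)) hu x
    exact h2.integrable_swap

lemma tendsto_eLpNorm_translate_sub {p : ℝ≥0∞} (hp1 : 1 ≤ p) (hp : p ≠ ⊤) {f : E → V}
    (hf : MemLp f p) :
    Tendsto (fun y : E => eLpNorm (fun x => f (x - y) - f x) p volume) (𝓝 0) (𝓝 0) := by
  have : Fact (1 ≤ p) := ⟨hp1⟩
  let g : E → C(E, E) := fun y => ⟨fun x => x - y, by fun_prop⟩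
  have hg : Continuous g := by
    refine ContinuousMap.continuous_of_continuous_uncurry _ ?_
    simp only [Function.uncurry_def]
    exact continuous_snd.sub continuous_fst
  have hmp : ∀ y, MeasurePreserving (g y) volume volume := fun y =>
    measurePreserving_sub_right volume y
  have h := (tendsto_const_nhds (x := hf.toLp f) (f := 𝓝 (0 : E))).compMeasurePreservingLp
    hg.continuousAt.tendsto hmp (hmp 0) hp
  have h2 := (h.sub_const (Lp.compMeasurePreserving (g 0) (hmp 0) (hf.toLp f))).norm
  rw [sub_self, norm_zero] at h2
  have h3 : ∀ y, eLpNorm (fun x => f (x - y) - f x) p volume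
      = ofReal ‖Lp.compMeasurePreserving (g y) (hmp y) (hf.toLp f)
        - Lp.compMeasurePreserving (g 0) (hmp 0) (hf.toLp f)‖ := by
    intro y
    rw [Lp.norm_def, ofReal_toReal (Lp.eLpNorm_ne_top _)]
    apply eLpNorm_congr_ae
    filter_upwards [Lp.coeFn_sub (Lp.compMeasurePreserving (g y) (hmp y) (hf.toLp f))
      (Lp.compMeasurePreserving (g 0) (hmp 0) (hf.toLp f)),
      Lp.coeFn_compMeasurePreserving (hf.toLp f) (hmp y),
      Lp.coeFn_compMeasurePreserving (hf.toLp f) (hmp 0),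
      (hmp y).quasiMeasurePreserving.ae_eq_comp hf.coeFn_toLp,
      (hmp 0).quasiMeasurePreserving.ae_eq_comp hf.coeFn_toLp] with x h1 h2 h3 h4 h5
    rw [h1, Pi.sub_apply, h2, h3, h4, h5]
    simp [g]
  simp only [h3]
  simpa using ENNReal.tendsto_ofReal h2

lemma lintegral_enorm_le_rpow {Ω : Type*} [MeasurableSpace Ω] {ν : Measure Ω}
    [IsProbabilityMeasure ν] {p : ℝ} (hp : 1 ≤ p) {g : Ω → V} (hg : AEStronglyMeasurable g ν) :
    (∫⁻ y, ‖g y‖ₑ ∂ν) ^ p ≤ ∫⁻ y, ‖g y‖ₑ ^ p ∂ν := by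
  have hp0 : 0 < p := by linarith
  have h := eLpNorm'_le_eLpNorm'_of_exponent_le one_pos hp ν hg
  simp only [eLpNorm'_eq_lintegral_enorm, rpow_one, div_one] at h
  calc _ ≤ ((∫⁻ y, ‖g y‖ₑ ^ p ∂ν) ^ (1 / p)) ^ p := rpow_le_rpow h hp0.le
    _ = _ := by rw [← rpow_mul, one_div_mul_cancel hp0.ne', rpow_one]

lemma eLpNorm_moll_sub_le [CompleteSpace V] {p : ℝ≥0∞} (hp1 : 1 ≤ p) (hp : p ≠ ⊤)
    (φ : ContDiffBump (0 : E)) {f : E → V} (hf : MemLp f p) {δ : ℝ≥0∞}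
    (hδ : ∀ y ∈ ball (0 : E) φ.rOut, eLpNorm (fun x => f (x - y) - f x) p volume ≤ δ) :
    eLpNorm (fun x => moll φ f x - f x) p volume ≤ δ := by
  wlog hsm : StronglyMeasurable f generalizing f
  · have hae := hf.1.ae_eq_mk
    have h1 := this (f := hf.1.mk f) (hf.ae_eq hae) (fun y hy => by
      refine le_trans (le_of_eq ?_) (hδ y hy)
      apply eLpNorm_congr_ae
      filter_upwards [hae, (measurePreserving_sub_right volume y).quasiMeasurePreserving.ae_eq_comp
        hae] with x h2 h3
      simp only [Function.comp_def] at h3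
      rw [h2, h3]) hf.1.stronglyMeasurable_mk
    refine le_trans (le_of_eq ?_) h1
    apply eLpNorm_congr_ae
    rw [moll_congr φ hae]
    filter_upwards [hae] with x hx
    rw [hx]
  have hp0 : p ≠ 0 := (zero_lt_one.trans_le hp1).ne'
  have hpr : 1 ≤ p.toReal := by rw [← ENNReal.toReal_one]; exact ENNReal.toReal_mono hp hp1
  set ν : Measure E := volume.withDensity fun y => ofReal (φ.normed volume y) with hν
  have hφm : Measurable (fun y => ofReal (φ.normed volume y)) :=
    (φ.contDiff_normed (n := 0)).continuous.measurable.ennreal_ofReal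
  have hprob : IsProbabilityMeasure ν := by
    constructor
    rw [hν, withDensity_apply _ MeasurableSet.univ, setLIntegral_univ,
      ← ofReal_integral_eq_lintegral_ofReal φ.integrable_normed
        (.of_forall fun y => φ.nonneg_normed y), φ.integral_normed, ofReal_one]
  have hmeas : Measurable (fun z : E × E => ‖f (z.1 - z.2) - f z.1‖ₑ ^ p.toReal) := by
    have : StronglyMeasurable (fun z : E × E => f (z.1 - z.2) - f z.1) :=
      (hsm.comp_measurable (measurable_fst.sub measurable_snd)).sub
        (hsm.comp_measurable measurable_fst)
    exact this.enorm.pow_const _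
  have hpt : ∀ x, ‖moll φ f x - f x‖ₑ ^ p.toReal ≤ ∫⁻ y, ‖f (x - y) - f x‖ₑ ^ p.toReal ∂ν := by
    intro x
    have hsm2 : StronglyMeasurable (fun y => f (x - y) - f x) :=
      (hsm.comp_measurable (measurable_const.sub measurable_id)).sub stronglyMeasurable_const
    refine le_trans (rpow_le_rpow ?_ (by linarith))
      (lintegral_enorm_le_rpow hpr hsm2.aestronglyMeasurable)
    have hex : Integrable (fun y => φ.normed volume y • f (x - y)) :=
      φ.hasCompactSupport_normed.convolutionExists_left
        (ContinuousLinearMap.lsmul ℝ ℝ) (φ.contDiff_normed (n := 0)).continuous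
        (hf.locallyIntegrable hp1) x
    have heq : moll φ f x - f x = ∫ y, φ.normed volume y • (f (x - y) - f x) := by
      simp only [smul_sub]
      rw [integral_sub hex (φ.integrable_normed.smul_const _), moll_apply, integral_smul_const,
        φ.integral_normed, one_smul]
    rw [heq, hν, lintegral_withDensity_eq_lintegral_mul₀ hφm.aemeasurable hsm2.enorm.aemeasurable]
    refine (enorm_integral_le_lintegral_enorm _).trans (le_of_eq ?_)
    congr 1; ext y
    rw [enorm_smul, Pi.mul_apply, Real.enorm_eq_ofReal (φ.nonneg_normed y)]
  rw [eLpNorm_eq_lintegral_rpow_enorm_toReal hp0 hp, one_div, ENNReal.rpow_inv_le_iff (by linarith)]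
  calc ∫⁻ x, ‖moll φ f x - f x‖ₑ ^ p.toReal
      ≤ ∫⁻ x, ∫⁻ y, ‖f (x - y) - f x‖ₑ ^ p.toReal ∂ν := lintegral_mono hpt
    _ = ∫⁻ y, (∫⁻ x, ‖f (x - y) - f x‖ₑ ^ p.toReal) ∂ν :=
        lintegral_lintegral_swap hmeas.aemeasurable
    _ ≤ ∫⁻ _, δ ^ p.toReal ∂ν := by
        apply lintegral_mono_ae
        rw [hν, ae_withDensity_iff hφm]
        refine .of_forall fun y hy => ?_
        have hyb : y ∈ ball (0 : E) φ.rOut := by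
          rw [← φ.support_normed_eq (μ := (volume : Measure E))]
          intro h0; apply hy; simp [h0]
        have := hδ y hyb
        rwa [eLpNorm_eq_lintegral_rpow_enorm_toReal hp0 hp, one_div,
          ENNReal.rpow_inv_le_iff (by linarith)] at this
    _ = δ ^ p.toReal := by simp

variable (E) in
/-- A fixed sequence of bumps shrinking to the origin. -/
def bump (k : ℕ) : ContDiffBump (0 : E) where
  rIn := 1 / (2 * (k + 1))
  rOut := 1 / (k + 1)
  rIn_pos := by positivity
  rIn_lt_rOut := by apply one_div_lt_one_div_of_lt <;> nlinarith [Nat.cast_nonneg (α := ℝ) k]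

lemma bump_rOut_tendsto : Tendsto (fun k => (bump E k).rOut) atTop (𝓝 0) :=
  tendsto_one_div_add_atTop_nhds_zero_nat

lemma tendsto_moll [CompleteSpace V] {p : ℝ≥0∞} (hp1 : 1 ≤ p) (hp : p ≠ ⊤) {f : E → V}
    (hf : MemLp f p) :
    Tendsto (fun k => eLpNorm (fun x => moll (bump E k) f x - f x) p volume) atTop (𝓝 0) := by
  rw [ENNReal.tendsto_nhds_zero]
  intro ε hε
  have h := ENNReal.tendsto_nhds_zero.1 (tendsto_eLpNorm_translate_sub hp1 hp hf) ε hε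
  obtain ⟨r, hr, hball⟩ := eventually_nhds_iff_ball.1 h
  filter_upwards [(bump_rOut_tendsto (E := E)).eventually_lt_const hr] with k hk
  exact eLpNorm_moll_sub_le hp1 hp _ hf fun y hy => hball y (ball_subset_ball hk.le hy)

end

/-! ### Calculus of weak derivatives -/

section

variable {Ω : Set E} {e : E} {u v w z : E → ℂ}

lemma integrable_mul_of_locInt (hu : LocallyIntegrableOn u Ω) {φ : E → ℂ}
    (hφ : Continuous φ) (hc : HasCompactSupport φ) (hs : tsupport φ ⊆ Ω) :
    Integrable (fun x => u x * φ x) := by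
  have h1 : IntegrableOn (fun x => u x * φ x) (tsupport φ) :=
    (hu.integrableOn_compact_subset hs hc).mul_continuousOn hφ.continuousOn hc
  refine (integrableOn_iff_integrable_of_support_subset ?_).1 h1
  intro x hx
  exact subset_tsupport φ (fun h => hx (by simp [h]))

lemma tsupport_fderiv_apply_subset (φ : E → ℂ) (e : E) :
    tsupport (fun x => fderiv ℝ φ x e) ⊆ tsupport φ := by
  refine closure_minimal (fun x hx => ?_) (isClosed_tsupport _)
  by_contra h
  exact hx (by simp [fderiv_of_notMem_tsupport ℝ h])

lemma cont_fderiv {φ : E → ℂ} (hφ : ContDiff ℝ ∞ φ) (e : E) :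
    Continuous (fun x => fderiv ℝ φ x e) :=
  (hφ.continuous_fderiv (by simp)).clm_apply continuous_const

lemma hcs_fderiv {φ : E → ℂ} (hφ : HasCompactSupport φ) (e : E) :
    HasCompactSupport (fun x => fderiv ℝ φ x e) := hφ.fderiv_apply ℝ e

lemma smooth_fderiv {φ : E → ℂ} (hφ : ContDiff ℝ ∞ φ) (e : E) :
    ContDiff ℝ ∞ (fun x => fderiv ℝ φ x e) :=
  (hφ.fderiv_right (m := ∞) (by simp)).clm_apply contDiff_const

lemma HasWeakDeriv.mono {Ω' : Set E} (h : HasWeakDeriv Ω e u w) (hs : Ω' ⊆ Ω) :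
    HasWeakDeriv Ω' e u w := fun φ h1 h2 h3 => h φ h1 h2 (h3.trans hs)

lemma HasWeakDeriv.add (hu : LocallyIntegrableOn u Ω) (hv : LocallyIntegrableOn v Ω)
    (hw : LocallyIntegrableOn w Ω) (hz : LocallyIntegrableOn z Ω)
    (h1 : HasWeakDeriv Ω e u w) (h2 : HasWeakDeriv Ω e v z) :
    HasWeakDeriv Ω e (fun x => u x + v x) (fun x => w x + z x) := by
  intro φ hφ hc hs
  have hc' := hcs_fderiv hc e
  have hs' := (tsupport_fderiv_apply_subset φ e).trans hs
  have hφ' := cont_fderiv hφ e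
  simp only [add_mul]
  rw [integral_add (integrable_mul_of_locInt hu hφ' hc' hs')
    (integrable_mul_of_locInt hv hφ' hc' hs'),
    integral_add (integrable_mul_of_locInt hw hφ.continuous hc hs)
    (integrable_mul_of_locInt hz hφ.continuous hc hs), h1 φ hφ hc hs, h2 φ hφ hc hs]
  ring

lemma HasWeakDeriv.const_mul (c : ℂ) (h : HasWeakDeriv Ω e u w) :
    HasWeakDeriv Ω e (fun x => c * u x) (fun x => c * w x) := by
  intro φ hφ hc hs
  simp only [mul_assoc, integral_const_mul]
  rw [h φ hφ hc hs, mul_neg]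

lemma hasWeakDeriv_const (c : ℂ) : HasWeakDeriv Ω e (fun _ => c) (fun _ => 0) := by
  intro φ hφ hc _
  have := integral_mul_fderiv_eq_neg_fderiv_mul_of_integrable (μ := (volume : Measure E))
    (f := fun _ : E => c) (g := φ) (v := e)
    (by simp) ((continuous_const.mul (cont_fderiv hφ e)).integrable_of_hasCompactSupport
      ((hcs_fderiv hc e).mul_left))
    ((continuous_const.mul hφ.continuous).integrable_of_hasCompactSupport hc.mul_left)
    (fun _ _ => by fun_prop) (fun x _ => (hφ.differentiable (by simp)) x)
  simpa using this

lemma HasWeakDeriv.sub (hu : LocallyIntegrableOn u Ω) (hv : LocallyIntegrableOn v Ω)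
    (hw : LocallyIntegrableOn w Ω) (hz : LocallyIntegrableOn z Ω)
    (h1 : HasWeakDeriv Ω e u w) (h2 : HasWeakDeriv Ω e v z) :
    HasWeakDeriv Ω e (fun x => u x - v x) (fun x => w x - z x) := by
  have := HasWeakDeriv.add hu (v := fun x => -1 * v x) (z := fun x => -1 * z x)
    (by simp only [neg_one_mul]; exact hv.neg) hw (by simp only [neg_one_mul]; exact hz.neg) h1 (h2.const_mul (-1))
  simpa [sub_eq_add_neg] using this

lemma HasWeakDeriv.star (h : HasWeakDeriv Ω e u w) :
    HasWeakDeriv Ω e (fun x => starRingEnd ℂ (u x)) (fun x => starRingEnd ℂ (w x)) := by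
  intro φ hφ hc hs
  have hφ' : ContDiff ℝ ∞ (fun x => starRingEnd ℂ (φ x)) := Complex.conjCLE.contDiff.comp hφ
  have hd : ∀ x, fderiv ℝ (fun x => starRingEnd ℂ (φ x)) x e = starRingEnd ℂ (fderiv ℝ φ x e) := by
    intro x
    have := (Complex.conjCLE.toContinuousLinearMap.hasFDerivAt (x := φ x)).comp x
      ((hφ.differentiable (by simp)) x).hasFDerivAt
    have h2 := this.fderiv
    simp only [Function.comp_def] at h2
    change fderiv ℝ (fun x => Complex.conjCLE (φ x)) x e = _
    erw [h2]; rfl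
  have hts : tsupport (fun x => starRingEnd ℂ (φ x)) = tsupport φ := by
    unfold tsupport; congr 1; ext x; simp
  have h1 := h _ hφ' (by rw [HasCompactSupport, hts]; exact hc) (hts ▸ hs)
  have h2 := congrArg (starRingEnd ℂ) h1
  rw [map_neg, ← integral_conj, ← integral_conj] at h2
  simpa [hd] using h2

lemma HasWeakDeriv.mul_cutoff (hu : LocallyIntegrableOn u Ω) (hw : LocallyIntegrableOn w Ω)
    (h : HasWeakDeriv Ω e u w) {χ : E → ℂ} (hχ : ContDiff ℝ ∞ χ) (hc : HasCompactSupport χ)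
    (hs : tsupport χ ⊆ Ω) :
    HasWeakDeriv univ e (fun x => u x * χ x) (fun x => w x * χ x + u x * fderiv ℝ χ x e) := by
  intro φ hφ hφc _
  have hprod : ContDiff ℝ ∞ (fun x => χ x * φ x) := hχ.mul hφ
  have hpc : HasCompactSupport (fun x => χ x * φ x) := hc.mul_right
  have hps : tsupport (fun x => χ x * φ x) ⊆ Ω := (tsupport_mul_subset_left).trans hs
  have hd : ∀ x, fderiv ℝ (fun x => χ x * φ x) x e
      = χ x * fderiv ℝ φ x e + fderiv ℝ χ x e * φ x := by
    intro x
    rw [fderiv_fun_mul (hχ.differentiable (by simp) x) (hφ.differentiable (by simp) x)]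
    simp [mul_comm]
  have h1 := h _ hprod hpc hps
  have i1 : Integrable (fun x => u x * (χ x * fderiv ℝ φ x e)) :=
    integrable_mul_of_locInt hu (hχ.continuous.mul (cont_fderiv hφ e))
      hc.mul_right ((tsupport_mul_subset_left).trans hs)
  have i2 : Integrable (fun x => u x * (fderiv ℝ χ x e * φ x)) :=
    integrable_mul_of_locInt hu ((cont_fderiv hχ e).mul hφ.continuous)
      (hcs_fderiv hc e).mul_right
      ((tsupport_mul_subset_left).trans ((tsupport_fderiv_apply_subset χ e).trans hs))
  have i3 : Integrable (fun x => w x * (χ x * φ x)) :=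
    integrable_mul_of_locInt hw hprod.continuous hpc hps
  simp only [hd, mul_add] at h1
  rw [integral_add i1 i2] at h1
  simp only [add_mul, mul_assoc]
  rw [integral_add i3 i2]
  linear_combination h1

lemma HasWeakDeriv.ae_eq (hΩ : IsOpen Ω) (hw : LocallyIntegrableOn w Ω)
    (hz : LocallyIntegrableOn z Ω) (h1 : HasWeakDeriv Ω e u w) (h2 : HasWeakDeriv Ω e u z) :
    ∀ᵐ x, x ∈ Ω → w x = z x := by
  have := hΩ.ae_eq_zero_of_integral_contDiff_smul_eq_zero (hw.sub hz) (fun g hg hc hs => by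
    have hg' : ContDiff ℝ ∞ (fun x => (g x : ℂ)) := Complex.ofRealCLM.contDiff.comp hg
    have hc' : HasCompactSupport (fun x => (g x : ℂ)) := hc.comp_left (g := fun r : ℝ => (r : ℂ))
      (by simp)
    have hs' : tsupport (fun x => (g x : ℂ)) ⊆ Ω := by
      refine (closure_mono fun x hx => ?_).trans hs
      intro h0; exact hx (by simp [h0])
    have e1 := h1 _ hg' hc' hs'
    have e2 := h2 _ hg' hc' hs'
    simp only [Pi.sub_apply, smul_sub, Complex.real_smul]
    have i1 := integrable_mul_of_locInt hw hg'.continuous hc' hs'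
    have i2 := integrable_mul_of_locInt hz hg'.continuous hc' hs'
    simp only [mul_comm (w _), mul_comm (z _)] at i1 i2 e1 e2
    rw [integral_sub i1 i2]
    linear_combination e1 - e2)
  filter_upwards [this] with x hx hxΩ
  exact sub_eq_zero.1 (hx hxΩ)

lemma HasWeakDeriv.congr {u' w' : E → ℂ} (h : HasWeakDeriv Ω e u w)
    (hu : ∀ᵐ x, x ∈ Ω → u x = u' x) (hw : ∀ᵐ x, x ∈ Ω → w x = w' x) :
    HasWeakDeriv Ω e u' w' := by
  intro φ hφ hc hs
  have e1 : ∫ x, u' x * fderiv ℝ φ x e = ∫ x, u x * fderiv ℝ φ x e := by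
    apply integral_congr_ae
    filter_upwards [hu] with x hx
    by_cases hxΩ : x ∈ Ω
    · rw [hx hxΩ]
    · have : fderiv ℝ φ x = 0 := fderiv_of_notMem_tsupport ℝ fun h => hxΩ (hs h)
      simp [this]
  have e2 : ∫ x, w' x * φ x = ∫ x, w x * φ x := by
    apply integral_congr_ae
    filter_upwards [hw] with x hx
    by_cases hxΩ : x ∈ Ω
    · rw [hx hxΩ]
    · simp [image_eq_zero_of_notMem_tsupport fun h => hxΩ (hs h)]
  rw [e1, e2, h φ hφ hc hs]

/-- Translation of a weak derivative. -/
lemma HasWeakDeriv.translate (a : E) (h : HasWeakDeriv Ω e u w) :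
    HasWeakDeriv ((fun x => x + a) ⁻¹' Ω) e (fun x => u (x + a)) (fun x => w (x + a)) := by
  intro φ hφ hc hs
  have hd : ∀ x, fderiv ℝ (fun x => φ (x - a)) x e = fderiv ℝ φ (x - a) e := by
    intro x; rw [fderiv_comp_sub]
  have hsup : tsupport (fun x => φ (x - a)) ⊆ Ω := by
    have : tsupport (fun x => φ (x - a)) = (fun x => x - a) ⁻¹' tsupport φ :=
      (tsupport_comp_eq_preimage φ (Homeomorph.subRight a))
    rw [this]
    intro x hx
    simpa using hs hx
  have h1 := h (fun x => φ (x - a)) (hφ.comp (contDiff_id.sub contDiff_const))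
    (hc.comp_homeomorph (Homeomorph.subRight a)) hsup
  simp only [hd] at h1
  rw [← integral_add_right_eq_self _ a, ← integral_add_right_eq_self (fun x => w x * _) a] at h1
  simpa using h1

end

/-! ### Local square integrability -/

lemma tendsto_integral_mul_of_tendsto_eLpNorm {α ι : Type*} [MeasurableSpace α] {μ : Measure α}
    {p q : ℝ≥0∞} [p.HolderConjugate q] {l : Filter ι} {a : α → ℂ} (ha : MemLp a p μ)
    {F : ι → α → ℂ} {f : α → ℂ} (hF : ∀ᶠ k in l, MemLp (F k) q μ) (hf : MemLp f q μ)
    (h : Tendsto (fun k => eLpNorm (fun x => F k x - f x) q μ) l (𝓝 0)) :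
    Tendsto (fun k => ∫ x, a x * F k x ∂μ) l (𝓝 (∫ x, a x * f x ∂μ)) := by
  refine tendsto_integral_of_L1' _ (ha.integrable_mul hf).aestronglyMeasurable ?_ ?_
  · filter_upwards [hF] with k hk using ha.integrable_mul hk
  · have h2 : Tendsto (fun k => eLpNorm a p μ * eLpNorm (fun x => F k x - f x) q μ) l (𝓝 0) := by
      have := ENNReal.Tendsto.const_mul h (Or.inr ha.eLpNorm_ne_top)
      simpa using this
    refine tendsto_of_tendsto_of_tendsto_of_le_of_le' tendsto_const_nhds h2
      (.of_forall fun _ => zero_le) ?_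
    filter_upwards [hF] with k hk
    have := eLpNorm_smul_le_mul_eLpNorm (p := p) (q := q) (r := 1) (hk.sub hf).1 ha.1
    refine le_trans (le_of_eq ?_) this
    apply eLpNorm_congr_ae
    refine .of_forall fun x => ?_
    simp [mul_sub]

section

variable {E F : Type*} [TopologicalSpace E] [T2Space E] [LocallyCompactSpace E] [MeasureSpace E]
  [OpensMeasurableSpace E] [IsLocallyFiniteMeasure (volume : Measure E)] [NormedAddCommGroup F]
  {Ω : Set E}

lemma LocL2.locallyIntegrableOn (hΩ : IsOpen Ω) {f : E → F} (h : LocL2 Ω f) :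
    LocallyIntegrableOn f Ω := by
  rw [locallyIntegrableOn_iff hΩ.isLocallyClosed]
  intro k hk hc
  have : IsFiniteMeasure (volOn k) := ⟨by simpa using hc.measure_lt_top⟩
  exact (h k hc hk).integrable one_le_two

lemma LocL2.mono {Ω' : Set E} {f : E → F} (h : LocL2 Ω f) (hs : Ω' ⊆ Ω) : LocL2 Ω' f :=
  fun K hK h' => h K hK (h'.trans hs)

lemma LocL2.sub {f g : E → F} (hf : LocL2 Ω f) (hg : LocL2 Ω g) :
    LocL2 Ω (fun x => f x - g x) := fun K hK h => (hf K hK h).sub (hg K hK h)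

lemma locL2_of_continuousOn {f : E → F} [SecondCountableTopologyEither E F]
    (hf : ContinuousOn f Ω) : LocL2 Ω f := by
  intro K hK hs
  have : IsFiniteMeasure (volOn K) := ⟨by simpa using hK.measure_lt_top⟩
  obtain ⟨C, hC⟩ := hK.exists_bound_of_continuousOn (hf.mono hs)
  exact MemLp.of_bound ((hf.mono hs).aestronglyMeasurable hK.measurableSet) C
    ((ae_restrict_iff' hK.measurableSet).2 (.of_forall hC))

lemma LocL2.apply {m : ℕ} {G : E → Cv m} (h : LocL2 Ω G) (i : Fin m) :
    LocL2 Ω (fun x => G x i) := by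
  intro K hK hs
  exact (h K hK hs).of_le
    ((EuclideanSpace.proj (𝕜 := ℂ) i).continuous.comp_aestronglyMeasurable (h K hK hs).1)
    (.of_forall fun x => PiLp.norm_apply_le (G x) i)

lemma LocL2.star {f : E → ℂ} (h : LocL2 Ω f) : LocL2 Ω (fun x => starRingEnd ℂ (f x)) := by
  intro K hK hs
  exact (h K hK hs).of_le (Complex.continuous_conj.comp_aestronglyMeasurable (h K hK hs).1)
    (.of_forall fun x => by simp)

lemma LocL2.memLp_mul {f χ : E → ℂ} (h : LocL2 Ω f) (hχ : Continuous χ)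
    (hc : HasCompactSupport χ) (hs : tsupport χ ⊆ Ω) : MemLp (fun x => f x * χ x) 2 := by
  obtain ⟨C, hC⟩ := hc.exists_bound_of_continuous hχ
  have h1 := h _ hc hs
  have h2 : MemLp (fun x => f x * χ x) 2 (volOn (tsupport χ)) := by
    refine h1.of_le_mul (c := C) (h1.1.mul hχ.aestronglyMeasurable) ?_
    refine .of_forall fun x => ?_
    rw [norm_mul, mul_comm]
    gcongr
    exact hC x
  rw [← memLp_indicator_iff_restrict (isClosed_tsupport χ).measurableSet] at h2
  convert h2 using 1
  ext x
  by_cases hx : x ∈ tsupport χ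
  · simp [hx]
  · simp [hx, image_eq_zero_of_notMem_tsupport hx]

end

/-! ### Coefficients -/

lemma norm_dir (i : Fin (n + 1)) : ‖(dir i : Rn1 n)‖ = 1 := by
  refine Fin.lastCases ?_ (fun j => ?_) i
  · simp [dir, Prod.norm_def]
  · simp [dir, dirX, Prod.norm_def]

lemma ae_fst_of_ae {P : Rn n → Prop} (h : ∀ᵐ x : Rn n, P x) : ∀ᵐ X : Rn1 n, P X.1 :=
  (Measure.quasiMeasurePreserving_fst (μ := (volume : Measure (Rn n)))
    (ν := (volume : Measure ℝ))).ae h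

lemma Elliptic.norm_entry_le (hA : Elliptic A Λ) : ∀ᵐ x : Rn n, ∀ i j, ‖A x i j‖ ≤ Λ := by
  filter_upwards [hA.upper] with x hx i j
  have := hx (EuclideanSpace.single j 1) (EuclideanSpace.single i 1)
  simpa [sesq, Finset.sum_ite_eq, Pi.single_apply, apply_ite] using this

lemma Elliptic.aestronglyMeasurable_fst (hA : Elliptic A Λ) (i j : Fin (n + 1)) :
    AEStronglyMeasurable (fun X : Rn1 n => A X.1 i j) :=
  (hA.meas i j).comp_quasiMeasurePreserving (Measure.quasiMeasurePreserving_fst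
    (μ := (volume : Measure (Rn n))) (ν := (volume : Measure ℝ)))

lemma Elliptic.memLp_row (hA : Elliptic A Λ) {S : Set (Rn1 n)} {p : ℝ≥0∞}
    {G : VF n} (hG : MemLp G p (volOn S)) (i : Fin (n + 1)) :
    MemLp (fun X => ∑ j, A X.1 i j * G X j) p (volOn S) := by
  refine memLp_finsetSum _ fun j _ => ?_
  have hm : AEStronglyMeasurable (fun X => G X j) (volOn S) :=
    (EuclideanSpace.proj (𝕜 := ℂ) j).continuous.comp_aestronglyMeasurable hG.1
  refine hG.of_le_mul (c := Λ) ((hA.aestronglyMeasurable_fst i j).restrict.mul hm) ?_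
  filter_upwards [ae_restrict_of_ae (ae_fst_of_ae hA.norm_entry_le)] with X hX
  rw [norm_mul]
  have := PiLp.norm_apply_le (G X) j
  have h0 : 0 ≤ Λ := (norm_nonneg _).trans (hX i j)
  exact mul_le_mul (hX i j) this (norm_nonneg _) h0

lemma energy_eq (A : Coeff n) (G : VF n) (Φ : Rn1 n → ℂ) (X : Rn1 n) :
    energy A G Φ X = ∑ i, (∑ j, A X.1 i j * G X j) * fderiv ℝ Φ X (dir i) := by
  simp only [energy, Finset.sum_mul]

/-- The weak equation may be tested with compactly supported Sobolev functions. -/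
lemma IsSolution.test {Ω : Set (Rn1 n)} (hΩ : IsOpen Ω) (hA : Elliptic A Λ) {u : Rn1 n → ℂ}
    {G : VF n} (hu : IsSolution A Ω u G) {Φ : Rn1 n → ℂ}
    {K : Fin (n + 1) → Rn1 n → ℂ} (hΦ : MemLp Φ 2) (hK : ∀ i, MemLp (K i) 2)
    (hw : ∀ i, HasWeakDeriv univ (dir i) Φ (K i)) {S : Set (Rn1 n)} (hS : IsCompact S)
    (hSΩ : S ⊆ Ω) (hΦS : ∀ X, X ∉ S → Φ X = 0) (hKS : ∀ i X, X ∉ S → K i X = 0) :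
    ∫ X, ∑ i, (∑ j, A X.1 i j * G X j) * K i X = 0 := by
  obtain ⟨r, hr, hrS⟩ := hS.exists_cthickening_subset_open hΩ hSΩ
  set S' := cthickening r S
  have hS' : IsCompact S' := hS.cthickening
  have hSS' : S ⊆ S' := self_subset_cthickening S
  have hG := hu.gradLocL2 S' hS' hrS
  have ha : ∀ i, MemLp (fun X => ∑ j, A X.1 i j * G X j) 2 (volOn S') := hA.memLp_row hG
  have hm : ∀ i k, MemLp (fun X => moll (bump (Rn1 n) k) (K i) X - K i X) 2 volume →
    MemLp (moll (bump (Rn1 n) k) (K i)) 2 volume := fun i k h => by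
      convert h.add (hK i) using 1; ext X; simp
  have hlim : ∀ i, Tendsto (fun k => ∫ X in S', (∑ j, A X.1 i j * G X j) *
      moll (bump (Rn1 n) k) (K i) X) atTop
      (𝓝 (∫ X in S', (∑ j, A X.1 i j * G X j) * K i X)) := by
    intro i
    have h1 := tendsto_moll one_le_two (by simp) (hK i)
    refine tendsto_integral_mul_of_tendsto_eLpNorm (p := 2) (q := 2) (ha i) ?_
      ((hK i).restrict _) ?_
    · have h3 : ∀ᶠ k in atTop, eLpNorm (fun x => moll (bump (Rn1 n) k) (K i) x - K i x) 2 volume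
          < ⊤ := h1.eventually_lt_const (by simp)
      filter_upwards [h3] with k hk
      refine (hm i k ⟨?_, hk⟩).restrict _
      exact ((moll_contDiff _ ((hK i).locallyIntegrable one_le_two)).continuous.aestronglyMeasurable).sub
        (hK i).1
    · exact tendsto_of_tendsto_of_tendsto_of_le_of_le tendsto_const_nhds h1
        (fun _ => zero_le) (fun k => eLpNorm_mono_measure _ Measure.restrict_le_self)
  have hsum := tendsto_finsetSum Finset.univ fun i _ => hlim i
  have hz : ∀ᶠ k in atTop, ∑ i, ∫ X in S', (∑ j, A X.1 i j * G X j) *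
      moll (bump (Rn1 n) k) (K i) X = 0 := by
    filter_upwards [(bump_rOut_tendsto (E := Rn1 n)).eventually_lt_const hr] with k hk
    have hcs := moll_hasCompactSupport (bump (Rn1 n) k) hS hΦS
    have hcd := moll_contDiff (bump (Rn1 n) k) (hΦ.locallyIntegrable one_le_two)
    have hts : tsupport (moll (bump (Rn1 n) k) Φ) ⊆ S' :=
      (moll_tsupport_subset _ hΦS).trans (cthickening_mono hk.le _)
    have he := hu.eqn _ hcd hcs (hts.trans hrS)
    rw [← integral_finsetSum]
    · rw [← he]
      have hkd : ∀ i X, fderiv ℝ (moll (bump (Rn1 n) k) Φ) X (dir i)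
          = moll (bump (Rn1 n) k) (K i) X := fun i X =>
        moll_fderiv _ (hΦ.locallyIntegrable one_le_two) (hw i) X
      simp only [energy_eq, hkd]
      refine setIntegral_eq_integral_of_forall_compl_eq_zero fun X hX => ?_
      refine Finset.sum_eq_zero fun i _ => ?_
      rw [← hkd, fderiv_of_notMem_tsupport ℝ fun h => hX (hts h)]
      simp
    · intro i _
      have hc : Continuous (moll (bump (Rn1 n) k) (K i)) :=
        (moll_contDiff _ ((hK i).locallyIntegrable one_le_two)).continuous
      have : MemLp (moll (bump (Rn1 n) k) (K i)) 2 (volOn S') :=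
        (locL2_of_continuousOn hc.continuousOn : LocL2 univ _) S' hS' (subset_univ _)
      exact (ha i).integrable_mul this
  have h0 := tendsto_nhds_unique hsum (tendsto_const_nhds.congr' (hz.mono fun k hk => hk.symm))
  rw [← h0, ← integral_finsetSum]
  · refine (setIntegral_eq_integral_of_forall_compl_eq_zero fun X hX => ?_).symm
    refine Finset.sum_eq_zero fun i _ => ?_
    rw [hKS i X fun h => hX (hSS' h), mul_zero]
  · intro i _
    exact (ha i).integrable_mul ((hK i).restrict _)

/-! ### Cutoff functions -/

variable (E) in
lemma exists_cutoff : ∃ C : ℝ, 0 < C ∧ ∀ (x : E) (R : ℝ), 0 < R → ∃ η : E → ℝ, ContDiff ℝ ∞ η ∧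
      tsupport η ⊆ cB x (2 * R) ∧ HasCompactSupport η ∧
      (∀ y ∈ cB x R, η y = 1) ∧ (∀ y, 0 ≤ η y) ∧ (∀ y, η y ≤ 1) ∧
      ∀ y, ‖fderiv ℝ η y‖ ≤ C / R := by
  let b : ContDiffBump (0 : E) := ⟨1, 2, one_pos, one_lt_two⟩
  obtain ⟨C, hC⟩ := (b.hasCompactSupport.fderiv ℝ).exists_bound_of_continuous
    ((b.contDiff (n := 1)).continuous_fderiv (by simp))
  refine ⟨|C| + 1, by positivity, fun x R hR => ?_⟩
  have hcd : ContDiff ℝ ∞ (fun y => b (R⁻¹ • (y - x))) :=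
    b.contDiff.comp ((contDiff_id.sub contDiff_const).const_smul _)
  have hts : tsupport (fun y => b (R⁻¹ • (y - x))) ⊆ cB x (2 * R) := by
    refine closure_minimal (fun y hy => ?_) isClosed_closedBall
    have : R⁻¹ • (y - x) ∈ ball (0 : E) 2 := by rw [← b.support_eq]; exact hy
    rw [mem_ball_zero_iff, norm_smul, norm_inv, Real.norm_of_nonneg hR.le] at this
    rw [mem_closedBall, dist_eq_norm]
    rw [inv_mul_lt_iff₀ hR] at this
    linarith
  refine ⟨fun y => b (R⁻¹ • (y - x)), hcd, hts, ?_, fun y hy => ?_, fun y => b.nonneg,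
    fun y => b.le_one, fun y => ?_⟩
  · exact (isCompact_closedBall x (2 * R)).of_isClosed_subset (isClosed_tsupport _) hts
  · apply b.one_of_mem_closedBall
    rw [mem_closedBall_zero_iff, norm_smul, norm_inv, Real.norm_of_nonneg hR.le, inv_mul_le_iff₀ hR]
    rw [mem_closedBall, dist_eq_norm] at hy
    simpa [b] using hy
  · have h1 : HasFDerivAt (fun y : E => R⁻¹ • (y - x)) (R⁻¹ • ContinuousLinearMap.id ℝ E) y :=
      ((hasFDerivAt_id y).sub_const x).const_smul _
    have h2 := (((b.contDiff (n := 1)).differentiable (by simp)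
      (R⁻¹ • (y - x))).hasFDerivAt).comp y h1
    have h3 := h2.fderiv
    simp only [Function.comp_def] at h3
    rw [h3]
    simp only [ContinuousLinearMap.comp_smul, ContinuousLinearMap.comp_id]
    rw [norm_smul, norm_inv, Real.norm_of_nonneg hR.le, div_eq_inv_mul]
    gcongr
    exact (hC _).trans ((le_abs_self C).trans (by linarith))

/-! ### Operations on solutions -/

section

variable {Ω : Set (Rn1 n)} {u : Rn1 n → ℂ} {G : VF n}

lemma IsSolution.mono {Ω' : Set (Rn1 n)} (h : IsSolution A Ω u G) (hs : Ω' ⊆ Ω) :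
    IsSolution A Ω' u G :=
  ⟨h.locL2.mono hs, h.gradLocL2.mono hs, fun i => (h.weakGrad i).mono hs,
    fun Φ h1 h2 h3 => h.eqn Φ h1 h2 (h3.trans hs)⟩

lemma IsSolution.sub_const (hΩ : IsOpen Ω) (h : IsSolution A Ω u G) (c : ℂ) :
    IsSolution A Ω (fun X => u X - c) G := by
  have hc : LocL2 Ω (fun _ : Rn1 n => c) := locL2_of_continuousOn continuousOn_const
  have h0 : LocL2 Ω (fun _ : Rn1 n => (0 : ℂ)) := locL2_of_continuousOn continuousOn_const
  refine ⟨h.locL2.sub hc, h.gradLocL2, fun i => ?_, h.eqn⟩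
  have := HasWeakDeriv.sub (h.locL2.locallyIntegrableOn hΩ) (hc.locallyIntegrableOn hΩ)
    ((h.gradLocL2.apply i).locallyIntegrableOn hΩ) (h0.locallyIntegrableOn hΩ) (h.weakGrad i)
    (hasWeakDeriv_const c)
  simpa using this

/-- The vector of partial derivatives of a real function, with complex entries. -/
def cgrad (η : Rn1 n → ℝ) (X : Rn1 n) : Cv (n + 1) :=
  WithLp.toLp 2 fun i => ((fderiv ℝ η X (dir i) : ℝ) : ℂ)

lemma norm_cgrad_le (η : Rn1 n → ℝ) (X : Rn1 n) :
    ‖cgrad η X‖ ^ 2 ≤ (n + 1) * ‖fderiv ℝ η X‖ ^ 2 := by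
  rw [EuclideanSpace.norm_sq_eq]
  calc ∑ i, ‖cgrad η X i‖ ^ 2 ≤ ∑ _i : Fin (n + 1), ‖fderiv ℝ η X‖ ^ 2 := by
        refine Finset.sum_le_sum fun i _ => ?_
        have := (fderiv ℝ η X).le_opNorm (dir i)
        rw [norm_dir, mul_one] at this
        simp only [cgrad, Complex.norm_real]
        gcongr
    _ = _ := by simp

lemma sesq_add_right (M : Matrix (Fin (n + 1)) (Fin (n + 1)) ℂ) (ξ η ζ : Cv (n + 1)) :
    sesq M ξ (η + ζ) = sesq M ξ η + sesq M ξ ζ := by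
  simp [sesq, mul_add, Finset.sum_add_distrib]

lemma sesq_smul_right (M : Matrix (Fin (n + 1)) (Fin (n + 1)) ℂ) (ξ η : Cv (n + 1)) (c : ℂ) :
    sesq M ξ (c • η) = (starRingEnd ℂ) c * sesq M ξ η := by
  simp only [sesq, PiLp.smul_apply, smul_eq_mul, map_mul, Finset.mul_sum]
  exact Finset.sum_congr rfl fun i _ => Finset.sum_congr rfl fun j _ => by ring

lemma caccioppoli_cutoff (hΩ : IsOpen Ω) (hΛ : 0 < Λ) (hA : Elliptic A Λ)
    (hu : IsSolution A Ω u G) {η : Rn1 n → ℝ} (hη : ContDiff ℝ ∞ η) (hc : HasCompactSupport η)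
    (hs : tsupport η ⊆ Ω) :
    ∫ X, η X ^ 2 * ‖G X‖ ^ 2 ≤ 4 * Λ ^ 4 * ∫ X, ‖u X‖ ^ 2 * ‖cgrad η X‖ ^ 2 := by
  set S := tsupport η with hSdef
  have hS : IsCompact S := hc
  set χ : Rn1 n → ℂ := fun X => ((η X ^ 2 : ℝ) : ℂ) with hχdef
  have hχ : ContDiff ℝ ∞ χ := Complex.ofRealCLM.contDiff.comp (hη.pow 2)
  have hχS : ∀ X, X ∉ S → χ X = 0 := fun X hX => by
    simp [hχdef, image_eq_zero_of_notMem_tsupport hX]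
  have hχs : tsupport χ ⊆ S := closure_minimal (fun X hX => by
    by_contra h; exact hX (hχS X h)) (isClosed_tsupport _)
  have hχc : HasCompactSupport χ := hS.of_isClosed_subset (isClosed_tsupport _) hχs
  have hdχ : ∀ X i, fderiv ℝ χ X (dir i) = 2 * η X * (fderiv ℝ η X (dir i) : ℝ) := by
    intro X i
    have h1 : HasFDerivAt η (fderiv ℝ η X) X := (hη.differentiable (by simp) X).hasFDerivAt
    have h2 := (Complex.ofRealCLM.hasFDerivAt).comp X (h1.pow 2)
    have h3 := h2.fderiv
    simp only [Function.comp_def, Complex.ofRealCLM_apply] at h3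
    rw [hχdef, h3]
    simp
  have hul := hu.locL2
  have hGl := hu.gradLocL2
  have hχcont := hχ.continuous
  have hΦ := hul.star.memLp_mul hχcont hχc (hχs.trans hs)
  have hKm : ∀ i : Fin (n + 1), MemLp (fun X => starRingEnd ℂ (G X i) * χ X
      + starRingEnd ℂ (u X) * fderiv ℝ χ X (dir i)) 2 := fun i =>
    ((hGl.apply i).star.memLp_mul hχcont hχc (hχs.trans hs)).add
      (hul.star.memLp_mul (cont_fderiv hχ _) (hcs_fderiv hχc _)
        ((tsupport_fderiv_apply_subset χ _).trans (hχs.trans hs)))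
  have htest := hu.test hΩ hA hΦ hKm (fun i =>
    HasWeakDeriv.mul_cutoff (hul.star.locallyIntegrableOn hΩ)
      ((hGl.apply i).star.locallyIntegrableOn hΩ) (hu.weakGrad i).star hχ hχc (hχs.trans hs))
    hS hs (fun X hX => by simp [hχS X hX]) (fun i X hX => by
      rw [hχS X hX, hdχ]; simp [image_eq_zero_of_notMem_tsupport hX])
  set Wt : VF n := fun X => (χ X) • G X + ((2 * η X : ℝ) * u X : ℂ) • cgrad η X
  have hint_eq : ∀ X, ∑ i, (∑ j, A X.1 i j * G X j) * (starRingEnd ℂ (G X i) * χ X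
      + starRingEnd ℂ (u X) * fderiv ℝ χ X (dir i)) = sesq (A X.1) (G X) (Wt X) := by
    intro X
    simp only [sesq, Finset.sum_mul]
    refine Finset.sum_congr rfl fun i _ => Finset.sum_congr rfl fun j _ => ?_
    simp only [Wt, PiLp.add_apply, PiLp.smul_apply, smul_eq_mul, map_add, map_mul, cgrad, hdχ]
    simp only [hχdef, Complex.conj_ofReal, Complex.ofReal_mul, map_mul, Complex.ofReal_ofNat,
      map_ofNat, Complex.ofReal_pow, map_pow]
    ring
  have hGS := hGl S hS hs
  have hI : Integrable (fun X => sesq (A X.1) (G X) (Wt X)) := by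
    simp only [← hint_eq]
    refine integrable_finsetSum _ fun i _ => ?_
    have h1 : IntegrableOn (fun X => (∑ j, A X.1 i j * G X j) * (starRingEnd ℂ (G X i) * χ X
      + starRingEnd ℂ (u X) * fderiv ℝ χ X (dir i))) S :=
      (hA.memLp_row hGS i).integrable_mul ((hKm i).restrict S)
    refine (integrableOn_iff_integrable_of_support_subset fun X hX => ?_).1 h1
    by_contra h
    apply hX
    simp [hχS X h, hdχ, image_eq_zero_of_notMem_tsupport h]
  simp only [hint_eq] at htest
  have hre : ∫ X, (sesq (A X.1) (G X) (Wt X)).re = 0 := by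
    have := integral_re hI
    simp only [RCLike.re_to_complex] at this
    rw [this, htest]; simp
  have hG2 : Integrable (fun X => η X ^ 2 * ‖G X‖ ^ 2) := by
    have h1 : IntegrableOn (fun X => η X ^ 2 * ‖G X‖ ^ 2) S :=
      IntegrableOn.continuousOn_mul (hη.continuous.pow 2).continuousOn hGS.norm.integrable_sq hS
    refine (integrableOn_iff_integrable_of_support_subset fun X hX => ?_).1 h1
    by_contra h
    exact hX (by simp [image_eq_zero_of_notMem_tsupport h])
  have hu2 : Integrable (fun X => ‖u X‖ ^ 2 * ‖cgrad η X‖ ^ 2) := by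
    have hcg : Continuous (cgrad η) := by
      refine (PiLp.continuous_toLp 2 _).comp (continuous_pi fun i => ?_)
      exact Complex.continuous_ofReal.comp
        ((hη.continuous_fderiv (by simp)).clm_apply continuous_const)
    have h1 : IntegrableOn (fun X => ‖u X‖ ^ 2 * ‖cgrad η X‖ ^ 2) S :=
      IntegrableOn.mul_continuousOn (hul S hS hs).norm.integrable_sq (hcg.norm.pow 2).continuousOn hS
    refine (integrableOn_iff_integrable_of_support_subset fun X hX => ?_).1 h1
    by_contra h
    apply hX
    have : cgrad η X = 0 := by ext i; simp [cgrad, fderiv_of_notMem_tsupport ℝ h]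
    simp [this]
  have hpt : ∀ᵐ X : Rn1 n, (1 / 2) * Λ⁻¹ * (η X ^ 2 * ‖G X‖ ^ 2)
      - 2 * Λ ^ 3 * (‖u X‖ ^ 2 * ‖cgrad η X‖ ^ 2) ≤ (sesq (A X.1) (G X) (Wt X)).re := by
    filter_upwards [ae_fst_of_ae hA.lower, ae_fst_of_ae hA.upper] with X h1 h2
    have e1 : (sesq (A X.1) (G X) (Wt X)).re = η X ^ 2 * (sesq (A X.1) (G X) (G X)).re
        + (starRingEnd ℂ ((2 * η X : ℝ) * u X : ℂ) * sesq (A X.1) (G X) (cgrad η X)).re := by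
      simp only [Wt]
      rw [sesq_add_right, sesq_smul_right, sesq_smul_right, Complex.add_re]
      congr 1
      simp only [hχdef, Complex.conj_ofReal, Complex.re_ofReal_mul]
    have e2 := h1 (G X)
    have e3 : -(2 * |η X| * ‖u X‖ * (Λ * ‖G X‖ * ‖cgrad η X‖)) ≤
        (starRingEnd ℂ ((2 * η X : ℝ) * u X : ℂ) * sesq (A X.1) (G X) (cgrad η X)).re := by
      refine (neg_le_of_abs_le (Complex.abs_re_le_norm _)).trans' (neg_le_neg ?_)
      rw [norm_mul, RCLike.norm_conj, norm_mul, Complex.norm_real, Real.norm_eq_abs, abs_mul,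
        abs_two]
      gcongr
      exact h2 _ _
    rw [e1]
    have e4 : η X ^ 2 * (Λ⁻¹ * ‖G X‖ ^ 2) ≤ η X ^ 2 * (sesq (A X.1) (G X) (G X)).re := by gcongr
    have e5 : 0 ≤ (1 / 2) * Λ⁻¹ * (|η X| * ‖G X‖ - 2 * Λ ^ 2 * (‖u X‖ * ‖cgrad η X‖)) ^ 2 := by
      positivity
    have e6 : (1 / 2) * Λ⁻¹ * (|η X| * ‖G X‖ - 2 * Λ ^ 2 * (‖u X‖ * ‖cgrad η X‖)) ^ 2
      = (1 / 2) * Λ⁻¹ * (η X ^ 2 * ‖G X‖ ^ 2) - 2 * |η X| * ‖u X‖ * (Λ * ‖G X‖ * ‖cgrad η X‖)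
        + 2 * Λ ^ 3 * (‖u X‖ ^ 2 * ‖cgrad η X‖ ^ 2) := by
      have : Λ⁻¹ * Λ = 1 := inv_mul_cancel₀ hΛ.ne'
      rw [← sq_abs (η X)]
      linear_combination ((-2) * Λ * |η X| * ‖G X‖ * ‖u X‖ * ‖cgrad η X‖
        + 2 * Λ ^ 3 * ‖u X‖ ^ 2 * ‖cgrad η X‖ ^ 2) * this
    linarith
  have hmono := integral_mono_ae ((hG2.const_mul _).sub (hu2.const_mul _)) hI.re hpt
  simp only [RCLike.re_to_complex] at hmono
  rw [hre] at hmono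
  simp only [Pi.sub_apply] at hmono
  rw [integral_sub (hG2.const_mul _) (hu2.const_mul _), integral_const_mul,
    integral_const_mul] at hmono
  have hinv : Λ * Λ⁻¹ = 1 := mul_inv_cancel₀ hΛ.ne'
  have h5 : (1 / 2) * Λ⁻¹ * ∫ X, η X ^ 2 * ‖G X‖ ^ 2 ≤
    2 * Λ ^ 3 * ∫ X, ‖u X‖ ^ 2 * ‖cgrad η X‖ ^ 2 := by linarith
  have h6 := mul_le_mul_of_nonneg_left h5 (by positivity : (0 : ℝ) ≤ 2 * Λ)
  calc _ = 2 * Λ * ((1 / 2) * Λ⁻¹ * ∫ X, η X ^ 2 * ‖G X‖ ^ 2) := by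
        linear_combination (-(∫ X, η X ^ 2 * ‖G X‖ ^ 2)) * hinv
    _ ≤ _ := h6
    _ = _ := by ring

/-- Caccioppoli's inequality. -/
lemma exists_caccioppoli (n : ℕ) {Λ : ℝ} (hΛ : 0 < Λ) : ∃ C : ℝ, 0 < C ∧
    ∀ (A : Coeff n), Elliptic A Λ → ∀ (Ω : Set (Rn1 n)) (u : Rn1 n → ℂ) (G : VF n),
      IsOpen Ω → IsSolution A Ω u G → ∀ (X : Rn1 n) (R : ℝ), 0 < R →
      cB X (2 * R) ⊆ Ω →
      ∫ Y in cB X R, ‖G Y‖ ^ 2 ≤ C / R ^ 2 * ∫ Y in cB X (2 * R), ‖u Y‖ ^ 2 := by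
  obtain ⟨C, hC, hcut⟩ := exists_cutoff (Rn1 n)
  refine ⟨4 * Λ ^ 4 * ((n + 1) * C ^ 2), by positivity, ?_⟩
  intro A hA Ω u G hΩ hu X R hR hball
  obtain ⟨η, h1, h2, h3, h4, h5, h6, h7⟩ := hcut X R hR
  have hcac := caccioppoli_cutoff hΩ hΛ hA hu h1 h3 (h2.trans hball)
  have hGS := (hu.gradLocL2 _ (isCompact_closedBall X (2 * R)) hball).norm.integrable_sq
  have huS := (hu.locL2 _ (isCompact_closedBall X (2 * R)) hball).norm.integrable_sq
  have hsub : cB X R ⊆ cB X (2 * R) := closedBall_subset_closedBall (by linarith)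
  have hz : ∀ Y, Y ∉ cB X (2 * R) → η Y = 0 := fun Y hY =>
    image_eq_zero_of_notMem_tsupport fun h => hY (h2 h)
  calc ∫ Y in cB X R, ‖G Y‖ ^ 2
      = ∫ Y in cB X R, η Y ^ 2 * ‖G Y‖ ^ 2 := by
        refine setIntegral_congr_fun measurableSet_closedBall fun Y hY => ?_
        simp [h4 Y hY]
    _ ≤ ∫ Y in cB X (2 * R), η Y ^ 2 * ‖G Y‖ ^ 2 := by
        refine setIntegral_mono_set ?_ (.of_forall fun Y => ?_) hsub.eventuallyLE
        · exact IntegrableOn.continuousOn_mul (h1.continuous.pow 2).continuousOn hGS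
            (isCompact_closedBall _ _)
        · simp only [Pi.zero_apply]; positivity
    _ = ∫ Y, η Y ^ 2 * ‖G Y‖ ^ 2 :=
        setIntegral_eq_integral_of_forall_compl_eq_zero fun Y hY => by simp [hz Y hY]
    _ ≤ 4 * Λ ^ 4 * ∫ Y, ‖u Y‖ ^ 2 * ‖cgrad η Y‖ ^ 2 := hcac
    _ = 4 * Λ ^ 4 * ∫ Y in cB X (2 * R), ‖u Y‖ ^ 2 * ‖cgrad η Y‖ ^ 2 := by
        congr 1
        refine (setIntegral_eq_integral_of_forall_compl_eq_zero fun Y hY => ?_).symm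
        have : cgrad η Y = 0 := by
          ext i; simp [cgrad, fderiv_of_notMem_tsupport ℝ fun h => hY (h2 h)]
        simp [this]
    _ ≤ 4 * Λ ^ 4 * ∫ Y in cB X (2 * R), ‖u Y‖ ^ 2 * ((n + 1) * (C / R) ^ 2) := by
        gcongr 4 * Λ ^ 4 * ?_
        refine integral_mono_of_nonneg (.of_forall fun Y => by positivity)
          (huS.mul_const _) (.of_forall fun Y => ?_)
        have := norm_cgrad_le η Y
        have h8 := h7 Y
        dsimp only
        gcongr
        exact this.trans (by gcongr)
    _ = _ := by
        rw [integral_mul_const]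
        field_simp

end

/-! ### Euclidean balls and cylinders -/

lemma dist_le_edst (X Y : Rn1 n) : dist X Y ≤ edst X Y := by
  rw [Prod.dist_eq, edst, dist_eq_norm, Real.dist_eq]
  refine max_le (Real.le_sqrt_of_sq_le ?_) (Real.le_sqrt_of_sq_le ?_)
  · nlinarith [sq_nonneg (X.2 - Y.2)]
  · rw [sq_abs]; nlinarith [sq_nonneg ‖X.1 - Y.1‖]

lemma edst_le_two_mul_dist (X Y : Rn1 n) : edst X Y ≤ 3 / 2 * dist X Y := by
  have h1 : ‖X.1 - Y.1‖ ≤ dist X Y := by rw [← dist_eq_norm, Prod.dist_eq]; exact le_max_left _ _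
  have h2 : |X.2 - Y.2| ≤ dist X Y := by rw [← Real.dist_eq, Prod.dist_eq]; exact le_max_right _ _
  have h3 : 0 ≤ dist X Y := dist_nonneg
  rw [edst, Real.sqrt_le_left (by positivity)]
  have h4 : (X.2 - Y.2) ^ 2 ≤ dist X Y ^ 2 := by rw [← sq_abs]; gcongr
  have h5 : ‖X.1 - Y.1‖ ^ 2 ≤ dist X Y ^ 2 := by gcongr
  nlinarith

lemma eball_subset_ball (X : Rn1 n) (r : ℝ) : eball X r ⊆ ball X r := fun Y hY => by
  rw [mem_ball, dist_comm]
  exact (dist_le_edst X Y).trans_lt hY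

lemma closedBall_subset_eball (X : Rn1 n) {r : ℝ} (hr : 0 < r) :
    cB X (r / 2) ⊆ eball X r := fun Y hY => by
  rw [mem_closedBall, dist_comm] at hY
  have := edst_le_two_mul_dist X Y
  change edst X Y < r
  linarith

lemma isOpen_eball (X : Rn1 n) (r : ℝ) : IsOpen (eball X r) := by
  refine isOpen_lt ?_ continuous_const
  unfold edst
  fun_prop

variable (n) in
/-- The volume of the unit cylinder. -/
def vol1 : ℝ := (volume : Measure (Rn1 n)).real (ball 0 1)

lemma vol1_pos : 0 < vol1 n := by
  have h1 := measure_ball_pos (volume : Measure (Rn1 n)) 0 one_pos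
  exact ENNReal.toReal_pos h1.ne' measure_ball_lt_top.ne

lemma finrank_rn1 : finrank ℝ (Rn1 n) = n + 1 := by simp [Rn1, Module.finrank_prod]

lemma volume_real_closedBall (X : Rn1 n) {r : ℝ} (hr : 0 ≤ r) :
    (volume : Measure (Rn1 n)).real (cB X r) = r ^ (n + 1) * vol1 n := by
  rw [Measure.real, Measure.addHaar_closedBall _ _ hr, finrank_rn1, toReal_mul,
    toReal_ofReal (by positivity)]
  rfl

lemma volume_closedBall (X : Rn1 n) {r : ℝ} (hr : 0 ≤ r) :
    volume (cB X r) = ofReal (r ^ (n + 1) * vol1 n) := by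
  rw [← volume_real_closedBall X hr, Measure.real, ofReal_toReal]
  exact measure_closedBall_lt_top.ne

lemma ofReal_setIntegral_norm_sq {V : Type*} [NormedAddCommGroup V] {F : Rn1 n → V}
    {S : Set (Rn1 n)} (hF : MemLp F 2 (volOn S)) :
    ofReal (∫ Y in S, ‖F Y‖ ^ 2) = ∫⁻ Y in S, ‖F Y‖ₑ ^ 2 := by
  rw [ofReal_integral_eq_lintegral_ofReal hF.norm.integrable_sq (.of_forall fun _ => by positivity)]
  congr 1; ext Y
  rw [ofReal_pow (norm_nonneg _), ofReal_norm]

/-! ### Pointwise bounds for solutions -/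

lemma exists_moser (n : ℕ) {C₀ : ℝ} (hC₀ : 0 < C₀) : ∃ C : ℝ, 0 < C ∧
    ∀ (A : Coeff n) (α : ℝ), DGNM A C₀ α → ∀ (Ω : Set (Rn1 n)) (u : Rn1 n → ℂ)
      (G : VF n), IsOpen Ω → IsSolution A Ω u G → ContinuousOn u Ω →
      ∀ (X : Rn1 n) (R : ℝ), 0 < R → cB X R ⊆ Ω →
      ‖u X‖ ^ 2 ≤ C / R ^ (n + 1) * ∫ Y in cB X R, ‖u Y‖ ^ 2 := by
  have hv := vol1_pos (n := n)
  refine ⟨C₀ ^ 2 * 2 ^ (n + 1) / vol1 n, by positivity, ?_⟩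
  intro A α hD Ω u G hΩ hu hcont X R hR hball
  obtain ⟨v, hvu, hest⟩ := hD Ω u G hΩ hu
  have hsubE : eball X R ⊆ cB X R := (eball_subset_ball X R).trans ball_subset_closedBall
  have h1 := (hest X (R / 2) (by positivity)
    (by rw [mul_div_cancel₀ _ two_ne_zero]; exact hsubE.trans hball)).2
  rw [mul_div_cancel₀ _ two_ne_zero] at h1
  set I := ∫ Y in cB X R, ‖u Y‖ ^ 2 with hI
  have hI0 : 0 ≤ I := integral_nonneg fun _ => by positivity
  have hrms : rms v (eball X R) ≤ ofReal (I / ((R / 2) ^ (n + 1) * vol1 n)) ^ (1 / 2 : ℝ) := by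
    unfold rms
    refine rpow_le_rpow ?_ (by norm_num)
    rw [setLAverage_eq, ofReal_div_of_pos (by positivity)]
    refine ENNReal.div_le_div ?_ ?_
    · rw [hI, ofReal_setIntegral_norm_sq (hu.locL2 _ (isCompact_closedBall X R) hball)]
      refine le_trans (le_of_eq ?_) (lintegral_mono_set hsubE)
      apply lintegral_congr_ae
      filter_upwards [ae_restrict_of_ae_restrict_of_subset (hsubE.trans hball) hvu] with Y hY
      rw [hY]
    · rw [← volume_closedBall X (by positivity)]
      exact measure_mono (closedBall_subset_eball X hR)
  set B : ℝ≥0∞ := ofReal C₀ * ofReal (I / ((R / 2) ^ (n + 1) * vol1 n)) ^ (1 / 2 : ℝ) with hB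
  have hXin : X ∈ eball X (R / 2) := by
    change edst X X < R / 2
    have := edst_le_two_mul_dist X X
    rw [dist_self] at this
    linarith
  have hXB : ‖u X‖ₑ ≤ B := by
    by_contra hlt
    push Not at hlt
    have hXΩ : X ∈ Ω := hball (mem_closedBall_self hR.le)
    have hca : ContinuousAt (fun Y => ‖u Y‖ₑ) X := (hcont.continuousAt (hΩ.mem_nhds hXΩ)).enorm
    have hnb : ∀ᶠ Y in 𝓝 X, B < ‖u Y‖ₑ ∧ Y ∈ eball X (R / 2) ∧ Y ∈ Ω :=
      (hca.eventually_const_lt hlt).and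
        (Filter.Eventually.and ((isOpen_eball X (R / 2)).mem_nhds hXin) (hΩ.mem_nhds hXΩ))
    obtain ⟨U, hU, hUo, hXU⟩ := _root_.eventually_nhds_iff.1 hnb
    have hae : ∀ᵐ Y : Rn1 n, Y ∉ U := by
      filter_upwards [(ae_restrict_iff' hΩ.measurableSet).1 hvu] with Y hY hYU
      obtain ⟨a1, a2, a3⟩ := hU Y hYU
      have := (h1 Y a2).trans (mul_le_mul_right hrms _)
      rw [hY a3] at this
      exact absurd (lt_of_lt_of_le a1 this) (lt_irrefl _)
    have hU0 : volume U = 0 := by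
      rw [ae_iff] at hae
      simpa using hae
    exact (hUo.measure_pos volume ⟨X, hXU⟩).ne' hU0
  have h2 : ‖u X‖ₑ ^ 2 ≤ B ^ 2 := pow_le_pow_left₀ zero_le hXB 2
  have h3 : ofReal (‖u X‖ ^ 2)
      ≤ ofReal (C₀ ^ 2 * (I / ((R / 2) ^ (n + 1) * vol1 n))) := by
    rw [ofReal_pow (norm_nonneg _), ofReal_norm]
    refine h2.trans (le_of_eq ?_)
    rw [hB, mul_pow, ← rpow_natCast (_ ^ (1 / 2 : ℝ)), ← rpow_mul,
      ofReal_mul (by positivity), ofReal_pow hC₀.le]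
    norm_num
  rw [ofReal_le_ofReal_iff (by positivity)] at h3
  refine h3.trans (le_of_eq ?_)
  rw [div_pow]
  field_simp

/-- `L¹` mean value bound for solutions. -/
lemma exists_moser_one (n : ℕ) {C₀ : ℝ} (hC₀ : 0 < C₀) : ∃ C : ℝ, 0 < C ∧
    ∀ (A : Coeff n) (α : ℝ), DGNM A C₀ α → ∀ (Ω : Set (Rn1 n)) (u : Rn1 n → ℂ)
      (G : VF n), IsOpen Ω → IsSolution A Ω u G → ContinuousOn u Ω →
      ∀ (X : Rn1 n) (R : ℝ), 0 < R → cB X R ⊆ Ω →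
      ∀ Y ∈ cB X (R / 2),
      ‖u Y‖ ≤ C / R ^ (n + 1) * ∫ Z in cB X R, ‖u Z‖ := by
  obtain ⟨C, hC, hmos⟩ := exists_moser n hC₀
  refine ⟨C * 4 ^ (n + 1) * 2 ^ (n + 1), by positivity, ?_⟩
  intro A α hD Ω u G hΩ hu hcont X R hR hball Y hY
  set I := ∫ Z in cB X R, ‖u Z‖ with hI
  have hI0 : 0 ≤ I := integral_nonneg fun _ => norm_nonneg _
  have hcomp := isCompact_closedBall X R
  have hcontB : ContinuousOn u (cB X R) := hcont.mono hball
  set g : Rn1 n → ℝ := fun Z => (R - dist Z X) ^ (n + 1) * ‖u Z‖ with hg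
  have hgc : ContinuousOn g (cB X R) :=
    ((continuous_const.sub (continuous_id.dist continuous_const)).pow _).continuousOn.mul
      hcontB.norm
  obtain ⟨Z₀, hZ₀, hmax⟩ := hcomp.exists_isMaxOn ⟨X, mem_closedBall_self hR.le⟩ hgc
  set M := g Z₀
  have hM : ∀ Z ∈ cB X R, g Z ≤ M := fun Z hZ => hmax hZ
  have hMI : M ≤ C * 4 ^ (n + 1) * I := by
    rcases le_or_gt M 0 with hM0 | hM0
    · exact hM0.trans (by positivity)
    set d := R - dist Z₀ X with hd
    have hd0 : 0 < d := by
      rcases lt_or_eq_of_le (show 0 ≤ d by rw [hd]; linarith [mem_closedBall.1 hZ₀]) with h | h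
      · exact h
      · exfalso
        have : M = d ^ (n + 1) * ‖u Z₀‖ := rfl
        rw [← h] at this
        simp at this
        linarith
    have hsub : cB Z₀ (d / 2) ⊆ cB X R := by
      refine closedBall_subset_closedBall' ?_
      linarith
    have h1 := hmos A α hD Ω u G hΩ hu hcont Z₀ (d / 2) (by positivity) (hsub.trans hball)
    have hptw : ∀ Z ∈ cB Z₀ (d / 2), ‖u Z‖ ^ 2 ≤ M / (d / 2) ^ (n + 1) * ‖u Z‖ := by
      intro Z hZ
      have h2 := hM Z (hsub hZ)
      have h3 : d / 2 ≤ R - dist Z X := by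
        have := dist_triangle Z Z₀ X
        have := mem_closedBall.1 hZ
        linarith
      have h4 : (d / 2) ^ (n + 1) * ‖u Z‖ ≤ M :=
        le_trans (mul_le_mul_of_nonneg_right (pow_le_pow_left₀ (by positivity) h3 _)
          (norm_nonneg _)) h2
      have h5 : ‖u Z‖ ≤ M / (d / 2) ^ (n + 1) := by rw [le_div_iff₀ (by positivity)]; linarith
      rw [sq]
      gcongr
    have hcI : IntegrableOn (fun Z => ‖u Z‖) (cB X R) := hcontB.norm.integrableOn_compact hcomp
    have h6 : ∫ Z in cB Z₀ (d / 2), ‖u Z‖ ^ 2 ≤ M / (d / 2) ^ (n + 1) * I := by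
      calc _ ≤ ∫ Z in cB Z₀ (d / 2), M / (d / 2) ^ (n + 1) * ‖u Z‖ := by
            refine setIntegral_mono_on ?_ ?_ measurableSet_closedBall hptw
            · exact ((hcontB.mono hsub).norm.pow 2).integrableOn_compact (isCompact_closedBall _ _)
            · exact (hcI.mono_set hsub).const_mul _
        _ ≤ _ := by
            rw [integral_const_mul]
            gcongr
            exact setIntegral_mono_set hcI (.of_forall fun _ => norm_nonneg _) hsub.eventuallyLE
    have h7 : M ^ 2 ≤ C * 4 ^ (n + 1) * I * M := by
      calc M ^ 2 = (d ^ (n + 1)) ^ 2 * ‖u Z₀‖ ^ 2 := by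
            change ((R - dist Z₀ X) ^ (n + 1) * ‖u Z₀‖) ^ 2 = _
            rw [mul_pow]
        _ ≤ (d ^ (n + 1)) ^ 2 * (C / (d / 2) ^ (n + 1) * (M / (d / 2) ^ (n + 1) * I)) := by
            gcongr
            exact h1.trans (by gcongr)
        _ = _ := by
            have : (4 : ℝ) ^ (n + 1) = 2 ^ (n + 1) * 2 ^ (n + 1) := by rw [← mul_pow]; norm_num
            rw [this, div_pow]
            field_simp
    nlinarith
  have hYR : dist Y X ≤ R / 2 := mem_closedBall.1 hY
  have h8 := hM Y (mem_closedBall.2 (by linarith))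
  have h9 : (R / 2) ^ (n + 1) * ‖u Y‖ ≤ M := le_trans (by
    simp only [hg]
    gcongr
    linarith) h8
  have h10 : (R / 2) ^ (n + 1) * ‖u Y‖ ≤ C * 4 ^ (n + 1) * I := h9.trans hMI
  rw [div_pow, div_mul_eq_mul_div, div_le_iff₀ (by positivity)] at h10
  rw [div_mul_eq_mul_div, le_div_iff₀ (by positivity)]
  linarith

/-! ### Differences of weakly differentiable functions -/

lemma eLpNorm_difference_le_of_contDiff {q : ℝ} (hq : 1 ≤ q) {v : E → ℂ}
    (hv : ContDiff ℝ ∞ v) {B : Set E} (hB : Convex ℝ B) (hBm : MeasurableSet B) (h : E) :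
    eLpNorm (fun x => v (x + h) - v x) (ofReal q)
        (volOn (B ∩ (fun x => x + h) ⁻¹' B))
      ≤ eLpNorm (fun x => fderiv ℝ v x h) (ofReal q) (volOn B) := by
  have hq0 : 0 < q := by linarith
  have hq1 : ofReal q ≠ 0 := by simpa using hq0
  rw [eLpNorm_eq_lintegral_rpow_enorm_toReal hq1 (by simp),
    eLpNorm_eq_lintegral_rpow_enorm_toReal hq1 (by simp), toReal_ofReal hq0.le]
  refine rpow_le_rpow ?_ (by positivity)
  set S := B ∩ (fun x => x + h) ⁻¹' B
  have hS : MeasurableSet S := hBm.inter (measurable_add_const h hBm)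
  have hcd := cont_fderiv hv h
  have hpt : ∀ x, ‖v (x + h) - v x‖ₑ ^ q
      ≤ ∫⁻ s in Icc (0 : ℝ) 1, ‖fderiv ℝ v (x + s • h) h‖ₑ ^ q := by
    intro x
    have hder : ∀ s ∈ uIcc (0 : ℝ) 1, HasDerivAt (fun s : ℝ => v (x + s • h))
        (fderiv ℝ v (x + s • h) h) s := by
      intro s _
      have h1 : HasDerivAt (fun s : ℝ => x + s • h) h s := by
        simpa using ((hasDerivAt_id s).smul_const h).const_add x
      exact ((hv.differentiable (by simp) (x + s • h)).hasFDerivAt).comp_hasDerivAt s h1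
    have hc : Continuous (fun s : ℝ => fderiv ℝ v (x + s • h) h) := by fun_prop
    have hint := intervalIntegral.integral_eq_sub_of_hasDerivAt hder (hc.intervalIntegrable _ _)
    simp only [one_smul, zero_smul, add_zero] at hint
    rw [← hint, intervalIntegral.integral_of_le zero_le_one, ← integral_Icc_eq_integral_Ioc]
    have hprob : IsProbabilityMeasure (volOn (Icc (0 : ℝ) 1)) := ⟨by simp⟩
    exact (rpow_le_rpow (enorm_integral_le_lintegral_enorm _) hq0.le).trans
      (lintegral_enorm_le_rpow hq hc.aestronglyMeasurable)
  have hmeas : Measurable (fun z : E × ℝ => ‖fderiv ℝ v (z.1 + z.2 • h) h‖ₑ ^ q) := by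
    have : Continuous (fun z : E × ℝ => fderiv ℝ v (z.1 + z.2 • h) h) := by fun_prop
    exact this.enorm.measurable.pow_const _
  calc ∫⁻ x in S, ‖v (x + h) - v x‖ₑ ^ q
      ≤ ∫⁻ x in S, ∫⁻ s in Icc (0 : ℝ) 1, ‖fderiv ℝ v (x + s • h) h‖ₑ ^ q := lintegral_mono hpt
    _ = ∫⁻ s in Icc (0 : ℝ) 1, ∫⁻ x in S, ‖fderiv ℝ v (x + s • h) h‖ₑ ^ q :=
        lintegral_lintegral_swap hmeas.aemeasurable
    _ ≤ ∫⁻ _ in Icc (0 : ℝ) 1, ∫⁻ x in B, ‖fderiv ℝ v x h‖ₑ ^ q := by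
        refine setLIntegral_mono' measurableSet_Icc fun s hs => ?_
        have hmp := measurePreserving_add_right (volume : Measure E) (s • h)
        have hpre : S ⊆ (fun x => x + s • h) ⁻¹' B := by
          intro x hx
          have := hB.add_smul_sub_mem hx.1 hx.2 hs
          simpa using this
        calc _ ≤ ∫⁻ x in (fun x => x + s • h) ⁻¹' B, ‖fderiv ℝ v (x + s • h) h‖ₑ ^ q :=
              lintegral_mono_set hpre
          _ = _ := hmp.setLIntegral_comp_preimage hBm
              (f := fun x => ‖fderiv ℝ v x h‖ₑ ^ q) (hcd.enorm.measurable.pow_const _)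
    _ = _ := by simp

lemma eLpNorm_difference_le_of_memLp {U W : E → ℂ} {h : E} {q : ℝ} (hq1 : 1 ≤ q)
    (hUq : MemLp U (ofReal q)) (hWq : MemLp W (ofReal q))
    (hUW : HasWeakDeriv univ h U W) {B : Set E} (hB : Convex ℝ B) (hBm : MeasurableSet B) :
    eLpNorm (fun x => U (x + h) - U x) (ofReal q)
        (volOn (B ∩ (fun x => x + h) ⁻¹' B))
      ≤ eLpNorm W (ofReal q) (volOn B) := by
  have hq1' : 1 ≤ ofReal q := by rw [← ofReal_one]; exact ofReal_le_ofReal hq1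
  have hlim1 := tendsto_moll hq1' (by simp) hUq
  have hlim2 := tendsto_moll hq1' (by simp) hWq
  have hlim : Tendsto (fun k => eLpNorm W (ofReal q) (volOn B)
      + eLpNorm (fun x => moll (bump E k) W x - W x) (ofReal q) volume
      + (eLpNorm (fun x => moll (bump E k) U x - U x) (ofReal q) volume
      + eLpNorm (fun x => moll (bump E k) U x - U x) (ofReal q) volume)) atTop
      (𝓝 (eLpNorm W (ofReal q) (volOn B))) := by
    simpa using (tendsto_const_nhds.add hlim2).add (hlim1.add hlim1)
  refine ge_of_tendsto' hlim fun k => ?_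
  have hUkc : ContDiff ℝ ∞ (moll (bump E k) U) := moll_contDiff _ (hUq.locallyIntegrable hq1')
  have hfd : (fun x => fderiv ℝ (moll (bump E k) U) x h) = moll (bump E k) W := by
    ext x; exact moll_fderiv _ (hUq.locallyIntegrable hq1') hUW x
  generalize moll (bump E k) U = Uk at hUkc hfd ⊢
  have hsm := eLpNorm_difference_le_of_contDiff hq1 hUkc hB hBm h
  have hWkc : ContDiff ℝ ∞ (moll (bump E k) W) := moll_contDiff _ (hWq.locallyIntegrable hq1')
  rw [hfd] at hsm
  generalize moll (bump E k) W = Wk at hWkc hsm ⊢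
  clear hfd hlim hlim1 hlim2
  generalize B ∩ (fun x => x + h) ⁻¹' B = S at hsm ⊢
  have hdiff : AEStronglyMeasurable (fun x => Uk x - U x) volume :=
    hUkc.continuous.aestronglyMeasurable.sub hUq.1
  have hmp := measurePreserving_add_right (volume : Measure E) h
  have hdiff' : AEStronglyMeasurable (fun x => Uk (x + h) - U (x + h)) volume :=
    hdiff.comp_measurePreserving hmp
  have t1 : eLpNorm (fun x => U (x + h) - U x) (ofReal q) (volOn S)
      ≤ eLpNorm (fun x => Uk (x + h) - Uk x) (ofReal q) (volOn S)
        + (eLpNorm (fun x => Uk x - U x) (ofReal q) volume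
        + eLpNorm (fun x => Uk x - U x) (ofReal q) volume) := by
    have a1 : (fun x => U (x + h) - U x) = (fun x => Uk (x + h) - Uk x)
        + ((fun x => Uk x - U x) - (fun x => Uk (x + h) - U (x + h))) :=
      funext fun x => by simp only [Pi.add_apply, Pi.sub_apply]; abel
    have a2 : eLpNorm (fun x => Uk (x + h) - U (x + h)) (ofReal q) volume
        = eLpNorm (fun x => Uk x - U x) (ofReal q) volume :=
      eLpNorm_comp_measurePreserving (f := fun x => x + h) (g := fun x => Uk x - U x) hdiff hmp
    have hsm1 : AEStronglyMeasurable (fun x => Uk (x + h) - Uk x) (volOn S) := by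
      have : Continuous (fun x => Uk (x + h) - Uk x) :=
        (hUkc.continuous.comp (continuous_id.add continuous_const)).sub hUkc.continuous
      exact this.aestronglyMeasurable
    rw [a1]
    refine (eLpNorm_add_le hsm1 (hdiff.restrict.sub hdiff'.restrict) hq1').trans ?_
    gcongr
    refine (eLpNorm_sub_le hdiff.restrict hdiff'.restrict hq1').trans ?_
    gcongr
    · exact Measure.restrict_le_self
    · rw [← a2]
      exact eLpNorm_mono_measure _ Measure.restrict_le_self
  have t2 : eLpNorm Wk (ofReal q) (volOn B)
      ≤ eLpNorm W (ofReal q) (volOn B) + eLpNorm (fun x => Wk x - W x) (ofReal q) volume := by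
    have a1 : Wk = W + (fun x => Wk x - W x) := by ext x; simp
    have a2 : AEStronglyMeasurable (fun x => Wk x - W x) volume :=
      hWkc.continuous.aestronglyMeasurable.sub hWq.1
    conv_lhs => rw [a1]
    refine (eLpNorm_add_le hWq.1.restrict a2.restrict hq1').trans ?_
    gcongr
    exact Measure.restrict_le_self
  calc _ ≤ _ := t1
    _ ≤ _ := by gcongr; exact hsm.trans t2

lemma eLpNorm_difference_le {Ω : Set E} {u w : E → ℂ} {h x₀ : E} {r q : ℝ}
    (hΩ : IsOpen Ω) (hq : q = 1 ∨ q = 2) (hu : LocL2 Ω u) (hw : LocL2 Ω w)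
    (hder : HasWeakDeriv Ω h u w) (hr : 0 < r) (hball : cB x₀ r ⊆ Ω) :
    eLpNorm (fun x => u (x + h) - u x) (ofReal q)
        (volOn (cB x₀ r ∩ (fun x => x + h) ⁻¹' cB x₀ r))
      ≤ eLpNorm w (ofReal q) (volOn (cB x₀ r)) := by
  have hq1 : 1 ≤ q := by rcases hq with rfl | rfl <;> norm_num
  set B := cB x₀ r with hBdef
  have hBm : MeasurableSet B := measurableSet_closedBall
  obtain ⟨δ, hδ, hδΩ⟩ := (isCompact_closedBall x₀ r).exists_cthickening_subset_open hΩ hball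
  have hball' : cB x₀ (r + δ) ⊆ Ω := by
    refine Subset.trans ?_ hδΩ
    rw [cthickening_closedBall hδ.le hr.le, add_comm]
  let b : ContDiffBump x₀ := ⟨r + δ / 2, r + δ, by positivity, by linarith⟩
  set χ : E → ℂ := fun x => (b x : ℂ) with hχdef
  have hχ : ContDiff ℝ ∞ χ := Complex.ofRealCLM.contDiff.comp b.contDiff
  have hχs : tsupport χ ⊆ cB x₀ (r + δ) := by
    refine closure_minimal (fun x hx => ?_) isClosed_closedBall
    refine ball_subset_closedBall ?_
    have : x ∈ Function.support b := fun h0 => hx (by simp [hχdef, h0])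
    rwa [b.support_eq] at this
  have hχc : HasCompactSupport χ :=
    (isCompact_closedBall _ _).of_isClosed_subset (isClosed_tsupport _) hχs
  have hχ1 : ∀ x ∈ ball x₀ (r + δ / 2), χ x = 1 := fun x hx => by
    simp [hχdef, b.one_of_mem_closedBall (ball_subset_closedBall hx)]
  have hBsub : B ⊆ ball x₀ (r + δ / 2) := closedBall_subset_ball (by linarith)
  have hdχ0 : ∀ x ∈ B, fderiv ℝ χ x h = 0 := by
    intro x hx
    have : χ =ᶠ[𝓝 x] fun _ => 1 := by
      filter_upwards [isOpen_ball.mem_nhds (hBsub hx)] with y hy using hχ1 y hy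
    rw [this.fderiv_eq]; simp
  set U : E → ℂ := fun x => u x * χ x
  set W : E → ℂ := fun x => w x * χ x + u x * fderiv ℝ χ x h
  have hUW : HasWeakDeriv univ h U W := HasWeakDeriv.mul_cutoff (hu.locallyIntegrableOn hΩ)
    (hw.locallyIntegrableOn hΩ) hder hχ hχc (hχs.trans hball')
  have hU2 : MemLp U 2 := hu.memLp_mul hχ.continuous hχc (hχs.trans hball')
  have hW2 : MemLp W 2 := (hw.memLp_mul hχ.continuous hχc (hχs.trans hball')).add
    (hu.memLp_mul (cont_fderiv hχ h) (hcs_fderiv hχc h)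
      ((tsupport_fderiv_apply_subset χ h).trans (hχs.trans hball')))
  have hlow : ∀ f : E → ℂ, MemLp f 2 → (∀ x, x ∉ tsupport χ → f x = 0) →
      MemLp f (ofReal q) := by
    intro f hf h0
    rcases hq with rfl | rfl
    · rw [ofReal_one]
      exact hf.mono_exponent_of_measure_support_ne_top (s := tsupport χ) h0
        (IsCompact.measure_lt_top hχc).ne one_le_two
    · simpa using hf
  have hUq : MemLp U (ofReal q) := hlow U hU2 fun x hx => by
    simp [U, image_eq_zero_of_notMem_tsupport hx]
  have hWq : MemLp W (ofReal q) := hlow W hW2 fun x hx => by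
    simp [W, image_eq_zero_of_notMem_tsupport hx, fderiv_of_notMem_tsupport ℝ hx]
  set S := B ∩ (fun x => x + h) ⁻¹' B
  have hS : MeasurableSet S := hBm.inter (measurable_add_const h hBm)
  have e1 : eLpNorm (fun x => u (x + h) - u x) (ofReal q) (volOn S)
      = eLpNorm (fun x => U (x + h) - U x) (ofReal q) (volOn S) := by
    apply eLpNorm_congr_ae
    filter_upwards [ae_restrict_mem hS] with x hx
    simp [U, hχ1 x (hBsub hx.1), hχ1 _ (hBsub hx.2)]
  have e2 : eLpNorm w (ofReal q) (volOn B)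
      = eLpNorm W (ofReal q) (volOn B) := by
    apply eLpNorm_congr_ae
    filter_upwards [ae_restrict_mem hBm] with x hx
    simp [W, hχ1 x (hBsub hx), hdχ0 x hx]
  rw [e1, e2]
  exact eLpNorm_difference_le_of_memLp hq1 hUq hWq hUW (convex_closedBall x₀ r) hBm

/-! ### Poincaré inequality, oscillation and the reverse Hölder inequality -/

/-- The coordinates of a point of `ℝⁿ⁺¹`. -/
def coord (h : Rn1 n) (i : Fin (n + 1)) : ℝ :=
  Fin.lastCases (motive := fun _ => ℝ) h.2 (fun j => h.1 j) i

lemma sum_coord_smul_dir (h : Rn1 n) : ∑ i, coord h i • (dir i : Rn1 n) = h := by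
  rw [Fin.sum_univ_castSucc]
  simp only [coord, dir, Fin.lastCases_castSucc, Fin.lastCases_last]
  ext i
  · simp [Prod.fst_sum, dirX, Pi.single_apply]
  · simp [Prod.snd_sum]

lemma abs_coord_le (h : Rn1 n) (i : Fin (n + 1)) : |coord h i| ≤ ‖h‖ := by
  refine Fin.lastCases ?_ (fun j => ?_) i
  · simp only [coord, Fin.lastCases_last]; exact norm_snd_le h
  · simp only [coord, Fin.lastCases_castSucc]
    exact (PiLp.norm_apply_le h.1 j).trans (norm_fst_le h)

lemma hasWeakDeriv_direction {Ω : Set (Rn1 n)} {u : Rn1 n → ℂ} {G : VF n}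
    (hu : LocallyIntegrableOn u Ω) (hG : ∀ i, LocallyIntegrableOn (fun X => G X i) Ω)
    (hw : ∀ i, HasWeakDeriv Ω (dir i) u (fun X => G X i)) (h : Rn1 n) :
    HasWeakDeriv Ω h u (fun X => ∑ i, (coord h i : ℂ) * G X i) := by
  intro φ hφ hc hs
  have h1 : ∀ X, fderiv ℝ φ X h = ∑ i, (coord h i : ℂ) * fderiv ℝ φ X (dir i) := by
    intro X
    conv_lhs => rw [← sum_coord_smul_dir h]
    simp [map_sum]
  simp only [h1, Finset.mul_sum, Finset.sum_mul]
  rw [integral_finsetSum, integral_finsetSum, ← Finset.sum_neg_distrib]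
  · refine Finset.sum_congr rfl fun i _ => ?_
    have := hw i φ hφ hc hs
    simp only [mul_assoc, mul_left_comm (u _), integral_const_mul]
    rw [this, mul_neg]
  · intro i _
    simp only [mul_assoc]
    exact (integrable_mul_of_locInt (hG i) hφ.continuous hc hs).const_mul _
  · intro i _
    simp only [mul_left_comm (u _)]
    exact (integrable_mul_of_locInt hu (cont_fderiv hφ _)
      (hcs_fderiv hc _)
      ((tsupport_fderiv_apply_subset φ _).trans hs)).const_mul _

lemma norm_sum_coord_mul_le (h : Rn1 n) (ξ : Cv (n + 1)) :
    ‖∑ i, (coord h i : ℂ) * ξ i‖ ≤ (n + 1) * ‖h‖ * ‖ξ‖ := by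
  calc _ ≤ ∑ i, ‖(coord h i : ℂ) * ξ i‖ := norm_sum_le _ _
    _ ≤ ∑ _i : Fin (n + 1), ‖h‖ * ‖ξ‖ := by
        refine Finset.sum_le_sum fun i _ => ?_
        rw [norm_mul, Complex.norm_real]
        exact mul_le_mul (abs_coord_le h i) (PiLp.norm_apply_le ξ i) (norm_nonneg _) (norm_nonneg _)
    _ = _ := by simp [mul_assoc]

lemma lintegral_difference_le {Ω : Set (Rn1 n)} {u : Rn1 n → ℂ} {G : VF n}
    (hΩ : IsOpen Ω) (hu : LocL2 Ω u) (hG : LocL2 Ω G)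
    (hw : ∀ i, HasWeakDeriv Ω (dir i) u (fun X => G X i)) {X : Rn1 n} {r : ℝ} (hr : 0 < r)
    (hball : cB X r ⊆ Ω) (h : Rn1 n) :
    ∫⁻ Y in cB X r ∩ (fun Y => Y + h) ⁻¹' cB X r,
      ‖u (Y + h) - u Y‖ₑ ≤ ofReal ((n + 1) * ‖h‖) * ∫⁻ Y in cB X r, ‖G Y‖ₑ := by
  have hd := hasWeakDeriv_direction (hu.locallyIntegrableOn hΩ)
    (fun i => (hG.apply i).locallyIntegrableOn hΩ) hw h
  have hwl : LocL2 Ω (fun X => ∑ i, (coord h i : ℂ) * G X i) := fun K hK hs =>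
    memLp_finsetSum _ fun i _ => ((hG.apply i) K hK hs).const_mul _
  have h1 := eLpNorm_difference_le hΩ (Or.inl rfl) hu hwl hd hr hball
  rw [ofReal_one, eLpNorm_one_eq_lintegral_enorm, eLpNorm_one_eq_lintegral_enorm] at h1
  refine h1.trans ?_
  rw [← lintegral_const_mul' _ _ ofReal_ne_top]
  refine lintegral_mono fun Y => ?_
  have := norm_sum_coord_mul_le h (G Y)
  rw [← ofReal_norm, ← ofReal_norm, ← ofReal_mul (by positivity)]
  exact ofReal_le_ofReal this

lemma lintegral_lintegral_sub_le {Ω : Set (Rn1 n)} {u : Rn1 n → ℂ} {G : VF n}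
    (hΩ : IsOpen Ω) (hu : ContinuousOn u Ω) (hG : LocL2 Ω G)
    (hw : ∀ i, HasWeakDeriv Ω (dir i) u (fun X => G X i)) {X : Rn1 n} {r : ℝ} (hr : 0 < r)
    (hball : cB X r ⊆ Ω) :
    ∫⁻ Y in cB X r, ∫⁻ Z in cB X r, ‖u Z - u Y‖ₑ
      ≤ volume (cB (0 : Rn1 n) (2 * r)) * (ofReal ((n + 1) * (2 * r)) *
        ∫⁻ Y in cB X r, ‖G Y‖ₑ) := by
  classical
  set B := cB X r with hB
  have hBm : MeasurableSet B := measurableSet_closedBall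
  set v : Rn1 n → ℂ := B.piecewise u (fun _ => 0)
  have hv : Measurable v := ContinuousOn.measurable_piecewise (hu.mono hball) continuousOn_const hBm
  have hvu : ∀ Y ∈ B, v Y = u Y := fun Y hY => by simp [v, hY]
  have hpre : ∀ h : Rn1 n, MeasurableSet ((fun Y => Y + h) ⁻¹' B) := fun h =>
    measurable_add_const h hBm
  have hM : MeasurableSet {z : Rn1 n × Rn1 n | z.1 ∈ B ∧ z.1 + z.2 ∈ B} :=
    (measurable_fst hBm).inter ((measurable_fst.add measurable_snd) hBm)
  have hmeas : Measurable (fun z : Rn1 n × Rn1 n =>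
      {z : Rn1 n × Rn1 n | z.1 ∈ B ∧ z.1 + z.2 ∈ B}.indicator
        (fun z => ‖v (z.1 + z.2) - v z.1‖ₑ) z) :=
    Measurable.indicator (((hv.comp (measurable_fst.add measurable_snd)).sub
      (hv.comp measurable_fst)).enorm) hM
  have e1 : ∫⁻ Y in B, ∫⁻ Z in B, ‖u Z - u Y‖ₑ
      = ∫⁻ Y, ∫⁻ h, {z : Rn1 n × Rn1 n | z.1 ∈ B ∧ z.1 + z.2 ∈ B}.indicator
        (fun z => ‖v (z.1 + z.2) - v z.1‖ₑ) (Y, h) := by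
    rw [← lintegral_indicator hBm]
    congr 1; ext Y
    by_cases hY : Y ∈ B
    · rw [indicator_of_mem hY, ← lintegral_indicator hBm, ← lintegral_add_left_eq_self _ Y]
      congr 1; ext h
      by_cases hh : Y + h ∈ B
      · simp [hY, hh, hvu]
      · simp [hh]
    · simp [hY]
  have e2 : ∫⁻ Y, ∫⁻ h, {z : Rn1 n × Rn1 n | z.1 ∈ B ∧ z.1 + z.2 ∈ B}.indicator
        (fun z => ‖v (z.1 + z.2) - v z.1‖ₑ) (Y, h)
      = ∫⁻ h, ∫⁻ Y, {z : Rn1 n × Rn1 n | z.1 ∈ B ∧ z.1 + z.2 ∈ B}.indicator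
        (fun z => ‖v (z.1 + z.2) - v z.1‖ₑ) (Y, h) :=
    lintegral_lintegral_swap hmeas.aemeasurable
  rw [e1, e2]
  have e3 : ∀ h, ∫⁻ Y, {z : Rn1 n × Rn1 n | z.1 ∈ B ∧ z.1 + z.2 ∈ B}.indicator
        (fun z => ‖v (z.1 + z.2) - v z.1‖ₑ) (Y, h)
      = ∫⁻ Y in B ∩ (fun Y => Y + h) ⁻¹' B, ‖u (Y + h) - u Y‖ₑ := by
    intro h
    rw [← lintegral_indicator (hBm.inter (hpre h))]
    congr 1; ext Y
    by_cases hY : Y ∈ B <;> by_cases hh : Y + h ∈ B <;> simp [hY, hh, hvu]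
  simp only [e3]
  calc ∫⁻ h, ∫⁻ Y in B ∩ (fun Y => Y + h) ⁻¹' B, ‖u (Y + h) - u Y‖ₑ
      ≤ ∫⁻ h, (cB (0 : Rn1 n) (2 * r)).indicator
        (fun _ => ofReal ((n + 1) * (2 * r)) * ∫⁻ Y in B, ‖G Y‖ₑ) h := by
        refine lintegral_mono fun h => ?_
        by_cases hh : h ∈ cB (0 : Rn1 n) (2 * r)
        · rw [indicator_of_mem hh]
          refine (lintegral_difference_le hΩ (locL2_of_continuousOn hu) hG hw hr hball h).trans ?_
          rw [mem_closedBall_zero_iff] at hh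
          gcongr
        · have : B ∩ (fun Y => Y + h) ⁻¹' B = ∅ := by
            ext Y
            simp only [mem_inter_iff, mem_preimage, mem_empty_iff_false, iff_false, not_and]
            intro h1 h2
            apply hh
            rw [mem_closedBall_zero_iff]
            have h3 : dist (Y + h) Y ≤ 2 * r := by
              have := dist_triangle_right (Y + h) Y X
              rw [hB, mem_closedBall] at h1 h2
              linarith
            simpa [dist_eq_norm] using h3
          rw [this]; simp
    _ = _ := by rw [lintegral_indicator measurableSet_closedBall, setLIntegral_const, mul_comm]

lemma exists_poincare (n : ℕ) : ∃ C : ℝ, 0 < C ∧ ∀ (Ω : Set (Rn1 n)) (u : Rn1 n → ℂ)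
    (G : VF n), IsOpen Ω → ContinuousOn u Ω → LocL2 Ω G →
    (∀ i, HasWeakDeriv Ω (dir i) u (fun X => G X i)) → ∀ (X : Rn1 n) (r : ℝ), 0 < r →
    cB X r ⊆ Ω → ∃ c : ℂ, ∫ Y in cB X r, ‖u Y - c‖ ≤ C * r * ∫ Y in cB X r, ‖G Y‖ := by
  refine ⟨2 ^ (n + 1) * (2 * (n + 1)), by positivity, ?_⟩
  intro Ω u G hΩ hu hG hw X r hr hball
  set B := cB X r with hB
  have hBm : MeasurableSet B := measurableSet_closedBall
  have hcomp : IsCompact B := isCompact_closedBall X r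
  have hfin : IsFiniteMeasure (volOn B) := ⟨by simpa using hcomp.measure_lt_top⟩
  have hGi : Integrable (fun Y => ‖G Y‖) (volOn B) :=
    ((hG B hcomp hball).integrable one_le_two).norm
  have h1 := lintegral_lintegral_sub_le hΩ hu hG hw hr hball
  have hv := vol1_pos (n := n)
  have hvB : volume B = ofReal (r ^ (n + 1) * vol1 n) := volume_closedBall X hr.le
  have hint : ∀ c : ℂ, ∫⁻ Z in B, ‖u Z - c‖ₑ = ofReal (∫ Z in B, ‖u Z - c‖) := by
    intro c
    rw [ofReal_integral_eq_lintegral_ofReal]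
    · congr 1; ext Z; rw [ofReal_norm]
    · exact ((hu.mono hball).sub continuousOn_const).norm.integrableOn_compact hcomp
    · exact .of_forall fun _ => norm_nonneg _
  have hGint : ∫⁻ Z in B, ‖G Z‖ₑ = ofReal (∫ Z in B, ‖G Z‖) := by
    rw [ofReal_integral_eq_lintegral_ofReal hGi (.of_forall fun _ => norm_nonneg _)]
    congr 1; ext Z; rw [ofReal_norm]
  have hJ0 : 0 ≤ ∫ Y in B, ‖G Y‖ := integral_nonneg fun _ => norm_nonneg _
  have hconv : volume (cB (0 : Rn1 n) (2 * r)) *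
      (ofReal ((n + 1) * (2 * r)) * ∫⁻ Y in B, ‖G Y‖ₑ)
      = ofReal ((2 * r) ^ (n + 1) * vol1 n * ((n + 1) * (2 * r) * ∫ Y in B, ‖G Y‖)) := by
    rw [hGint, volume_closedBall _ (by positivity), ← ofReal_mul (by positivity),
      ← ofReal_mul (by positivity)]
  rw [hconv] at h1
  have hcontI : ContinuousOn (fun Y => ∫⁻ Z in B, ‖u Z - u Y‖ₑ) B := by
    simp only [hint]
    refine ENNReal.continuous_ofReal.comp_continuousOn ?_
    refine continuousOn_of_dominated (F := fun Y Z => ‖u Z - u Y‖) (μ := volOn B)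
      (bound := fun _ => 2 * (hcomp.exists_bound_of_continuousOn (hu.mono hball)).choose) ?_ ?_ ?_ ?_
    · intro Y _
      exact (((hu.mono hball).sub continuousOn_const).norm).aestronglyMeasurable hBm
    · intro Y hY
      filter_upwards [ae_restrict_mem hBm] with Z hZ
      have := (hcomp.exists_bound_of_continuousOn (hu.mono hball)).choose_spec
      rw [norm_norm]
      refine (norm_sub_le _ _).trans ?_
      linarith [this Z hZ, this Y hY]
    · exact integrable_const _
    · refine .of_forall fun Z => ?_
      exact (continuousOn_const.sub (hu.mono hball)).norm
  obtain ⟨y, hyB, hy⟩ := exists_le_setLAverage (μ := (volume : Measure (Rn1 n)))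
    (s := B) (f := fun Y => ∫⁻ Z in B, ‖u Z - u Y‖ₑ)
    (by rw [hvB]; simp; positivity) hcomp.measure_lt_top.ne
    (hcontI.aemeasurable hBm)
  refine ⟨u y, ?_⟩
  rw [setLAverage_eq] at hy
  have h2 := hy.trans (ENNReal.div_le_div_right h1 _)
  rw [hint, hvB, ← ofReal_div_of_pos (by positivity), ofReal_le_ofReal_iff (by positivity)] at h2
  refine h2.trans (le_of_eq ?_)
  rw [mul_pow]
  field_simp

lemma exists_oscillation (n : ℕ) {C₀ : ℝ} (hC₀ : 0 < C₀) : ∃ C : ℝ, 0 < C ∧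
    ∀ (A : Coeff n) (α : ℝ), DGNM A C₀ α → ∀ (Ω : Set (Rn1 n)) (u : Rn1 n → ℂ)
      (G : VF n), IsOpen Ω → IsSolution A Ω u G → ContinuousOn u Ω →
      ∀ (X : Rn1 n) (R : ℝ), 0 < R → cB X R ⊆ Ω →
      ∃ c : ℂ, ∀ Y ∈ cB X (R / 2),
      ‖u Y - c‖ ≤ C / R ^ n * ∫ Z in cB X R, ‖G Z‖ := by
  obtain ⟨C₁, hC₁, hmos⟩ := exists_moser_one n hC₀
  obtain ⟨C₂, hC₂, hpoi⟩ := exists_poincare n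
  refine ⟨C₁ * C₂, by positivity, ?_⟩
  intro A α hD Ω u G hΩ hu hcont X R hR hball
  obtain ⟨c, hc⟩ := hpoi Ω u G hΩ hcont hu.gradLocL2 hu.weakGrad X R hR hball
  refine ⟨c, fun Y hY => ?_⟩
  have h1 := hmos A α hD Ω _ G hΩ (hu.sub_const hΩ c) (hcont.sub continuousOn_const) X R hR hball
    Y hY
  refine h1.trans ?_
  calc _ ≤ C₁ / R ^ (n + 1) * (C₂ * R * ∫ Z in cB X R, ‖G Z‖) := by gcongr
    _ = _ := by rw [pow_succ]; field_simp

lemma exists_reverse_holder (n : ℕ) {C₀ Λ : ℝ} (hC₀ : 0 < C₀) (hΛ : 0 < Λ) : ∃ K : ℝ, 0 < K ∧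
    ∀ (A : Coeff n) (α : ℝ), Standard A Λ C₀ α → ∀ (Ω : Set (Rn1 n)) (u : Rn1 n → ℂ)
      (G : VF n), IsOpen Ω → IsSolution A Ω u G → ContinuousOn u Ω →
      ∀ (X : Rn1 n) (r : ℝ), 0 < r → cB X (4 * r) ⊆ Ω →
      (∫ Y in cB X r, ‖G Y‖ ^ 2) * r ^ (n + 1) ≤ K * (∫ Y in cB X (4 * r), ‖G Y‖) ^ 2 := by
  obtain ⟨C₁, hC₁, hosc⟩ := exists_oscillation n hC₀
  obtain ⟨C₂, hC₂, hcac⟩ := exists_caccioppoli n hΛ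
  have hv := vol1_pos (n := n)
  refine ⟨C₂ * 2 ^ (n + 1) * vol1 n * (C₁ / 4 ^ n) ^ 2, by positivity, ?_⟩
  intro A α hA Ω u G hΩ hu hcont X r hr hball
  set J := ∫ Y in cB X (4 * r), ‖G Y‖
  have hJ0 : 0 ≤ J := integral_nonneg fun _ => norm_nonneg _
  obtain ⟨c, hc⟩ := hosc A α hA.dgnm Ω u G hΩ hu hcont X (4 * r) (by positivity) hball
  have hsub : cB X (2 * r) ⊆ cB X (4 * r) := closedBall_subset_closedBall (by linarith)
  have h1 := hcac A hA.elliptic Ω _ G hΩ (hu.sub_const hΩ c) X r hr (hsub.trans hball)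
  have h2 : ∫ Y in cB X (2 * r), ‖u Y - c‖ ^ 2
      ≤ (C₁ / (4 * r) ^ n * J) ^ 2 * ((2 * r) ^ (n + 1) * vol1 n) := by
    have hcst : ∫ _ in cB X (2 * r), (C₁ / (4 * r) ^ n * J) ^ 2
        = (C₁ / (4 * r) ^ n * J) ^ 2 * ((2 * r) ^ (n + 1) * vol1 n) := by
      rw [setIntegral_const, volume_real_closedBall X (by positivity), smul_eq_mul, mul_comm]
    rw [← hcst]
    refine setIntegral_mono_on ?_ ?_ measurableSet_closedBall fun Y hY => ?_
    · exact (((hcont.mono (hsub.trans hball)).sub continuousOn_const).norm.pow 2).integrableOn_compact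
        (isCompact_closedBall _ _)
    · exact integrableOn_const (vol_cB_ne _ _)
    · have := hc Y (by convert hY using 2; ring)
      gcongr
  calc _ ≤ C₂ / r ^ 2 * ((C₁ / (4 * r) ^ n * J) ^ 2 * ((2 * r) ^ (n + 1) * vol1 n)) * r ^ (n + 1) := by
        gcongr
        exact h1.trans (by gcongr)
    _ = _ := by
        rw [mul_pow 4 r, mul_pow 2 r]
        field_simp
        ring

/-! ### Gehring's lemma -/

lemma volume_closedBall_mul (X : E) {c r : ℝ} (hc : 0 ≤ c) (hr : 0 ≤ r) :
    volume (cB X (c * r)) = ofReal c ^ finrank ℝ E * volume (cB X r) := by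
  rw [Measure.addHaar_closedBall_mul _ _ hc hr, ← Measure.addHaar_closedBall_center volume X r,
    ofReal_pow hc]

lemma level_le_setLIntegral {w : E → ℝ≥0∞} {X : E} {r : ℝ} (hr : 0 < r) {M K η : ℝ≥0∞}
    (hM : M ≠ ⊤) {S : Set E} (hS : MeasurableSet S)
    (h₁ : M ^ 2 * volume (cB X r) ≤ ∫⁻ Y in cB X r, w Y ^ 2)
    (hRH : (∫⁻ Y in cB X r, w Y ^ 2) * volume (cB X r) ≤ (K * ∫⁻ Y in cB X (4 * r), w Y) ^ 2)
    (hwS : ∀ Y ∈ cB X (4 * r), Y ∉ S → w Y ≤ η * M)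
    (hη : K * η * 4 ^ finrank ℝ E ≤ 2⁻¹) :
    M * volume (cB X r) ≤ 2 * K * ∫⁻ Y in cB X (4 * r) ∩ S, w Y := by
  set v := volume (cB X r)
  set I := ∫⁻ Y in cB X (4 * r) ∩ S, w Y
  have hv : v ≠ ⊤ := vol_cB_ne _ _
  have hMv : M * v ≠ ⊤ := mul_ne_top hM hv
  have h2 : M * v ≤ K * ∫⁻ Y in cB X (4 * r), w Y := by
    refine (ENNReal.pow_le_pow_left_iff two_ne_zero).1 (le_trans ?_ hRH)
    calc (M * v) ^ 2 = M ^ 2 * v * v := by ring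
      _ ≤ _ := by gcongr
  have h3 : ∫⁻ Y in cB X (4 * r), w Y
      ≤ I + η * M * (4 ^ finrank ℝ E * v) := by
    rw [← lintegral_inter_add_sdiff _ (cB X (4 * r)) hS]
    refine add_le_add le_rfl ?_
    calc ∫⁻ Y in cB X (4 * r) \ S, w Y
        ≤ ∫⁻ _ in cB X (4 * r) \ S, η * M :=
          setLIntegral_mono' (measurableSet_closedBall.diff hS)
            fun Y hY => hwS Y hY.1 hY.2
      _ ≤ η * M * volume (cB X (4 * r)) := by
          rw [setLIntegral_const]
          gcongr
          exact sdiff_subset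
      _ = _ := by
          rw [volume_closedBall_mul X (by norm_num) hr.le]
          simp [v]
  have h4 : M * v ≤ K * I + 2⁻¹ * (M * v) := by
    calc M * v ≤ K * (I + η * M * (4 ^ finrank ℝ E * v)) := h2.trans (by gcongr)
      _ = K * I + K * η * 4 ^ finrank ℝ E * (M * v) := by ring
      _ ≤ _ := by gcongr
  refine (ENNReal.add_le_add_iff_right hMv).1 ?_
  calc _ = 2 * (M * v) := by ring
    _ ≤ 2 * (K * I + 2⁻¹ * (M * v)) := by gcongr
    _ = 2 * K * I + 2 * 2⁻¹ * (M * v) := by ring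
    _ = _ := by rw [ENNReal.mul_inv_cancel two_ne_zero (by simp), one_mul]

/-- Relative distance to the boundary of `B(X₀, R₀)`. -/
def bdryDist (X₀ : E) (R₀ : ℝ) (X : E) : ℝ≥0∞ := ofReal (1 - dist X X₀ / R₀)

lemma bdryDist_le_one (X₀ : E) {R₀ : ℝ} (hR₀ : 0 < R₀) (X : E) : bdryDist X₀ R₀ X ≤ 1 := by
  rw [bdryDist, ← ofReal_one]
  exact ofReal_le_ofReal (by have := div_nonneg (dist_nonneg (x := X) (y := X₀)) hR₀.le; linarith)

lemma measurable_bdryDist (X₀ : E) (R₀ : ℝ) : Measurable (bdryDist X₀ R₀) := by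
  unfold bdryDist
  fun_prop

lemma bdryDist_comparable (X₀ : E) {R₀ : ℝ} (hR₀ : 0 < R₀) {X Y : E} {ρ : ℝ}
    (hρ : ρ = 1 - dist X X₀ / R₀) (hρ0 : 0 < ρ) (h : dist Y X ≤ ρ * R₀ / 2) :
    bdryDist X₀ R₀ Y ≤ 2 * bdryDist X₀ R₀ X ∧ bdryDist X₀ R₀ X ≤ 2 * bdryDist X₀ R₀ Y := by
  have h1 : |dist Y X₀ - dist X X₀| ≤ ρ * R₀ / 2 := (abs_dist_sub_le Y X X₀).trans h
  have h2 : |dist Y X₀ / R₀ - dist X X₀ / R₀| ≤ ρ / 2 := by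
    rw [← sub_div, abs_div, abs_of_pos hR₀, div_le_iff₀ hR₀]
    linarith
  rw [abs_le] at h2
  have e2 : (2 : ℝ≥0∞) = ofReal 2 := by simp
  unfold bdryDist
  rw [e2, ← ofReal_mul (by norm_num), ← ofReal_mul (by norm_num)]
  exact ⟨ofReal_le_ofReal (by linarith [h2.1, h2.2]), ofReal_le_ofReal (by linarith [h2.1, h2.2])⟩

/-- A reverse Hölder inequality on the balls inside `B(X₀, R₀)`. -/
def RevHolder (w : E → ℝ≥0∞) (X₀ : E) (R₀ : ℝ) (K : ℝ≥0∞) : Prop :=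
  ∀ X r, 0 < r → cB X (4 * r) ⊆ ball X₀ R₀ →
    (∫⁻ Y in cB X r, w Y ^ 2) * volume (cB X r) ≤ (K * ∫⁻ Y in cB X (4 * r), w Y) ^ 2

lemma exists_stopping_ball [Nontrivial E] {w : E → ℝ≥0∞} {X₀ : E} {R₀ : ℝ} (hR₀ : 0 < R₀) {K κ l : ℝ≥0∞}
    (hw : Measurable w)
    (hκ : K * κ * 8 ^ finrank ℝ E ≤ 2⁻¹)
    (hRH : RevHolder w X₀ R₀ K)
    (hl : l ≠ ⊤)
    (ha : (∫⁻ Y, w Y ^ 2) * 20 ^ finrank ℝ E ≤ l ^ 2 * volume (cB X₀ R₀))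
    {X : E} (hX : l < bdryDist X₀ R₀ X ^ finrank ℝ E * w X)
    (hleb : Tendsto (fun r => (∫⁻ Y in cB X r, w Y ^ 2) / volume (cB X r)) (𝓝[>] 0) (𝓝 (w X ^ 2))) :
    ∃ r, 0 < r ∧ 4 * r ≤ R₀ ∧
      ∫⁻ Y in cB X (20 * r), (bdryDist X₀ R₀ Y ^ finrank ℝ E * w Y) ^ 2
        ≤ 2 * 160 ^ finrank ℝ E * K * l * ∫⁻ Y in cB X (4 * r) ∩
          {Y | κ * l < bdryDist X₀ R₀ Y ^ finrank ℝ E * w Y},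
            bdryDist X₀ R₀ Y ^ finrank ℝ E * w Y := by
  set d := finrank ℝ E
  set b := bdryDist X₀ R₀
  set ρ : ℝ := 1 - dist X X₀ / R₀ with hρ
  have hbX : b X = ofReal ρ := rfl
  have hρ0 : 0 < ρ := by
    by_contra hneg
    rw [hbX, ENNReal.ofReal_of_nonpos (not_lt.1 hneg), zero_pow Module.finrank_pos.ne', zero_mul] at hX
    exact not_lt_bot hX
  have hρ1 : ρ ≤ 1 := by have := div_nonneg (dist_nonneg (x := X) (y := X₀)) hR₀.le; linarith
  have hb0 : b X ≠ 0 := by rw [hbX]; simpa using hρ0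
  have hbt : b X ≠ ⊤ := ofReal_ne_top
  have hbd0 : b X ^ d ≠ 0 := pow_ne_zero _ hb0
  have hbdt : b X ^ d ≠ ⊤ := ENNReal.pow_ne_top hbt
  set M : ℝ≥0∞ := l / b X ^ d with hMdef
  have hMt : M ≠ ⊤ := ENNReal.div_ne_top hl hbd0
  have hMl : b X ^ d * M = l := ENNReal.mul_div_cancel hbd0 hbdt
  have hMw : M < w X := by
    rw [hMdef]
    exact ENNReal.div_lt_of_lt_mul' hX
  set rX : ℝ := ρ * R₀ / 20 with hrX
  have hrX0 : 0 < rX := by positivity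
  have hrk : ∀ k : ℕ, 0 < rX / 20 ^ k := fun k => by positivity
  let P : ℕ → Prop := fun k =>
    M ^ 2 * volume (cB X (rX / 20 ^ k)) ≤ ∫⁻ Y in cB X (rX / 20 ^ k), w Y ^ 2
  have hvpos : ∀ r : ℝ, 0 < r → volume (cB X r) ≠ 0 := fun r hr =>
    (measure_closedBall_pos volume X hr).ne'
  have hvt : ∀ r : ℝ, volume (cB X r) ≠ ⊤ := fun r => vol_cB_ne _ _
  have hex : ∃ k, P k ∧ k ≠ 0 := by
    have hlim : Tendsto (fun k : ℕ => rX / 20 ^ k) atTop (𝓝[>] 0) := by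
      refine tendsto_nhdsWithin_iff.2 ⟨?_, .of_forall hrk⟩
      have := (tendsto_pow_atTop_nhds_zero_of_lt_one (r := (1 / 20 : ℝ)) (by norm_num)
        (by norm_num)).const_mul rX
      simpa [div_eq_mul_inv] using this
    have h1 : ∀ᶠ k : ℕ in atTop, M ^ 2 < (∫⁻ Y in cB X (rX / 20 ^ k), w Y ^ 2)
        / volume (cB X (rX / 20 ^ k)) :=
      (hleb.comp hlim).eventually_const_lt (by gcongr)
    obtain ⟨k, hk, hk1⟩ := (h1.and (eventually_ge_atTop 1)).exists
    refine ⟨k, ?_, by omega⟩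
    exact (ENNReal.le_div_iff_mul_le (Or.inl (hvpos _ (hrk k))) (Or.inl (hvt _))).1 hk.le
  classical
  set k := Nat.find hex
  obtain ⟨hk, hk0⟩ : P k ∧ k ≠ 0 := Nat.find_spec hex
  set r := rX / 20 ^ k with hr
  have hr0 : 0 < r := hrk k
  have h20 : 20 * r = rX / 20 ^ (k - 1) := by
    obtain ⟨m, hm⟩ := Nat.exists_eq_succ_of_ne_zero hk0
    rw [hr, hm, Nat.succ_sub_one, Nat.succ_eq_add_one, pow_succ]
    field_simp
  have h20le : 20 * r ≤ rX := by
    rw [h20]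
    exact div_le_self hrX0.le (one_le_pow₀ (by norm_num))
  have hup : ∫⁻ Y in cB X (20 * r), w Y ^ 2
      ≤ M ^ 2 * volume (cB X (20 * r)) := by
    by_cases hk1 : k - 1 = 0
    · have e : 20 * r = rX := by rw [h20, hk1]; simp
      rw [e]
      have e2 : volume (cB X rX)
          = b X ^ d * (20⁻¹) ^ d * volume (cB X₀ R₀) := by
        have : rX = (ρ / 20) * R₀ := by rw [hrX]; ring
        rw [this, volume_closedBall_mul X (by positivity) hR₀.le,
          ofReal_div_of_pos (by norm_num), div_eq_mul_inv, mul_pow, ← hbX,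
          Measure.addHaar_closedBall_center volume X, Measure.addHaar_closedBall_center volume X₀]
        simp [d]
      have e20 : (20 : ℝ≥0∞) ^ d * (20⁻¹) ^ d = 1 := by
        rw [← mul_pow, ENNReal.mul_inv_cancel (by norm_num) (by norm_num), one_pow]
      calc ∫⁻ Y in cB X rX, w Y ^ 2 ≤ ∫⁻ Y, w Y ^ 2 := setLIntegral_le_lintegral _ _
        _ = (∫⁻ Y, w Y ^ 2) * 20 ^ d * (20⁻¹) ^ d := by rw [mul_assoc, e20, mul_one]
        _ ≤ l ^ 2 * volume (cB X₀ R₀) * (20⁻¹) ^ d := by gcongr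
        _ = b X ^ d * (M ^ 2 * (b X ^ d * (20⁻¹) ^ d * volume (cB X₀ R₀))) := by
            rw [← hMl]; ring
        _ ≤ 1 * (M ^ 2 * volume (cB X rX)) := by
            rw [e2]
            gcongr
            exact pow_le_one₀ zero_le (bdryDist_le_one X₀ hR₀ X)
        _ = _ := one_mul _
    · have := Nat.find_min hex (m := k - 1) (by omega)
      have hnP : ¬ P (k - 1) := fun h => this ⟨h, hk1⟩
      rw [h20]
      exact (not_le.1 hnP).le
  have hcomp : ∀ Y ∈ cB X (20 * r), b Y ≤ 2 * b X ∧ b X ≤ 2 * b Y := by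
    intro Y hY
    refine bdryDist_comparable X₀ hR₀ hρ hρ0 ?_
    have : dist Y X ≤ 20 * r := hY
    have : 0 < ρ * R₀ := by positivity
    linarith
  have hsub4 : cB X (4 * r) ⊆ cB X (20 * r) := closedBall_subset_closedBall (by linarith)
  have hsub0 : cB X (4 * r) ⊆ ball X₀ R₀ := by
    intro Y hY
    have h1 : dist Y X ≤ 4 * r := hY
    have h2 : dist X X₀ = (1 - ρ) * R₀ := by rw [hρ]; field_simp; ring
    have h3 := dist_triangle Y X X₀
    have : 0 < ρ * R₀ := by positivity
    simp only [mem_ball]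
    nlinarith
  set S := {Y | κ * l < b Y ^ d * w Y} with hSdef
  have hSm : MeasurableSet S :=
    measurableSet_lt measurable_const (((measurable_bdryDist X₀ R₀).pow_const _).mul hw)
  have key := level_le_setLIntegral (w := w) (K := K) (η := κ * 2 ^ d) (S := S) hr0 hMt hSm hk
    (hRH X r hr0 hsub0) (fun Y hY hYS => by
      have h1 : b Y ^ d * w Y ≤ κ * l := not_lt.1 hYS
      have h2 : b X ^ d * w Y ≤ b X ^ d * (κ * 2 ^ d * M) := by
        calc b X ^ d * w Y ≤ (2 * b Y) ^ d * w Y := by gcongr; exact (hcomp Y (hsub4 hY)).2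
          _ = 2 ^ d * (b Y ^ d * w Y) := by ring
          _ ≤ 2 ^ d * (κ * l) := by gcongr
          _ = _ := by rw [← hMl]; ring
      exact (ENNReal.mul_le_mul_iff_right hbd0 hbdt).1 h2)
    (by
      calc K * (κ * 2 ^ d) * 4 ^ d = K * κ * (2 * 4) ^ d := by rw [mul_pow]; ring
        _ ≤ _ := by rw [show (2 * 4 : ℝ≥0∞) = 8 by norm_num]; exact hκ)
  refine ⟨r, hr0, ?_, ?_⟩
  · have : ρ * R₀ ≤ R₀ := by nlinarith
    linarith
  have hsubS : ∫⁻ Y in cB X (4 * r) ∩ S, b X ^ d * w Y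
      ≤ 2 ^ d * ∫⁻ Y in cB X (4 * r) ∩ S, b Y ^ d * w Y := by
    rw [← lintegral_const_mul' _ _ (by simp)]
    refine setLIntegral_mono' (measurableSet_closedBall.inter hSm) fun Y hY => ?_
    calc b X ^ d * w Y ≤ (2 * b Y) ^ d * w Y := by gcongr; exact (hcomp Y (hsub4 hY.1)).2
      _ = _ := by ring
  calc ∫⁻ Y in cB X (20 * r), (b Y ^ d * w Y) ^ 2
      ≤ ∫⁻ Y in cB X (20 * r), (2 ^ d * b X ^ d) ^ 2 * w Y ^ 2 := by
        refine setLIntegral_mono' measurableSet_closedBall fun Y hY => ?_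
        rw [mul_pow, ← mul_pow 2 (b X) d]
        gcongr
        exact (hcomp Y hY).1
    _ = (2 ^ d * b X ^ d) ^ 2 * ∫⁻ Y in cB X (20 * r), w Y ^ 2 :=
        lintegral_const_mul' _ _ (by exact ENNReal.pow_ne_top (mul_ne_top (by simp) hbdt))
    _ ≤ (2 ^ d * b X ^ d) ^ 2 * (M ^ 2 * (20 ^ d * volume (cB X r))) := by
        gcongr
        refine hup.trans_eq ?_
        rw [volume_closedBall_mul X (by norm_num) hr0.le]
        simp [d]
    _ = (2 ^ d) ^ 2 * 20 ^ d * l * b X ^ d * (M * volume (cB X r)) := by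
        rw [← hMl]; ring
    _ ≤ (2 ^ d) ^ 2 * 20 ^ d * l * b X ^ d *
          (2 * K * ∫⁻ Y in cB X (4 * r) ∩ S, w Y) := by gcongr
    _ = (2 ^ d) ^ 2 * 20 ^ d * l * (2 * K) *
          ∫⁻ Y in cB X (4 * r) ∩ S, b X ^ d * w Y := by
        rw [lintegral_const_mul' _ _ hbdt]; ring
    _ ≤ (2 ^ d) ^ 2 * 20 ^ d * l * (2 * K) *
          (2 ^ d * ∫⁻ Y in cB X (4 * r) ∩ S, b Y ^ d * w Y) := by gcongr
    _ = _ := by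
        have : (160 : ℝ≥0∞) ^ d = (2 ^ d) ^ 2 * 20 ^ d * 2 ^ d := by
          rw [← pow_mul, mul_comm d 2, pow_mul, ← mul_pow, ← mul_pow]; norm_num
        rw [this]; ring

lemma lintegral_superlevel_le [Nontrivial E] {w : E → ℝ≥0∞} {X₀ : E} {R₀ : ℝ} (hR₀ : 0 < R₀) {K κ l : ℝ≥0∞}
    (hw : Measurable w) (hfin : ∫⁻ Y, w Y ^ 2 ≠ ⊤)
    (hκ : K * κ * 8 ^ finrank ℝ E ≤ 2⁻¹)
    (hRH : RevHolder w X₀ R₀ K)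
    (hl : l ≠ ⊤)
    (ha : (∫⁻ Y, w Y ^ 2) * 20 ^ finrank ℝ E ≤ l ^ 2 * volume (cB X₀ R₀)) :
    ∫⁻ Y in {Y | l < bdryDist X₀ R₀ Y ^ finrank ℝ E * w Y},
        (bdryDist X₀ R₀ Y ^ finrank ℝ E * w Y) ^ 2
      ≤ 2 * 160 ^ finrank ℝ E * K * l *
        ∫⁻ Y in {Y | κ * l < bdryDist X₀ R₀ Y ^ finrank ℝ E * w Y},
          bdryDist X₀ R₀ Y ^ finrank ℝ E * w Y := by
  set d := finrank ℝ E
  set W : E → ℝ≥0∞ := fun Y => bdryDist X₀ R₀ Y ^ d * w Y with hW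
  have hWm : Measurable W := ((measurable_bdryDist X₀ R₀).pow_const _).mul hw
  set C : ℝ≥0∞ := 2 * 160 ^ d * K * l
  have hleb : ∀ᵐ X : E, Tendsto (fun r => (∫⁻ Y in cB X r, w Y ^ 2)
      / volume (cB X r)) (𝓝[>] 0) (𝓝 (w X ^ 2)) := by
    have := (Besicovitch.vitaliFamily (volume : Measure E)).ae_tendsto_lintegral_div
      (f := fun Y => w Y ^ 2) (hw.pow_const 2).aemeasurable hfin
    filter_upwards [this] with X hX
    exact hX.comp (Besicovitch.tendsto_filterAt volume X)
  set t : Set E := {X | l < W X ∧ Tendsto (fun r => (∫⁻ Y in cB X r, w Y ^ 2)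
      / volume (cB X r)) (𝓝[>] 0) (𝓝 (w X ^ 2))}
  have hst : ∀ X : E, ∃ r, X ∈ t → 0 < r ∧ 4 * r ≤ R₀ ∧
      ∫⁻ Y in cB X (20 * r), W Y ^ 2 ≤ C * ∫⁻ Y in cB X (4 * r) ∩ {Y | κ * l < W Y}, W Y := by
    intro X
    by_cases hX : X ∈ t
    · obtain ⟨r, h⟩ := exists_stopping_ball hR₀ hw hκ hRH hl ha hX.1 hX.2
      exact ⟨r, fun _ => h⟩
    · exact ⟨0, fun h => absurd h hX⟩
  choose r hr using hst
  obtain ⟨u, hut, hdisj, hcov⟩ := Vitali.exists_disjoint_subfamily_covering_enlargement_closedBall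
    t (fun X => X) (fun X => 4 * r X) R₀ (fun X hX => (hr X hX).2.1) 5 (by norm_num)
  have hcount : u.Countable := hdisj.countable_of_nonempty_interior fun X hX =>
    ⟨X, ball_subset_interior_closedBall (mem_ball_self (by
      have := (hr X (hut hX)).1; positivity))⟩
  have := hcount.to_subtype
  have hsub : ({Y | l < W Y} : Set E) ≤ᵐ[volume] (⋃ X : u, cB (X : E) (20 * r X) : Set E) := by
    filter_upwards [hleb] with X hX hlX
    obtain ⟨Y, hY, hYs⟩ := hcov X ⟨hlX, hX⟩
    refine mem_iUnion.2 ⟨⟨Y, hY⟩, ?_⟩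
    have h4 := (hr X ⟨hlX, hX⟩).1
    have := hYs (mem_closedBall_self (by positivity))
    rwa [← mul_assoc, show (5 : ℝ) * 4 = 20 by norm_num] at this
  have hSm : MeasurableSet {Y | κ * l < W Y} := measurableSet_lt measurable_const hWm
  calc ∫⁻ Y in {Y | l < W Y}, W Y ^ 2
      ≤ ∫⁻ Y in (⋃ X : u, cB (X : E) (20 * r X) : Set E), W Y ^ 2 :=
        lintegral_mono' (Measure.restrict_mono_ae hsub) le_rfl
    _ ≤ ∑' X : u, ∫⁻ Y in cB (X : E) (20 * r X), W Y ^ 2 := lintegral_iUnion_le _ _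
    _ ≤ ∑' X : u, C * ∫⁻ Y in cB (X : E) (4 * r X) ∩ {Y | κ * l < W Y}, W Y :=
        ENNReal.tsum_le_tsum fun X => (hr X (hut X.2)).2.2
    _ = C * ∫⁻ Y in (⋃ X ∈ u, cB X (4 * r X) ∩ {Y | κ * l < W Y}), W Y := by
        rw [ENNReal.tsum_mul_left, lintegral_biUnion hcount
          (fun X _ => measurableSet_closedBall.inter hSm)
          (hdisj.mono fun X => inter_subset_left)]
    _ ≤ C * ∫⁻ Y in {Y | κ * l < W Y}, W Y := by
        gcongr
        exact iUnion₂_subset fun X _ => inter_subset_right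

section

variable {α : Type*} [MeasurableSpace α] {μ : Measure α}

/-- A good-`λ` inequality gives geometric decay of the `L²` mass of superlevel sets. -/
lemma superlevel_decay {W : α → ℝ≥0∞} (hW : Measurable W) (hfin : ∫⁻ Y, W Y ^ 2 ∂μ ≠ ⊤)
    {C κ : ℝ≥0} (hC : 0 < C) (hκ : 0 < κ) {l : ℝ≥0} (hl : 0 < l) (hκC : κ ≤ 2 * C)
    (h : ∫⁻ Y in {Y | ↑l < W Y}, W Y ^ 2 ∂μ ≤ C * l * ∫⁻ Y in {Y | ↑(κ * l) < W Y}, W Y ∂μ)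
    (h2C : 1 ≤ 2 * C) :
    ∫⁻ Y in {Y | ↑(2 * C * l) < W Y}, W Y ^ 2 ∂μ
      ≤ ↑((C / κ) / (C / κ + 1 / 2)) * ∫⁻ Y in {Y | ↑(κ * l) < W Y}, W Y ^ 2 ∂μ := by
  set S₁ := {Y | ↑(κ * l) < W Y}
  set S₂ := {Y | ↑(2 * C * l) < W Y}
  have hm2 : MeasurableSet S₂ := measurableSet_lt measurable_const hW
  have hm1 : MeasurableSet S₁ := measurableSet_lt measurable_const hW
  have h21 : S₂ ⊆ S₁ := fun Y hY => lt_of_le_of_lt (by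
    have : κ * l ≤ 2 * C * l := by gcongr
    exact_mod_cast this) (show (↑(2 * C * l) : ℝ≥0∞) < W Y from hY)
  set a := ∫⁻ Y in S₂, W Y ^ 2 ∂μ
  set b := ∫⁻ Y in S₁ \ S₂, W Y ^ 2 ∂μ
  have hab : ∫⁻ Y in S₁, W Y ^ 2 ∂μ = a + b := by
    rw [← lintegral_inter_add_sdiff _ S₁ hm2, inter_eq_self_of_subset_right h21]
  have hat : a ≠ ⊤ := ne_top_of_le_ne_top hfin (setLIntegral_le_lintegral _ _)
  have hbt : b ≠ ⊤ := ne_top_of_le_ne_top hfin (setLIntegral_le_lintegral _ _)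
  have hlow : ∀ (S : Set α) (c : ℝ≥0), 0 < c → MeasurableSet S → (∀ Y ∈ S, ↑c ≤ W Y) →
      ∫⁻ Y in S, W Y ∂μ ≤ (c⁻¹ : ℝ≥0) * ∫⁻ Y in S, W Y ^ 2 ∂μ := by
    intro S c hc hS hcS
    rw [← lintegral_const_mul' _ _ coe_ne_top]
    refine setLIntegral_mono' hS fun Y hY => ?_
    calc W Y = ((c⁻¹ : ℝ≥0) * (c : ℝ≥0∞)) * W Y := by
          rw [← ENNReal.coe_mul, inv_mul_cancel₀ hc.ne', ENNReal.coe_one, one_mul]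
      _ ≤ (c⁻¹ : ℝ≥0) * W Y * W Y := by gcongr; exact hcS Y hY
      _ = _ := by ring
  have hb1 : ∫⁻ Y in S₁ \ S₂, W Y ∂μ ≤ ((κ * l)⁻¹ : ℝ≥0) * b :=
    hlow _ _ (by positivity) (hm1.diff hm2) fun Y hY => le_of_lt hY.1
  have ha1 : ∫⁻ Y in S₂, W Y ∂μ ≤ ((2 * C * l)⁻¹ : ℝ≥0) * a :=
    hlow _ _ (by positivity) hm2 fun Y hY => le_of_lt hY
  have hle : a ≤ C * l * (((2 * C * l)⁻¹ : ℝ≥0) * a + ((κ * l)⁻¹ : ℝ≥0) * b) := by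
    calc a ≤ ∫⁻ Y in {Y | ↑l < W Y}, W Y ^ 2 ∂μ := by
          refine lintegral_mono_set fun Y hY => lt_of_le_of_lt ?_
            (show (↑(2 * C * l) : ℝ≥0∞) < W Y from hY)
          have : l ≤ 2 * C * l := le_mul_of_one_le_left zero_le h2C
          exact_mod_cast this
      _ ≤ C * l * ∫⁻ Y in S₁, W Y ∂μ := h
      _ ≤ _ := by
          gcongr
          rw [← lintegral_inter_add_sdiff _ S₁ hm2, inter_eq_self_of_subset_right h21]
          exact add_le_add ha1 hb1
  rw [hab]
  clear_value a b
  lift a to ℝ≥0 using hat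
  lift b to ℝ≥0 using hbt
  norm_cast at hle ⊢
  have e1 : C * l * ((2 * C * l)⁻¹ * a + (κ * l)⁻¹ * b) = 1 / 2 * a + C / κ * b := by field_simp
  rw [e1] at hle
  rw [div_mul_eq_mul_div, le_div_iff₀ (by positivity)]
  have e2 : a = 1 / 2 * a + 1 / 2 * a := by ring
  have hle' : 1 / 2 * a ≤ C / κ * b := by
    have : 1 / 2 * a + 1 / 2 * a ≤ 1 / 2 * a + C / κ * b := by rw [← e2]; exact hle
    exact le_of_add_le_add_left this
  calc a * (C / κ + 1 / 2) = C / κ * a + 1 / 2 * a := by ring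
    _ ≤ C / κ * a + C / κ * b := by gcongr
    _ = _ := by ring

/-- Geometric decay of superlevel masses upgrades integrability. -/
lemma lintegral_rpow_le_of_decay {W : α → ℝ≥0∞} (hW : Measurable W)
    (hfin : ∫⁻ Y, W Y ^ 2 ∂μ ≠ ⊤) {θ m l : ℝ≥0} (hm : 1 < m) (hl : 0 < l)
    (h : ∀ s : ℝ≥0, l ≤ s → ∫⁻ Y in {Y | ↑(m * s) < W Y}, W Y ^ 2 ∂μ
      ≤ θ * ∫⁻ Y in {Y | ↑s < W Y}, W Y ^ 2 ∂μ)
    {ε : ℝ} (hε : 0 < ε) (hθ : m ^ ε * θ < 1) :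
    ∫⁻ Y, W Y ^ (2 + ε) ∂μ ≤ ↑(l ^ ε * (1 + m ^ ε * (1 - m ^ ε * θ)⁻¹)) * ∫⁻ Y, W Y ^ 2 ∂μ := by
  set a := ∫⁻ Y, W Y ^ 2 ∂μ
  have hm0 : 0 < m := lt_trans one_pos hm
  have hdec : ∀ j : ℕ, ∫⁻ Y in {Y | ↑(m ^ j * l) < W Y}, W Y ^ 2 ∂μ ≤ ↑(θ ^ j) * a := by
    intro j
    induction j with
    | zero => simpa using setLIntegral_le_lintegral _ _
    | succ j ih =>
      have e : m ^ (j + 1) * l = m * (m ^ j * l) := by ring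
      rw [e]
      refine (h _ (le_mul_of_one_le_left zero_le (one_le_pow₀ hm.le))).trans ?_
      calc _ ≤ (θ : ℝ≥0∞) * (↑(θ ^ j) * a) := by gcongr
        _ = _ := by push_cast; ring
  have hae : ∀ᵐ Y ∂μ, W Y < ⊤ := by
    filter_upwards [ae_lt_top (hW.pow_const 2) hfin] with Y hY
    by_contra hn
    rw [not_lt, top_le_iff] at hn
    simp [hn] at hY
  have hpt : ∀ᵐ Y ∂μ, W Y ^ (2 + ε) ≤ ↑(l ^ ε) * W Y ^ 2 + ∑' j : ℕ,
      ↑((m ^ (j + 1) * l) ^ ε) * ({Y | ↑(m ^ j * l) < W Y} : Set α).indicator (fun Y => W Y ^ 2) Y := by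
    filter_upwards [hae] with Y hY
    have hsplit : W Y ^ (2 + ε) = W Y ^ ε * W Y ^ 2 := by
      rw [add_comm, ENNReal.rpow_add_of_nonneg _ _ hε.le (by norm_num)]
      norm_num
    rw [hsplit]
    by_cases hYl : W Y ≤ l
    · refine le_trans ?_ le_self_add
      gcongr
      rw [coe_rpow_of_nonneg _ hε.le]
      gcongr
    · push Not at hYl
      have hex : ∃ j : ℕ, W Y ≤ ↑(m ^ j * l) := by
        lift W Y to ℝ≥0 using hY.ne with x
        obtain ⟨j, hj⟩ := pow_unbounded_of_one_lt (x / l) hm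
        refine ⟨j, ?_⟩
        rw [ENNReal.coe_le_coe]
        exact ((div_lt_iff₀ hl).1 hj).le
      classical
      set k := Nat.find hex with hk
      have hk1 := Nat.find_spec hex
      have hk0 : k ≠ 0 := by
        intro h0
        rw [← hk, h0] at hk1
        simp at hk1
        exact absurd hYl (not_lt.2 hk1)
      obtain ⟨j, hj⟩ := Nat.exists_eq_succ_of_ne_zero hk0
      have hlt : ↑(m ^ j * l) < W Y := not_le.1 (Nat.find_min hex (m := j) (by omega))
      refine le_trans ?_ le_add_self
      refine le_trans ?_ (ENNReal.le_tsum j)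
      rw [indicator_of_mem (by exact hlt), coe_rpow_of_nonneg _ hε.le]
      gcongr
      rw [← hk, hj] at hk1
      exact hk1
  calc ∫⁻ Y, W Y ^ (2 + ε) ∂μ ≤ ∫⁻ Y, (↑(l ^ ε) * W Y ^ 2 + ∑' j : ℕ,
        ↑((m ^ (j + 1) * l) ^ ε) *
          ({Y | ↑(m ^ j * l) < W Y} : Set α).indicator (fun Y => W Y ^ 2) Y) ∂μ :=
        lintegral_mono_ae hpt
    _ = ↑(l ^ ε) * a + ∑' j : ℕ, ↑((m ^ (j + 1) * l) ^ ε) *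
          ∫⁻ Y in {Y | ↑(m ^ j * l) < W Y}, W Y ^ 2 ∂μ := by
        have hms : ∀ j : ℕ, MeasurableSet {Y | ↑(m ^ j * l) < W Y} := fun j =>
          measurableSet_lt measurable_const hW
        rw [lintegral_add_left ((hW.pow_const 2).const_mul _), lintegral_const_mul' _ _ (by simp),
          lintegral_tsum fun j => (((hW.pow_const 2).indicator (hms j)).const_mul _).aemeasurable]
        congr 1
        refine tsum_congr fun j => ?_
        rw [lintegral_const_mul' _ _ coe_ne_top, lintegral_indicator (hms j)]
    _ ≤ ↑(l ^ ε) * a + ∑' j : ℕ, ↑(l ^ ε * m ^ ε) * a * ↑(m ^ ε * θ) ^ j := by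
        refine add_le_add le_rfl (ENNReal.tsum_le_tsum fun j => ?_)
        calc _ ≤ ↑((m ^ (j + 1) * l) ^ ε) * (↑(θ ^ j) * a) := mul_le_mul_right (hdec j) _
          _ = ↑((m ^ (j + 1) * l) ^ ε * θ ^ j) * a := by push_cast; ring
          _ = _ := by
            rw [NNReal.mul_rpow, ← NNReal.rpow_natCast, ← NNReal.rpow_mul, mul_comm _ ε,
              NNReal.rpow_mul, NNReal.rpow_natCast]
            push_cast
            ring
    _ = _ := by
        rw [ENNReal.tsum_mul_left, ENNReal.tsum_geometric, ← ENNReal.coe_one, ← ENNReal.coe_sub,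
          ← ENNReal.coe_inv (tsub_pos_of_lt hθ).ne']
        push_cast
        ring

end

variable (E) in
lemma exists_gehring [Nontrivial E] (K : ℝ≥0) :
    ∃ ε : ℝ, 0 < ε ∧ ε ≤ 1 ∧ ∃ C : ℝ≥0, ∀ (w : E → ℝ≥0∞), Measurable w → ∀ (X₀ : E) (R₀ : ℝ),
      0 < R₀ → ∫⁻ Y in ball X₀ R₀, w Y ^ 2 ≠ ⊤ →
      RevHolder w X₀ R₀ K →
      ∫⁻ Y in ball X₀ (R₀ / 2), w Y ^ (2 + ε)
        ≤ C * ((∫⁻ Y in ball X₀ R₀, w Y ^ 2) / volume (cB X₀ R₀)) ^ (ε / 2)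
          * ∫⁻ Y in ball X₀ R₀, w Y ^ 2 := by
  set d := finrank ℝ E with hd
  set C₁ : ℝ≥0 := 2 * 160 ^ d * (K + 1)
  set κ : ℝ≥0 := (2 * 8 ^ d * (K + 1))⁻¹ with hκ
  have hκ0 : 0 < κ := by positivity
  have hone : ∀ a : ℝ≥0, 1 ≤ a → 1 ≤ 2 * a ^ d * (K + 1) := fun a ha =>
    one_le_mul (one_le_mul one_le_two (one_le_pow₀ ha)) le_add_self
  have hC₁ : 1 ≤ C₁ := hone _ (by norm_num)
  have hC₁0 : 0 < C₁ := lt_of_lt_of_le one_pos hC₁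
  have hκ1 : κ ≤ 1 := inv_le_one_of_one_le₀ (hone _ (by norm_num))
  set m : ℝ≥0 := 2 * C₁ / κ with hm
  have h2C : 1 < 2 * C₁ := lt_of_lt_of_le (by norm_num : (1 : ℝ≥0) < 2 * 1) (by gcongr)
  have hm1 : 1 < m := by
    rw [hm, lt_div_iff₀ hκ0, one_mul]
    exact lt_of_le_of_lt hκ1 h2C
  set θ : ℝ≥0 := (C₁ / κ) / (C₁ / κ + 1 / 2)
  have hθ : θ < 1 := by
    rw [div_lt_one (by positivity)]
    exact lt_add_of_pos_right _ (by positivity)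
  obtain ⟨ε, hε0, hε1, hεθ⟩ : ∃ ε : ℝ, 0 < ε ∧ ε ≤ 1 ∧ m ^ ε * θ < 1 := by
    have hc : Tendsto (fun x : ℝ => (m : ℝ) ^ x * θ) (𝓝[>] 0) (𝓝 ((m : ℝ) ^ (0 : ℝ) * θ)) :=
      ((Real.continuousAt_const_rpow (by positivity)).tendsto.mul_const _).mono_left
        nhdsWithin_le_nhds
    rw [Real.rpow_zero, one_mul] at hc
    have h1 := hc.eventually_lt_const (show (θ : ℝ) < 1 by exact_mod_cast hθ)
    have h2 : ∀ᶠ x : ℝ in 𝓝[>] 0, x ≤ 1 := nhdsWithin_le_nhds (Iic_mem_nhds one_pos)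
    obtain ⟨ε, ⟨h1, h2⟩, h3⟩ := ((h1.and h2).and self_mem_nhdsWithin).exists
    exact ⟨ε, h3, h2, by exact_mod_cast h1⟩
  refine ⟨ε, hε0, hε1, (2 ^ d) ^ (2 + ε) * (κ ^ ε * (1 + m ^ ε * (1 - m ^ ε * θ)⁻¹)
    * (20 ^ d) ^ (ε / 2)), ?_⟩
  intro w' hw' X₀ R₀ hR₀ hfin' hRH'
  set w : E → ℝ≥0∞ := (ball X₀ R₀).indicator w' with hwdef
  have hw : Measurable w := hw'.indicator measurableSet_ball
  have hwsq : (fun Y => w Y ^ 2) = (ball X₀ R₀).indicator fun Y => w' Y ^ 2 := by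
    ext Y
    by_cases hY : Y ∈ ball X₀ R₀ <;> simp [hwdef, hY]
  have ha' : ∫⁻ Y, w Y ^ 2 = ∫⁻ Y in ball X₀ R₀, w' Y ^ 2 := by
    rw [hwsq, lintegral_indicator measurableSet_ball]
  rw [← ha'] at hfin' ⊢
  set a := ∫⁻ Y, w Y ^ 2
  set v := volume (cB X₀ R₀)
  have hv0 : v ≠ 0 := (measure_closedBall_pos volume X₀ hR₀).ne'
  have hvt : v ≠ ⊤ := vol_cB_ne _ _
  set W : E → ℝ≥0∞ := fun Y => bdryDist X₀ R₀ Y ^ d * w Y with hW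
  have hWm : Measurable W := ((measurable_bdryDist X₀ R₀).pow_const _).mul hw
  have hWw : ∀ Y, W Y ≤ w Y := fun Y =>
    mul_le_of_le_one_left zero_le (pow_le_one₀ zero_le (bdryDist_le_one X₀ hR₀ Y))
  have hWa : ∫⁻ Y, W Y ^ 2 ≤ a := lintegral_mono fun Y => by gcongr; exact hWw Y
  have hlow : ∫⁻ Y in ball X₀ (R₀ / 2), w' Y ^ (2 + ε)
      ≤ ↑((2 ^ d : ℝ≥0) ^ (2 + ε)) * ∫⁻ Y, W Y ^ (2 + ε) := by
    rw [← lintegral_const_mul' _ _ coe_ne_top]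
    refine le_trans (setLIntegral_mono' measurableSet_ball fun Y hY => ?_)
      (setLIntegral_le_lintegral (ball X₀ (R₀ / 2)) _)
    have hYb : Y ∈ ball X₀ R₀ := ball_subset_ball (by linarith) hY
    have hYd : dist Y X₀ / R₀ ≤ 1 / 2 := by
      rw [div_le_iff₀ hR₀]
      have : dist Y X₀ < R₀ / 2 := hY
      linarith
    have h1 : 1 ≤ 2 * bdryDist X₀ R₀ Y := by
      rw [bdryDist, show (2 : ℝ≥0∞) = ofReal 2 by simp, ← ofReal_mul (by norm_num), ← ofReal_one]
      exact ofReal_le_ofReal (by linarith)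
    have h2 : w' Y ≤ ↑(2 ^ d : ℝ≥0) * W Y := by
      calc w' Y = 1 ^ d * w Y := by simp [hwdef, hYb]
        _ ≤ (2 * bdryDist X₀ R₀ Y) ^ d * w Y := by gcongr
        _ = _ := by rw [hW]; push_cast; ring
    calc w' Y ^ (2 + ε) ≤ (↑(2 ^ d : ℝ≥0) * W Y) ^ (2 + ε) := by gcongr
      _ = _ := by rw [mul_rpow_of_nonneg _ _ (by positivity), coe_rpow_of_nonneg _ (by positivity)]
  refine hlow.trans ?_
  by_cases ha0 : a = 0
  · have h0 : ∫⁻ Y, W Y ^ (2 + ε) = 0 := by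
      rw [lintegral_eq_zero_iff (hWm.pow_const _)]
      have : ∫⁻ Y, W Y ^ 2 = 0 := le_antisymm (hWa.trans_eq ha0) zero_le
      rw [lintegral_eq_zero_iff (hWm.pow_const _)] at this
      filter_upwards [this] with Y hY
      have : W Y = 0 := by simpa using hY
      simp only [Pi.zero_apply, this]
      exact ENNReal.zero_rpow_of_pos (by positivity)
    rw [h0, mul_zero]
    exact zero_le
  have hq0 : 20 ^ d * (a / v) ≠ 0 := mul_ne_zero (by simp) (ENNReal.div_pos ha0 hvt).ne'
  have hqt : 20 ^ d * (a / v) ≠ ⊤ := mul_ne_top (by simp) (ENNReal.div_ne_top hfin' hv0)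
  obtain ⟨l₀, hl₀⟩ : ∃ l₀ : ℝ≥0, (l₀ : ℝ≥0∞) = (20 ^ d * (a / v)) ^ (1 / 2 : ℝ) :=
    ⟨_, ENNReal.coe_toNNReal (rpow_ne_top_of_nonneg (by norm_num) hqt)⟩
  have hl₀pos : 0 < l₀ := by
    rw [← ENNReal.coe_pos, hl₀]
    exact ENNReal.rpow_pos (pos_iff_ne_zero.2 hq0) hqt
  have hl₀sq : (l₀ : ℝ≥0∞) ^ 2 = 20 ^ d * (a / v) := by
    rw [hl₀, ← rpow_natCast, ← rpow_mul]
    norm_num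
  have hWfin : ∫⁻ Y, W Y ^ 2 ≠ ⊤ := ne_top_of_le_ne_top hfin' hWa
  have hRH : RevHolder w X₀ R₀ (K + 1 : ℝ≥0) := by
    intro X r hr hs
    have hs' : cB X r ⊆ ball X₀ R₀ := (closedBall_subset_closedBall (by linarith)).trans hs
    have e1 : ∫⁻ Y in cB X r, w Y ^ 2 = ∫⁻ Y in cB X r, w' Y ^ 2 :=
      setLIntegral_congr_fun measurableSet_closedBall fun Y hY => by simp [hwdef, hs' hY]
    have e2 : ∫⁻ Y in cB X (4 * r), w Y
        = ∫⁻ Y in cB X (4 * r), w' Y :=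
      setLIntegral_congr_fun measurableSet_closedBall fun Y hY => by simp [hwdef, hs hY]
    rw [e1, e2]
    refine (hRH' X r hr hs).trans ?_
    gcongr
    exact le_self_add
  have hdec : ∀ s : ℝ≥0, κ * l₀ ≤ s → ∫⁻ Y in {Y | ↑(m * s) < W Y}, W Y ^ 2
      ≤ θ * ∫⁻ Y in {Y | ↑s < W Y}, W Y ^ 2 := by
    intro s hs
    have hsl : κ * (s / κ) = s := mul_div_cancel₀ _ hκ0.ne'
    have hl₀s : l₀ ≤ s / κ := by rw [le_div_iff₀ hκ0, mul_comm]; exact hs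
    have hspos : 0 < s / κ := lt_of_lt_of_le hl₀pos hl₀s
    have hms : 2 * C₁ * (s / κ) = m * s := by rw [hm]; ring
    have := superlevel_decay (μ := volume) hWm hWfin hC₁0 hκ0 hspos (hκ1.trans h2C.le) (by
      have hlev := lintegral_superlevel_le (X₀ := X₀) (K := ((K + 1 : ℝ≥0) : ℝ≥0∞)) (κ := κ)
        (l := ((s / κ : ℝ≥0) : ℝ≥0∞)) hR₀ hw hfin' (by
          rw [← hd, hκ]
          have : (K + 1) * (2 * 8 ^ d * (K + 1))⁻¹ * 8 ^ d = (2 : ℝ≥0)⁻¹ := by field_simp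
          calc _ = (((K + 1) * (2 * 8 ^ d * (K + 1))⁻¹ * 8 ^ d : ℝ≥0) : ℝ≥0∞) := by push_cast; rfl
            _ ≤ _ := by rw [this]; simp) hRH coe_ne_top (by
          calc a * 20 ^ d = 20 ^ d * (a / v) * v := by
                rw [mul_assoc, ENNReal.div_mul_cancel hv0 hvt, mul_comm]
            _ ≤ _ := by rw [← hl₀sq]; gcongr)
      have e1 : (C₁ : ℝ≥0∞) = 2 * 160 ^ d * ((K + 1 : ℝ≥0) : ℝ≥0∞) := by simp [C₁]
      rw [e1, ENNReal.coe_mul κ]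
      exact hlev) h2C.le
    rw [hms, hsl] at this
    exact this
  have hmain := lintegral_rpow_le_of_decay (μ := volume) hWm hWfin hm1
    (mul_pos hκ0 hl₀pos) hdec hε0 hεθ
  calc _ ≤ ↑((2 ^ d : ℝ≥0) ^ (2 + ε)) *
        (↑((κ * l₀) ^ ε * (1 + m ^ ε * (1 - m ^ ε * θ)⁻¹)) * a) := by
        gcongr
        exact hmain.trans (by gcongr)
    _ = _ := by
        have e : ((l₀ ^ ε : ℝ≥0) : ℝ≥0∞) = ↑((20 ^ d : ℝ≥0) ^ (ε / 2)) * (a / v) ^ (ε / 2) := by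
          rw [coe_rpow_of_nonneg _ hε0.le, hl₀, ← rpow_mul,
            mul_rpow_of_nonneg _ _ (by positivity),
            coe_rpow_of_nonneg _ (by positivity)]
          have : (1 / 2 : ℝ) * ε = ε / 2 := by ring
          rw [this]
          push_cast
          rfl
        rw [NNReal.mul_rpow]
        simp only [ENNReal.coe_mul]
        rw [e]
        ring

/-! ### Difference quotients and classical derivatives -/

lemma hasWeakDeriv_of_contDiff {Ω : Set E} {e : E} {u : E → ℂ} (hu : ContDiff ℝ ∞ u) :
    HasWeakDeriv Ω e u (fun x => fderiv ℝ u x e) := by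
  intro φ hφ hc _
  exact integral_mul_fderiv_eq_neg_fderiv_mul_of_integrable (μ := (volume : Measure E))
    (((cont_fderiv hu e).mul hφ.continuous).integrable_of_hasCompactSupport hc.mul_left)
    ((hu.continuous.mul (cont_fderiv hφ e)).integrable_of_hasCompactSupport
      (hcs_fderiv hc e).mul_left)
    ((hu.continuous.mul hφ.continuous).integrable_of_hasCompactSupport hc.mul_left)
    (fun x _ => (hu.differentiable (by simp)) x) (fun x _ => (hφ.differentiable (by simp)) x)

lemma HasWeakDeriv.smul_dir {Ω : Set E} {e : E} {u w : E → ℂ} (h : HasWeakDeriv Ω e u w)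
    (s : ℝ) : HasWeakDeriv Ω (s • e) u (fun x => s * w x) := by
  intro φ hφ hc hs
  have := h φ hφ hc hs
  simp only [map_smul, Complex.real_smul, mul_assoc]
  rw [integral_const_mul, ← mul_neg, ← this, ← integral_const_mul]
  congr 1; ext x; ring

/-- The difference quotient of `u` in the direction `e`. -/
def diffQuot {V : Type*} [AddCommGroup V] [Module ℂ V] (e : E) (s : ℝ) (u : E → V) (x : E) : V :=
  (s : ℂ)⁻¹ • (u (x + s • e) - u x)

lemma hasDerivAt_line {φ : E → ℂ} {e x : E} {τ : ℝ} (hφ : DifferentiableAt ℝ φ (x + τ • e)) :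
    HasDerivAt (fun τ : ℝ => φ (x + τ • e)) (fderiv ℝ φ (x + τ • e) e) τ := by
  have h1 : HasDerivAt (fun τ : ℝ => x + τ • e) e τ := by
    simpa using ((hasDerivAt_id τ).smul_const e).const_add x
  exact hφ.hasFDerivAt.comp_hasDerivAt τ h1

lemma norm_diffQuot_sub_le {φ : E → ℂ} (hφ : ContDiff ℝ ∞ φ) {e x : E} {s δ : ℝ} (hs : s ≠ 0)
    (h : ∀ τ : ℝ, |τ| ≤ |s| → ‖fderiv ℝ φ (x + τ • e) e - fderiv ℝ φ x e‖ ≤ δ) :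
    ‖diffQuot e s φ x - fderiv ℝ φ x e‖ ≤ δ := by
  have h1 := Convex.norm_image_sub_le_of_norm_hasDerivWithin_le (𝕜 := ℝ)
    (f := fun τ : ℝ => φ (x + τ • e) - τ • fderiv ℝ φ x e)
    (f' := fun τ : ℝ => fderiv ℝ φ (x + τ • e) e - fderiv ℝ φ x e)
    (s := cB (0 : ℝ) |s|) (x := 0) (y := s) (C := δ)
    (fun τ _ => ((hasDerivAt_line ((hφ.differentiable (by simp)) _)).sub
      (by simpa using (hasDerivAt_id τ).smul_const (fderiv ℝ φ x e))).hasDerivWithinAt)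
    (fun τ hτ => h τ (by simpa using hτ)) (convex_closedBall _ _)
    (by simp) (by simp)
  have h2 : diffQuot e s φ x - fderiv ℝ φ x e
      = (s : ℂ)⁻¹ * ((φ (x + s • e) - s • fderiv ℝ φ x e) - (φ (x + (0 : ℝ) • e)
        - (0 : ℝ) • fderiv ℝ φ x e)) := by
    have : (s : ℂ) ≠ 0 := by exact_mod_cast hs
    simp only [diffQuot, zero_smul, add_zero, sub_zero, smul_eq_mul, Complex.real_smul]
    field_simp
    ring
  rw [h2, norm_mul, norm_inv, Complex.norm_real, Real.norm_eq_abs, inv_mul_le_iff₀ (by positivity)]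
  refine h1.trans_eq ?_
  rw [sub_zero, Real.norm_eq_abs, mul_comm]

lemma tendsto_eLpNorm_diffQuot_of_contDiff {φ : E → ℂ} (hφ : ContDiff ℝ ∞ φ)
    (hc : HasCompactSupport φ) (e : E) :
    Tendsto (fun s : ℝ => eLpNorm (fun x => diffQuot e s φ x - fderiv ℝ φ x e) 2 volume)
      (𝓝[≠] 0) (𝓝 0) := by
  set K := cthickening ‖e‖ (tsupport φ)
  have hK : IsCompact K := IsCompact.cthickening hc
  have hv : volume K ^ ((2 : ℝ≥0∞).toReal⁻¹) ≠ ⊤ :=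
    rpow_ne_top_of_nonneg (by positivity) hK.measure_lt_top.ne
  have huc := (hcs_fderiv hc e).uniformContinuous_of_continuous (cont_fderiv hφ e)
  have hbd : ∀ δ : ℝ, 0 < δ → ∀ᶠ s : ℝ in 𝓝[≠] 0,
      eLpNorm (fun x => diffQuot e s φ x - fderiv ℝ φ x e) 2 volume
        ≤ volume K ^ ((2 : ℝ≥0∞).toReal⁻¹) * ofReal δ := by
    intro δ hδ
    obtain ⟨η, hη, hηδ⟩ := uniformContinuous_iff.1 huc δ hδ
    have h1 : ∀ᶠ s : ℝ in 𝓝[≠] 0, |s| * ‖e‖ < η := by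
      have : Tendsto (fun s : ℝ => |s| * ‖e‖) (𝓝 0) (𝓝 (|0| * ‖e‖)) :=
        (continuous_abs.tendsto 0).mul_const _
      rw [abs_zero, zero_mul] at this
      exact nhdsWithin_le_nhds (this.eventually_lt_const hη)
    have h2 : ∀ᶠ s : ℝ in 𝓝[≠] 0, |s| < 1 := by
      have := (continuous_abs.tendsto (0 : ℝ))
      rw [abs_zero] at this
      exact nhdsWithin_le_nhds (this.eventually_lt_const one_pos)
    filter_upwards [h1, h2, self_mem_nhdsWithin] with s hs1 hs2 hs0
    have hpt : ∀ x, ‖diffQuot e s φ x - fderiv ℝ φ x e‖ ≤ δ := by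
      intro x
      refine norm_diffQuot_sub_le hφ hs0 fun τ hτ => ?_
      rw [← dist_eq_norm]
      refine (hηδ ?_).le
      rw [dist_eq_norm, add_sub_cancel_left, norm_smul, Real.norm_eq_abs]
      exact lt_of_le_of_lt (by gcongr) hs1
    have hout : ∀ x, x ∉ K → diffQuot e s φ x - fderiv ℝ φ x e = 0 := by
      intro x hx
      have hx1 : x ∉ tsupport φ := fun h => hx (self_subset_cthickening _ h)
      have hx2 : x + s • e ∉ tsupport φ := fun h => hx
        (mem_cthickening_of_dist_le x (x + s • e) _ _ h (by
          rw [dist_eq_norm, sub_add_cancel_left, norm_neg, norm_smul, Real.norm_eq_abs]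
          nlinarith [norm_nonneg e]))
      simp [diffQuot, image_eq_zero_of_notMem_tsupport hx1, image_eq_zero_of_notMem_tsupport hx2,
        fderiv_of_notMem_tsupport ℝ hx1]
    have hind : (fun x => diffQuot e s φ x - fderiv ℝ φ x e)
        = K.indicator (fun x => diffQuot e s φ x - fderiv ℝ φ x e) := by
      ext x
      by_cases hx : x ∈ K
      · rw [indicator_of_mem hx]
      · rw [indicator_of_notMem hx, hout x hx]
    rw [hind, eLpNorm_indicator_eq_eLpNorm_restrict hK.measurableSet]
    refine (eLpNorm_le_of_ae_bound (.of_forall hpt)).trans_eq ?_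
    rw [Measure.restrict_apply_univ]
  rw [ENNReal.tendsto_nhds_zero]
  intro ε hε
  have hlim : Tendsto (fun δ : ℝ => volume K ^ ((2 : ℝ≥0∞).toReal⁻¹) * ofReal δ) (𝓝[>] 0)
      (𝓝 0) := by
    have : Tendsto (fun δ : ℝ => ofReal δ) (𝓝[>] 0) (𝓝 0) := by
      have := (ENNReal.continuous_ofReal.tendsto 0).mono_left (nhdsWithin_le_nhds (s := Ioi 0))
      simpa using this
    simpa using ENNReal.Tendsto.const_mul this (Or.inr hv)
  obtain ⟨δ, hδ1, hδ0⟩ := ((ENNReal.tendsto_nhds_zero.1 hlim ε hε).and self_mem_nhdsWithin).exists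
  filter_upwards [hbd δ hδ0] with s hs using hs.trans hδ1

lemma eLpNorm_diffQuot_le {U W : E → ℂ} {e : E} (hU : MemLp U 2) (hW : MemLp W 2)
    (h : HasWeakDeriv univ e U W) {s : ℝ} (hs : s ≠ 0) :
    eLpNorm (diffQuot e s U) 2 volume ≤ eLpNorm W 2 volume := by
  have h2 : ofReal 2 = 2 := by simp
  have h1 := eLpNorm_difference_le_of_memLp (q := 2) (h := s • e) one_le_two (U := U)
    (W := fun x => s * W x) (by rwa [h2]) (by rw [h2]; exact hW.const_mul _) (h.smul_dir s)
    convex_univ MeasurableSet.univ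
  rw [h2, preimage_univ, univ_inter, Measure.restrict_univ] at h1
  have h3 : diffQuot e s U = (s : ℂ)⁻¹ • fun x => U (x + s • e) - U x := rfl
  have h4 : (fun x => (s : ℂ) * W x) = (s : ℂ) • W := rfl
  rw [h4, eLpNorm_const_smul] at h1
  rw [h3, eLpNorm_const_smul, enorm_inv (by exact_mod_cast hs)]
  have hs0 : ‖(s : ℂ)‖ₑ ≠ 0 := by simpa using hs
  calc _ ≤ ‖(s : ℂ)‖ₑ⁻¹ * (‖(s : ℂ)‖ₑ * eLpNorm W 2 volume) := by gcongr
    _ = _ := by rw [← mul_assoc, ENNReal.inv_mul_cancel hs0 (by simp), one_mul]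

lemma tendsto_eLpNorm_diffQuot {U W : E → ℂ} {e : E} (hU : MemLp U 2) (hW : MemLp W 2)
    (h : HasWeakDeriv univ e U W) {K : Set E} (hK : IsCompact K) (hUK : ∀ x, x ∉ K → U x = 0) :
    Tendsto (fun s : ℝ => eLpNorm (fun x => diffQuot e s U x - W x) 2 volume) (𝓝[≠] 0) (𝓝 0) := by
  rw [ENNReal.tendsto_nhds_zero]
  intro ε hε
  have hε3 : 0 < ε / 3 := ENNReal.div_pos hε.ne' (by simp)
  obtain ⟨k, hk⟩ := (ENNReal.tendsto_nhds_zero.1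
    (tendsto_moll one_le_two (by simp) hW) (ε / 3) hε3).exists
  have hUl : LocallyIntegrable U := hU.locallyIntegrable one_le_two
  have hWl : LocallyIntegrable W := hW.locallyIntegrable one_le_two
  have hφ : ContDiff ℝ ∞ (moll (bump E k) U) := moll_contDiff _ hUl
  have hφc : HasCompactSupport (moll (bump E k) U) := moll_hasCompactSupport _ hK hUK
  have hφd : ∀ x, fderiv ℝ (moll (bump E k) U) x e = moll (bump E k) W x := moll_fderiv _ hUl h
  generalize moll (bump E k) U = φ at hφ hφc hφd
  have hk' : eLpNorm (fun x => fderiv ℝ φ x e - W x) 2 volume ≤ ε / 3 := by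
    simpa only [hφd] using hk
  clear hφd hk
  have hφL : MemLp φ 2 := hφ.continuous.memLp_of_hasCompactSupport hφc
  have hφ'L : MemLp (fun x => fderiv ℝ φ x e) 2 :=
    (cont_fderiv hφ e).memLp_of_hasCompactSupport (hcs_fderiv hφc e)
  have hdiff : HasWeakDeriv univ e (fun x => φ x - U x) (fun x => fderiv ℝ φ x e - W x) :=
    HasWeakDeriv.sub (hφ.continuous.locallyIntegrable.locallyIntegrableOn _)
      (hUl.locallyIntegrableOn _)
      ((cont_fderiv hφ e).locallyIntegrable.locallyIntegrableOn _)
      (hWl.locallyIntegrableOn _) (hasWeakDeriv_of_contDiff hφ) h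
  filter_upwards [ENNReal.tendsto_nhds_zero.1 (tendsto_eLpNorm_diffQuot_of_contDiff hφ hφc e)
    (ε / 3) hε3, self_mem_nhdsWithin] with s hs hs0
  have h1 := (eLpNorm_diffQuot_le (hφL.sub hU) (hφ'L.sub hW) hdiff hs0).trans hk'
  have hme : MeasurePreserving (fun x : E => x + s • e) volume volume :=
    measurePreserving_add_right volume (s • e)
  have hDφ : AEStronglyMeasurable (diffQuot e s φ) volume :=
    AEStronglyMeasurable.const_smul ((hφL.1.comp_measurePreserving hme).sub hφL.1) (s : ℂ)⁻¹
  have hDm : AEStronglyMeasurable (diffQuot e s (fun x => φ x - U x)) volume :=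
    AEStronglyMeasurable.const_smul
      (((hφL.1.sub hU.1).comp_measurePreserving hme).sub (hφL.1.sub hU.1)) (s : ℂ)⁻¹
  have hsplit : (fun x => diffQuot e s U x - W x)
      = ((fun x => diffQuot e s φ x - fderiv ℝ φ x e) + fun x => fderiv ℝ φ x e - W x)
        - diffQuot e s (fun x => φ x - U x) := by
    ext x
    simp only [diffQuot, Pi.add_apply, Pi.sub_apply, smul_eq_mul]
    ring
  rw [hsplit]
  calc _ ≤ (eLpNorm (fun x => diffQuot e s φ x - fderiv ℝ φ x e) 2 volume
        + eLpNorm (fun x => fderiv ℝ φ x e - W x) 2 volume)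
        + eLpNorm (diffQuot e s (fun x => φ x - U x)) 2 volume :=
        (eLpNorm_sub_le ((hDφ.sub hφ'L.1).add (hφ'L.1.sub hW.1)) hDm one_le_two).trans
          (by gcongr; exact eLpNorm_add_le (hDφ.sub hφ'L.1) (hφ'L.1.sub hW.1) one_le_two)
    _ ≤ (ε / 3 + ε / 3) + ε / 3 := by gcongr; exact h1
    _ = ε := ENNReal.add_thirds ε

lemma tendsto_eLpNorm_diffQuot_closedBall {Ω : Set E} {u w : E → ℂ} {e x₀ : E} {r : ℝ}
    (hΩ : IsOpen Ω) (hu : LocL2 Ω u) (hw : LocL2 Ω w) (h : HasWeakDeriv Ω e u w) (hr : 0 < r)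
    (hball : cB x₀ (4 * r) ⊆ Ω) :
    Tendsto (fun s : ℝ => eLpNorm (fun x => diffQuot e s u x - w x) 2
      (volOn (cB x₀ r))) (𝓝[≠] 0) (𝓝 0) := by
  obtain ⟨C, -, hcut⟩ := exists_cutoff E
  obtain ⟨η, h1, h2, h3, h4, -, -, -⟩ := hcut x₀ (2 * r) (by positivity)
  have h2Ω : tsupport η ⊆ Ω := h2.trans (by rw [← mul_assoc]; norm_num; exact hball)
  set χ : E → ℂ := fun x => (η x : ℂ) with hχ
  have hχc : ContDiff ℝ ∞ χ := Complex.ofRealCLM.contDiff.comp h1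
  have hχs : tsupport χ ⊆ tsupport η := closure_mono fun x hx h0 => hx (by simp [hχ, h0])
  have hχcs : HasCompactSupport χ := IsCompact.of_isClosed_subset h3 (isClosed_tsupport _) hχs
  have hχΩ := hχs.trans h2Ω
  have hD := h.mul_cutoff (hu.locallyIntegrableOn hΩ) (hw.locallyIntegrableOn hΩ) hχc hχcs hχΩ
  have hU := hu.memLp_mul hχc.continuous hχcs hχΩ
  have hW := (hw.memLp_mul hχc.continuous hχcs hχΩ).add
    (hu.memLp_mul (cont_fderiv hχc e) (hcs_fderiv hχcs e)
      ((tsupport_fderiv_apply_subset χ e).trans hχΩ))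
  have hlim := tendsto_eLpNorm_diffQuot hU hW hD hχcs (fun x hx => by
    simp [image_eq_zero_of_notMem_tsupport hx])
  have hsm : ∀ᶠ s : ℝ in 𝓝[≠] 0, |s| * ‖e‖ < r := by
    have : Tendsto (fun s : ℝ => |s| * ‖e‖) (𝓝 0) (𝓝 (|0| * ‖e‖)) :=
      (continuous_abs.tendsto 0).mul_const _
    rw [abs_zero, zero_mul] at this
    exact nhdsWithin_le_nhds (this.eventually_lt_const hr)
  refine tendsto_of_tendsto_of_tendsto_of_le_of_le' tendsto_const_nhds hlim
    (.of_forall fun _ => zero_le) ?_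
  filter_upwards [hsm] with s hs
  refine le_trans (le_of_eq (eLpNorm_congr_ae ?_)) (eLpNorm_restrict_le _ _ _ (cB x₀ r))
  filter_upwards [ae_restrict_mem measurableSet_closedBall] with x hx
  have hx0 : dist x x₀ ≤ r := hx
  have hχ1 : ∀ y ∈ cB x₀ (2 * r), χ y = 1 := fun y hy => by simp [hχ, h4 y hy]
  have hx1 : χ x = 1 := hχ1 x (by rw [mem_closedBall]; linarith)
  have hx2 : χ (x + s • e) = 1 := hχ1 _ (by
    rw [mem_closedBall]
    have : dist (x + s • e) x = |s| * ‖e‖ := by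
      rw [dist_eq_norm, add_sub_cancel_left, norm_smul, Real.norm_eq_abs]
    linarith [dist_triangle (x + s • e) x x₀])
  have hx3 : fderiv ℝ χ x e = 0 := by
    have : χ =ᶠ[𝓝 x] fun _ => 1 := by
      filter_upwards [ball_mem_nhds x hr] with y hy
      refine hχ1 y ?_
      rw [mem_closedBall]
      have : dist y x < r := hy
      linarith [dist_triangle y x x₀]
    rw [this.fderiv_eq]
    simp
  simp [diffQuot, hx1, hx2, hx3]

/-- A continuous function with continuous weak derivative is differentiable. -/
lemma HasWeakDeriv.hasDerivAt {Ω : Set E} {e : E} {u w : E → ℂ} (hΩ : IsOpen Ω)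
    (hu : ContinuousOn u Ω) (hw : ContinuousOn w Ω) (h : HasWeakDeriv Ω e u w) {x₀ : E}
    (hx₀ : x₀ ∈ Ω) : HasDerivAt (fun s : ℝ => u (x₀ + s • e)) (w x₀) 0 := by
  obtain ⟨C, -, hcut⟩ := exists_cutoff E
  obtain ⟨r, hr, hrΩ⟩ := isOpen_iff.1 hΩ x₀ hx₀
  obtain ⟨η, h1, h2, h3, h4, -, -, -⟩ := hcut x₀ (r / 4) (by positivity)
  have h2Ω : tsupport η ⊆ Ω := h2.trans ((closedBall_subset_ball (by linarith)).trans hrΩ)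
  set χ : E → ℂ := fun x => (η x : ℂ) with hχ
  have hχc : ContDiff ℝ ∞ χ := Complex.ofRealCLM.contDiff.comp h1
  have hχs : tsupport χ ⊆ tsupport η := closure_mono fun x hx h0 => hx (by simp [hχ, h0])
  have hχcs : HasCompactSupport χ := IsCompact.of_isClosed_subset h3 (isClosed_tsupport _) hχs
  have hχΩ := hχs.trans h2Ω
  have hD := h.mul_cutoff (hu.locallyIntegrableOn hΩ.measurableSet)
    (hw.locallyIntegrableOn hΩ.measurableSet) hχc hχcs hχΩ
  have hcont : ∀ (f χ : E → ℂ), ContinuousOn f Ω → Continuous χ → tsupport χ ⊆ Ω →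
      Continuous (fun x => f x * χ x) := by
    intro f χ hf hχ hs
    refine continuous_of_tsupport fun x hx => ?_
    exact (hf.continuousAt (hΩ.mem_nhds (hs (tsupport_mul_subset_right hx)))).mul hχ.continuousAt
  have hU : Continuous (fun x => u x * χ x) := hcont u χ hu hχc.continuous hχΩ
  have hW : Continuous (fun x => w x * χ x + u x * fderiv ℝ χ x e) :=
    (hcont w χ hw hχc.continuous hχΩ).add
      (hcont u _ hu (cont_fderiv hχc e) ((tsupport_fderiv_apply_subset χ e).trans hχΩ))
  have hWc : HasCompactSupport (fun x => w x * χ x + u x * fderiv ℝ χ x e) :=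
    hχcs.mul_left.add (hcs_fderiv hχcs e).mul_left
  have hUc : HasCompactSupport (fun x => u x * χ x) := hχcs.mul_left
  have key : ∀ f : E → ℂ, Continuous f → HasCompactSupport f →
      TendstoUniformly (fun k => moll (bump E k) f) f atTop := by
    intro f hf hfc
    rw [tendstoUniformly_iff]
    intro ε hε
    obtain ⟨δ, hδ, hδε⟩ := uniformContinuous_iff.1
      (hfc.uniformContinuous_of_continuous hf) (ε / 2) (by positivity)
    filter_upwards [(bump_rOut_tendsto (E := E)).eventually_lt_const hδ] with k hk x
    rw [dist_comm]
    refine lt_of_le_of_lt (ContDiffBump.dist_normed_convolution_le (ε := ε / 2)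
      hf.aestronglyMeasurable fun y hy => (hδε ?_).le) (by linarith)
    exact (mem_ball.1 hy).trans hk
  have hder := hasDerivAt_of_tendstoUniformly (𝕜 := ℝ)
    (f := fun k (s : ℝ) => moll (bump E k) (fun x => u x * χ x) (x₀ + s • e))
    (f' := fun k (s : ℝ) => moll (bump E k) (fun x => w x * χ x + u x * fderiv ℝ χ x e) (x₀ + s • e))
    (g := fun s : ℝ => u (x₀ + s • e) * χ (x₀ + s • e))
    (g' := fun s : ℝ => w (x₀ + s • e) * χ (x₀ + s • e)
      + u (x₀ + s • e) * fderiv ℝ χ (x₀ + s • e) e) (l := atTop)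
    ((key _ hW hWc).comp fun s : ℝ => x₀ + s • e)
    (.of_forall fun k s => by
      have := hasDerivAt_line (e := e) (x := x₀) (τ := s)
        (((moll_contDiff (bump E k) hU.locallyIntegrable).differentiable (by simp)) (x₀ + s • e))
      rwa [moll_fderiv _ hU.locallyIntegrable hD] at this)
    (fun s => (key _ hU hUc).tendsto_at _) 0
  have hχ1 : ∀ y ∈ cB x₀ (r / 4), χ y = 1 := fun y hy => by simp [hχ, h4 y hy]
  have hev : χ =ᶠ[𝓝 x₀] fun _ => 1 := by
    filter_upwards [closedBall_mem_nhds x₀ (by positivity : 0 < r / 4)] with y hy using hχ1 y hy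
  simp only [zero_smul, add_zero, hev.eq_of_nhds, hev.fderiv_eq, fderiv_fun_const, mul_one,
    Pi.zero_apply, zero_apply, mul_zero] at hder
  refine hder.congr_of_eventuallyEq ?_
  have hl : Tendsto (fun s : ℝ => x₀ + s • e) (𝓝 0) (𝓝 x₀) := by
    have : Continuous (fun s : ℝ => x₀ + s • e) := by fun_prop
    simpa using this.tendsto 0
  filter_upwards [hl.eventually hev] with s hs
  rw [hs, mul_one]

lemma memLp_restrict_union {V : Type*} [NormedAddCommGroup V] {H : E → V} {s t : Set E}
    (hs : MemLp H 2 (volOn s)) (ht : MemLp H 2 (volOn t)) :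
    MemLp H 2 (volOn (s ∪ t)) := by
  have hm : AEStronglyMeasurable H (volOn (s ∪ t)) := aestronglyMeasurable_union_iff.2 ⟨hs.1, ht.1⟩
  refine ⟨hm, ?_⟩
  have h1 := hs.2
  have h2 := ht.2
  rw [eLpNorm_lt_top_iff_lintegral_rpow_enorm_lt_top two_ne_zero (by simp)] at h1 h2 ⊢
  exact (lintegral_union_le _ _ _).trans_lt (ENNReal.add_lt_top.2 ⟨h1, h2⟩)

/-- Gluing of local `L²` limits. -/
lemma exists_locL2_limit {V : Type*} [NormedAddCommGroup V] {Ω : Set E}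
    {ι : Type*} {l : Filter ι} [l.NeBot] {F : ι → E → V}
    (hF : ∀ X ∈ Ω, ∃ r > 0, cB X r ⊆ Ω ∧ (∀ᶠ k in l, AEStronglyMeasurable (F k)
        (volOn (cB X r))) ∧
      ∃ g : E → V, MemLp g 2 (volOn (cB X r)) ∧
      Tendsto (fun k => eLpNorm (fun x => F k x - g x) 2 (volOn (cB X r))) l (𝓝 0)) :
    ∃ H : E → V, LocL2 Ω H ∧ ∀ X ∈ Ω, ∃ r > 0, cB X r ⊆ Ω ∧ Tendsto (fun k => eLpNorm (fun x => F k x - H x) 2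
        (volOn (cB X r))) l (𝓝 0) := by
  classical
  by_cases hne : Ω = ∅
  · subst hne
    refine ⟨fun _ => 0, fun K _ hK => ?_, by simp⟩
    rw [subset_empty_iff.1 hK]
    simp
  choose! r hr hrΩ hFm g hg hlim using hF
  obtain ⟨T, hTΩ, hTc, hcov⟩ := TopologicalSpace.countable_cover_nhdsWithin (s := Ω)
    (f := fun X => cB X (r X)) fun X hX => nhdsWithin_le_nhds (closedBall_mem_nhds X (hr X hX))
  have hTne : T.Nonempty := by
    by_contra h
    rw [not_nonempty_iff_eq_empty] at h
    rw [h] at hcov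
    simp only [mem_empty_iff_false, iUnion_of_empty, iUnion_empty] at hcov
    exact hne (subset_empty_iff.1 hcov)
  obtain ⟨c, hc⟩ := hTc.exists_eq_range hTne
  have hcΩ : ∀ j, c j ∈ Ω := fun j => hTΩ (hc ▸ mem_range_self j)
  have hcov' : ∀ X ∈ Ω, ∃ j, X ∈ cB (c j) (r (c j)) := by
    intro X hX
    obtain ⟨Y, hY, hXY⟩ := mem_iUnion₂.1 (hcov hX)
    rw [hc] at hY
    obtain ⟨j, rfl⟩ := hY
    exact ⟨j, hXY⟩
  have huniq : ∀ X ∈ Ω, ∀ Y ∈ Ω, ∀ᵐ x, x ∈ cB X (r X) →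
      x ∈ cB Y (r Y) → g X x = g Y x := by
    intro X hX Y hY
    set S := cB X (r X) ∩ cB Y (r Y)
    have hS : MeasurableSet S := measurableSet_closedBall.inter measurableSet_closedBall
    have hmX : volOn S ≤ volOn (cB X (r X)) := Measure.restrict_mono inter_subset_left le_rfl
    have hmY : volOn S ≤ volOn (cB Y (r Y)) := Measure.restrict_mono inter_subset_right le_rfl
    have hgX := (hg X hX).mono_measure hmX
    have hgY := (hg Y hY).mono_measure hmY
    have h0 : eLpNorm (fun x => g X x - g Y x) 2 (volOn S) ≤ 0 := by
      have hsum := (hlim X hX).add (hlim Y hY)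
      rw [add_zero] at hsum
      refine ge_of_tendsto hsum ?_
      filter_upwards [hFm X hX] with k hk
      have hkS := hk.mono_measure hmX
      have e : (fun x => g X x - g Y x) = (fun x => F k x - g Y x) - fun x => F k x - g X x := by
        ext x; simp
      rw [e, add_comm]
      exact (eLpNorm_sub_le (hkS.sub hgY.1) (hkS.sub hgX.1) one_le_two).trans
        (add_le_add (eLpNorm_mono_measure _ hmY) (eLpNorm_mono_measure _ hmX))
    have h1 := (eLpNorm_eq_zero_iff (hgX.1.sub hgY.1) two_ne_zero).1 (le_antisymm h0 zero_le)
    rw [Filter.EventuallyEq, ae_restrict_iff' hS] at h1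
    filter_upwards [h1] with x hx h2 h3
    exact sub_eq_zero.1 (hx ⟨h2, h3⟩)
  set H : E → V := fun x => if h : ∃ j, x ∈ cB (c j) (r (c j)) then g (c (Nat.find h)) x else 0
  have hH : ∀ X ∈ Ω, H =ᵐ[volOn (cB X (r X))] g X := by
    intro X hX
    rw [Filter.EventuallyEq, ae_restrict_iff' measurableSet_closedBall]
    have hall : ∀ᵐ x, ∀ j, x ∈ cB X (r X) →
        x ∈ cB (c j) (r (c j)) → g X x = g (c j) x :=
      ae_all_iff.2 fun j => huniq X hX (c j) (hcΩ j)
    filter_upwards [hall] with x hx hxX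
    have hex := hcov' x (hrΩ X hX hxX)
    simp only [H, dif_pos hex]
    exact (hx _ hxX (Nat.find_spec hex)).symm
  refine ⟨H, fun K hK hKΩ => ?_, fun X hX => ⟨r X, hr X hX, hrΩ X hX, ?_⟩⟩
  · refine hK.induction_on (p := fun S => MemLp H 2 (volOn S)) (by simp)
      (fun s t hst ht => ht.mono_measure (Measure.restrict_mono hst le_rfl))
      (fun s t hs ht => memLp_restrict_union hs ht) fun X hX => ⟨cB X (r X),
        nhdsWithin_le_nhds (closedBall_mem_nhds X (hr X (hKΩ hX))), ?_⟩
    exact (hg X (hKΩ hX)).ae_eq (hH X (hKΩ hX)).symm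
  · refine (hlim X hX).congr fun k => eLpNorm_congr_ae ?_
    filter_upwards [hH X hX] with x hx
    rw [hx]

/-! ### Limits of solutions -/

lemma eLpNorm_restrict_union_le {V : Type*} [NormedAddCommGroup V] (H : E → V) (s t : Set E) :
    eLpNorm H 2 (volOn (s ∪ t)) ≤ eLpNorm H 2 (volOn s) + eLpNorm H 2 (volOn t) := by
  simp only [eLpNorm_eq_lintegral_rpow_enorm_toReal two_ne_zero ENNReal.ofNat_ne_top]
  refine le_trans (rpow_le_rpow (lintegral_union_le _ _ _) (by simp))
    (ENNReal.rpow_add_le_add_rpow _ _ (by simp) (by simp; norm_num))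

lemma tendsto_eLpNorm_restrict_compact {V : Type*} [NormedAddCommGroup V] {Ω : Set E} {ι : Type*}
    {l : Filter ι} {F : ι → E → V} {H : E → V}
    (h : ∀ X ∈ Ω, ∃ r > 0, cB X r ⊆ Ω ∧ Tendsto (fun k => eLpNorm
      (fun x => F k x - H x) 2 (volOn (cB X r))) l (𝓝 0))
    {K : Set E} (hK : IsCompact K) (hKΩ : K ⊆ Ω) :
    Tendsto (fun k => eLpNorm (fun x => F k x - H x) 2 (volOn K)) l (𝓝 0) := by
  refine hK.induction_on (p := fun S => Tendsto (fun k => eLpNorm (fun x => F k x - H x) 2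
    (volOn S)) l (𝓝 0)) (by simp [tendsto_const_nhds]) (fun s t hst ht => ?_) (fun s t hs ht => ?_)
    fun X hX => ?_
  · exact tendsto_of_tendsto_of_tendsto_of_le_of_le tendsto_const_nhds ht (fun _ => zero_le)
      fun k => eLpNorm_mono_measure _ (Measure.restrict_mono hst le_rfl)
  · have := hs.add ht
    rw [add_zero] at this
    exact tendsto_of_tendsto_of_tendsto_of_le_of_le tendsto_const_nhds this (fun _ => zero_le)
      fun k => eLpNorm_restrict_union_le _ _ _
  · obtain ⟨r, hr, -, hlim⟩ := h X (hKΩ hX)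
    exact ⟨_, nhdsWithin_le_nhds (closedBall_mem_nhds X hr), hlim⟩

lemma integral_eq_setIntegral_of_zero {a f : E → ℂ} {K : Set E}
    (ha : ∀ x, x ∉ K → a x = 0) : ∫ x, a x * f x = ∫ x in K, a x * f x :=
  (setIntegral_eq_integral_of_forall_compl_eq_zero fun x hx => by rw [ha x hx, zero_mul]).symm

lemma tendsto_integral_mul_of_compact {ι : Type*} {l : Filter ι} {a : E → ℂ} (ha : MemLp a 2)
    {K : Set E} (haK : ∀ x, x ∉ K → a x = 0) {F : ι → E → ℂ} {H : E → ℂ}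
    (hF : ∀ᶠ k in l, MemLp (F k) 2 (volOn K)) (hH : MemLp H 2 (volOn K))
    (h : Tendsto (fun k => eLpNorm (fun x => F k x - H x) 2 (volOn K)) l (𝓝 0)) :
    Tendsto (fun k => ∫ x, a x * F k x) l (𝓝 (∫ x, a x * H x)) := by
  rw [integral_eq_setIntegral_of_zero haK]
  simp only [integral_eq_setIntegral_of_zero haK]
  exact tendsto_integral_mul_of_tendsto_eLpNorm (ha.restrict K) hF hH h

lemma exists_tendsto_eLpNorm_of_cauchy {α V : Type*} [MeasurableSpace α] {μ : Measure α}
    [NormedAddCommGroup V] [CompleteSpace V] {F : ℕ → α → V} {k₀ : ℕ}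
    (hF : ∀ k, k₀ ≤ k → MemLp (F k) 2 μ)
    (hc : ∀ ε : ℝ≥0∞, 0 < ε → ∃ N, ∀ j k, N ≤ j → N ≤ k →
      eLpNorm (fun x => F j x - F k x) 2 μ ≤ ε) :
    ∃ g, MemLp g 2 μ ∧ Tendsto (fun k => eLpNorm (fun x => F k x - g x) 2 μ) atTop (𝓝 0) := by
  have : Fact ((1 : ℝ≥0∞) ≤ 2) := ⟨one_le_two⟩
  have hF' : ∀ k, MemLp (F (k + k₀)) 2 μ := fun k => hF _ (by omega)
  have hcau : CauchySeq fun k => (hF' k).toLp (F (k + k₀)) := by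
    rw [EMetric.cauchySeq_iff]
    intro ε hε
    obtain ⟨δ, hδ0, hδ⟩ := exists_between hε
    obtain ⟨N, hN⟩ := hc δ hδ0
    refine ⟨N, fun j hj k hk => ?_⟩
    rw [Lp.edist_toLp_toLp]
    exact lt_of_le_of_lt (hN _ _ (by omega) (by omega)) hδ
  obtain ⟨g, hg⟩ := cauchySeq_tendsto_of_complete hcau
  refine ⟨g, Lp.memLp g, ?_⟩
  rw [← tendsto_add_atTop_iff_nat k₀]
  have h1 := (Lp.tendsto_Lp_iff_tendsto_eLpNorm'' (fun k => F (k + k₀)) hF' g (Lp.memLp g)).1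
    (by rwa [Lp.toLp_coeFn])
  exact h1

section

variable {Ω : Set (Rn1 n)}

/-- The coefficient of `Gⱼ` in the energy integrand. -/
def energyCoef (A : Coeff n) (Φ : Rn1 n → ℂ) (j : Fin (n + 1)) (X : Rn1 n) : ℂ :=
  ∑ i, A X.1 i j * fderiv ℝ Φ X (dir i)

lemma energy_eq_sum (A : Coeff n) (G : VF n) (Φ : Rn1 n → ℂ) (X : Rn1 n) :
    energy A G Φ X = ∑ j, energyCoef A Φ j X * G X j := by
  rw [energy, Finset.sum_comm]
  refine Finset.sum_congr rfl fun j _ => ?_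
  rw [energyCoef, Finset.sum_mul]
  exact Finset.sum_congr rfl fun i _ => by ring

lemma energyCoef_eq_zero {Φ : Rn1 n → ℂ} {j : Fin (n + 1)} {X : Rn1 n} (hX : X ∉ tsupport Φ) :
    energyCoef A Φ j X = 0 := by
  simp [energyCoef, fderiv_of_notMem_tsupport ℝ hX]

lemma Elliptic.memLp_energyCoef (hA : Elliptic A Λ) {Φ : Rn1 n → ℂ} (hΦ : ContDiff ℝ ∞ Φ)
    (hc : HasCompactSupport Φ) (j : Fin (n + 1)) (p : ℝ≥0∞) : MemLp (energyCoef A Φ j) p := by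
  refine memLp_finsetSum _ fun i _ => ?_
  have h1 : MemLp (fun X => fderiv ℝ Φ X (dir i)) p :=
    (cont_fderiv hΦ _).memLp_of_hasCompactSupport (hcs_fderiv hc _)
  refine h1.of_le_mul (c := Λ) ((hA.aestronglyMeasurable_fst i j).mul h1.1) ?_
  filter_upwards [ae_fst_of_ae hA.norm_entry_le] with X hX
  rw [norm_mul]
  gcongr
  exact hX i j

lemma integrable_coef_mul {a f : Rn1 n → ℂ} {K : Set (Rn1 n)}
    (ha : MemLp a 2) (haK : ∀ X, X ∉ K → a X = 0) (hf : MemLp f 2 (volOn K)) :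
    Integrable (fun X => a X * f X) := by
  have h1 : IntegrableOn (fun X => a X * f X) K := (ha.restrict K).integrable_mul hf
  refine (integrableOn_iff_integrable_of_support_subset fun X hX => ?_).1 h1
  by_contra hn
  exact hX (by simp [haK X hn])

lemma integral_energy (hA : Elliptic A Λ) {G : VF n}
    {Φ : Rn1 n → ℂ} (hΦ : ContDiff ℝ ∞ Φ) (hc : HasCompactSupport Φ)
    (hG : MemLp G 2 (volOn (tsupport Φ))) :
    ∫ X, energy A G Φ X = ∑ j, ∫ X, energyCoef A Φ j X * G X j := by
  simp only [energy_eq_sum]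
  refine integral_finsetSum _ fun j _ => ?_
  refine integrable_coef_mul (hA.memLp_energyCoef hΦ hc j 2) (fun X hX => energyCoef_eq_zero hX) ?_
  exact hG.of_le ((EuclideanSpace.proj (𝕜 := ℂ) j).continuous.comp_aestronglyMeasurable hG.1)
    (.of_forall fun x => PiLp.norm_apply_le (G x) j)

lemma LocL2.const_smul {V : Type*} [NormedAddCommGroup V] [NormedSpace ℂ V] {f : Rn1 n → V}
    (hf : LocL2 Ω f) (c : ℂ) : LocL2 Ω (fun X => c • f X) :=
  fun K hK hs => (hf K hK hs).const_smul c

lemma IsSolution.const_smul {u : Rn1 n → ℂ} {G : VF n}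
    (h : IsSolution A Ω u G) (c : ℂ) :
    IsSolution A Ω (fun X => c • u X) (fun X => c • G X) := by
  refine ⟨h.locL2.const_smul c, h.gradLocL2.const_smul c,
    fun i => (h.weakGrad i).const_mul c, fun Φ h1 h2 h3 => ?_⟩
  have : ∀ X, energy A (fun X => c • G X) Φ X = c * energy A G Φ X := by
    intro X
    simp only [energy, PiLp.smul_apply, smul_eq_mul, Finset.mul_sum]
    exact Finset.sum_congr rfl fun i _ => Finset.sum_congr rfl fun j _ => by ring
  simp only [this]
  rw [integral_const_mul, h.eqn Φ h1 h2 h3, mul_zero]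

lemma IsSolution.sub (hΩ : IsOpen Ω) (hA : Elliptic A Λ) {u v : Rn1 n → ℂ}
    {G H : VF n} (h : IsSolution A Ω u G) (h' : IsSolution A Ω v H) :
    IsSolution A Ω (fun X => u X - v X) (fun X => G X - H X) := by
  refine ⟨h.locL2.sub h'.locL2, h.gradLocL2.sub h'.gradLocL2, fun i => ?_, fun Φ h1 h2 h3 => ?_⟩
  · exact HasWeakDeriv.sub (h.locL2.locallyIntegrableOn hΩ) (h'.locL2.locallyIntegrableOn hΩ)
      ((h.gradLocL2.apply i).locallyIntegrableOn hΩ) ((h'.gradLocL2.apply i).locallyIntegrableOn hΩ)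
      (h.weakGrad i) (h'.weakGrad i)
  · have hG := h.gradLocL2 _ h2 h3
    have hH := h'.gradLocL2 _ h2 h3
    have hI : ∀ (F : VF n), LocL2 Ω F → ∀ j,
        Integrable (fun X => energyCoef A Φ j X * F X j) := fun F hF j =>
      integrable_coef_mul (hA.memLp_energyCoef h1 h2 j 2) (fun X hX => energyCoef_eq_zero hX)
        ((hF.apply j) _ h2 h3)
    have e1 := h.eqn Φ h1 h2 h3
    have e2 := h'.eqn Φ h1 h2 h3
    rw [integral_energy hA h1 h2 hG] at e1
    rw [integral_energy hA h1 h2 hH] at e2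
    rw [integral_energy hA (G := fun X => G X - H X) h1 h2 (hG.sub hH)]
    simp only [PiLp.sub_apply, mul_sub]
    rw [Finset.sum_congr rfl fun j _ => integral_sub (hI G h.gradLocL2 j) (hI H h'.gradLocL2 j),
      Finset.sum_sub_distrib, e1, e2, sub_zero]

lemma LocL2.translate {V : Type*} [NormedAddCommGroup V] {f : Rn1 n → V} (hf : LocL2 Ω f)
    (a : Rn1 n) : LocL2 ((fun X => X + a) ⁻¹' Ω) (fun X => f (X + a)) := by
  intro K hK hs
  have hK' : IsCompact ((fun X => X + a) '' K) := hK.image (by fun_prop)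
  have h1 := hf _ hK' (image_subset_iff.2 hs)
  have hmp : MeasurePreserving (fun X : Rn1 n => X + a) (volOn K)
      (volOn ((fun X => X + a) '' K)) := by
    have := (measurePreserving_add_right (volume : Measure (Rn1 n)) a).restrict_preimage
      hK'.measurableSet
    rwa [preimage_image_eq _ (add_left_injective a)] at this
  exact h1.comp_measurePreserving hmp

lemma IsSolution.translate {u : Rn1 n → ℂ} {G : VF n} (h : IsSolution A Ω u G)
    {a : Rn1 n} (ha : a.1 = 0) :
    IsSolution A ((fun X => X + a) ⁻¹' Ω) (fun X => u (X + a)) (fun X => G (X + a)) := by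
  refine ⟨h.locL2.translate a, h.gradLocL2.translate a, fun i => (h.weakGrad i).translate a,
    fun Φ h1 h2 h3 => ?_⟩
  have hsup : tsupport (fun X => Φ (X - a)) = (fun X => X - a) ⁻¹' tsupport Φ :=
    tsupport_comp_eq_preimage Φ (Homeomorph.subRight a)
  have hz := h.eqn (fun X => Φ (X - a)) (h1.comp (contDiff_id.sub contDiff_const))
    (h2.comp_homeomorph (Homeomorph.subRight a)) (by
      rw [hsup]
      intro X hX
      simpa using h3 hX)
  rw [← integral_add_right_eq_self _ a] at hz
  rw [← hz]
  congr 1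
  ext X
  have hf : fderiv ℝ (fun X => Φ (X - a)) (X + a) = fderiv ℝ Φ X := by
    rw [fderiv_comp_sub, add_sub_cancel_right]
  simp only [energy, hf, Prod.fst_add, ha, add_zero]

lemma IsSolution.isSolution_diffQuot (hΩ : IsOpen Ω) (hA : Elliptic A Λ) {u : Rn1 n → ℂ}
    {G : VF n} (h : IsSolution A Ω u G) {e : Rn1 n} (he : e.1 = 0) (s : ℝ) :
    IsSolution A (Ω ∩ (fun X => X + s • e) ⁻¹' Ω) (diffQuot e s u) (diffQuot e s G) := by
  have ho : IsOpen ((fun X : Rn1 n => X + s • e) ⁻¹' Ω) := hΩ.preimage (by fun_prop)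
  have h1 := (h.translate (a := s • e) (by simp [he])).mono (inter_subset_right : Ω ∩ _ ⊆ _)
  exact (h1.sub (hΩ.inter ho) hA (h.mono inter_subset_left)).const_smul _

lemma eLpNorm_caccioppoli (n : ℕ) {Λ : ℝ} (hΛ : 0 < Λ) : ∃ C : ℝ≥0, ∀ (A : Coeff n),
    Elliptic A Λ → ∀ (Ω : Set (Rn1 n)) (u : Rn1 n → ℂ) (G : VF n),
      IsOpen Ω → IsSolution A Ω u G → ∀ (X : Rn1 n) (R : ℝ), 0 < R →
      cB X (2 * R) ⊆ Ω →
      ∫⁻ Y in cB X R, ‖G Y‖ₑ ^ 2 ≤ C * ofReal (R⁻¹ ^ 2) * ∫⁻ Y in cB X (2 * R), ‖u Y‖ₑ ^ 2 := by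
  obtain ⟨C, hC, hcac⟩ := exists_caccioppoli n hΛ
  refine ⟨C.toNNReal, fun A hA Ω u G hΩ hu X R hR hball => ?_⟩
  have hsub : cB X R ⊆ cB X (2 * R) := closedBall_subset_closedBall (by linarith)
  rw [← ofReal_setIntegral_norm_sq (hu.gradLocL2 _ (isCompact_closedBall X R) (hsub.trans hball)),
    ← ofReal_setIntegral_norm_sq (hu.locL2 _ (isCompact_closedBall X (2 * R)) hball),
    ← ofReal, ← ofReal_mul hC.le, ← ofReal_mul (by positivity)]
  refine ofReal_le_ofReal ((hcac A hA Ω u G hΩ hu X R hR hball).trans_eq ?_)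
  rw [inv_pow, div_eq_mul_inv]

lemma eLpNorm_grad_le {u : Rn1 n → ℂ} {G : VF n} {S T : Set (Rn1 n)}
    {c : ℝ≥0∞} (h : ∫⁻ Y in S, ‖G Y‖ₑ ^ 2 ≤ c * ∫⁻ Y in T, ‖u Y‖ₑ ^ 2) :
    eLpNorm G 2 (volOn S) ≤ c ^ (1 / 2 : ℝ) * eLpNorm u 2 (volOn T) := by
  simp only [eLpNorm_eq_lintegral_rpow_enorm_toReal two_ne_zero ENNReal.ofNat_ne_top,
    ENNReal.toReal_ofNat, ENNReal.rpow_two]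
  rw [← mul_rpow_of_nonneg _ _ (by norm_num)]
  exact rpow_le_rpow h (by norm_num)

lemma DGNM.exists_continuousOn {C₀ α : ℝ} (hα : 0 < α) (hD : DGNM A C₀ α) (hΩ : IsOpen Ω)
    {u : Rn1 n → ℂ} {G : VF n} (hu : IsSolution A Ω u G) :
    ∃ v : Rn1 n → ℂ, ContinuousOn v Ω ∧ v =ᵐ[volOn Ω] u := by
  obtain ⟨v, hv, hest⟩ := hD Ω u G hΩ hu
  refine ⟨v, fun X hX => ContinuousAt.continuousWithinAt ?_, hv⟩
  obtain ⟨r, hr, hrΩ⟩ := isOpen_iff.1 hΩ X hX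
  set R := r / 4 with hR
  have hR0 : 0 < R := by positivity
  have hcl : cB X (2 * R) ⊆ Ω := (closedBall_subset_ball (by linarith)).trans hrΩ
  have hsubE : eball X (2 * R) ⊆ cB X (2 * R) :=
    (eball_subset_ball X _).trans ball_subset_closedBall
  have hrms : rms v (eball X (2 * R)) ≠ ⊤ := by
    refine rpow_ne_top_of_nonneg (by norm_num) ?_
    rw [setLAverage_eq]
    refine ENNReal.div_ne_top (ne_top_of_le_ne_top ?_ (lintegral_mono_set (μ := volume) hsubE)) ?_
    · have h1 := (hu.locL2 _ (isCompact_closedBall X (2 * R)) hcl).2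
      rw [eLpNorm_lt_top_iff_lintegral_rpow_enorm_lt_top two_ne_zero (by simp)] at h1
      have h2 : ∫⁻ Y in cB X (2 * R), ‖v Y‖ₑ ^ 2
          = ∫⁻ Y in cB X (2 * R), ‖u Y‖ₑ ^ (2 : ℝ≥0∞).toReal := by
        refine lintegral_congr_ae ?_
        filter_upwards [ae_mono (Measure.restrict_mono hcl le_rfl) hv] with Y hY
        rw [hY]; simp
      rw [h2]; exact h1.ne
    · have : cB X R ⊆ eball X (2 * R) := by
        simpa using closedBall_subset_eball X (r := 2 * R) (by positivity)
      exact ((measure_closedBall_pos volume X hR0).trans_le (measure_mono this)).ne'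
  have hcoef : Tendsto (fun Z : Rn1 n => ofReal (C₀ * (edst Z X / R) ^ α)
      * rms v (eball X (2 * R))) (𝓝 X) (𝓝 0) := by
    have hc : Continuous (fun Z : Rn1 n => C₀ * (edst Z X / R) ^ α) := by
      unfold edst
      exact continuous_const.mul ((by fun_prop : Continuous fun Z : Rn1 n =>
        √(‖Z.1 - X.1‖ ^ 2 + (Z.2 - X.2) ^ 2) / R).rpow_const fun _ => Or.inr hα.le)
    have h0 : ofReal (C₀ * (edst X X / R) ^ α) = 0 := by simp [edst, Real.zero_rpow hα.ne']
    have := ENNReal.Tendsto.mul_const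
      ((ENNReal.continuous_ofReal.comp hc).tendsto X) (b := rms v (eball X (2 * R)))
      (Or.inr hrms)
    simpa [h0] using this
  have hnorm : Tendsto (fun Z => ‖v Z - v X‖ₑ) (𝓝 X) (𝓝 0) := by
    refine tendsto_of_tendsto_of_tendsto_of_le_of_le' tendsto_const_nhds hcoef
      (.of_forall fun _ => zero_le) ?_
    have hXR : ∀ Z ∈ cB X (R / 2), Z ∈ eball X R := fun Z hZ => closedBall_subset_eball X hR0 hZ
    filter_upwards [closedBall_mem_nhds X (by positivity : 0 < R / 2)] with Z hZ
    exact (hest X R hR0 (hsubE.trans hcl)).1 Z (hXR Z hZ) X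
      (hXR X (mem_closedBall_self (by positivity)))
  rw [ContinuousAt, EMetric.tendsto_nhds]
  intro ε hε
  filter_upwards [hnorm.eventually_lt_const hε] with Z hZ
  rwa [edist_eq_enorm_sub]

lemma IsSolution.congr {u u' : Rn1 n → ℂ} {G : VF n}
    (h : IsSolution A Ω u G) (hu : ∀ᵐ X, X ∈ Ω → u X = u' X) : IsSolution A Ω u' G := by
  refine ⟨fun K hK hs => (h.locL2 K hK hs).ae_eq ?_, h.gradLocL2, fun i =>
    (h.weakGrad i).congr hu (.of_forall fun _ _ => rfl), h.eqn⟩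
  rw [Filter.EventuallyEq, ae_restrict_iff' hK.measurableSet]
  filter_upwards [hu] with X hX hXK using hX (hs hXK)

lemma LocL2.locL2_diffQuot {V : Type*} [NormedAddCommGroup V] [NormedSpace ℂ V] {f : Rn1 n → V}
    (hf : LocL2 Ω f) (e : Rn1 n) (s : ℝ) :
    LocL2 (Ω ∩ (fun X => X + s • e) ⁻¹' Ω) (diffQuot e s f) :=
  LocL2.const_smul (((hf.translate (s • e)).mono inter_subset_right).sub
    (hf.mono inter_subset_left)) _

lemma eventually_subset_translate (hΩ : IsOpen Ω) {K : Set (Rn1 n)} (hK : IsCompact K)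
    (hKΩ : K ⊆ Ω) (e : Rn1 n) {s : ℕ → ℝ} (hs : Tendsto s atTop (𝓝 0)) :
    ∀ᶠ k in atTop, K ⊆ Ω ∩ (fun X => X + s k • e) ⁻¹' Ω := by
  obtain ⟨δ, hδ, hδΩ⟩ := hK.exists_cthickening_subset_open hΩ hKΩ
  have h1 : Tendsto (fun k => ‖s k • e‖) atTop (𝓝 0) := by
    have := (hs.smul_const e).norm
    simpa using this
  filter_upwards [h1.eventually_lt_const hδ] with k hk X hX
  refine ⟨hKΩ hX, hδΩ (mem_cthickening_of_dist_le _ X _ _ hX ?_)⟩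
  rw [dist_eq_norm, add_sub_cancel_left]
  exact hk.le

/-- For `t`-independent coefficients, `∂ₜu` is a solution with `u`. -/
lemma IsSolution.exists_timeDeriv {C₀ α : ℝ} (hα : 0 < α) (hΛ : 0 < Λ) (hA : Elliptic A Λ)
    (hD : DGNM A C₀ α) (hΩ : IsOpen Ω) {u : Rn1 n → ℂ} {G : VF n}
    (hu : IsSolution A Ω u G) (hcont : ContinuousOn u Ω) :
    ∃ (w : Rn1 n → ℂ) (H : VF n), IsSolution A Ω w H ∧ ContinuousOn w Ω ∧
      (∀ᵐ X, X ∈ Ω → w X = G X (Fin.last n)) ∧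
      ∀ X ∈ Ω, HasDerivAt (fun s : ℝ => u (X.1, s)) (w X) X.2 := by
  set e : Rn1 n := dir (Fin.last n) with he
  have he' : e = (0, 1) := by simp [he, dir]
  have he1 : e.1 = 0 := by rw [he']
  set s : ℕ → ℝ := fun k => 1 / ((k : ℝ) + 1) with hsdef
  have hs0 : ∀ k, s k ≠ 0 := fun k => by positivity
  have hs : Tendsto s atTop (𝓝 0) := tendsto_one_div_add_atTop_nhds_zero_nat
  have hs' : Tendsto s atTop (𝓝[≠] 0) := tendsto_nhdsWithin_iff.2 ⟨hs, .of_forall hs0⟩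
  set g : Rn1 n → ℂ := fun X => G X (Fin.last n)
  have hgL : LocL2 Ω g := hu.gradLocL2.apply _
  have hgw : HasWeakDeriv Ω e u g := hu.weakGrad (Fin.last n)
  obtain ⟨C, hcac⟩ := eLpNorm_caccioppoli n hΛ
  have hballs : ∀ X ∈ Ω, ∃ r > 0, cB X (16 * r) ⊆ Ω := by
    intro X hX
    obtain ⟨r, hr, hrΩ⟩ := isOpen_iff.1 hΩ X hX
    exact ⟨r / 32, by positivity, (closedBall_subset_ball (by linarith)).trans hrΩ⟩
  have hlimu : ∀ X ∈ Ω, ∃ r > 0, cB X r ⊆ Ω ∧ Tendsto (fun k => eLpNorm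
      (fun x => diffQuot e (s k) u x - g x) 2 (volOn (cB X r)))
      atTop (𝓝 0) := by
    intro X hX
    obtain ⟨r, hr, hrΩ⟩ := hballs X hX
    exact ⟨r, hr, (closedBall_subset_closedBall (by linarith)).trans hrΩ,
      (tendsto_eLpNorm_diffQuot_closedBall hΩ hu.locL2 hgL hgw hr
      ((closedBall_subset_closedBall (by linarith)).trans hrΩ)).comp hs'⟩
  obtain ⟨H, hHL, hHlim⟩ := exists_locL2_limit (Ω := Ω) (l := atTop)
      (F := fun k => diffQuot e (s k) G) (by
    intro X hX
    obtain ⟨r, hr, hrΩ⟩ := hballs X hX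
    have h4 : cB X (4 * r) ⊆ Ω := (closedBall_subset_closedBall (by linarith)).trans hrΩ
    have h2 : cB X (2 * r) ⊆ cB X (4 * r) := closedBall_subset_closedBall (by linarith)
    have h1 : cB X r ⊆ cB X (4 * r) := closedBall_subset_closedBall (by linarith)
    have hsub := eventually_subset_translate hΩ (isCompact_closedBall X (4 * r)) h4 e hs
    obtain ⟨k₀, hk₀⟩ := eventually_atTop.1 hsub
    have hmem : ∀ k, k₀ ≤ k → MemLp (diffQuot e (s k) G) 2
        (volOn (cB X r)) := fun k hk =>
      hu.gradLocL2.locL2_diffQuot e (s k) _ (isCompact_closedBall X r) (h1.trans (hk₀ k hk))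
    have hmemu : ∀ k, k₀ ≤ k → MemLp (diffQuot e (s k) u) 2
        (volOn (cB X (2 * r))) := fun k hk =>
      hu.locL2.locL2_diffQuot e (s k) _ (isCompact_closedBall X (2 * r)) (h2.trans (hk₀ k hk))
    have hgm : MemLp g 2 (volOn (cB X (2 * r))) :=
      hgL _ (isCompact_closedBall X (2 * r)) (h2.trans h4)
    refine ⟨r, hr, h1.trans h4, ?_, ?_⟩
    · filter_upwards [eventually_ge_atTop k₀] with k hk using (hmem k hk).1
    refine exists_tendsto_eLpNorm_of_cauchy (k₀ := k₀) hmem fun ε hε => ?_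
    set c : ℝ≥0∞ := (C * ofReal (r⁻¹ ^ 2)) ^ (1 / 2 : ℝ)
    have hc : c ≠ ⊤ := rpow_ne_top_of_nonneg (by norm_num) (mul_ne_top coe_ne_top ofReal_ne_top)
    have hlim2 : Tendsto (fun k => c * (eLpNorm (fun x => diffQuot e (s k) u x - g x) 2
        (volOn (cB X (2 * r))))) atTop (𝓝 0) := by
      have := (tendsto_eLpNorm_diffQuot_closedBall (x₀ := X) (r := 2 * r) hΩ hu.locL2 hgL hgw
        (by positivity) ((closedBall_subset_closedBall (by linarith)).trans hrΩ)).comp hs'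
      simpa using ENNReal.Tendsto.const_mul this (Or.inr hc)
    obtain ⟨N, hN⟩ := eventually_atTop.1 (ENNReal.tendsto_nhds_zero.1 hlim2 (ε / 2)
      (ENNReal.half_pos hε.ne'))
    refine ⟨max N k₀, fun j k hj hk => ?_⟩
    have hj0 : k₀ ≤ j := (le_max_right _ _).trans hj
    have hk0 : k₀ ≤ k := (le_max_right _ _).trans hk
    set Ω' : Set (Rn1 n) := ball X (4 * r)
    have hΩ' : ∀ k, k₀ ≤ k → Ω' ⊆ Ω ∩ (fun X => X + s k • e) ⁻¹' Ω := fun k hk =>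
      ball_subset_closedBall.trans (hk₀ k hk)
    have hsol := ((hu.isSolution_diffQuot hΩ hA he1 (s j)).mono (hΩ' j hj0)).sub isOpen_ball hA
      ((hu.isSolution_diffQuot hΩ hA he1 (s k)).mono (hΩ' k hk0))
    have hest := eLpNorm_grad_le (hcac A hA Ω' _ _ isOpen_ball hsol X r hr
      (closedBall_subset_ball (by linarith)))
    refine hest.trans ?_
    have e3 : (fun x => diffQuot e (s j) u x - diffQuot e (s k) u x)
        = (fun x => diffQuot e (s j) u x - g x) - fun x => diffQuot e (s k) u x - g x := by
      ext x; simp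
    rw [e3]
    calc _ ≤ c * (eLpNorm (fun x => diffQuot e (s j) u x - g x) 2
          (volOn (cB X (2 * r)))
          + eLpNorm (fun x => diffQuot e (s k) u x - g x) 2
          (volOn (cB X (2 * r)))) := by
          gcongr
          exact eLpNorm_sub_le ((hmemu j hj0).sub hgm).1 ((hmemu k hk0).sub hgm).1 one_le_two
      _ ≤ ε / 2 + ε / 2 := by
          rw [mul_add]
          exact add_le_add (hN j ((le_max_left _ _).trans hj)) (hN k ((le_max_left _ _).trans hk))
      _ = ε := ENNReal.add_halves ε)
  have hsolg : IsSolution A Ω g H := by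
    refine ⟨hgL, hHL, fun i φ h1 h2 h3 => ?_, fun Φ h1 h2 h3 => ?_⟩
    · have hsub := eventually_subset_translate hΩ h2 h3 e hs
      have hL := tendsto_integral_mul_of_compact (a := fun X => fderiv ℝ φ X (dir i))
        (F := fun k => diffQuot e (s k) u) (l := atTop)
        ((cont_fderiv h1 _).memLp_of_hasCompactSupport (hcs_fderiv h2 _))
        (K := tsupport φ) (fun x hx => by simp [fderiv_of_notMem_tsupport ℝ hx])
        (by filter_upwards [hsub] with k hk using hu.locL2.locL2_diffQuot e (s k) _ h2 hk)
        (hgL _ h2 h3) (tendsto_eLpNorm_restrict_compact hlimu h2 h3)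
      have hR := tendsto_integral_mul_of_compact (a := φ)
        (F := fun k X => diffQuot e (s k) G X i) (H := fun X => H X i) (l := atTop)
        (h1.continuous.memLp_of_hasCompactSupport h2)
        (K := tsupport φ) (fun x hx => image_eq_zero_of_notMem_tsupport hx)
        (by filter_upwards [hsub] with k hk using
              ((hu.gradLocL2.locL2_diffQuot e (s k)).apply i) _ h2 hk)
        ((hHL.apply i) _ h2 h3)
        (tendsto_of_tendsto_of_tendsto_of_le_of_le tendsto_const_nhds
          (tendsto_eLpNorm_restrict_compact hHlim h2 h3) (fun _ => zero_le) fun k =>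
          eLpNorm_mono fun x => PiLp.norm_apply_le (diffQuot e (s k) G x - H x) i)
      have heq := tendsto_nhds_unique (hL.congr' (by
        filter_upwards [hsub] with k hk
        have := (hu.isSolution_diffQuot hΩ hA he1 (s k)).weakGrad i φ h1 h2 hk
        calc _ = ∫ X, diffQuot e (s k) u X * fderiv ℝ φ X (dir i) := by congr 1; ext X; ring
          _ = _ := this
          _ = -∫ X, φ X * diffQuot e (s k) G X i := by congr 2; ext X; ring)) hR.neg
      calc _ = ∫ X, fderiv ℝ φ X (dir i) * g X := by congr 1; ext X; ring
        _ = _ := heq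
        _ = _ := by congr 2; ext X; ring
    · have hsub := eventually_subset_translate hΩ h2 h3 e hs
      have hR : ∀ j, Tendsto (fun k => ∫ X, energyCoef A Φ j X * diffQuot e (s k) G X j) atTop
          (𝓝 (∫ X, energyCoef A Φ j X * H X j)) := fun j =>
        tendsto_integral_mul_of_compact (hA.memLp_energyCoef h1 h2 j 2)
          (K := tsupport Φ) (fun x hx => energyCoef_eq_zero hx)
          (by filter_upwards [hsub] with k hk using
                ((hu.gradLocL2.locL2_diffQuot e (s k)).apply j) _ h2 hk)
          ((hHL.apply j) _ h2 h3)
          (tendsto_of_tendsto_of_tendsto_of_le_of_le tendsto_const_nhds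
            (tendsto_eLpNorm_restrict_compact hHlim h2 h3) (fun _ => zero_le) fun k =>
            eLpNorm_mono fun x => PiLp.norm_apply_le (diffQuot e (s k) G x - H x) j)
      have hsum := tendsto_finsetSum Finset.univ fun j _ => hR j
      rw [integral_energy hA h1 h2 (hHL _ h2 h3)]
      refine tendsto_nhds_unique hsum (tendsto_const_nhds.congr' ?_)
      filter_upwards [hsub] with k hk
      have := (hu.isSolution_diffQuot hΩ hA he1 (s k)).eqn Φ h1 h2 hk
      rw [integral_energy hA h1 h2 (hu.gradLocL2.locL2_diffQuot e (s k) _ h2 hk)] at this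
      exact this.symm
  obtain ⟨w, hw, hwg⟩ := hD.exists_continuousOn hα hΩ hsolg
  have hwg' : ∀ᵐ X, X ∈ Ω → w X = g X := (ae_restrict_iff' hΩ.measurableSet).1 hwg
  refine ⟨w, H, hsolg.congr (by filter_upwards [hwg'] with X hX h using (hX h).symm), hw,
    hwg', fun X hX => ?_⟩
  have hd := (hgw.congr (.of_forall fun _ _ => rfl)
    (by filter_upwards [hwg'] with X hX h using (hX h).symm : ∀ᵐ X, X ∈ Ω → g X = w X)).hasDerivAt
    hΩ hcont hw hX
  have h2 := HasDerivAt.comp_sub_const (x := X.2) (a := X.2) (f := fun s : ℝ => u (X + s • e))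
    (f' := w X) (by rwa [sub_self])
  refine h2.congr_of_eventuallyEq (.of_forall fun r => ?_)
  have : X + (r - X.2) • e = (X.1, r) := by
    rw [he']
    ext <;> simp
  simp only [this]

end

/-! ### Averages over horizontal slabs -/

section

variable {V : Type*} [NormedAddCommGroup V] [NormedSpace ℂ V]

lemma isOpen_halfSpace (n : ℕ) (σ : ℝ) : IsOpen (halfSpace n σ) :=
  isOpen_lt continuous_const (by fun_prop)

/-- A bounded weight in the height variable, supported in a compact set of heights. -/
structure IsKernel (σ : ℝ) (k : ℝ → ℂ) : Prop where
  meas : Measurable k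
  bdd : ∃ C : ℝ, ∀ s, ‖k s‖ ≤ C
  supp : ∃ J : Set ℝ, IsCompact J ∧ (∀ s ∈ J, 0 < σ * s) ∧ ∀ s, s ∉ J → k s = 0

/-- The weighted vertical integral. -/
def slab (k : ℝ → ℂ) (F : Rn1 n → V) (x : Rn n) : V := ∫ s, k s • F (x, s)

lemma restrict_prod_univ (B : Set (Rn n)) :
    (volume : Measure (Rn1 n)).restrict (B ×ˢ univ) = (volOn B).prod volume := by
  rw [Measure.volume_eq_prod, ← Measure.prod_restrict, Measure.restrict_univ]

lemma IsKernel.integrableOn {k : ℝ → ℂ} (hk : IsKernel σ k) {F : Rn1 n → V}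
    (hF : LocL2 (halfSpace n σ) F) {B : Set (Rn n)} (hB : IsCompact B) :
    IntegrableOn (fun X : Rn1 n => k X.2 • F X) (B ×ˢ univ) := by
  obtain ⟨C, hC⟩ := hk.bdd
  obtain ⟨J, hJ, hJσ, hkJ⟩ := hk.supp
  have hK : IsCompact (B ×ˢ J) := hB.prod hJ
  have hfin : IsFiniteMeasure ((volume : Measure (Rn1 n)).restrict (B ×ˢ J)) :=
    ⟨by simpa using hK.measure_lt_top⟩
  have h1 : IntegrableOn F (B ×ˢ J) := (hF _ hK fun X hX => hJσ _ hX.2).integrable one_le_two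
  have h2 : IntegrableOn (fun X : Rn1 n => k X.2 • F X) (B ×ˢ J) := by
    refine Integrable.bdd_smul h1 C (hk.meas.comp measurable_snd).aestronglyMeasurable
      (.of_forall fun X => hC _)
  refine h2.of_forall_sdiff_eq_zero (hB.measurableSet.prod MeasurableSet.univ) fun X hX => ?_
  have : X.2 ∉ J := fun h => hX.2 ⟨hX.1.1, h⟩
  rw [hkJ _ this, zero_smul]

lemma IsKernel.integrable_prod {k : ℝ → ℂ} (hk : IsKernel σ k) {F : Rn1 n → V}
    (hF : LocL2 (halfSpace n σ) F) {B : Set (Rn n)} (hB : IsCompact B) :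
    Integrable (fun X : Rn n × ℝ => k X.2 • F X) ((volOn B).prod volume) := by
  have := hk.integrableOn hF hB
  rwa [IntegrableOn, restrict_prod_univ] at this

lemma IsKernel.locallyIntegrable [CompleteSpace V] {k : ℝ → ℂ} (hk : IsKernel σ k) {F : Rn1 n → V}
    (hF : LocL2 (halfSpace n σ) F) : LocallyIntegrable (slab k F) := by
  rw [locallyIntegrable_iff]
  exact fun B hB => (hk.integrable_prod hF hB).integral_prod_left

lemma IsKernel.ae_integrable {k : ℝ → ℂ} (hk : IsKernel σ k) {F : Rn1 n → V}
    (hF : LocL2 (halfSpace n σ) F) : ∀ᵐ x : Rn n, Integrable (fun s => k s • F (x, s)) := by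
  have h : ∀ j : ℕ, ∀ᵐ x : Rn n, x ∈ cB (0 : Rn n) j →
      Integrable (fun s => k s • F (x, s)) := fun j =>
    (ae_restrict_iff' measurableSet_closedBall).1
      (hk.integrable_prod hF (isCompact_closedBall (0 : Rn n) j)).prod_right_ae
  filter_upwards [ae_all_iff.2 h] with x hx
  obtain ⟨j, hj⟩ := exists_nat_ge (dist x 0)
  exact hx j hj

/-- The product test function `φ(x) k(s)`. -/
lemma fderiv_mul_prod {φ : Rn n → ℂ} {k : ℝ → ℂ} (hφ : ContDiff ℝ ∞ φ) (hk : ContDiff ℝ ∞ k)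
    (X : Rn1 n) (i : Fin n) :
    fderiv ℝ (fun X : Rn1 n => φ X.1 * k X.2) X (dir i.castSucc)
      = fderiv ℝ φ X.1 (dirX i) * k X.2 := by
  have h1 : HasFDerivAt (fun X : Rn1 n => φ X.1)
      ((fderiv ℝ φ X.1).comp (ContinuousLinearMap.fst ℝ (Rn n) ℝ)) X :=
    ((hφ.differentiable (by simp)) X.1).hasFDerivAt.comp X hasFDerivAt_fst
  have h2 : HasFDerivAt (fun X : Rn1 n => k X.2)
      ((fderiv ℝ k X.2).comp (ContinuousLinearMap.snd ℝ (Rn n) ℝ)) X :=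
    ((hk.differentiable (by simp)) X.2).hasFDerivAt.comp X hasFDerivAt_snd
  change fderiv ℝ ((fun X : Rn1 n => φ X.1) * fun X => k X.2) X _ = _
  rw [(h1.mul h2).fderiv]
  simp [dir, mul_comm]

lemma tsupport_mul_prod_subset (φ : Rn n → ℂ) (k : ℝ → ℂ) :
    tsupport (fun X : Rn1 n => φ X.1 * k X.2) ⊆ tsupport φ ×ˢ tsupport k := by
  refine closure_minimal (fun X hX => ?_) ((isClosed_tsupport φ).prod (isClosed_tsupport k))
  exact ⟨subset_tsupport _ fun h => hX (by simp [h]), subset_tsupport _ fun h => hX (by simp [h])⟩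

lemma HasWeakDeriv.slab {u g : Rn1 n → ℂ} {i : Fin n} (hu : LocL2 (halfSpace n σ) u)
    (hg : LocL2 (halfSpace n σ) g) (h : HasWeakDeriv (halfSpace n σ) (dir i.castSucc) u g)
    {k : ℝ → ℂ} (hk : IsKernel σ k) :
    HasWeakDeriv univ (dirX i) (slab k u) (slab k g) := by
  intro φ hφ hc _
  set B := tsupport φ with hB
  have hBc : IsCompact B := hc
  set D : Rn n → ℂ := fun x => fderiv ℝ φ x (dirX i)
  have hD : Continuous D := cont_fderiv hφ _
  have hDB : ∀ x, x ∉ B → D x = 0 := fun x hx => by simp [D, fderiv_of_notMem_tsupport ℝ hx]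
  have hφB : ∀ x, x ∉ B → φ x = 0 := fun x hx => image_eq_zero_of_notMem_tsupport hx
  set T : Rn1 n → ℂ := fun X => u X * D X.1 + g X * φ X.1
  have hTL : LocL2 (halfSpace n σ) T := by
    intro K hK hs
    have hm : ∀ (f : Rn1 n → ℂ) (ψ : Rn n → ℂ), LocL2 (halfSpace n σ) f → Continuous ψ →
        MemLp (fun X => f X * ψ X.1) 2 (volOn K) := by
      intro f ψ hf hψ
      obtain ⟨C, hC⟩ := hK.exists_bound_of_continuousOn (f := fun X : Rn1 n => ψ X.1) (by fun_prop)
      refine (hf K hK hs).of_le_mul (c := C) ((hf K hK hs).1.mul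
        (by fun_prop : Continuous fun X : Rn1 n => ψ X.1).aestronglyMeasurable) ?_
      refine (ae_restrict_iff' hK.measurableSet).2 (.of_forall fun X hX => ?_)
      rw [norm_mul, mul_comm]
      gcongr
      exact hC X hX
    exact (hm u D hu hD).add (hm g φ hg hφ.continuous)
  have hTB : ∀ X : Rn1 n, X.1 ∉ B → T X = 0 := fun X hX => by simp [T, hDB _ hX, hφB _ hX]
  have hfub : ∀ κ : ℝ → ℂ, IsKernel σ κ → ∫ X : Rn1 n, κ X.2 * T X = ∫ s, κ s * ∫ x, T (x, s) ∧
      ∫ X : Rn1 n, κ X.2 * T X = (∫ x, LayerPot.slab κ u x * D x) + ∫ x, LayerPot.slab κ g x * φ x := by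
    intro κ hκ
    have hI := hκ.integrable_prod hTL hBc
    have e0 : ∫ X : Rn1 n, κ X.2 * T X
        = ∫ X : Rn n × ℝ, κ X.2 • T X ∂((volOn B).prod volume) := by
      rw [← restrict_prod_univ, setIntegral_eq_integral_of_forall_compl_eq_zero]
      · rfl
      · intro X hX
        rw [hTB X fun h => hX ⟨h, mem_univ _⟩, smul_zero]
    have e1 : ∀ s, ∫ x in B, T (x, s) = ∫ x, T (x, s) := fun s =>
      setIntegral_eq_integral_of_forall_compl_eq_zero fun x hx => hTB (x, s) hx
    refine ⟨?_, ?_⟩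
    · rw [e0, integral_prod_symm _ hI]
      congr 1; ext s
      rw [← e1 s, ← integral_const_mul]
      rfl
    · rw [e0, integral_prod _ hI]
      have e2 : ∀ᵐ x ∂(volOn B), ∫ s, κ s • T (x, s)
          = LayerPot.slab κ u x * D x + LayerPot.slab κ g x * φ x := by
        filter_upwards [ae_restrict_of_ae (hκ.ae_integrable hu),
          ae_restrict_of_ae (hκ.ae_integrable hg)] with x hx1 hx2
        have e3 : ∀ s, κ s • T (x, s) = (κ s • u (x, s)) * D x + (κ s • g (x, s)) * φ x := by
          intro s; simp only [T, smul_eq_mul]; ring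
        simp only [e3]
        rw [integral_add (hx1.mul_const _) (hx2.mul_const _), integral_mul_const,
          integral_mul_const]
        rfl
      rw [integral_congr_ae e2]
      have hint : ∀ (f : Rn1 n → ℂ) (ψ : Rn n → ℂ), LocL2 (halfSpace n σ) f → Continuous ψ →
          IntegrableOn (fun x => LayerPot.slab κ f x * ψ x) B := fun f ψ hf hψ =>
        IntegrableOn.mul_continuousOn ((hκ.locallyIntegrable hf).integrableOn_isCompact hBc)
          hψ.continuousOn hBc
      rw [integral_add (hint u D hu hD) (hint g φ hg hφ.continuous),
        setIntegral_eq_integral_of_forall_compl_eq_zero (fun x hx => by rw [hDB x hx, mul_zero]),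
        setIntegral_eq_integral_of_forall_compl_eq_zero (fun x hx => by rw [hφB x hx, mul_zero])]
  set f : ℝ → ℂ := fun s => ∫ x, T (x, s)
  have hIo : IsOpen {s : ℝ | 0 < σ * s} := isOpen_lt continuous_const (by fun_prop)
  have hfl : LocallyIntegrableOn f {s : ℝ | 0 < σ * s} := by
    rw [locallyIntegrableOn_iff hIo.isLocallyClosed]
    intro J hJσ hJ
    have hκ : IsKernel σ (J.indicator fun _ => 1) :=
      ⟨measurable_const.indicator hJ.measurableSet, ⟨1, fun s => by
        by_cases hs : s ∈ J <;> simp [hs]⟩, J, hJ, hJσ, fun s hs => by simp [hs]⟩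
    have := (hκ.integrable_prod hTL hBc).integral_prod_right
    have h2 : (fun s => ∫ x in B, (J.indicator (fun _ => (1 : ℂ)) s) • T (x, s))
        = J.indicator f := by
      ext s
      by_cases hs : s ∈ J
      · simp only [indicator_of_mem hs, one_smul, f]
        exact setIntegral_eq_integral_of_forall_compl_eq_zero fun x hx => hTB (x, s) hx
      · simp [hs]
    have h3 : Integrable (J.indicator f) := by rw [← h2]; exact this
    rwa [integrable_indicator_iff hJ.measurableSet] at h3
  have hf0 : ∀ᵐ s, s ∈ {s : ℝ | 0 < σ * s} → f s = 0 := by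
    refine hIo.ae_eq_zero_of_integral_contDiff_smul_eq_zero hfl fun κ h1 h2 h3 => ?_
    set κ' : ℝ → ℂ := fun s => (κ s : ℂ)
    have hκd : ContDiff ℝ ∞ κ' := Complex.ofRealCLM.contDiff.comp h1
    have hκs : tsupport κ' ⊆ tsupport κ := closure_mono fun s hs h0 => hs (by simp [κ', h0])
    have hκc : HasCompactSupport κ' := IsCompact.of_isClosed_subset h2 (isClosed_tsupport _) hκs
    obtain ⟨C, hC⟩ := hκc.exists_bound_of_continuous hκd.continuous
    have hκ : IsKernel σ κ' := ⟨hκd.continuous.measurable, ⟨C, hC⟩, tsupport κ', hκc,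
      fun s hs => h3 (hκs hs), fun s hs => image_eq_zero_of_notMem_tsupport hs⟩
    have h4 := h (fun X => φ X.1 * κ' X.2) ((hφ.comp contDiff_fst).mul (hκd.comp contDiff_snd))
      (IsCompact.of_isClosed_subset (hBc.prod hκc) (isClosed_tsupport _)
        (tsupport_mul_prod_subset φ κ'))
      ((tsupport_mul_prod_subset φ κ').trans fun X hX => h3 (hκs hX.2))
    have e1 := (hfub κ' hκ).1
    have e2 : ∫ s, κ s • f s = ∫ s, κ' s * f s := by congr 1
    rw [e2, ← e1]
    simp only [fderiv_mul_prod hφ hκd] at h4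
    have hint : ∀ (w : Rn1 n → ℂ) (ψ : Rn n → ℂ), LocL2 (halfSpace n σ) w → Continuous ψ →
        (∀ x, x ∉ B → ψ x = 0) → Integrable (fun X : Rn1 n => w X * (ψ X.1 * κ' X.2)) := by
      intro w ψ hw hψ hψB
      obtain ⟨C', hC'⟩ := (HasCompactSupport.intro hBc hψB).exists_bound_of_continuous hψ
      have h5 := hκ.integrableOn hw hBc
      have h6 : IntegrableOn (fun X : Rn1 n => ψ X.1 * (κ' X.2 • w X)) (B ×ˢ univ) :=
        Integrable.bdd_mul h5 (by fun_prop : Continuous fun X : Rn1 n => ψ X.1).aestronglyMeasurable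
          (.of_forall fun X => hC' _)
      have h7 := (integrableOn_iff_integrable_of_support_subset fun X hX => ?_).1 h6
      · refine h7.congr (.of_forall fun X => ?_)
        simp only [smul_eq_mul]; ring
      · refine ⟨?_, mem_univ _⟩
        by_contra hn
        exact hX (by simp [hψB _ hn])
    have hsum : ∫ X : Rn1 n, κ' X.2 * T X
        = (∫ X : Rn1 n, u X * (D X.1 * κ' X.2)) + ∫ X : Rn1 n, g X * (φ X.1 * κ' X.2) := by
      rw [← integral_add (hint u D hu hD hDB) (hint g φ hg hφ.continuous hφB)]
      congr 1; ext X; simp only [T]; ring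
    rw [hsum, h4, neg_add_cancel]
  have hz : ∫ s, k s * f s = 0 := by
    obtain ⟨J, hJ, hJσ, hkJ⟩ := hk.supp
    refine integral_eq_zero_of_ae ?_
    filter_upwards [hf0] with s hs
    by_cases hsJ : s ∈ J
    · simp [hs (hJσ s hsJ)]
    · simp [hkJ s hsJ]
  have h1 := (hfub k hk).1
  have h2 := (hfub k hk).2
  rw [h1, hz] at h2
  exact eq_neg_of_add_eq_zero_left h2.symm

lemma IsKernel.slab_apply {m : ℕ} {k : ℝ → ℂ} (hk : IsKernel σ k) {F : Rn1 n → Cv m}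
    (hF : LocL2 (halfSpace n σ) F) (j : Fin m) :
    ∀ᵐ x : Rn n, slab k F x j = slab k (fun X => F X j) x := by
  filter_upwards [hk.ae_integrable hF] with x hx
  exact ((EuclideanSpace.proj (𝕜 := ℂ) j).integral_comp_comm hx).symm

lemma slab_congr_ae {k : ℝ → ℂ} (hk : IsKernel σ k) {F F' : Rn1 n → V}
    (h : ∀ᵐ X, X ∈ halfSpace n σ → F X = F' X) : ∀ᵐ x : Rn n, slab k F x = slab k F' x := by
  obtain ⟨J, -, hJσ, hkJ⟩ := hk.supp
  rw [Measure.volume_eq_prod] at h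
  filter_upwards [Measure.ae_ae_of_ae_prod h] with x hx
  refine integral_congr_ae ?_
  filter_upwards [hx] with s hs
  by_cases hsJ : s ∈ J
  · rw [hs (hJσ s hsJ)]
  · rw [hkJ s hsJ, zero_smul, zero_smul]

end

/-! ### Gradients on slices -/

/-- Averaging weight on the heights between `t` and `t + σδ`. -/
def avgKernel (σ t δ : ℝ) (s : ℝ) : ℂ := (uIoc t (t + σ * δ)).indicator (fun _ => ((1 / δ : ℝ) : ℂ)) s

/-- The weight that corrects the average to the value at height `t`. -/
def corKernel (σ t δ : ℝ) (s : ℝ) : ℂ :=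
  (uIoc t (t + σ * δ)).indicator (fun s => ((-σ * (1 - σ * (s - t) / δ) : ℝ) : ℂ)) s

lemma sign_mul_self (hσ : σ = 1 ∨ σ = -1) : σ * σ = 1 := by rcases hσ with rfl | rfl <;> norm_num

lemma mem_slabHeights (hσ : σ = 1 ∨ σ = -1) {t δ s : ℝ} (hs : s ∈ uIcc t (t + σ * δ))
    (hδ : 0 < δ) : 0 ≤ σ * (s - t) ∧ σ * (s - t) ≤ δ := by
  rcases hσ with rfl | rfl
  · rw [uIcc_of_le (by linarith)] at hs
    constructor <;> linarith [hs.1, hs.2]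
  · rw [uIcc_of_ge (by linarith)] at hs
    constructor <;> linarith [hs.1, hs.2]

lemma norm_avgKernel_le (t : ℝ) {δ : ℝ} (hδ : 0 < δ) (s : ℝ) : ‖avgKernel σ t δ s‖ ≤ 1 / δ := by
  unfold avgKernel
  by_cases hs : s ∈ uIoc t (t + σ * δ)
  · rw [indicator_of_mem hs, Complex.norm_real, Real.norm_of_nonneg (by positivity)]
  · rw [indicator_of_notMem hs, norm_zero]; positivity

lemma norm_corKernel_le (hσ : σ = 1 ∨ σ = -1) (t : ℝ) {δ : ℝ} (hδ : 0 < δ) (s : ℝ) :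
    ‖corKernel σ t δ s‖ ≤ 1 := by
  unfold corKernel
  by_cases hs : s ∈ uIoc t (t + σ * δ)
  · have h := mem_slabHeights hσ (uIoc_subset_uIcc hs) hδ
    have h1 : σ * (s - t) / δ ≤ 1 := (div_le_one hδ).2 h.2
    have h2 : 0 ≤ σ * (s - t) / δ := div_nonneg h.1 hδ.le
    rw [indicator_of_mem hs, Complex.norm_real, norm_mul]
    have h3 : ‖(-σ : ℝ)‖ = 1 := by rcases hσ with rfl | rfl <;> norm_num
    rw [h3, one_mul, Real.norm_of_nonneg (by linarith)]
    linarith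
  · rw [indicator_of_notMem hs, norm_zero]; exact zero_le_one

lemma slabHeights_pos (hσ : σ = 1 ∨ σ = -1) {t δ : ℝ} (ht : 0 < σ * t) (hδ : 0 < δ) {s : ℝ}
    (hs : s ∈ uIcc t (t + σ * δ)) : 0 < σ * s := by
  have := (mem_slabHeights hσ hs hδ).1
  linarith [mul_sub σ s t]

lemma isKernel_avgKernel (hσ : σ = 1 ∨ σ = -1) {t δ : ℝ} (ht : 0 < σ * t) (hδ : 0 < δ) :
    IsKernel σ (avgKernel σ t δ) :=
  ⟨measurable_const.indicator measurableSet_uIoc, ⟨_, norm_avgKernel_le t hδ⟩,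
    uIcc t (t + σ * δ), isCompact_uIcc, fun _ hs => slabHeights_pos hσ ht hδ hs,
    fun _ hs => indicator_of_notMem (fun h => hs (uIoc_subset_uIcc h)) _⟩

lemma isKernel_corKernel (hσ : σ = 1 ∨ σ = -1) {t δ : ℝ} (ht : 0 < σ * t) (hδ : 0 < δ) :
    IsKernel σ (corKernel σ t δ) :=
  ⟨(by fun_prop : Measurable fun s : ℝ => ((-σ * (1 - σ * (s - t) / δ) : ℝ) : ℂ)).indicator
    measurableSet_uIoc, ⟨_, norm_corKernel_le hσ t hδ⟩,
    uIcc t (t + σ * δ), isCompact_uIcc, fun _ hs => slabHeights_pos hσ ht hδ hs,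
    fun _ hs => indicator_of_notMem (fun h => hs (uIoc_subset_uIcc h)) _⟩

lemma eq_avg_add_cor (hσ : σ = 1 ∨ σ = -1) {t δ : ℝ} (hδ : 0 < δ) {f f' : ℝ → ℂ}
    (hf : ∀ s ∈ uIcc t (t + σ * δ), HasDerivAt f (f' s) s)
    (hf' : ContinuousOn f' (uIcc t (t + σ * δ))) :
    f t = (∫ s, avgKernel σ t δ s * f s) + ∫ s, corKernel σ t δ s * f' s := by
  have hδ' : (δ : ℂ) ≠ 0 := by exact_mod_cast hδ.ne'
  set ψ : ℝ → ℂ := fun s => 1 - σ * (s - t) / δ with hψ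
  have hψd : ∀ s : ℝ, HasDerivAt ψ (-(σ / δ : ℂ)) s := by
    intro s
    have h0 : HasDerivAt (fun s : ℝ => (s : ℂ)) 1 s := Complex.ofRealCLM.hasDerivAt
    have := ((((h0.sub_const (t : ℂ)).const_mul (σ : ℂ)).div_const (δ : ℂ)).const_sub 1)
    simpa [hψ] using this
  have hψc : Continuous ψ := by fun_prop
  have hfc : ContinuousOn f (uIcc t (t + σ * δ)) := fun s hs => (hf s hs).continuousAt.continuousWithinAt
  have hi1 : IntervalIntegrable (fun s => -(σ / δ : ℂ) * f s) volume t (t + σ * δ) :=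
    (continuousOn_const.mul hfc).intervalIntegrable
  have hi2 : IntervalIntegrable (fun s => ψ s * f' s) volume t (t + σ * δ) :=
    (hψc.continuousOn.mul hf').intervalIntegrable
  have hftc := intervalIntegral.integral_eq_sub_of_hasDerivAt
    (fun s hs => (hψd s).mul (hf s hs)) (hi1.add hi2)
  have hend : ψ (t + σ * δ) = 0 := by
    have : (σ : ℂ) * σ = 1 := by exact_mod_cast sign_mul_self hσ
    simp only [hψ]
    push_cast
    rw [add_sub_cancel_left, ← mul_assoc, this, one_mul, div_self hδ', sub_self]
  have hst : ψ t = 1 := by simp [hψ]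
  rw [Pi.mul_apply, Pi.mul_apply, hend, hst, zero_mul, one_mul, zero_sub,
    intervalIntegral.integral_add hi1 hi2, intervalIntegral.intervalIntegral_eq_integral_uIoc,
    intervalIntegral.intervalIntegral_eq_integral_uIoc] at hftc
  have hs : (if t ≤ t + σ * δ then (1 : ℝ) else -1) = σ := by
    rcases hσ with rfl | rfl
    · rw [if_pos (by linarith)]
    · rw [if_neg (by linarith)]
  rw [hs] at hftc
  have e1 : ∫ s, avgKernel σ t δ s * f s
      = -(σ • ∫ s in uIoc t (t + σ * δ), -(σ / δ : ℂ) * f s) := by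
    rw [← integral_smul, ← integral_neg, ← integral_indicator measurableSet_uIoc]
    congr 1; ext s
    by_cases h : s ∈ uIoc t (t + σ * δ)
    · have h2 : (σ : ℂ) * σ = 1 := by exact_mod_cast sign_mul_self hσ
      simp only [avgKernel, indicator_of_mem h, Complex.real_smul]
      push_cast
      calc _ = (1 : ℂ) / δ * f s := by ring
        _ = ((σ : ℂ) * σ) / δ * f s := by rw [h2]
        _ = _ := by ring
    · simp [avgKernel, indicator_of_notMem h]
  have e2 : ∫ s, corKernel σ t δ s * f' s = -(σ • ∫ s in uIoc t (t + σ * δ), ψ s * f' s) := by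
    rw [← integral_smul, ← integral_neg, ← integral_indicator measurableSet_uIoc]
    congr 1; ext s
    by_cases h : s ∈ uIoc t (t + σ * δ)
    · simp only [corKernel, indicator_of_mem h, Complex.real_smul, hψ]
      push_cast
      ring
    · simp [corKernel, indicator_of_notMem h]
  rw [e1, e2, ← neg_add, hftc, neg_neg]

/-- The gradient on the slice at height `t`, expressed through averages over the heights between
`t` and `t + σδ` of the gradient `G` and the gradient `H` of the `t`-derivative. -/
def sliceGrad (σ t δ : ℝ) (G H : VF n) (x : Rn n) : Cv (n + 1) :=
  slab (avgKernel σ t δ) G x + slab (corKernel σ t δ) H x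

lemma continuousOn_slice {u : Rn1 n → ℂ} (hu : ContinuousOn u (halfSpace n σ)) (x : Rn n)
    {J : Set ℝ} (hJ : ∀ s ∈ J, 0 < σ * s) : ContinuousOn (fun s => u (x, s)) J :=
  hu.comp (by fun_prop) fun s hs => hJ s hs

lemma slice_eq (hσ : σ = 1 ∨ σ = -1) {t δ : ℝ} (ht : 0 < σ * t) (hδ : 0 < δ)
    {u w : Rn1 n → ℂ} (hw : ContinuousOn w (halfSpace n σ))
    (hd : ∀ X ∈ halfSpace n σ, HasDerivAt (fun s : ℝ => u (X.1, s)) (w X) X.2) (x : Rn n) :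
    u (x, t) = slab (avgKernel σ t δ) u x + slab (corKernel σ t δ) w x :=
  eq_avg_add_cor hσ hδ (f := fun s => u (x, s)) (f' := fun s => w (x, s))
    (fun s hs => hd (x, s) (slabHeights_pos hσ ht hδ hs))
    (continuousOn_slice hw x fun _ hs => slabHeights_pos hσ ht hδ hs)

lemma isSliceGrad_sliceGrad (hσ : σ = 1 ∨ σ = -1) {A : Coeff n} {u w w₂ : Rn1 n → ℂ}
    {G H : VF n} (hu : IsSolution A (halfSpace n σ) u G)
    (hw : IsSolution A (halfSpace n σ) w H) (hwc : ContinuousOn w (halfSpace n σ))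
    (hwG : ∀ᵐ X, X ∈ halfSpace n σ → w X = G X (Fin.last n))
    (hd : ∀ X ∈ halfSpace n σ, HasDerivAt (fun s : ℝ => u (X.1, s)) (w X) X.2)
    (hwc₂ : ContinuousOn w₂ (halfSpace n σ))
    (hwG₂ : ∀ᵐ X, X ∈ halfSpace n σ → w₂ X = H X (Fin.last n))
    (hd₂ : ∀ X ∈ halfSpace n σ, HasDerivAt (fun s : ℝ => w (X.1, s)) (w₂ X) X.2)
    {t δ : ℝ} (ht : 0 < σ * t) (hδ : 0 < δ) : IsSliceGrad u t (sliceGrad σ t δ G H) := by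
  have hk := isKernel_avgKernel hσ ht hδ
  have hk' := isKernel_corKernel hσ ht hδ
  refine ⟨(hk.locallyIntegrable hu.gradLocL2).add (hk'.locallyIntegrable hw.gradLocL2),
    fun i => ?_, ?_⟩
  · have h1 := HasWeakDeriv.slab hu.locL2 (hu.gradLocL2.apply _) (hu.weakGrad i.castSucc) hk
    have h2 := HasWeakDeriv.slab hw.locL2 (hw.gradLocL2.apply _) (hw.weakGrad i.castSucc) hk'
    have h3 := HasWeakDeriv.add ((hk.locallyIntegrable hu.locL2).locallyIntegrableOn _)
      ((hk'.locallyIntegrable hw.locL2).locallyIntegrableOn _)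
      ((hk.locallyIntegrable (hu.gradLocL2.apply i.castSucc)).locallyIntegrableOn _)
      ((hk'.locallyIntegrable (hw.gradLocL2.apply i.castSucc)).locallyIntegrableOn _) h1 h2
    refine h3.congr (.of_forall fun x _ => (slice_eq hσ ht hδ hwc hd x).symm) ?_
    filter_upwards [hk.slab_apply hu.gradLocL2 i.castSucc,
      hk'.slab_apply hw.gradLocL2 i.castSucc] with x h4 h5 _
    rw [sliceGrad, PiLp.add_apply, h4, h5]
  · filter_upwards [hk.slab_apply hu.gradLocL2 (Fin.last n),
      hk'.slab_apply hw.gradLocL2 (Fin.last n), slab_congr_ae hk hwG, slab_congr_ae hk' hwG₂]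
      with x h4 h5 h6 h7
    rw [sliceGrad, PiLp.add_apply, h4, h5, ← h6, ← h7, ← slice_eq hσ ht hδ hwc₂ hd₂ x]
    exact hd (x, t) ht

lemma IsSliceGrad.ae_eq {u : Rn1 n → ℂ} {t : ℝ} {v v' : Rn n → Cv (n + 1)}
    (h : IsSliceGrad u t v) (h' : IsSliceGrad u t v') : v =ᵐ[volume] v' := by
  have hl : ∀ (v : Rn n → Cv (n + 1)), LocallyIntegrable v → ∀ j,
      LocallyIntegrableOn (fun x => v x j) univ := by
    intro v hv j
    rw [locallyIntegrableOn_univ, locallyIntegrable_iff]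
    intro K hK
    exact (EuclideanSpace.proj (𝕜 := ℂ) j).integrable_comp (hv.integrableOn_isCompact hK)
  have ht : ∀ i : Fin n, ∀ᵐ x, v x i.castSucc = v' x i.castSucc := fun i => by
    filter_upwards [HasWeakDeriv.ae_eq isOpen_univ (hl v h.locInt _) (hl v' h'.locInt _)
      (h.tangential i) (h'.tangential i)] with x hx using hx (mem_univ _)
  filter_upwards [ae_all_iff.2 ht, h.vertical, h'.vertical] with x h1 h2 h3
  ext j
  refine Fin.lastCases ?_ (fun i => h1 i) j
  exact h2.unique h3

/-! ### Higher integrability of gradients, and bounds on slices -/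

lemma lintegral_rpow_le_measure_mul {α : Type*} [MeasurableSpace α] {μ : Measure α} {f : α → ℝ≥0∞}
    (hf : AEMeasurable f μ) {q : ℝ} (hq : 1 < q) :
    (∫⁻ x, f x ∂μ) ^ q ≤ μ univ ^ (q - 1) * ∫⁻ x, f x ^ q ∂μ := by
  have hpq := Real.HolderConjugate.conjExponent hq
  have hq0 : 0 < q := by linarith
  have h := ENNReal.lintegral_mul_le_Lp_mul_Lq μ hpq hf (aemeasurable_const (b := (1 : ℝ≥0∞)))
  simp only [Pi.mul_apply, mul_one, ENNReal.one_rpow, lintegral_const, one_mul] at h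
  calc _ ≤ ((∫⁻ x, f x ^ q ∂μ) ^ (1 / q) * μ univ ^ (1 / q.conjExponent)) ^ q := by gcongr
    _ = _ := by
      rw [mul_rpow_of_nonneg _ _ hq0.le, ← rpow_mul, ← rpow_mul,
        one_div_mul_cancel hq0.ne', rpow_one, mul_comm]
      congr 2
      rw [Real.conjExponent]
      have : q - 1 ≠ 0 := by linarith
      field_simp

lemma lintegral_slab_rpow_le {V : Type*} [NormedAddCommGroup V] [NormedSpace ℂ V] {k : ℝ → ℂ}
    {κ : ℝ} {J : Set ℝ} (hJ : MeasurableSet J) (hk : ∀ s, ‖k s‖ ≤ κ) (hkJ : ∀ s, s ∉ J → k s = 0)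
    {B : Set (Rn n)} {F : Rn1 n → V} (hF : AEStronglyMeasurable F (volOn (B ×ˢ J)))
    {q : ℝ} (hq : 1 < q) :
    ∫⁻ x in B, ‖slab k F x‖ₑ ^ q
      ≤ ofReal κ ^ q * volume J ^ (q - 1) * ∫⁻ X in B ×ˢ J, ‖F X‖ₑ ^ q := by
  have hq0 : 0 < q := by linarith
  rw [Measure.volume_eq_prod, ← Measure.prod_restrict] at hF
  have hm : AEMeasurable (fun X : Rn n × ℝ => ‖F X‖ₑ ^ q)
      ((volOn B).prod (volOn J)) := hF.enorm.pow_const q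
  have e : ∫⁻ X in B ×ˢ J, ‖F X‖ₑ ^ q = ∫⁻ x in B, ∫⁻ s in J, ‖F (x, s)‖ₑ ^ q := by
    rw [Measure.volume_eq_prod, ← Measure.prod_restrict, lintegral_prod _ hm]
  rw [e, ← lintegral_const_mul'' _ hm.lintegral_prod_right']
  refine lintegral_mono_ae ?_
  filter_upwards [hF.prodMk_left] with x hx
  have h1 : ‖slab k F x‖ₑ ≤ ofReal κ * ∫⁻ s in J, ‖F (x, s)‖ₑ := by
    refine (enorm_integral_le_lintegral_enorm _).trans ?_
    rw [← lintegral_const_mul' _ _ ofReal_ne_top, ← lintegral_indicator hJ]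
    refine lintegral_mono fun s => ?_
    by_cases hs : s ∈ J
    · rw [indicator_of_mem hs, enorm_smul]
      gcongr
      rw [← ofReal_norm]
      exact ofReal_le_ofReal (hk s)
    · simp [hkJ s hs, hs]
  calc ‖slab k F x‖ₑ ^ q ≤ (ofReal κ * ∫⁻ s in J, ‖F (x, s)‖ₑ) ^ q := by gcongr
    _ = ofReal κ ^ q * (∫⁻ s in J, ‖F (x, s)‖ₑ) ^ q := mul_rpow_of_nonneg _ _ hq0.le
    _ ≤ ofReal κ ^ q * (volume J ^ (q - 1) * ∫⁻ s in J, ‖F (x, s)‖ₑ ^ q) := by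
        gcongr
        simpa using lintegral_rpow_le_measure_mul (μ := volOn J) hx.enorm hq
    _ = _ := by ring

lemma exists_higher_integrability (n : ℕ) {C₀ Λ : ℝ} (hC₀ : 0 < C₀) (hΛ : 0 < Λ) :
    ∃ ε : ℝ, 0 < ε ∧ ε ≤ 1 ∧ ∃ C : ℝ≥0, ∀ (A : Coeff n) (α : ℝ), Standard A Λ C₀ α →
      ∀ (Ω : Set (Rn1 n)) (u : Rn1 n → ℂ) (G : VF n), IsOpen Ω →
      IsSolution A Ω u G → ContinuousOn u Ω →
      ∀ (X : Rn1 n) (R : ℝ), 0 < R → cB X R ⊆ Ω →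
      ∫⁻ Y in cB X (R / 4), ‖G Y‖ₑ ^ (2 + ε)
        ≤ C * ((∫⁻ Y in cB X R, ‖G Y‖ₑ ^ 2) / volume (cB X R))
          ^ ((2 + ε) / 2) * volume (cB X R) := by
  obtain ⟨K, hK, hRH⟩ := exists_reverse_holder n hC₀ hΛ
  have hv := vol1_pos (n := n)
  obtain ⟨ε, hε0, hε1, C, hgeh⟩ := exists_gehring (Rn1 n) (√(K * vol1 n)).toNNReal
  refine ⟨ε, hε0, hε1, C, fun A α hA Ω u G hΩ hu hcont X R hR hball => ?_⟩
  have hG : MemLp G 2 (volOn (cB X R)) := hu.gradLocL2 _ (isCompact_closedBall X R) hball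
  have hGm : AEMeasurable (fun Y => ‖G Y‖ₑ) (volOn (cB X R)) := hG.1.enorm
  set w := hGm.mk
  have hwG : ∀ S ⊆ cB X R, (fun Y => ‖G Y‖ₑ) =ᵐ[volOn S] w := fun S hS =>
    ae_mono (Measure.restrict_mono hS le_rfl) hGm.ae_eq_mk
  have hint : ∀ S ⊆ cB X R, ∀ p : ℝ,
      ∫⁻ Y in S, w Y ^ p = ∫⁻ Y in S, ‖G Y‖ₑ ^ p := fun S hS p =>
    lintegral_congr_ae ((hwG S hS).mono fun Y hY => by simp only [← hY])
  have hint2 : ∀ S ⊆ cB X R, ∫⁻ Y in S, w Y ^ 2 = ∫⁻ Y in S, ‖G Y‖ₑ ^ 2 :=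
    fun S hS => lintegral_congr_ae ((hwG S hS).mono fun Y hY => by simp only [← hY])
  have hint1 : ∀ S ⊆ cB X R, ∫⁻ Y in S, w Y = ∫⁻ Y in S, ‖G Y‖ₑ :=
    fun S hS => lintegral_congr_ae ((hwG S hS).mono fun Y hY => by simp only [← hY])
  have hbc : ball X R ⊆ cB X R := ball_subset_closedBall
  set v := volume (cB X R)
  have hv0 : v ≠ 0 := (measure_closedBall_pos volume X hR).ne'
  have hvt : v ≠ ⊤ := vol_cB_ne _ _
  have hIfin : ∫⁻ Y in cB X R, ‖G Y‖ₑ ^ 2 ≠ ⊤ := by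
    rw [← ofReal_setIntegral_norm_sq hG]
    exact ofReal_ne_top
  have hmain := hgeh w hGm.measurable_mk X R hR (by
      rw [hint2 _ hbc]
      exact ne_top_of_le_ne_top hIfin (lintegral_mono_set hbc)) (by
    intro Y r hr hs
    have hs4 := hs.trans hbc
    have hs1 : cB Y r ⊆ cB Y (4 * r) := closedBall_subset_closedBall (by linarith)
    rw [hint2 _ (hs1.trans hs4), hint1 _ hs4]
    have hreal := hRH A α hA Ω u G hΩ hu hcont Y r hr (hs4.trans hball)
    have hG1 := hG.mono_measure (Measure.restrict_mono (hs1.trans hs4) le_rfl)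
    have hG4 := hG.mono_measure (Measure.restrict_mono hs4 le_rfl)
    have hfin4 : IsFiniteMeasure (volOn (cB Y (4 * r))) :=
      ⟨by simpa using (isCompact_closedBall _ _).measure_lt_top⟩
    rw [← ofReal_setIntegral_norm_sq hG1, volume_closedBall Y hr.le,
      ← ofReal_mul (integral_nonneg fun _ => by positivity),
      ← ofReal_integral_norm_eq_lintegral_enorm (hG4.integrable one_le_two), ← ofReal,
      ← ofReal_mul (Real.sqrt_nonneg _), ← ofReal_pow (mul_nonneg
        (Real.sqrt_nonneg _) (integral_nonneg fun _ => norm_nonneg _))]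
    refine ofReal_le_ofReal ?_
    rw [mul_pow, Real.sq_sqrt (by positivity)]
    calc _ = ((∫ Z in cB Y r, ‖G Z‖ ^ 2) * r ^ (n + 1)) * vol1 n := by ring
      _ ≤ _ := by
        refine (mul_le_mul_of_nonneg_right hreal hv.le).trans_eq ?_
        ring)
  have hsmall : cB X (R / 4) ⊆ ball X (R / 2) := closedBall_subset_ball (by linarith)
  have hhalf : ball X (R / 2) ⊆ cB X R := (ball_subset_ball (by linarith)).trans hbc
  rw [hint _ hhalf, hint2 _ hbc] at hmain
  set I := ∫⁻ Y in cB X R, ‖G Y‖ₑ ^ 2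
  calc _ ≤ ∫⁻ Y in ball X (R / 2), ‖G Y‖ₑ ^ (2 + ε) := lintegral_mono_set hsmall
    _ ≤ C * (I / v) ^ (ε / 2) * I := by
        refine hmain.trans ?_
        gcongr <;> exact lintegral_mono_set hbc
    _ = C * (I / v) ^ (ε / 2) * (I / v * v) := by rw [ENNReal.div_mul_cancel hv0 hvt]
    _ = C * ((I / v) ^ (ε / 2) * (I / v) ^ (1 : ℝ)) * v := by rw [rpow_one]; ring
    _ = _ := by
        rw [← ENNReal.rpow_add_of_nonneg _ _ (by positivity) (by norm_num)]
        congr 3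
        ring

lemma lintegral_eball_le_rms {V : Type*} [NormedAddCommGroup V] (F : Rn1 n → V) (X : Rn1 n)
    {r : ℝ} (hr : 0 < r) :
    ∫⁻ Y in eball X r, ‖F Y‖ₑ ^ 2 ≤ rms F (eball X r) ^ 2 * volume (cB X r) := by
  have h1 : rms F (eball X r) ^ 2 = (∫⁻ Y in eball X r, ‖F Y‖ₑ ^ 2) / volume (eball X r) := by
    rw [rms, ← rpow_natCast, ← rpow_mul, setLAverage_eq]
    norm_num
  have hsub : eball X r ⊆ cB X r := (eball_subset_ball X r).trans ball_subset_closedBall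
  have h0 : volume (eball X r) ≠ 0 :=
    ((measure_closedBall_pos volume X (by positivity : 0 < r / 2)).trans_le
      (measure_mono (closedBall_subset_eball X hr))).ne'
  have ht : volume (eball X r) ≠ ⊤ := ne_top_of_le_ne_top (vol_cB_ne _ _) (measure_mono hsub)
  calc _ = rms F (eball X r) ^ 2 * volume (eball X r) := by rw [h1, ENNReal.div_mul_cancel h0 ht]
    _ ≤ _ := by gcongr

lemma closedBall_subset_halfSpace {σ : ℝ} (hσ : σ = 1 ∨ σ = -1) {X : Rn1 n} {r : ℝ}
    (hr : r < σ * X.2) : cB X r ⊆ halfSpace n σ := by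
  intro Y hY
  have h1 : |Y.2 - X.2| ≤ r := by
    have : dist Y X ≤ r := hY
    rw [Prod.dist_eq] at this
    rw [← Real.dist_eq]
    exact (le_max_right _ _).trans this
  rw [abs_le] at h1
  change 0 < σ * Y.2
  rcases hσ with rfl | rfl <;> linarith [h1.1, h1.2]

lemma exists_slice_bound (n : ℕ) {C₀ Λ : ℝ} (hC₀ : 0 < C₀) (hΛ : 0 < Λ) :
    ∃ ε : ℝ, 0 < ε ∧ ε ≤ 1 ∧ ∃ C : ℝ≥0, ∀ (A : Coeff n) (α : ℝ), Standard A Λ C₀ α →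
      ∀ σ : ℝ, σ = 1 ∨ σ = -1 → ∀ (u w : Rn1 n → ℂ) (G H : VF n),
      IsSolution A (halfSpace n σ) u G → ContinuousOn u (halfSpace n σ) →
      IsSolution A (halfSpace n σ) w H → ContinuousOn w (halfSpace n σ) →
      (∀ᵐ X, X ∈ halfSpace n σ → w X = G X (Fin.last n)) →
      ∀ (x₀ : Rn n) (t : ℝ), 0 < σ * t →
      ∫⁻ x in cB x₀ (σ * t / 64), ‖sliceGrad σ t (σ * t / 64) G H x‖ₑ ^ (2 + ε)
        ≤ C * rms G (eball (x₀, t) (σ * t / 4)) ^ (2 + ε) * ofReal (σ * t) ^ n := by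
  obtain ⟨ε, hε0, hε1, C₁, hhigh⟩ := exists_higher_integrability n hC₀ hΛ
  obtain ⟨C₂, hcac⟩ := eLpNorm_caccioppoli n hΛ
  set q : ℝ := 2 + ε with hq
  have hq1 : 1 < q := by linarith
  have hq0 : 0 < q := by linarith
  set a₁ : ℝ≥0 := 4 ^ (n + 1) with ha₁
  set a₂ : ℝ≥0 := C₂ * 256 * 4 ^ (n + 1) with ha₂
  set vv : ℝ≥0 := (vol1 n).toNNReal
  refine ⟨ε, hε0, hε1, 2 ^ (q - 1) * (64 * C₁ * a₁ ^ (q / 2) + C₁ * a₂ ^ (q / 2)) * vv, ?_⟩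
  intro A α hA σ hσ u w G H hu hcont hw hwc hwG x₀ t ht
  set τ := σ * t with hτ
  set X : Rn1 n := (x₀, t) with hX
  set M := rms G (eball X (τ / 4))
  set δ := τ / 64 with hδ
  have hδ0 : 0 < δ := by positivity
  have hballs : ∀ r, r < τ → cB X r ⊆ halfSpace n σ := fun r hr => closedBall_subset_halfSpace hσ hr
  set v := volume (cB X (τ / 16)) with hvdef
  have hv0 : v ≠ 0 := (measure_closedBall_pos volume X (by positivity)).ne'
  have hvt : v ≠ ⊤ := vol_cB_ne _ _
  have hv4 : volume (cB X (τ / 4)) = 4 ^ (n + 1) * v := by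
    rw [show τ / 4 = 4 * (τ / 16) by ring, volume_closedBall_mul X (by norm_num) (by positivity),
      finrank_rn1]
    simp [v]
  have hG8 : ∫⁻ Y in cB X (τ / 8), ‖G Y‖ₑ ^ 2 ≤ M ^ 2 * (4 ^ (n + 1) * v) := by
    rw [← hv4]
    refine le_trans (lintegral_mono_set ?_) (lintegral_eball_le_rms G X (by positivity : 0 < τ / 4))
    have := closedBall_subset_eball X (by positivity : 0 < τ / 4)
    rwa [show τ / 4 / 2 = τ / 8 by ring] at this
  have hG16 : (∫⁻ Y in cB X (τ / 16), ‖G Y‖ₑ ^ 2) / v ≤ a₁ * M ^ 2 := by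
    refine ENNReal.div_le_of_le_mul ?_
    refine (lintegral_mono_set (closedBall_subset_closedBall (by linarith))).trans (hG8.trans_eq ?_)
    rw [ha₁]; push_cast; ring
  set T : ℝ≥0∞ := ofReal τ with hT
  have hT0 : T ≠ 0 := by simpa [hT] using ht
  have hTt : T ≠ ⊤ := ofReal_ne_top
  have hH16 : (∫⁻ Y in cB X (τ / 16), ‖H Y‖ₑ ^ 2) / v ≤ a₂ * (T⁻¹ ^ 2 * M ^ 2) := by
    refine ENNReal.div_le_of_le_mul ?_
    have h1 := hcac A hA.elliptic _ w H (isOpen_halfSpace n σ) hw X (τ / 16) (by positivity)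
      (by rw [show 2 * (τ / 16) = τ / 8 by ring]; exact hballs _ (by linarith))
    have h2 : ∫⁻ Y in cB X (τ / 8), ‖w Y‖ₑ ^ 2
        ≤ ∫⁻ Y in cB X (τ / 8), ‖G Y‖ₑ ^ 2 := by
      refine lintegral_mono_ae ((ae_restrict_iff' measurableSet_closedBall).2 ?_)
      filter_upwards [hwG] with Y hY hYb
      rw [hY (hballs _ (by linarith) hYb)]
      gcongr
      rw [← ofReal_norm, ← ofReal_norm]
      exact ofReal_le_ofReal (PiLp.norm_apply_le (G Y) _)
    rw [show 2 * (τ / 16) = τ / 8 by ring] at h1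
    have h3 : ofReal ((τ / 16)⁻¹ ^ 2) = 256 * T⁻¹ ^ 2 := by
      rw [inv_div, hT, ← ENNReal.ofReal_inv_of_pos ht, ← ofReal_pow (by positivity),
        show (256 : ℝ≥0∞) = ofReal 256 by simp, ← ofReal_mul (by norm_num)]
      congr 1
      rw [div_eq_mul_inv, mul_pow]; norm_num
    rw [h3] at h1
    calc _ ≤ C₂ * (256 * T⁻¹ ^ 2) * (M ^ 2 * (4 ^ (n + 1) * v)) := by
          refine h1.trans ?_
          gcongr
          exact h2.trans hG8
      _ = _ := by rw [ha₂]; push_cast; ring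
  have hGq := hhigh A α hA _ u G (isOpen_halfSpace n σ) hu hcont X (τ / 16) (by positivity)
    (hballs _ (by linarith))
  have hHq := hhigh A α hA _ w H (isOpen_halfSpace n σ) hw hwc X (τ / 16) (by positivity)
    (hballs _ (by linarith))
  rw [show τ / 16 / 4 = δ by rw [hδ]; ring] at hGq hHq
  have hMq : (M ^ 2) ^ (q / 2) = M ^ q := by
    rw [← rpow_natCast, ← rpow_mul]; congr 1; push_cast; ring
  have hTq : (T⁻¹ ^ 2) ^ (q / 2) = T⁻¹ ^ q := by
    rw [← rpow_natCast, ← rpow_mul]; congr 1; push_cast; ring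
  have hGq' : ∫⁻ Y in cB X δ, ‖G Y‖ₑ ^ q ≤ C₁ * ((a₁ ^ (q / 2) : ℝ≥0) * M ^ q) * v := by
    refine hGq.trans ?_
    gcongr
    calc _ ≤ (a₁ * M ^ 2) ^ (q / 2) := by gcongr
      _ = _ := by
        rw [mul_rpow_of_nonneg _ _ (by positivity), hMq, coe_rpow_of_nonneg _ (by positivity)]
  have hHq' : ∫⁻ Y in cB X δ, ‖H Y‖ₑ ^ q
      ≤ C₁ * ((a₂ ^ (q / 2) : ℝ≥0) * (T⁻¹ ^ q * M ^ q)) * v := by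
    refine hHq.trans ?_
    gcongr
    calc _ ≤ (a₂ * (T⁻¹ ^ 2 * M ^ 2)) ^ (q / 2) := by gcongr
      _ = _ := by
        rw [mul_rpow_of_nonneg _ _ (by positivity),
          mul_rpow_of_nonneg _ _ (by positivity), hMq, hTq,
          coe_rpow_of_nonneg _ (by positivity)]
  set J := uIoc t (t + σ * δ)
  set B := cB x₀ δ
  have hBJ : B ×ˢ J ⊆ cB X δ := by
    intro Y hY
    rw [mem_closedBall, Prod.dist_eq]
    refine max_le hY.1 ?_
    have h1 := mem_slabHeights hσ (uIoc_subset_uIcc hY.2) hδ0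
    rw [Real.dist_eq, abs_le]
    rcases hσ with rfl | rfl <;> constructor <;> simp only [hX] <;> linarith [h1.1, h1.2]
  have hJv : volume J = ofReal δ := by
    rw [Real.volume_uIoc, add_sub_cancel_left, abs_mul]
    have : |σ| = 1 := by rcases hσ with rfl | rfl <;> norm_num
    rw [this, one_mul, abs_of_pos hδ0]
  have hmeas : ∀ F : VF n, LocL2 (halfSpace n σ) F →
      AEStronglyMeasurable F (volOn (B ×ˢ J)) := fun F hF =>
    (hF _ (isCompact_closedBall X δ) (hballs _ (by rw [hδ]; linarith))).1.mono_measure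
      (Measure.restrict_mono hBJ le_rfl)
  have hD : ofReal δ = T / 64 := by rw [hδ, ofReal_div_of_pos (by norm_num)]; simp [hT]
  set D := ofReal δ
  have hD0 : D ≠ 0 := by rw [hD]; exact (ENNReal.div_pos hT0 (by simp)).ne'
  have hDt : D ≠ ⊤ := ofReal_ne_top
  have hDT : D⁻¹ = 64 * T⁻¹ := by rw [hD, ENNReal.inv_div (by simp) (by simp), div_eq_mul_inv]
  have h1 := lintegral_slab_rpow_le (B := B) (J := J) measurableSet_uIoc (norm_avgKernel_le t hδ0)
    (fun s hs => indicator_of_notMem hs _) (hmeas G hu.gradLocL2) hq1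
  have h2 := lintegral_slab_rpow_le (B := B) (J := J) measurableSet_uIoc (norm_corKernel_le hσ t hδ0)
    (fun s hs => indicator_of_notMem hs _) (hmeas H hw.gradLocL2) hq1
  have hk1 : ofReal (1 / δ) ^ q * volume J ^ (q - 1) = 64 * T⁻¹ := by
    rw [one_div, ENNReal.ofReal_inv_of_pos hδ0, hJv, ENNReal.inv_rpow, ← ENNReal.rpow_neg,
      ← ENNReal.rpow_add _ _ hD0 hDt, ← hDT, ← ENNReal.rpow_neg_one]
    congr 1; ring
  have hk2 : ofReal 1 ^ q * volume J ^ (q - 1) * T⁻¹ ^ q ≤ T⁻¹ := by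
    rw [ofReal_one, ENNReal.one_rpow, one_mul, hJv]
    have : D ≤ T := by rw [hD]; exact ENNReal.div_le_of_le_mul (le_mul_of_one_le_right zero_le (by norm_num))
    calc D ^ (q - 1) * T⁻¹ ^ q ≤ T ^ (q - 1) * T⁻¹ ^ q := by gcongr
      _ = T⁻¹ := by
        rw [ENNReal.inv_rpow, ← ENNReal.rpow_neg, ← ENNReal.rpow_add _ _ hT0 hTt,
          ← ENNReal.rpow_neg_one]
        congr 1; ring
  rw [hk1] at h1
  have h1' : ∫⁻ x in B, ‖slab (avgKernel σ t δ) G x‖ₑ ^ q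
      ≤ 64 * T⁻¹ * (C₁ * ((a₁ ^ (q / 2) : ℝ≥0) * M ^ q) * v) := by
    refine h1.trans ?_
    gcongr
    exact (lintegral_mono_set hBJ).trans hGq'
  have h2' : ∫⁻ x in B, ‖slab (corKernel σ t δ) H x‖ₑ ^ q
      ≤ T⁻¹ * (C₁ * ((a₂ ^ (q / 2) : ℝ≥0) * M ^ q) * v) := by
    calc _ ≤ ofReal 1 ^ q * volume J ^ (q - 1) *
          (C₁ * ((a₂ ^ (q / 2) : ℝ≥0) * (T⁻¹ ^ q * M ^ q)) * v) := by
          refine h2.trans ?_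
          gcongr
          exact (lintegral_mono_set hBJ).trans hHq'
      _ = (ofReal 1 ^ q * volume J ^ (q - 1) * T⁻¹ ^ q) *
          (C₁ * ((a₂ ^ (q / 2) : ℝ≥0) * M ^ q) * v) := by ring
      _ ≤ _ := by gcongr
  have hm1 : AEMeasurable (fun x => ‖slab (avgKernel σ t δ) G x‖ₑ ^ q) (volOn B) :=
    (((isKernel_avgKernel hσ ht hδ0).locallyIntegrable hu.gradLocL2).aestronglyMeasurable.enorm.pow_const
      q).restrict
  have hvT : T⁻¹ * v ≤ vv * T ^ n := by
    rw [hvdef, volume_closedBall X (by positivity), ofReal_mul (by positivity),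
      ofReal_pow (by positivity)]
    have h5 : ofReal (τ / 16) ≤ T := ofReal_le_ofReal (by linarith)
    calc _ ≤ T⁻¹ * (T ^ (n + 1) * ofReal (vol1 n)) := by gcongr
      _ = T⁻¹ * T * (T ^ n * ofReal (vol1 n)) := by ring
      _ = _ := by rw [ENNReal.inv_mul_cancel hT0 hTt, one_mul, mul_comm]; rfl
  calc ∫⁻ x in B, ‖sliceGrad σ t δ G H x‖ₑ ^ q
      ≤ ∫⁻ x in B, 2 ^ (q - 1) * (‖slab (avgKernel σ t δ) G x‖ₑ ^ q
          + ‖slab (corKernel σ t δ) H x‖ₑ ^ q) := by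
        refine lintegral_mono fun x => ?_
        calc _ ≤ (‖slab (avgKernel σ t δ) G x‖ₑ + ‖slab (corKernel σ t δ) H x‖ₑ) ^ q := by
              gcongr; exact enorm_add_le _ _
          _ ≤ _ := ENNReal.rpow_add_le_mul_rpow_add_rpow _ _ hq1.le
    _ = 2 ^ (q - 1) * ((∫⁻ x in B, ‖slab (avgKernel σ t δ) G x‖ₑ ^ q)
          + ∫⁻ x in B, ‖slab (corKernel σ t δ) H x‖ₑ ^ q) := by
        rw [lintegral_const_mul' _ _ (rpow_ne_top_of_nonneg (by linarith) (by simp)),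
          lintegral_add_left' hm1]
    _ ≤ 2 ^ (q - 1) * (64 * T⁻¹ * (C₁ * ((a₁ ^ (q / 2) : ℝ≥0) * M ^ q) * v)
          + T⁻¹ * (C₁ * ((a₂ ^ (q / 2) : ℝ≥0) * M ^ q) * v)) := by gcongr
    _ = 2 ^ (q - 1) * (64 * C₁ * (a₁ ^ (q / 2) : ℝ≥0) + C₁ * (a₂ ^ (q / 2) : ℝ≥0)) * M ^ q
          * (T⁻¹ * v) := by ring
    _ ≤ 2 ^ (q - 1) * (64 * C₁ * (a₁ ^ (q / 2) : ℝ≥0) + C₁ * (a₂ ^ (q / 2) : ℝ≥0)) * M ^ q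
          * (vv * T ^ n) := by gcongr
    _ = _ := by
        have h2c : ((2 ^ (q - 1) : ℝ≥0) : ℝ≥0∞) = 2 ^ (q - 1) := by
          rw [coe_rpow_of_nonneg _ (by linarith)]; rfl
        simp only [ENNReal.coe_mul, ENNReal.coe_add, h2c]
        push_cast
        ring

/-! ### The non-tangential maximal function controls the slices -/

/-- A continuous solution `u` with gradient `G` in a half-space, together with its continuous
`t`-derivative `w`, with gradient `H`, and the resulting slice gradients. -/
structure VerticalPair (A : Coeff n) (σ : ℝ) (u w : Rn1 n → ℂ) (G H : VF n) :
    Prop where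
  sol : IsSolution A (halfSpace n σ) u G
  cont : ContinuousOn u (halfSpace n σ)
  solT : IsSolution A (halfSpace n σ) w H
  contT : ContinuousOn w (halfSpace n σ)
  ae_eq : ∀ᵐ X, X ∈ halfSpace n σ → w X = G X (Fin.last n)
  isSliceGrad : ∀ t δ : ℝ, 0 < σ * t → 0 < δ → IsSliceGrad u t (sliceGrad σ t δ G H)

lemma Standard.exists_verticalPair {A : Coeff n} {Λ C₀ α : ℝ} (hΛ : 0 < Λ) (hα : 0 < α)
    (hA : Standard A Λ C₀ α) (hσ : σ = 1 ∨ σ = -1) {u : Rn1 n → ℂ} {G : VF n}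
    (hu : IsSolution A (halfSpace n σ) u G) (hcont : ContinuousOn u (halfSpace n σ)) :
    ∃ w H, VerticalPair A σ u w G H := by
  obtain ⟨w, H, hw, hwc, hwG, hd⟩ := IsSolution.exists_timeDeriv hα hΛ hA.elliptic hA.dgnm
    (isOpen_halfSpace n σ) hu hcont
  obtain ⟨w₂, H₂, -, hwc₂, hwG₂, hd₂⟩ := IsSolution.exists_timeDeriv hα hΛ hA.elliptic hA.dgnm
    (isOpen_halfSpace n σ) hw hwc
  exact ⟨w, H, hu, hcont, hw, hwc, hwG, fun t δ ht hδ =>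
    isSliceGrad_sliceGrad hσ hu hw hwc hwG hd hwc₂ hwG₂ hd₂ ht hδ⟩

lemma abs_eq_sign_mul (hσ : σ = 1 ∨ σ = -1) {t : ℝ} (ht : 0 < σ * t) : |t| = σ * t := by
  rcases hσ with rfl | rfl
  · rw [abs_of_pos (by linarith)]; ring
  · rw [abs_of_neg (by linarith)]; ring

lemma rms_le_ntMax (hσ : σ = 1 ∨ σ = -1) (F : VF n) {x₀ y : Rn n} {t : ℝ}
    (h : ‖y - x₀‖ < σ * t) : rms F (eball (x₀, t) (σ * t / 4)) ≤ ntMax σ F y := by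
  have ht : 0 < σ * t := (norm_nonneg _).trans_lt h
  have h1 : (x₀, t) ∈ cone σ y := h
  have h2 := le_iSup₂ (f := fun (X : Rn1 n) (_ : X ∈ cone σ y) => rms F (eball X (|X.2| / 4)))
    (x₀, t) h1
  simp only [abs_eq_sign_mul hσ ht] at h2
  exact h2

lemma lowerSemicontinuous_ntMax (σ : ℝ) (F : VF n) :
    LowerSemicontinuous (ntMax σ F) := by
  intro x l hl
  simp only [ntMax, lt_iSup_iff] at hl
  obtain ⟨X, hX, hl⟩ := hl
  have : ∀ᶠ y in 𝓝 x, X ∈ cone σ y :=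
    (isOpen_lt (by fun_prop : Continuous fun y : Rn n => ‖y - X.1‖) continuous_const).mem_nhds hX
  filter_upwards [this] with y hy
  exact hl.trans_le (le_iSup₂ (f := fun (X : Rn1 n) (_ : X ∈ cone σ y) =>
    rms F (eball X (|X.2| / 4))) X hy)

lemma measurable_ntMax (σ : ℝ) (F : VF n) : Measurable (ntMax σ F) :=
  (lowerSemicontinuous_ntMax σ F).measurable

lemma volume_closedBall_eq (x y : Rn n) (r : ℝ) :
    volume (cB x r) = volume (cB y r) :=
  (Measure.addHaar_closedBall_center volume x r).trans
    (Measure.addHaar_closedBall_center volume y r).symm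

lemma lintegral_lintegral_closedBall {f : Rn n → ℝ≥0∞} (hf : AEMeasurable f) (r : ℝ) :
    ∫⁻ y, (∫⁻ x in cB y r, f x) = volume (cB (0 : Rn n) r) * ∫⁻ x, f x := by
  set g := hf.mk
  have hg : Measurable g := hf.measurable_mk
  have e1 : ∀ y, ∫⁻ x in cB y r, f x
      = ∫⁻ x, {X : Rn n × Rn n | dist X.2 X.1 ≤ r}.indicator (fun X => g X.2) (y, x) := by
    intro y
    rw [← lintegral_indicator measurableSet_closedBall]
    refine lintegral_congr_ae ?_
    filter_upwards [hf.ae_eq_mk] with x hx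
    simp only [indicator, mem_closedBall, mem_ofPred_eq]
    rw [hx]
  have hS : MeasurableSet {X : Rn n × Rn n | dist X.2 X.1 ≤ r} :=
    (isClosed_le (by fun_prop) continuous_const).measurableSet
  simp only [e1]
  rw [lintegral_lintegral_swap
    (f := fun y x => {X : Rn n × Rn n | dist X.2 X.1 ≤ r}.indicator (fun X => g X.2) (y, x))
    ((hg.comp measurable_snd).indicator hS).aemeasurable]
  have e2 : ∀ x, ∫⁻ y, {X : Rn n × Rn n | dist X.2 X.1 ≤ r}.indicator (fun X => g X.2) (y, x)
      = volume (cB (0 : Rn n) r) * g x := by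
    intro x
    have : (fun y => {X : Rn n × Rn n | dist X.2 X.1 ≤ r}.indicator (fun X => g X.2) (y, x))
        = (cB x r).indicator fun _ => g x := by
      ext y
      simp only [indicator, mem_closedBall, mem_ofPred_eq, dist_comm]
    rw [this, lintegral_indicator measurableSet_closedBall, setLIntegral_const,
      volume_closedBall_eq x 0, mul_comm]
  simp only [e2]
  rw [lintegral_const_mul _ hg]
  congr 1
  exact lintegral_congr_ae (hf.ae_eq_mk.mono fun x hx => hx.symm)

lemma lintegral_le_of_forall_closedBall {f K : Rn n → ℝ≥0∞} (hf : AEMeasurable f) {r : ℝ}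
    (hr : 0 < r)
    (h : ∀ y, ∫⁻ x in cB y r, f x ≤ volume (cB (0 : Rn n) r) * K y) :
    ∫⁻ x, f x ≤ ∫⁻ y, K y := by
  have hv0 : volume (cB (0 : Rn n) r) ≠ 0 := (measure_closedBall_pos volume _ hr).ne'
  have hvt : volume (cB (0 : Rn n) r) ≠ ⊤ := vol_cB_ne _ _
  refine (ENNReal.mul_le_mul_iff_right hv0 hvt).1 ?_
  rw [← lintegral_lintegral_closedBall hf, ← lintegral_const_mul' _ _ hvt]
  exact lintegral_mono h

lemma exists_slice_average (n : ℕ) {C₀ Λ : ℝ} (hC₀ : 0 < C₀) (hΛ : 0 < Λ) :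
    ∃ ε : ℝ, 0 < ε ∧ ∀ p : ℝ, 0 < p → p < 2 + ε → ∃ C : ℝ≥0, ∀ (A : Coeff n) (α : ℝ),
      Standard A Λ C₀ α → ∀ σ : ℝ, σ = 1 ∨ σ = -1 →
      ∀ (u w : Rn1 n → ℂ) (G H : VF n), VerticalPair A σ u w G H →
      ∀ (x₀ y : Rn n) (t : ℝ), 0 < σ * t → ‖y - x₀‖ < σ * t →
      ∫⁻ x in cB x₀ (σ * t / 64), ‖sliceGrad σ t (σ * t / 64) G H x‖ₑ ^ p
        ≤ volume (cB (0 : Rn n) (σ * t / 64)) * (C * ntMax σ G y ^ p) := by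
  obtain ⟨ε, hε0, -, C₁, hC₁⟩ := exists_slice_bound n hC₀ hΛ
  refine ⟨ε, hε0, fun p hp0 hp => ?_⟩
  set q : ℝ := 2 + ε with hq
  have hq0 : 0 < q := by linarith
  set κ : ℝ≥0∞ := volume (cB (0 : Rn n) 1) with hκ
  have hκ0 : κ ≠ 0 := (measure_closedBall_pos volume _ one_pos).ne'
  have hκt : κ ≠ ⊤ := vol_cB_ne _ _
  obtain ⟨C₂, hC₂⟩ : ∃ C₂ : ℝ≥0, (C₂ : ℝ≥0∞) = (C₁ * 64 ^ n * κ⁻¹) ^ (p / q) :=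
    ⟨_, ENNReal.coe_toNNReal (rpow_ne_top_of_nonneg (by positivity)
      (mul_ne_top (by finiteness) (ENNReal.inv_ne_top.2 hκ0)))⟩
  refine ⟨C₂, fun A α hA σ hσ u w G H hP x₀ y t ht hy => ?_⟩
  set r := σ * t / 64 with hr
  have hr0 : 0 < r := by positivity
  set v := volume (cB (0 : Rn n) r) with hv
  have hv0 : v ≠ 0 := (measure_closedBall_pos volume _ hr0).ne'
  have hvt : v ≠ ⊤ := vol_cB_ne _ _
  have hvT : ofReal (σ * t) ^ n = 64 ^ n * κ⁻¹ * v := by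
    have h1 : v = ofReal r ^ n * κ := by
      rw [hv, Measure.addHaar_closedBall' _ _ hr0.le, ofReal_pow hr0.le]
      simp [hκ]
    have h2 : ofReal (σ * t) = 64 * ofReal r := by
      rw [show (64 : ℝ≥0∞) = ofReal 64 by simp, ← ofReal_mul (by norm_num)]
      congr 1; rw [hr]; ring
    rw [h1, h2, mul_pow]
    calc _ = 64 ^ n * ofReal r ^ n * (κ⁻¹ * κ) := by
          rw [ENNReal.inv_mul_cancel hκ0 hκt, mul_one]
      _ = _ := by ring
  have hmain := hC₁ A α hA σ hσ u w G H hP.sol hP.cont hP.solT hP.contT hP.ae_eq x₀ t ht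
  set V := sliceGrad σ t r G H
  have hVm : AEMeasurable (fun x => ‖V x‖ₑ ^ p) (volOn (cB x₀ r)) :=
    ((hP.isSliceGrad t r ht hr0).locInt.aestronglyMeasurable.enorm.pow_const p).restrict
  have hqp : 1 < q / p := (one_lt_div hp0).2 hp
  have hH := lintegral_rpow_le_measure_mul hVm hqp
  have e1 : ∀ x, (‖V x‖ₑ ^ p) ^ (q / p) = ‖V x‖ₑ ^ q := fun x => by
    rw [← rpow_mul]; congr 1; field_simp
  simp only [e1, Measure.restrict_apply_univ] at hH
  rw [volume_closedBall_eq x₀ 0, ← hv] at hH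
  set I := ∫⁻ x in cB x₀ r, ‖V x‖ₑ ^ p
  set N := ntMax σ G y
  have h1 : I ^ (q / p) ≤ v ^ (q / p) * ((C₁ * 64 ^ n * κ⁻¹) * N ^ q) := by
    calc _ ≤ v ^ (q / p - 1) * (C₁ * N ^ q * (64 ^ n * κ⁻¹ * v)) := by
          refine hH.trans ?_
          gcongr
          refine hmain.trans ?_
          rw [hvT]
          gcongr
          exact rms_le_ntMax hσ G hy
      _ = v ^ (q / p - 1) * v ^ (1 : ℝ) * ((C₁ * 64 ^ n * κ⁻¹) * N ^ q) := by
          rw [rpow_one]; ring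
      _ = _ := by rw [← ENNReal.rpow_add _ _ hv0 hvt, sub_add_cancel]
  calc I = (I ^ (q / p)) ^ (p / q) := by
        rw [← rpow_mul, div_mul_div_cancel₀ hp0.ne', div_self hq0.ne', rpow_one]
    _ ≤ (v ^ (q / p) * ((C₁ * 64 ^ n * κ⁻¹) * N ^ q)) ^ (p / q) := by gcongr
    _ = _ := by
      have hpq : 0 ≤ p / q := by positivity
      rw [mul_rpow_of_nonneg _ _ hpq, mul_rpow_of_nonneg _ _ hpq, ← hC₂,
        ← rpow_mul, ← rpow_mul, div_mul_div_cancel₀ hp0.ne', div_self hq0.ne',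
        rpow_one, mul_div_cancel₀ _ hq0.ne']

/-- The slices are bounded by the maximal function, in `L^p` and against test functions. -/
lemma exists_slice_estimates (n : ℕ) {C₀ Λ : ℝ} (hC₀ : 0 < C₀) (hΛ : 0 < Λ) :
    ∃ ε : ℝ, 0 < ε ∧ ∀ p : ℝ, 0 < p → p < 2 + ε → ∃ C : ℝ≥0, ∀ (A : Coeff n) (α : ℝ),
      Standard A Λ C₀ α → ∀ σ : ℝ, σ = 1 ∨ σ = -1 →
      ∀ (u w : Rn1 n → ℂ) (G H : VF n), VerticalPair A σ u w G H →
      ∀ t : ℝ, 0 < σ * t →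
      (∫⁻ x, ‖sliceGrad σ t (σ * t / 64) G H x‖ₑ ^ p ≤ C * ∫⁻ x, ntMax σ G x ^ p) ∧
      ∀ ψ : Rn n → ℝ≥0∞, Measurable ψ → ∫⁻ x, ‖sliceGrad σ t (σ * t / 64) G H x‖ₑ * ψ x
          ≤ C * ∫⁻ y, ntMax σ G y * ⨆ x ∈ cB y (σ * t), ψ x := by
  obtain ⟨ε, hε, h⟩ := exists_slice_average n hC₀ hΛ
  refine ⟨ε, hε, fun p hp0 hp => ?_⟩
  obtain ⟨C₁, hC₁⟩ := h p hp0 hp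
  obtain ⟨C₂, hC₂⟩ := h 1 one_pos (by linarith)
  refine ⟨max C₁ C₂, fun A α hA σ hσ u w G H hP t ht => ?_⟩
  have hr : 0 < σ * t / 64 := by positivity
  have hVm := (hP.isSliceGrad t _ ht hr).locInt.aestronglyMeasurable.enorm
  constructor
  · rw [← lintegral_const_mul' _ _ coe_ne_top]
    refine lintegral_le_of_forall_closedBall (hVm.pow_const p) hr fun y => ?_
    refine (hC₁ A α hA σ hσ u w G H hP y y t ht (by simpa using ht)).trans ?_
    gcongr
    exact le_max_left _ _
  · intro ψ hψ
    rw [← lintegral_const_mul' _ _ coe_ne_top]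
    refine lintegral_le_of_forall_closedBall (hVm.mul hψ.aemeasurable) hr fun y => ?_
    set S := ⨆ x ∈ cB y (σ * t), ψ x
    have h1 := hC₂ A α hA σ hσ u w G H hP y y t ht (by simpa using ht)
    simp only [rpow_one] at h1
    calc _ ≤ ∫⁻ x in cB y (σ * t / 64), ‖sliceGrad σ t (σ * t / 64) G H x‖ₑ * S := by
          refine setLIntegral_mono' measurableSet_closedBall fun x hx => ?_
          gcongr
          exact le_iSup₂ (f := fun x (_ : x ∈ cB y (σ * t)) => ψ x) x
            (closedBall_subset_closedBall (by linarith) hx)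
      _ = (∫⁻ x in cB y (σ * t / 64), ‖sliceGrad σ t (σ * t / 64) G H x‖ₑ) * S := by
          rw [lintegral_mul_const'' _ hVm.restrict]
      _ ≤ (volume (cB (0 : Rn n) (σ * t / 64)) * (C₂ * ntMax σ G y)) * S := by gcongr
      _ ≤ _ := by
          rw [mul_assoc, mul_assoc]
          gcongr
          exact le_max_right _ _

/-! ### Non-tangential traces -/

lemma lintegral_enorm_le_rms {V : Type*} [NormedAddCommGroup V] {F : Rn1 n → V} {X : Rn1 n}
    {τ : ℝ} (hτ : 0 < τ)
    (hF : AEStronglyMeasurable F (volOn (cB X (τ / 8)))) :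
    ∫⁻ Z in cB X (τ / 8), ‖F Z‖ₑ ≤ rms F (eball X (τ / 4)) * volume (cB X (τ / 4)) := by
  set M := rms F (eball X (τ / 4))
  set v := volume (cB X (τ / 4))
  have h2 := lintegral_rpow_le_measure_mul hF.enorm one_lt_two
  rw [Measure.restrict_apply_univ] at h2
  have h3 : ∫⁻ Z in cB X (τ / 8), ‖F Z‖ₑ ^ (2 : ℝ) ≤ M ^ 2 * v := by
    simp only [ENNReal.rpow_two]
    refine le_trans (lintegral_mono_set ?_) (lintegral_eball_le_rms F X (by positivity))
    have := closedBall_subset_eball X (by positivity : 0 < τ / 4)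
    rwa [show τ / 4 / 2 = τ / 8 by ring] at this
  have h4 : (∫⁻ Z in cB X (τ / 8), ‖F Z‖ₑ) ^ (2 : ℝ) ≤ (M * v) ^ (2 : ℝ) := by
    refine h2.trans ?_
    calc _ ≤ v ^ ((2 : ℝ) - 1) * (M ^ 2 * v) := by
          gcongr
          exact measure_mono (closedBall_subset_closedBall (by linarith))
      _ = _ := by rw [show (2 : ℝ) - 1 = 1 by norm_num, rpow_one, ENNReal.rpow_two]; ring
  exact (ENNReal.rpow_le_rpow_iff two_pos).1 h4

/-- A continuous solution in a half-space, for an operator with pointwise estimates. -/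
def HalfSol (C₀ σ : ℝ) (u : Rn1 n → ℂ) (G : VF n) : Prop :=
  (σ = 1 ∨ σ = -1) ∧ ∃ (A : Coeff n) (α : ℝ), DGNM A C₀ α ∧ IsSolution A (halfSpace n σ) u G ∧
    ContinuousOn u (halfSpace n σ)

/-- A solution oscillates on a Whitney ball at most by the mean of its gradient. -/
lemma exists_local_oscillation (n : ℕ) {C₀ : ℝ} (hC₀ : 0 < C₀) : ∃ C : ℝ≥0,
    ∀ {σ : ℝ} {u : Rn1 n → ℂ} {G : VF n}, HalfSol C₀ σ u G →
    ∀ X ∈ halfSpace n σ,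
      ∀ Y ∈ cB X (σ * X.2 / 16),
      ‖u Y - u X‖ₑ ≤ C * ofReal (σ * X.2) * rms G (eball X (σ * X.2 / 4)) := by
  obtain ⟨C, hC, h⟩ := exists_oscillation n hC₀
  set D : ℝ := 2 * (C * 8 ^ n * (1 / 4) ^ (n + 1) * vol1 n) with hD
  have hv := vol1_pos (n := n)
  refine ⟨D.toNNReal, fun {σ u G} ⟨hσ, A, α, hA, hu, hcont⟩ X hX Y hY => ?_⟩
  set τ := σ * X.2 with hτ
  have hτ0 : 0 < τ := hX
  have hsub : cB X (τ / 8) ⊆ halfSpace n σ := closedBall_subset_halfSpace hσ (by linarith)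
  obtain ⟨c, hc⟩ := h A α hA _ u G (isOpen_halfSpace n σ) hu hcont X (τ / 8) (by positivity) hsub
  rw [show τ / 8 / 2 = τ / 16 by ring] at hc
  set M := rms G (eball X (τ / 4))
  set I := ∫ Z in cB X (τ / 8), ‖G Z‖ with hI
  have hG := hu.gradLocL2 _ (isCompact_closedBall X (τ / 8)) hsub
  have hfin : IsFiniteMeasure ((volume : Measure (Rn1 n)).restrict (cB X (τ / 8))) :=
    ⟨by simpa using (isCompact_closedBall _ _).measure_lt_top⟩
  have hIe : ofReal I = ∫⁻ Z in cB X (τ / 8), ‖G Z‖ₑ :=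
    ofReal_integral_norm_eq_lintegral_enorm (hG.integrable one_le_two)
  set v := volume (cB X (τ / 4)) with hvd
  have h1 : ofReal I ≤ M * v := by
    rw [hIe]
    exact lintegral_enorm_le_rms hτ0 hG.1
  have hcY := hc Y hY
  have hcX := hc X (mem_closedBall_self (by positivity))
  have h5 : ‖u Y - u X‖ ≤ 2 * (C / (τ / 8) ^ n) * I := by
    calc ‖u Y - u X‖ = ‖(u Y - c) - (u X - c)‖ := by congr 1; ring
      _ ≤ ‖u Y - c‖ + ‖u X - c‖ := norm_sub_le _ _
      _ ≤ _ := by linarith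
  rw [← ofReal_norm]
  calc ofReal ‖u Y - u X‖ ≤ ofReal (2 * (C / (τ / 8) ^ n)) * ofReal I := by
        rw [← ofReal_mul (by positivity)]
        exact ofReal_le_ofReal h5
    _ ≤ ofReal (2 * (C / (τ / 8) ^ n)) * (M * v) := by gcongr
    _ = ofReal (2 * (C / (τ / 8) ^ n)) * v * M := by ring
    _ = _ := by
        congr 1
        rw [hvd, volume_closedBall X (by positivity), ← ofReal_mul (by positivity)]
        change _ = ofReal D * _
        rw [← ofReal_mul (by positivity)]
        congr 1
        rw [hD, div_pow, div_pow, div_pow]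
        rw [one_pow]
        field_simp
        ring

/-- Local oscillation bounds chain along segments. -/
lemma enorm_sub_le_of_chain {u : E → ℂ}
    {S : Set E} (hS : Convex ℝ S) {D : ℝ≥0∞} {ρ : ℝ}
    (h : ∀ X ∈ S, ∀ Y ∈ S, dist Y X ≤ ρ → ‖u Y - u X‖ₑ ≤ D) (m : ℕ) :
    ∀ Z ∈ S, ∀ Z' ∈ S, dist Z Z' ≤ m * ρ → ‖u Z - u Z'‖ₑ ≤ m * D := by
  induction m with
  | zero =>
    intro Z _ Z' _ hd
    have : Z = Z' := dist_le_zero.1 (by simpa using hd)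
    simp [this]
  | succ m ih =>
    intro Z hZ Z' hZ' hd
    set Y : E := Z + ((1 : ℝ) / (m + 1)) • (Z' - Z) with hY
    have hm : (0 : ℝ) < m + 1 := by positivity
    have hYS : Y ∈ S := hS.add_smul_sub_mem hZ hZ' ⟨by positivity, by
      rw [div_le_one hm]; linarith [Nat.cast_nonneg (α := ℝ) m]⟩
    have hd' : dist Z Z' = ‖Z' - Z‖ := by rw [dist_comm, dist_eq_norm]
    push_cast at hd
    rw [hd'] at hd
    have h1 : dist Z Y ≤ ρ := by
      rw [dist_comm, dist_eq_norm, hY, add_sub_cancel_left, norm_smul, Real.norm_of_nonneg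
        (by positivity), one_div, inv_mul_le_iff₀ hm]
      exact hd
    have h2 : dist Y Z' ≤ m * ρ := by
      have : Y - Z' = (-(m / (m + 1) : ℝ)) • (Z' - Z) := by
        have e : (-(m / (m + 1) : ℝ)) = (1 : ℝ) / (m + 1) - 1 := by field_simp; ring
        rw [e, sub_smul, one_smul, hY]; abel
      rw [dist_eq_norm, this, norm_smul, norm_neg, Real.norm_of_nonneg (by positivity),
        div_mul_eq_mul_div, div_le_iff₀ hm, mul_assoc, mul_comm ρ]
      gcongr
    calc ‖u Z - u Z'‖ₑ = ‖(u Z - u Y) + (u Y - u Z')‖ₑ := by congr 1; ring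
      _ ≤ ‖u Z - u Y‖ₑ + ‖u Y - u Z'‖ₑ := enorm_add_le _ _
      _ ≤ D + m * D := add_le_add (h Y hYS Z hZ h1) (ih Y hYS Z' hZ' h2)
      _ = _ := by push_cast; ring

lemma convex_cone_slab (σ : ℝ) (y : Rn n) (a b : ℝ) :
    Convex ℝ {X : Rn1 n | X ∈ cone σ y ∧ a ≤ σ * X.2 ∧ σ * X.2 ≤ b} := by
  have h1 : Convex ℝ (cone σ y) := by
    intro X hX Y hY s r hs hr hsr
    have hX' : ‖y - X.1‖ < σ * X.2 := hX
    have hY' : ‖y - Y.1‖ < σ * Y.2 := hY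
    change ‖y - (s • X.1 + r • Y.1)‖ < σ * (s * X.2 + r * Y.2)
    have e : y - (s • X.1 + r • Y.1) = s • (y - X.1) + r • (y - Y.1) := by
      calc _ = (s + r) • y - (s • X.1 + r • Y.1) := by rw [hsr, one_smul]
        _ = _ := by rw [add_smul, smul_sub, smul_sub]; abel
    rw [e]
    refine (norm_add_le _ _).trans_lt ?_
    rw [norm_smul, norm_smul, Real.norm_of_nonneg hs, Real.norm_of_nonneg hr]
    rcases eq_or_lt_of_le hs with rfl | hs'
    · have : r = 1 := by linarith
      subst this; linarith
    · nlinarith [mul_lt_mul_of_pos_left hX' hs', mul_le_mul_of_nonneg_left hY'.le hr]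
  have hl : IsLinearMap ℝ (fun X : Rn1 n => σ * X.2) :=
    ⟨fun _ _ => mul_add _ _ _, fun c X => by simp [mul_left_comm]⟩
  have h2 : Convex ℝ {X : Rn1 n | a ≤ σ * X.2} := convex_halfSpace_ge hl a
  have h3 : Convex ℝ {X : Rn1 n | σ * X.2 ≤ b} := convex_halfSpace_le hl b
  exact h1.inter (h2.inter h3)

/-- Comparison of the values of a solution at points of a cone of comparable height. -/
lemma exists_cone_oscillation (n : ℕ) {C₀ : ℝ} (hC₀ : 0 < C₀) : ∃ C : ℝ≥0,
    ∀ {σ : ℝ} {u : Rn1 n → ℂ} {G : VF n}, HalfSol C₀ σ u G →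
    ∀ (y : Rn n) (τ : ℝ) (M : ℝ≥0∞), 0 < τ →
      (∀ X ∈ cone σ y, τ ≤ σ * X.2 → rms G (eball X (σ * X.2 / 4)) ≤ M) →
      ∀ Z ∈ cone σ y, ∀ Z' ∈ cone σ y, τ ≤ σ * Z.2 → σ * Z.2 ≤ 2 * τ → τ ≤ σ * Z'.2 →
      σ * Z'.2 ≤ 2 * τ → ‖u Z - u Z'‖ₑ ≤ C * ofReal τ * M := by
  obtain ⟨C, h⟩ := exists_local_oscillation n hC₀
  refine ⟨64 * (C * 2), fun {σ u G} hs y τ M hτ hM Z hZ Z' hZ' h1 h2 h3 h4 => ?_⟩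
  have hch := enorm_sub_le_of_chain (convex_cone_slab σ y τ (2 * τ)) (u := u) (ρ := τ / 16)
    (D := C * 2 * ofReal τ * M) (by
      rintro X ⟨hX, hX1, hX2⟩ Y - hd
      refine (h hs X (hτ.trans_le hX1) Y ?_).trans ?_
      · exact mem_closedBall.2 (hd.trans (by linarith))
      · have : ofReal (σ * X.2) ≤ 2 * ofReal τ := by
          rw [show (2 : ℝ≥0∞) = ofReal 2 by simp, ← ofReal_mul (by norm_num)]
          exact ofReal_le_ofReal hX2
        calc _ ≤ C * (2 * ofReal τ) * M := by
              gcongr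
              exact hM X hX hX1
          _ = _ := by ring) 64 Z ⟨hZ, h1, h2⟩ Z' ⟨hZ', h3, h4⟩ (by
        have hZ1 : ‖y - Z.1‖ < σ * Z.2 := hZ
        have hZ2 : ‖y - Z'.1‖ < σ * Z'.2 := hZ'
        rw [Prod.dist_eq]
        refine max_le ?_ ?_
        · rw [dist_eq_norm]
          calc ‖Z.1 - Z'.1‖ = ‖(y - Z'.1) - (y - Z.1)‖ := by congr 1; abel
            _ ≤ ‖y - Z'.1‖ + ‖y - Z.1‖ := norm_sub_le _ _
            _ ≤ _ := by push_cast; linarith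
        · rw [Real.dist_eq, abs_le]
          push_cast
          rcases hs.1 with rfl | rfl <;> constructor <;> linarith)
  refine hch.trans_eq ?_
  push_cast; ring

/-- Dyadic summation in a cone. -/
lemma exists_cone_limit (hσ : σ = 1 ∨ σ = -1) {u : Rn1 n → ℂ} {y : Rn n} {θ K : ℝ} (hθ : 0 < θ)
    (h : ∀ τ : ℝ, 0 < τ → ∀ Z ∈ cone σ y, ∀ Z' ∈ cone σ y, τ ≤ σ * Z.2 → σ * Z.2 ≤ 2 * τ →
      τ ≤ σ * Z'.2 → σ * Z'.2 ≤ 2 * τ → ‖u Z - u Z'‖ ≤ K * τ ^ θ) :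
    ∃ l : ℂ, Tendsto (fun s : ℝ => u (y, σ * s)) (𝓝[>] 0) (𝓝 l) ∧
      ∀ Z ∈ cone σ y, ‖u Z - l‖ ≤ K / (1 - 2⁻¹ ^ θ) * (σ * Z.2) ^ θ := by
  have hss := sign_mul_self hσ
  have hax : ∀ s : ℝ, 0 < s → (y, σ * s) ∈ cone σ y := fun s hs => by
    change ‖y - y‖ < σ * (σ * s)
    rw [← mul_assoc, hss]; simpa using hs
  have hht : ∀ s : ℝ, σ * (σ * s) = s := fun s => by rw [← mul_assoc, hss, one_mul]
  have hpos : ∀ Z ∈ cone σ y, 0 < σ * Z.2 := fun Z hZ => (norm_nonneg (y - Z.1)).trans_lt hZ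
  have hK : 0 ≤ K := by
    have := h 1 one_pos _ (hax 1 one_pos) _ (hax 1 one_pos) (by rw [hht])
      (by rw [hht]; norm_num) (by rw [hht]) (by rw [hht]; norm_num)
    rw [Real.one_rpow] at this
    linarith [norm_nonneg (u (y, σ * 1) - u (y, σ * 1))]
  set q : ℝ := 2⁻¹ ^ θ with hq
  have hq0 : 0 < q := by positivity
  have hq1 : q < 1 := Real.rpow_lt_one (by norm_num) (by norm_num) hθ
  have hKq : K ≤ K / (1 - q) := le_div_self hK (by linarith) (by linarith)
  have hkey : ∀ k : ℕ, ∀ Z ∈ cone σ y, ∀ s : ℝ, 0 < s → σ * Z.2 ≤ 2 ^ k * s → s ≤ σ * Z.2 →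
      ‖u Z - u (y, σ * s)‖ ≤ K / (1 - q) * (σ * Z.2) ^ θ := by
    intro k
    induction k with
    | zero =>
      intro Z hZ s hs h1 h2
      have h0 : σ * Z.2 = s := le_antisymm (by simpa using h1) h2
      refine (h s hs Z hZ _ (hax s hs) h2 (by linarith) (by simp [hht])
        (by rw [hht]; linarith)).trans ?_
      rw [h0]
      exact mul_le_mul_of_nonneg_right hKq (Real.rpow_nonneg hs.le _)
    | succ k ih =>
      intro Z hZ s hs h1 h2
      set τ := σ * Z.2 / 2 with hτ
      have hτ0 : 0 < τ := by have := hpos Z hZ; positivity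
      have hZτ : σ * Z.2 = 2 * τ := by rw [hτ]; ring
      have hmono : K * τ ^ θ ≤ K * (σ * Z.2) ^ θ := by gcongr; linarith
      by_cases hs2 : τ ≤ s
      · refine (h τ hτ0 Z hZ _ (hax s hs) (by linarith) hZτ.le (by rwa [hht])
          (by rw [hht]; linarith)).trans (hmono.trans ?_)
        exact mul_le_mul_of_nonneg_right hKq (Real.rpow_nonneg (hpos Z hZ).le _)
      · have hi := ih _ (hax τ hτ0) s hs (by
          rw [hht]; rw [pow_succ] at h1; linarith) (by rw [hht]; linarith)
        have hj := h τ hτ0 Z hZ _ (hax τ hτ0) (by linarith) hZτ.le (by simp [hht])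
          (by rw [hht]; linarith)
        rw [hht] at hi
        have hτq : τ ^ θ = q * (σ * Z.2) ^ θ := by
          rw [hq, ← Real.mul_rpow (by norm_num) (hpos Z hZ).le, hτ]
          congr 1; ring
        calc ‖u Z - u (y, σ * s)‖ = ‖(u Z - u (y, σ * τ)) + (u (y, σ * τ) - u (y, σ * s))‖ := by
              congr 1; ring
          _ ≤ K * (σ * Z.2) ^ θ + K / (1 - q) * (q * (σ * Z.2) ^ θ) := by
              rw [hτq] at hi
              exact (norm_add_le _ _).trans (add_le_add (hj.trans hmono) hi)
          _ = _ := by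
              have : 1 - q ≠ 0 := by linarith
              field_simp
              ring
  have hkey' : ∀ Z ∈ cone σ y, ∀ s : ℝ, 0 < s → s ≤ σ * Z.2 →
      ‖u Z - u (y, σ * s)‖ ≤ K / (1 - q) * (σ * Z.2) ^ θ := by
    intro Z hZ s hs hle
    obtain ⟨k, hk⟩ := pow_unbounded_of_one_lt (σ * Z.2 / s) one_lt_two
    exact hkey k Z hZ s hs ((div_le_iff₀ hs).1 hk.le) hle
  have hD : 0 ≤ K / (1 - q) := div_nonneg hK (by linarith)
  have hlim0 : Tendsto (fun s : ℝ => K / (1 - q) * s ^ θ) (𝓝[>] 0) (𝓝 0) := by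
    have : Tendsto (fun s : ℝ => K / (1 - q) * s ^ θ) (𝓝 0) (𝓝 (K / (1 - q) * 0 ^ θ)) :=
      ((Real.continuous_rpow_const hθ.le).tendsto 0).const_mul _
    rw [Real.zero_rpow hθ.ne', mul_zero] at this
    exact this.mono_left nhdsWithin_le_nhds
  have hc : Cauchy (map (fun s : ℝ => u (y, σ * s)) (𝓝[>] 0)) := by
    rw [Metric.cauchy_iff]
    refine ⟨inferInstance, fun ε hε => ?_⟩
    obtain ⟨h0, hh1, hh2⟩ := ((hlim0.eventually (gt_mem_nhds (half_pos hε))).and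
      self_mem_nhdsWithin).exists
    have hh0 : 0 < h0 := hh2
    refine ⟨_, image_mem_map (Ioc_mem_nhdsGT hh0), ?_⟩
    rintro _ ⟨s, hs, rfl⟩ _ ⟨s', hs', rfl⟩
    have e1 := hkey' _ (hax h0 hh0) s hs.1 (by rw [hht]; exact hs.2)
    have e2 := hkey' _ (hax h0 hh0) s' hs'.1 (by rw [hht]; exact hs'.2)
    rw [hht] at e1 e2
    rw [dist_eq_norm]
    calc _ = ‖(u (y, σ * h0) - u (y, σ * s')) - (u (y, σ * h0) - u (y, σ * s))‖ := by congr 1; ring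
      _ ≤ _ := norm_sub_le _ _
      _ < ε := by linarith
  obtain ⟨l, hl⟩ := cauchy_map_iff_exists_tendsto.1 hc
  refine ⟨l, hl, fun Z hZ => ?_⟩
  refine le_of_tendsto (hl.const_sub (u Z)).norm ?_
  filter_upwards [Ioc_mem_nhdsGT (hpos Z hZ)] with s hs
  exact hkey' Z hZ s hs.1 hs.2

lemma tendsto_cone_of_norm_sub_le {u : Rn1 n → ℂ} {y : Rn n} {l : ℂ} {θ K : ℝ} (hθ : 0 < θ)
    (h : ∀ Z ∈ cone σ y, ‖u Z - l‖ ≤ K * (σ * Z.2) ^ θ) :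
    Tendsto u (𝓝[cone σ y] (y, (0 : ℝ))) (𝓝 l) := by
  rw [tendsto_iff_norm_sub_tendsto_zero]
  have hlim : Tendsto (fun Z : Rn1 n => K * (σ * Z.2) ^ θ) (𝓝[cone σ y] (y, (0 : ℝ))) (𝓝 0) := by
    have hcont : Continuous fun Z : Rn1 n => K * (σ * Z.2) ^ θ :=
      continuous_const.mul ((Real.continuous_rpow_const hθ.le).comp (by fun_prop))
    have := hcont.tendsto (y, (0 : ℝ))
    simp only [mul_zero, Real.zero_rpow hθ.ne'] at this
    exact this.mono_left nhdsWithin_le_nhds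
  refine squeeze_zero' (.of_forall fun _ => norm_nonneg _) ?_ hlim
  filter_upwards [self_mem_nhdsWithin] with Z hZ
  exact h Z hZ

/-- The vertical limit of `u` at the boundary. -/
def trace (σ : ℝ) (u : Rn1 n → ℂ) (y : Rn n) : ℂ := limUnder (𝓝[>] (0 : ℝ)) fun s => u (y, σ * s)

lemma trace_spec (hσ : σ = 1 ∨ σ = -1) {u : Rn1 n → ℂ} {y : Rn n} {θ K : ℝ} (hθ : 0 < θ)
    (h : ∀ τ : ℝ, 0 < τ → ∀ Z ∈ cone σ y, ∀ Z' ∈ cone σ y, τ ≤ σ * Z.2 → σ * Z.2 ≤ 2 * τ →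
      τ ≤ σ * Z'.2 → σ * Z'.2 ≤ 2 * τ → ‖u Z - u Z'‖ ≤ K * τ ^ θ) :
    ∀ Z ∈ cone σ y, ‖u Z - trace σ u y‖ ≤ K / (1 - 2⁻¹ ^ θ) * (σ * Z.2) ^ θ := by
  obtain ⟨l, hl, h1⟩ := exists_cone_limit hσ hθ h
  have : trace σ u y = l := hl.limUnder_eq
  rwa [this]

lemma aestronglyMeasurable_trace (hσ : σ = 1 ∨ σ = -1) {u : Rn1 n → ℂ}
    (hc : ContinuousOn u (halfSpace n σ))
    (h : ∀ᵐ y : Rn n, Tendsto u (𝓝[cone σ y] (y, (0 : ℝ))) (𝓝 (trace σ u y))) :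
    AEStronglyMeasurable (trace σ u) := by
  have hss := sign_mul_self hσ
  have hpos : ∀ k : ℕ, 0 < (1 : ℝ) / (k + 1) := fun k => by positivity
  refine aestronglyMeasurable_of_tendsto_ae atTop
    (f := fun (k : ℕ) (y : Rn n) => u (y, σ * (1 / (k + 1)))) (fun k => ?_) ?_
  · refine Continuous.aestronglyMeasurable ?_
    rw [← continuousOn_univ]
    refine hc.comp (by fun_prop) fun y _ => ?_
    change 0 < σ * (σ * (1 / ((k : ℝ) + 1)))
    rw [← mul_assoc, hss, one_mul]; exact hpos k
  · filter_upwards [h] with y hy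
    refine hy.comp (tendsto_nhdsWithin_iff.2 ⟨?_, .of_forall fun k => ?_⟩)
    · have := (tendsto_one_div_add_atTop_nhds_zero_nat (𝕜 := ℝ)).const_mul σ
      rw [mul_zero] at this
      exact tendsto_const_nhds.prodMk_nhds this
    · change ‖y - y‖ < σ * (σ * (1 / ((k : ℝ) + 1)))
      rw [← mul_assoc, hss, one_mul, sub_self, norm_zero]; exact hpos k

/-- Trace of a solution with finite maximal function of the gradient. -/
lemma exists_trace_estimate (n : ℕ) {C₀ : ℝ} (hC₀ : 0 < C₀) : ∃ C : ℝ, 0 < C ∧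
    ∀ {σ : ℝ} {u : Rn1 n → ℂ} {G : VF n}, HalfSol C₀ σ u G →
    ∀ y : Rn n, ntMax σ G y ≠ ⊤ →
      ∀ Z ∈ cone σ y, ‖u Z - trace σ u y‖ ≤ C * (ntMax σ G y).toReal * (σ * Z.2) := by
  obtain ⟨C, h⟩ := exists_cone_oscillation n hC₀
  refine ⟨2 * (C + 1), by positivity, fun {σ u G} hs y hN Z hZ => ?_⟩
  have hpos : 0 < σ * Z.2 := (norm_nonneg (y - Z.1)).trans_lt hZ
  have h1 := trace_spec hs.1 (u := u) (y := y) (θ := 1) (K := C * (ntMax σ G y).toReal) one_pos (by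
    intro τ hτ Z hZ Z' hZ' h1 h2 h3 h4
    have := h hs y τ (ntMax σ G y) hτ
      (fun X hX _ => rms_le_ntMax hs.1 G (x₀ := X.1) (t := X.2) hX) Z hZ Z' hZ' h1 h2 h3 h4
    have h5 := ENNReal.toReal_mono (by finiteness) this
    rw [toReal_enorm, toReal_mul, toReal_mul, toReal_ofReal hτ.le] at h5
    rw [Real.rpow_one]
    refine h5.trans_eq ?_
    simp only [ENNReal.coe_toReal]; ring) Z hZ
  refine h1.trans ?_
  rw [Real.rpow_one, Real.rpow_one]
  norm_num
  have : (0:ℝ) ≤ (ntMax σ G y).toReal * (σ * Z.2) := by positivity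
  have hC : (0:ℝ) ≤ C := C.2
  nlinarith

lemma exists_trace_lipschitz (n : ℕ) {C₀ : ℝ} (hC₀ : 0 < C₀) : ∃ C : ℝ, 0 < C ∧
    ∀ {σ : ℝ} {u : Rn1 n → ℂ} {G : VF n}, HalfSol C₀ σ u G →
    ∀ x y : Rn n, ntMax σ G x ≠ ⊤ → ntMax σ G y ≠ ⊤ →
      ‖trace σ u x - trace σ u y‖ ≤
        C * ‖x - y‖ * ((ntMax σ G x).toReal + (ntMax σ G y).toReal) := by
  obtain ⟨C, hC, h⟩ := exists_trace_estimate n hC₀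
  refine ⟨2 * C, by positivity, fun {σ u G} hs x y hx hy => ?_⟩
  have hss := sign_mul_self hs.1
  rcases eq_or_ne x y with rfl | hne
  · simp
  have hr : 0 < ‖x - y‖ := norm_pos_iff.2 (sub_ne_zero.2 hne)
  set r := ‖x - y‖ with hrd
  set Z : Rn1 n := (y, σ * (2 * r))
  have hZ2 : σ * Z.2 = 2 * r := by
    change σ * (σ * (2 * r)) = _
    rw [← mul_assoc, hss, one_mul]
  have hZx : Z ∈ cone σ x := by
    change ‖x - y‖ < σ * Z.2
    rw [hZ2]; linarith
  have hZy : Z ∈ cone σ y := by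
    change ‖y - y‖ < σ * Z.2
    rw [hZ2, sub_self, norm_zero]; linarith
  have e1 := h hs x hx Z hZx
  have e2 := h hs y hy Z hZy
  rw [hZ2] at e1 e2
  calc _ = ‖(u Z - trace σ u y) - (u Z - trace σ u x)‖ := by congr 1; ring
    _ ≤ _ := norm_sub_le _ _
    _ ≤ _ := by linarith

/-! ### Functionals on test functions dominated by an integral -/

/-- Riesz representation of a functional that factors, with a bound, through a Hilbert space. -/
lemma exists_inner_eq {W H : Type*} [AddCommGroup W] [Module ℂ W] [NormedAddCommGroup H]
    [InnerProductSpace ℂ H] [CompleteSpace H] (J : W →ₗ[ℂ] H) (D : W →ₗ[ℂ] ℂ) {C : ℝ}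
    (h : ∀ w, ‖D w‖ ≤ C * ‖J w‖) : ∃ v : H, ∀ w, D w = inner ℂ v (J w) := by
  have hker : LinearMap.ker J ≤ LinearMap.ker D := fun w hw => by
    have h1 := h w
    rw [LinearMap.mem_ker.1 hw, norm_zero, mul_zero] at h1
    exact norm_le_zero_iff.1 h1
  set D' : LinearMap.range J →ₗ[ℂ] ℂ :=
    ((LinearMap.ker J).liftQ D hker).comp J.quotKerEquivRange.symm.toLinearMap
  have hD' : ∀ w, D' ⟨J w, LinearMap.mem_range_self J w⟩ = D w := fun w => by
    change (LinearMap.ker J).liftQ D hker (J.quotKerEquivRange.symm ⟨J w, _⟩) = _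
    rw [LinearMap.quotKerEquivRange_symm_apply_image]
    rfl
  obtain ⟨g, hg, -⟩ := exists_extension_norm_eq (𝕜 := ℂ) (LinearMap.range J) (D'.mkContinuous C (by
      rintro ⟨_, w, rfl⟩
      rw [hD']
      exact h w))
  refine ⟨(InnerProductSpace.toDual ℂ H).symm g, fun w => ?_⟩
  rw [InnerProductSpace.toDual_symm_apply, ← hD' w]
  exact (hg ⟨J w, LinearMap.mem_range_self J w⟩).symm

variable (E) in
/-- The space `C₀^∞`. -/
def testFun : Submodule ℂ (E → ℂ) where
  carrier := {φ | ContDiff ℝ ∞ φ ∧ HasCompactSupport φ}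
  add_mem' := fun ha hb => ⟨ha.1.add hb.1, ha.2.add hb.2⟩
  zero_mem' := ⟨contDiff_const, HasCompactSupport.zero⟩
  smul_mem' := fun c _ ha => ⟨ha.1.const_smul c, ha.2.smul_left⟩

lemma locallyIntegrable_rpow_weight {p : ℝ} (hp : 1 ≤ p) {M m : Rn n → ℝ} (hM : Measurable M)
    (hm : Continuous m) (hm0 : ∀ x, 0 < m x) (hmM : ∀ x, m x ≤ M x)
    (hint : Integrable fun x => M x ^ p) : LocallyIntegrable fun x => M x ^ (2 - p) := by
  rw [locallyIntegrable_iff]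
  intro K hK
  have hfin : IsFiniteMeasure ((volume : Measure (Rn n)).restrict K) :=
    ⟨by simpa using hK.measure_lt_top⟩
  obtain ⟨c, hc⟩ : ∃ c : ℝ, ∀ x ∈ K, M x ^ (2 - p) ≤ c + M x ^ p := by
    rcases K.eq_empty_or_nonempty with rfl | hne
    · exact ⟨0, fun x hx => absurd hx (notMem_empty x)⟩
    obtain ⟨x₀, -, hx₀⟩ := hK.exists_isMinOn hne hm.continuousOn
    refine ⟨1 + m x₀ ^ (2 - p), fun x hx => ?_⟩
    have hMx : 0 < M x := (hm0 x).trans_le (hmM x)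
    have h0 : 0 < m x₀ ^ (2 - p) := Real.rpow_pos_of_pos (hm0 x₀) _
    have h1 : 0 < M x ^ p := Real.rpow_pos_of_pos hMx _
    rcases le_total p 2 with h2 | h2
    · rcases le_total (M x) 1 with h3 | h3
      · linarith [Real.rpow_le_one hMx.le h3 (by linarith : 0 ≤ 2 - p)]
      · linarith [Real.rpow_le_rpow_of_exponent_le h3 (by linarith : 2 - p ≤ p)]
    · have : M x ^ (2 - p) ≤ m x₀ ^ (2 - p) :=
        Real.rpow_le_rpow_of_nonpos (hm0 x₀) ((hx₀ hx).trans (hmM x)) (by linarith)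
      linarith
  refine Integrable.mono' ((integrable_const c).add hint.integrableOn)
    (hM.pow_const _).aestronglyMeasurable ((ae_restrict_iff' hK.measurableSet).2
      (.of_forall fun x hx => ?_))
  rw [Real.norm_of_nonneg (Real.rpow_nonneg ((hm0 x).le.trans (hmM x)) _)]
  exact hc x hx

lemma norm_le_of_forall_testFun {g : Rn n → ℂ} {M : Rn n → ℝ} (hg : LocallyIntegrable g)
    (hM : LocallyIntegrable M)
    (h : ∀ φ ∈ testFun (Rn n), ‖∫ x, g x * φ x‖ ≤ ∫ x, M x * ‖φ x‖) : ∀ᵐ x, ‖g x‖ ≤ M x := by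
  have hb : ∀ᶠ k in atTop, (bump (Rn n) k).rOut ≤ 2 * (bump (Rn n) k).rIn :=
    .of_forall fun k => by
      change (1 : ℝ) / (k + 1) ≤ 2 * (1 / (2 * (k + 1)))
      have : (0 : ℝ) < k + 1 := by positivity
      field_simp; norm_num
  filter_upwards [ContDiffBump.ae_convolution_tendsto_right_of_locallyIntegrable
    bump_rOut_tendsto hb hg, ContDiffBump.ae_convolution_tendsto_right_of_locallyIntegrable
    bump_rOut_tendsto hb hM] with x hx1 hx2
  refine le_of_tendsto_of_tendsto hx1.norm hx2 (.of_forall fun k => ?_)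
  change ‖moll (bump (Rn n) k) g x‖ ≤ moll (bump (Rn n) k) M x
  rw [moll_apply_swap, moll_apply_swap]
  set ρ := (bump (Rn n) k).normed volume
  have hρ0 : ∀ z, 0 ≤ ρ z := fun z => ContDiffBump.nonneg_normed _ z
  have hφ : (fun y => ((ρ (x - y) : ℝ) : ℂ)) ∈ testFun (Rn n) := by
    refine ⟨Complex.ofRealCLM.contDiff.comp
      ((ContDiffBump.contDiff_normed _).comp (contDiff_const.sub contDiff_id)), ?_⟩
    have h1 : HasCompactSupport fun y => ρ (x - y) :=
      (ContDiffBump.hasCompactSupport_normed (bump (Rn n) k)).comp_homeomorph (Homeomorph.subLeft x)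
    exact h1.comp_left (g := fun r : ℝ => (r : ℂ)) (by simp)
  have h2 := h _ hφ
  calc _ = ‖∫ y, g y * ((ρ (x - y) : ℝ) : ℂ)‖ := by congr 2; ext y; rw [Complex.real_smul, mul_comm]
    _ ≤ _ := h2
    _ = _ := by
        congr 1; ext y
        rw [Complex.norm_real, Real.norm_of_nonneg (hρ0 _), smul_eq_mul, mul_comm]

set_option maxHeartbeats 1000000 in
/-- A functional on `C₀^∞` dominated by integration against a weight is given by a function
dominated by that weight. -/
lemma exists_density {p : ℝ} (hp : 1 ≤ p) {M m : Rn n → ℝ} (hM : Measurable M)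
    (hm : Continuous m) (hm0 : ∀ x, 0 < m x) (hmM : ∀ x, m x ≤ M x)
    (hint : Integrable fun x => M x ^ p) (D : testFun (Rn n) →ₗ[ℂ] ℂ)
    (hD : ∀ φ : testFun (Rn n), ‖D φ‖ ≤ ∫ x, M x * ‖(φ : Rn n → ℂ) x‖) :
    ∃ g : Rn n → ℂ, LocallyIntegrable g ∧ (∀ᵐ x, ‖g x‖ ≤ M x) ∧
      ∀ φ : testFun (Rn n), D φ = ∫ x, g x * (φ : Rn n → ℂ) x := by
  have hM0 : ∀ x, 0 < M x := fun x => (hm0 x).trans_le (hmM x)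
  set k : Rn n → ℝ := fun x => M x ^ (1 - p / 2) with hk
  have hkm : Measurable k := hM.pow_const _
  have hk0 : ∀ x, 0 < k x := fun x => Real.rpow_pos_of_pos (hM0 x) _
  have hksq : ∀ x, k x ^ 2 = M x ^ (2 - p) := fun x => by
    rw [hk, ← Real.rpow_natCast, ← Real.rpow_mul (hM0 x).le]
    congr 1; push_cast; ring
  have hkl := locallyIntegrable_rpow_weight hp hM hm hm0 hmM hint
  have hkL : ∀ K : Set (Rn n), IsCompact K → MemLp (fun x => (k x : ℂ)) 2 (volOn K) := by
    intro K hK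
    rw [memLp_two_iff_integrable_sq_norm (by fun_prop)]
    refine (hkl.integrableOn_isCompact hK).congr (.of_forall fun x => ?_)
    simp only [Complex.norm_real, Real.norm_of_nonneg (hk0 x).le, hksq]
  have hJ : ∀ φ : testFun (Rn n), MemLp (fun x => (k x : ℂ) * (φ : Rn n → ℂ) x) 2 volume := by
    intro φ
    obtain ⟨B, hB⟩ := φ.2.2.exists_bound_of_continuous φ.2.1.continuous
    have h1 : MemLp ((tsupport (φ : Rn n → ℂ)).indicator fun x => (k x : ℂ)) 2 volume :=
      (memLp_indicator_iff_restrict (isClosed_tsupport _).measurableSet).2 (hkL _ φ.2.2)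
    refine h1.of_le_mul (c := B) (Measurable.aestronglyMeasurable (by
      have := φ.2.1.continuous.measurable; fun_prop)) (.of_forall fun x => ?_)
    by_cases hx : x ∈ tsupport (φ : Rn n → ℂ)
    · rw [indicator_of_mem hx, norm_mul, mul_comm]
      gcongr; exact hB x
    · rw [image_eq_zero_of_notMem_tsupport hx, mul_zero, norm_zero]
      simp [indicator_of_notMem hx]
  set J : testFun (Rn n) →ₗ[ℂ] Lp ℂ 2 (volume : Measure (Rn n)) :=
    { toFun := fun φ => (hJ φ).toLp _
      map_add' := fun φ ψ => by
        rw [← MemLp.toLp_add]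
        refine MemLp.toLp_congr _ _ (.of_forall fun x => ?_)
        simp [mul_add]
      map_smul' := fun c φ => by
        rw [RingHom.id_apply, ← MemLp.toLp_const_smul]
        refine MemLp.toLp_congr _ _ (.of_forall fun x => ?_)
        simp [mul_left_comm] } with hJd
  set l : Rn n → ℝ := fun x => M x ^ (p / 2) with hl
  have hl0 : ∀ x, 0 < l x := fun x => Real.rpow_pos_of_pos (hM0 x) _
  have hlk : ∀ x, l x * k x = M x := fun x => by
    rw [hl, hk, ← Real.rpow_add (hM0 x)]
    rw [add_sub_cancel, Real.rpow_one]
  have hlL : MemLp l 2 volume := by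
    rw [memLp_two_iff_integrable_sq_norm (hM.pow_const _).aestronglyMeasurable]
    refine hint.congr (.of_forall fun x => ?_)
    change M x ^ p = ‖l x‖ ^ 2
    rw [Real.norm_of_nonneg (hl0 x).le, hl, ← Real.rpow_natCast, ← Real.rpow_mul (hM0 x).le]
    congr 1; push_cast; ring
  have hbound : ∀ φ, ‖D φ‖ ≤ (eLpNorm l 2 volume).toReal * ‖J φ‖ := by
    intro φ
    refine (hD φ).trans ?_
    have h1 : ∫ x, M x * ‖(φ : Rn n → ℂ) x‖ = ∫ x, l x * ‖(k x : ℂ) * (φ : Rn n → ℂ) x‖ := by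
      congr 1; ext x
      rw [norm_mul, Complex.norm_real, Real.norm_of_nonneg (hk0 x).le, ← mul_assoc, hlk]
    rw [h1]
    have hJn : ‖J φ‖ = (eLpNorm (fun x => ‖(k x : ℂ) * (φ : Rn n → ℂ) x‖) 2 volume).toReal := by
      rw [eLpNorm_norm]
      exact Lp.norm_toLp _ (hJ φ)
    have h2 := eLpNorm_smul_le_mul_eLpNorm (p := 2) (q := 2) (r := 1) (hJ φ).norm.1 hlL.1
    have h3 : ∫ x, l x * ‖(k x : ℂ) * (φ : Rn n → ℂ) x‖
        = (eLpNorm (l • fun x => ‖(k x : ℂ) * (φ : Rn n → ℂ) x‖) 1 volume).toReal := by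
      rw [eLpNorm_one_eq_lintegral_enorm, integral_eq_lintegral_of_nonneg_ae
        (.of_forall fun x => mul_nonneg (hl0 x).le (norm_nonneg _))
        (hlL.1.mul (hJ φ).norm.1)]
      congr 1
      refine lintegral_congr fun x => ?_
      rw [Pi.smul_apply', smul_eq_mul, Real.enorm_eq_ofReal (mul_nonneg (hl0 x).le (norm_nonneg _))]
    rw [h3, hJn, ← toReal_mul]
    exact ENNReal.toReal_mono (mul_ne_top hlL.2.ne (hJ φ).norm.2.ne) h2
  obtain ⟨v, hv⟩ := exists_inner_eq J D hbound
  set g : Rn n → ℂ := fun x => (starRingEnd ℂ) (v x) * k x with hg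
  have hgl : LocallyIntegrable g := by
    rw [locallyIntegrable_iff]
    intro K hK
    exact (((Lp.memLp v).star).restrict K).integrable_mul (hkL K hK)
  have hrep : ∀ φ : testFun (Rn n), D φ = ∫ x, g x * (φ : Rn n → ℂ) x := by
    intro φ
    rw [hv φ, L2.inner_def]
    refine integral_congr_ae ?_
    filter_upwards [(hJ φ).coeFn_toLp] with x hx
    change inner ℂ (v x) (((hJ φ).toLp _ : Lp ℂ 2 (volume : Measure (Rn n))) x) = _
    rw [hx, RCLike.inner_apply, hg]
    ring
  have hMl : LocallyIntegrable M := by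
    rw [locallyIntegrable_iff]
    intro K hK
    have hfin : IsFiniteMeasure ((volume : Measure (Rn n)).restrict K) :=
      ⟨by simpa using hK.measure_lt_top⟩
    refine Integrable.mono' ((integrable_const (1 : ℝ)).add hint.integrableOn)
      hM.aestronglyMeasurable (.of_forall fun x => ?_)
    rw [Real.norm_of_nonneg (hM0 x).le]
    change _ ≤ 1 + M x ^ p
    rcases le_total (M x) 1 with h | h
    · linarith [Real.rpow_pos_of_pos (hM0 x) p]
    · linarith [Real.self_le_rpow_of_one_le h hp]
  refine ⟨g, hgl, norm_le_of_forall_testFun hgl hMl fun φ hφ => ?_, hrep⟩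
  rw [← hrep ⟨φ, hφ⟩]
  exact hD ⟨φ, hφ⟩

/-! ### The co-normal derivative on a slice -/

lemma hasWeakDeriv_of_lipschitz {f : E → ℝ} {C : ℝ≥0} (hf : LipschitzWith C f) (e : E) :
    HasWeakDeriv univ e (fun x => (f x : ℂ)) fun x => ((lineDeriv ℝ f x e : ℝ) : ℂ) := by
  intro φ hφ hc _
  have hd := smooth_fderiv hφ e
  have hdc := hcs_fderiv hc e
  have hmeas : AEStronglyMeasurable (fun x => lineDeriv ℝ f x e) (volume : Measure E) :=
    (measurable_lineDeriv hf.continuous).aestronglyMeasurable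
  have hbd : ∀ x, ‖lineDeriv ℝ f x e‖ ≤ C * ‖e‖ := fun x => norm_lineDeriv_le_of_lipschitz ℝ hf
  have key : ∀ L : ℂ →L[ℝ] ℝ, ∫ x, f x * L (fderiv ℝ φ x e) = -∫ x, lineDeriv ℝ f x e * L (φ x) := by
    intro L
    have h1 : ContDiff ℝ ∞ fun x => L (φ x) := L.contDiff.comp hφ
    have h2 : HasCompactSupport fun x => L (φ x) := hc.comp_left L.map_zero
    obtain ⟨D, hD⟩ := h1.lipschitzWith_of_hasCompactSupport h2 (by simp)
    have h3 := LipschitzWith.integral_lineDeriv_mul_eq (μ := (volume : Measure E)) hf hD h2 e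
    have h4 : ∀ x, lineDeriv ℝ (fun x => L (φ x)) x (-e) = -L (fderiv ℝ φ x e) := by
      intro x
      have : HasFDerivAt (fun x => L (φ x)) (L ∘L fderiv ℝ φ x) x := (L.hasFDerivAt.comp x (hφ.differentiable (by simp) x).hasFDerivAt)
      rw [(this.hasLineDerivAt (-e)).lineDeriv]
      simp
    rw [h3, ← integral_neg]
    congr 1; ext x
    rw [h4]; ring
  have hI1 : Integrable fun x => (f x : ℂ) * fderiv ℝ φ x e :=
    (by have := hf.continuous; have := hd.continuous; fun_prop :
      Continuous fun x => (f x : ℂ) * fderiv ℝ φ x e).integrable_of_hasCompactSupport hdc.mul_left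
  have hI2 : Integrable fun x => ((lineDeriv ℝ f x e : ℝ) : ℂ) * φ x :=
    Integrable.bdd_mul (hφ.continuous.integrable_of_hasCompactSupport hc)
      (Complex.continuous_ofReal.comp_aestronglyMeasurable hmeas)
      (.of_forall fun x => by rw [Complex.norm_real]; exact hbd x)
  have hre : ∀ {F : E → ℂ}, Integrable F → (∫ x, F x).re = ∫ x, (F x).re := fun h =>
    (Complex.reCLM.integral_comp_comm h).symm
  have him : ∀ {F : E → ℂ}, Integrable F → (∫ x, F x).im = ∫ x, (F x).im := fun h =>
    (Complex.imCLM.integral_comp_comm h).symm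
  apply Complex.ext
  · rw [hre hI1, Complex.neg_re, hre hI2]
    simpa using key Complex.reCLM
  · rw [him hI1, Complex.neg_im, him hI2]
    simpa using key Complex.imCLM

/-- The ramp from `0` at height `t` to `1` at height `t + σδ`. -/
def ramp (σ t δ s : ℝ) : ℝ := max 0 (min 1 (σ * (s - t) / δ))

lemma ramp_nonneg (σ t δ s : ℝ) : 0 ≤ ramp σ t δ s := le_max_left _ _

lemma ramp_le_one (σ t δ s : ℝ) : ramp σ t δ s ≤ 1 := max_le zero_le_one (min_le_left _ _)

lemma ramp_of_nonpos {t δ s : ℝ} (hδ : 0 < δ) (h : σ * (s - t) ≤ 0) : ramp σ t δ s = 0 :=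
  max_eq_left ((min_le_right _ _).trans (div_nonpos_of_nonpos_of_nonneg h hδ.le))

lemma ramp_of_ge {t δ s : ℝ} (hδ : 0 < δ) (h : δ ≤ σ * (s - t)) : ramp σ t δ s = 1 := by
  rw [ramp, min_eq_left ((one_le_div hδ).2 h), max_eq_right zero_le_one]

lemma ramp_of_mem {t δ s : ℝ} (hδ : 0 < δ) (h0 : 0 ≤ σ * (s - t)) (h : σ * (s - t) ≤ δ) :
    ramp σ t δ s = σ * (s - t) / δ := by
  rw [ramp, min_eq_right ((div_le_one hδ).2 h), max_eq_right (div_nonneg h0 hδ.le)]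

lemma lipschitzWith_ramp (hσ : σ = 1 ∨ σ = -1) (t : ℝ) {δ : ℝ} (hδ : 0 < δ) :
    LipschitzWith (Real.toNNReal (1 / δ)) fun X : Rn1 n => ramp σ t δ X.2 := by
  have h1 : LipschitzWith (Real.toNNReal (1 / δ)) fun X : Rn1 n => σ * (X.2 - t) / δ := by
    refine LipschitzWith.of_dist_le_mul fun X Y => ?_
    have hle : |X.2 - Y.2| ≤ dist X Y := by
      rw [← Real.dist_eq, Prod.dist_eq]; exact le_max_right _ _
    have ha : |σ| = 1 := by rcases hσ with rfl | rfl <;> norm_num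
    rw [Real.dist_eq, show σ * (X.2 - t) / δ - σ * (Y.2 - t) / δ = σ * (1 / δ) * (X.2 - Y.2) by ring,
      abs_mul, abs_mul, ha, one_mul, abs_of_pos (by positivity : 0 < 1 / δ),
      Real.coe_toNNReal _ (by positivity)]
    gcongr
  exact (h1.const_min 1).const_max 0

lemma lineDeriv_ramp_castSucc (t δ : ℝ) (X : Rn1 n) (i : Fin n) :
    lineDeriv ℝ (fun X : Rn1 n => ramp σ t δ X.2) X (dir i.castSucc) = 0 := by
  simp [lineDeriv, dir]

lemma mem_uIoc_iff_of_ne (hσ : σ = 1 ∨ σ = -1) {t δ s : ℝ} (hδ : 0 < δ)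
    (h0 : σ * (s - t) ≠ 0) (h1 : σ * (s - t) ≠ δ) :
    s ∈ uIoc t (t + σ * δ) ↔ 0 < σ * (s - t) ∧ σ * (s - t) < δ := by
  rcases hσ with rfl | rfl
  · rw [uIoc_of_le (by linarith), mem_Ioc]
    constructor
    · intro h; exact ⟨by linarith [h.1], lt_of_le_of_ne (by linarith [h.2]) h1⟩
    · intro h; exact ⟨by linarith [h.1], by linarith [h.2]⟩
  · rw [uIoc_of_ge (by linarith), mem_Ioc]
    constructor
    · intro h; exact ⟨lt_of_le_of_ne (by linarith [h.2]) (Ne.symm h0), by linarith [h.1]⟩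
    · intro h; exact ⟨by linarith [h.2], by linarith [h.1]⟩

lemma lineDeriv_ramp_last (hσ : σ = 1 ∨ σ = -1) {t δ : ℝ} (hδ : 0 < δ) {X : Rn1 n}
    (h0 : σ * (X.2 - t) ≠ 0) (h1 : σ * (X.2 - t) ≠ δ) :
    ((lineDeriv ℝ (fun X : Rn1 n => ramp σ t δ X.2) X (dir (Fin.last n)) : ℝ) : ℂ)
      = σ * avgKernel σ t δ X.2 := by
  have hd : dir (Fin.last n) = ((0 : Rn n), (1 : ℝ)) := by simp [dir]
  have hc : Continuous fun r : ℝ => σ * (X.2 + r - t) := by fun_prop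
  have hc0 : Tendsto (fun r : ℝ => σ * (X.2 + r - t)) (𝓝 0) (𝓝 (σ * (X.2 - t))) := by
    have := hc.tendsto 0
    rwa [add_zero] at this
  have hl : lineDeriv ℝ (fun X : Rn1 n => ramp σ t δ X.2) X (dir (Fin.last n))
      = deriv (fun r : ℝ => ramp σ t δ (X.2 + r)) 0 := by
    simp [lineDeriv, hd]
  rw [hl]
  unfold avgKernel
  rcases lt_or_gt_of_ne h0 with h2 | h2
  · have e : (fun r : ℝ => ramp σ t δ (X.2 + r)) =ᶠ[𝓝 0] fun _ => 0 :=
      (hc0.eventually (gt_mem_nhds h2)).mono fun r hr => ramp_of_nonpos hδ hr.le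
    rw [e.deriv_eq, deriv_const, indicator_of_notMem]
    · simp
    · rw [mem_uIoc_iff_of_ne hσ hδ h0 h1]
      exact fun h => absurd h.1 h2.not_gt
  rcases lt_or_gt_of_ne h1 with h3 | h3
  · have e : (fun r : ℝ => ramp σ t δ (X.2 + r)) =ᶠ[𝓝 0] fun r => σ * (X.2 + r - t) / δ :=
      ((hc0.eventually (lt_mem_nhds h2)).and (hc0.eventually (gt_mem_nhds h3))).mono
        fun r hr => ramp_of_mem hδ hr.1.le hr.2.le
    have hder : HasDerivAt (fun r : ℝ => σ * (X.2 + r - t) / δ) (σ * 1 / δ) 0 :=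
      ((((hasDerivAt_id (0 : ℝ)).const_add X.2).sub_const t).const_mul σ).div_const δ
    rw [e.deriv_eq, hder.deriv, indicator_of_mem ((mem_uIoc_iff_of_ne hσ hδ h0 h1).2 ⟨h2, h3⟩)]
    push_cast; ring
  · have e : (fun r : ℝ => ramp σ t δ (X.2 + r)) =ᶠ[𝓝 0] fun _ => 1 :=
      (hc0.eventually (lt_mem_nhds h3)).mono fun r hr => ramp_of_ge hδ hr.le
    rw [e.deriv_eq, deriv_const, indicator_of_notMem]
    · simp
    · rw [mem_uIoc_iff_of_ne hσ hδ h0 h1]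
      exact fun h => absurd h.2 h3.not_gt

lemma ae_height_ne (a : ℝ) : ∀ᵐ X : Rn1 n, X.2 ≠ a := by
  have h : ∀ᵐ s : ℝ, s ≠ a := by simp [ae_iff]
  exact (Measure.quasiMeasurePreserving_snd (μ := (volume : Measure (Rn n)))
    (ν := (volume : Measure ℝ))).ae h

lemma hasWeakDeriv_ramp (hσ : σ = 1 ∨ σ = -1) (t : ℝ) {δ : ℝ} (hδ : 0 < δ) (i : Fin (n + 1)) :
    HasWeakDeriv univ (dir i) (fun X : Rn1 n => (ramp σ t δ X.2 : ℂ))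
      fun X => if i = Fin.last n then (σ : ℂ) * avgKernel σ t δ X.2 else 0 := by
  have hss := sign_mul_self hσ
  refine (hasWeakDeriv_of_lipschitz (lipschitzWith_ramp hσ t hδ) (dir i)).congr
    (.of_forall fun _ _ => rfl) ?_
  filter_upwards [ae_height_ne (n := n) t, ae_height_ne (n := n) (t + σ * δ)] with X h1 h2 _
  refine Fin.lastCases ?_ (fun j => ?_) i
  · rw [if_pos rfl]
    refine lineDeriv_ramp_last hσ hδ (fun h => h1 ?_) fun h => h2 ?_
    · rcases hσ with rfl | rfl <;> linarith
    · rcases hσ with rfl | rfl <;> linarith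
  · rw [if_neg (Fin.castSucc_lt_last j).ne, lineDeriv_ramp_castSucc, Complex.ofReal_zero]

/-- The co-normal component of a vector field on `ℝⁿ⁺¹`. -/
def conormalField (A : Coeff n) (F : VF n) (X : Rn1 n) : ℂ := -∑ j, A X.1 (Fin.last n) j * F X j

lemma LocL2.conormalField (hA : Elliptic A Λ) {Ω : Set (Rn1 n)} {F : VF n}
    (hF : LocL2 Ω F) : LocL2 Ω (conormalField A F) := fun K hK hs =>
  (hA.memLp_row (hF K hK hs) (Fin.last n)).neg

lemma conormal_slab {k : ℝ → ℂ} (hk : IsKernel σ k) {F : VF n}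
    (hF : LocL2 (halfSpace n σ) F) :
    ∀ᵐ x : Rn n, conormal A (slab k F) x = slab k (conormalField A F) x := by
  filter_upwards [ae_all_iff.2 fun j => hk.slab_apply hF j, hk.ae_integrable hF] with x hx hi
  have hj : ∀ j, Integrable fun s => k s * F (x, s) j := fun j =>
    (EuclideanSpace.proj (𝕜 := ℂ) j).integrable_comp hi
  simp only [conormal, hx]
  have e : ∀ s, k s • conormalField A F (x, s) = -∑ j, A x (Fin.last n) j * (k s * F (x, s) j) := by
    intro s
    simp only [conormalField, smul_eq_mul, mul_neg, Finset.mul_sum]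
    congr 1
    exact Finset.sum_congr rfl fun j _ => by ring
  simp only [slab, e]
  rw [integral_neg, integral_finsetSum _ fun j _ => (hj j).const_mul _]
  simp only [integral_const_mul, smul_eq_mul]

lemma IsKernel.integral_slab_mul {k : ℝ → ℂ} (hk : IsKernel σ k) {f : Rn1 n → ℂ}
    (hf : LocL2 (halfSpace n σ) f) {ψ : Rn n → ℂ} (hψ : Continuous ψ) (hc : HasCompactSupport ψ) :
    Integrable (fun X : Rn1 n => k X.2 * f X * ψ X.1) ∧
    ∫ x, slab k f x * ψ x = ∫ X : Rn1 n, k X.2 * f X * ψ X.1 := by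
  set B := tsupport ψ
  have hB : IsCompact B := hc
  have hψB : ∀ x, x ∉ B → ψ x = 0 := fun x hx => image_eq_zero_of_notMem_tsupport hx
  obtain ⟨C, hC⟩ := hc.exists_bound_of_continuous hψ
  have hI : Integrable (fun X : Rn n × ℝ => k X.2 * f X * ψ X.1)
      ((volOn B).prod volume) :=
    (hk.integrable_prod hf hB).mul_bdd (c := C)
      (by fun_prop : Continuous fun X : Rn n × ℝ => ψ X.1).aestronglyMeasurable
      (.of_forall fun X => hC _)
  have hz : ∀ X : Rn1 n, X ∉ B ×ˢ (univ : Set ℝ) → k X.2 * f X * ψ X.1 = 0 := fun X hX => by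
    rw [hψB X.1 fun h => hX ⟨h, mem_univ _⟩, mul_zero]
  have hI' : IntegrableOn (fun X : Rn1 n => k X.2 * f X * ψ X.1) (B ×ˢ univ) := by
    rw [IntegrableOn, restrict_prod_univ]; exact hI
  refine ⟨(integrableOn_iff_integrable_of_support_subset fun X hX => by
    by_contra hn; exact hX (hz X hn)).1 hI', ?_⟩
  rw [← setIntegral_eq_integral_of_forall_compl_eq_zero hz, restrict_prod_univ,
    integral_prod _ hI, ← setIntegral_eq_integral_of_forall_compl_eq_zero (s := B)
      fun x hx => by rw [hψB x hx, mul_zero]]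
  congr 1; ext x
  rw [slab, ← integral_mul_const]
  rfl

/-- Integrals over thin horizontal layers tend to zero. -/
lemma tendsto_lintegral_layer (hσ : σ = 1 ∨ σ = -1) {t : ℝ} (ht : 0 < σ * t) {f : Rn1 n → ℂ}
    (hf : LocL2 (halfSpace n σ) f) {B : Set (Rn n)} (hB : IsCompact B) :
    Tendsto (fun δ => ∫⁻ X in B ×ˢ uIoc t (t + σ * δ), ‖f X‖ₑ) (𝓝[>] 0) (𝓝 0) := by
  set K := B ×ˢ uIcc t (t + σ * 1)
  have hK : IsCompact K := hB.prod isCompact_uIcc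
  have hfin : IsFiniteMeasure ((volume : Measure (Rn1 n)).restrict K) :=
    ⟨by simpa using hK.measure_lt_top⟩
  have h1 : ∫⁻ X in K, ‖f X‖ₑ ≠ ⊤ :=
    ((hf K hK fun X hX => slabHeights_pos hσ ht one_pos hX.2).integrable one_le_two).2.ne
  have hJ : ∀ δ : ℝ, 0 < δ → δ ≤ 1 → B ×ˢ uIoc t (t + σ * δ) ⊆ K := by
    intro δ h0 h1 X hX
    refine ⟨hX.1, ?_⟩
    have h2 := mem_slabHeights hσ (uIoc_subset_uIcc hX.2) h0
    rcases hσ with rfl | rfl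
    · rw [uIcc_of_le (by linarith)]; constructor <;> linarith [h2.1, h2.2]
    · rw [uIcc_of_ge (by linarith)]; constructor <;> linarith [h2.1, h2.2]
  have hvol : Tendsto (fun δ => (volume : Measure (Rn1 n)).restrict K (B ×ˢ uIoc t (t + σ * δ)))
      (𝓝[>] 0) (𝓝 0) := by
    have h2 : Tendsto (fun δ : ℝ => volume B * ofReal |σ * δ|) (𝓝[>] 0) (𝓝 0) := by
      have h3 : Tendsto (fun δ : ℝ => ofReal |σ * δ|) (𝓝 0) (𝓝 0) := by
        have : Continuous fun δ : ℝ => ofReal |σ * δ| :=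
          ENNReal.continuous_ofReal.comp (by fun_prop)
        simpa using this.tendsto 0
      have h4 := ENNReal.Tendsto.const_mul (h3.mono_left (nhdsWithin_le_nhds (s := Ioi 0)))
        (Or.inr hB.measure_lt_top.ne : (0 : ℝ≥0∞) ≠ 0 ∨ volume B ≠ ⊤)
      rwa [mul_zero] at h4
    refine tendsto_of_tendsto_of_tendsto_of_le_of_le tendsto_const_nhds h2 (fun _ => zero_le)
      fun δ => ?_
    refine (Measure.restrict_apply_le _ _).trans ?_
    rw [Measure.volume_eq_prod, Measure.prod_prod, Real.volume_uIoc, add_sub_cancel_left]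
  have h2 := tendsto_setLIntegral_zero h1 hvol
  refine h2.congr' ?_
  filter_upwards [Ioc_mem_nhdsGT one_pos] with δ hδ
  rw [Measure.restrict_restrict_of_subset (hJ δ hδ.1 hδ.2)]

lemma norm_integral_layer_le {t δ c : ℝ} {f : Rn1 n → ℂ} {g : Rn1 n → ℂ}
    {B : Set (Rn n)} (hB : IsCompact B)
    (hg : ∀ X ∈ B ×ˢ uIoc t (t + σ * δ), ‖g X‖ ≤ c * ‖f X‖)
    (hg0 : ∀ X, X ∉ B ×ˢ uIoc t (t + σ * δ) → g X = 0) :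
    ‖∫ X, g X‖ₑ ≤ ofReal c * ∫⁻ X in B ×ˢ uIoc t (t + σ * δ), ‖f X‖ₑ := by
  rw [← setIntegral_eq_integral_of_forall_compl_eq_zero hg0, ← lintegral_const_mul' _ _
    ofReal_ne_top]
  refine (enorm_integral_le_lintegral_enorm _).trans
    (setLIntegral_mono' (hB.measurableSet.prod measurableSet_uIoc) fun X hX => ?_)
  rw [← ofReal_norm, ← ofReal_norm (f X), ← ENNReal.ofReal_mul']
  · exact ofReal_le_ofReal (hg X hX)
  · exact norm_nonneg _

/-- The solution tested against a truncated test function. -/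
lemma VerticalPair.integral_ramp {u w : Rn1 n → ℂ} {G H : VF n}
    (hP : VerticalPair A σ u w G H) (hσ : σ = 1 ∨ σ = -1) (hA : Elliptic A Λ) {t δ : ℝ}
    (ht : 0 < σ * t) (hδ : 0 < δ) {Φ : Rn1 n → ℂ} (hΦ : ContDiff ℝ ∞ Φ)
    (hc : HasCompactSupport Φ) :
    IntegrableOn (energy A G Φ) {X | 0 ≤ σ * (X.2 - t)} ∧
    ∫ X, (ramp σ t δ X.2 : ℂ) * energy A G Φ X
      = σ * ∫ X, avgKernel σ t δ X.2 * conormalField A G X * Φ X := by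
  set S : Set (Rn1 n) := tsupport Φ ∩ {X | 0 ≤ σ * (X.2 - t)} with hSd
  have hcl : IsClosed {X : Rn1 n | 0 ≤ σ * (X.2 - t)} := isClosed_le continuous_const (by fun_prop)
  have hS : IsCompact S := IsCompact.inter_right hc hcl
  have hSΩ : S ⊆ halfSpace n σ := fun X hX => by
    have : 0 ≤ σ * (X.2 - t) := hX.2
    change 0 < σ * X.2
    linarith [mul_sub σ X.2 t]
  have hrow : ∀ i, MemLp (fun X => ∑ j, A X.1 i j * G X j) 2 (volOn S) := fun i =>
    hA.memLp_row (hP.sol.gradLocL2 S hS hSΩ) i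
  have hfin : IsFiniteMeasure ((volume : Measure (Rn1 n)).restrict S) :=
    ⟨by simpa using hS.measure_lt_top⟩
  set r : Rn1 n → ℂ := fun X => (ramp σ t δ X.2 : ℂ)
  have hrl := lipschitzWith_ramp (n := n) hσ t hδ
  have hrc : Continuous r := Complex.continuous_ofReal.comp hrl.continuous
  have hr1 : ∀ X, ‖r X‖ ≤ 1 := fun X => by
    rw [Complex.norm_real, Real.norm_of_nonneg (ramp_nonneg _ _ _ _)]; exact ramp_le_one _ _ _ _
  have hr0 : ∀ X : Rn1 n, ¬ 0 ≤ σ * (X.2 - t) → r X = 0 := fun X hX => by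
    simp only [r, ramp_of_nonpos hδ (not_le.1 hX).le, Complex.ofReal_zero]
  have hΦ0 : ∀ X, X ∉ tsupport Φ → Φ X = 0 := fun X hX => image_eq_zero_of_notMem_tsupport hX
  have hD0 : ∀ X i, X ∉ tsupport Φ → fderiv ℝ Φ X (dir i) = 0 := fun X i hX => by
    rw [fderiv_of_notMem_tsupport ℝ hX]; rfl
  have hav := isKernel_avgKernel hσ ht hδ
  set a : Rn1 n → ℂ := fun X => avgKernel σ t δ X.2
  have ham : Measurable a := hav.meas.comp measurable_snd
  have ha1 : ∀ X, ‖a X‖ ≤ 1 / δ := fun X => norm_avgKernel_le t hδ _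
  have ha0 : ∀ X : Rn1 n, ¬ 0 ≤ σ * (X.2 - t) → a X = 0 := fun X hX => by
    refine indicator_of_notMem (fun h => hX ?_) _
    exact (mem_slabHeights hσ (uIoc_subset_uIcc h) hδ).1
  have hw : ∀ i, HasWeakDeriv univ (dir i) (fun X => r X * Φ X)
      (fun X => (if i = Fin.last n then (σ : ℂ) * a X else 0) * Φ X + r X * fderiv ℝ Φ X (dir i)) := by
    intro i
    have hli : LocallyIntegrable (fun X => if i = Fin.last n then (σ : ℂ) * a X else 0) := by
      by_cases hi : i = Fin.last n
      · simp only [if_pos hi]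
        rw [locallyIntegrable_iff]
        intro K hK
        have : IsFiniteMeasure ((volume : Measure (Rn1 n)).restrict K) :=
          ⟨by simpa using hK.measure_lt_top⟩
        exact (Integrable.of_bound ham.aestronglyMeasurable _ (.of_forall ha1)).const_mul _
      · simp only [if_neg hi]
        exact locallyIntegrable_const 0
    exact (hasWeakDeriv_ramp hσ t hδ i).mul_cutoff (hrc.locallyIntegrable.locallyIntegrableOn _)
      (hli.locallyIntegrableOn _) hΦ hc (subset_univ _)
  have hΦ2 : ∀ p, MemLp Φ p volume := fun p => hΦ.continuous.memLp_of_hasCompactSupport hc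
  have hd2 : ∀ i p, MemLp (fun X => fderiv ℝ Φ X (dir i)) p volume := fun i p =>
    (cont_fderiv hΦ _).memLp_of_hasCompactSupport (hcs_fderiv hc _)
  have hrd : ∀ i, MemLp (fun X => r X * fderiv ℝ Φ X (dir i)) 2 volume := fun i =>
    (hd2 i 2).of_le_mul (c := 1) (hrc.mul (cont_fderiv hΦ _)).aestronglyMeasurable
      (.of_forall fun X => by
        rw [norm_mul]; exact mul_le_mul_of_nonneg_right (hr1 X) (norm_nonneg _))
  have hrΦ : MemLp (fun X => r X * Φ X) 2 volume :=
    (hΦ2 2).of_le_mul (c := 1) (hrc.mul hΦ.continuous).aestronglyMeasurable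
      (.of_forall fun X => by
        rw [norm_mul]; exact mul_le_mul_of_nonneg_right (hr1 X) (norm_nonneg _))
  have haΦ : MemLp (fun X => a X * Φ X) 2 volume :=
    (hΦ2 2).of_le_mul (c := 1 / δ) (ham.aestronglyMeasurable.mul hΦ.continuous.aestronglyMeasurable)
      (.of_forall fun X => by
        rw [norm_mul]; exact mul_le_mul_of_nonneg_right (ha1 X) (norm_nonneg _))
  have hK2 : ∀ i, MemLp (fun X => (if i = Fin.last n then (σ : ℂ) * a X else 0) * Φ X
      + r X * fderiv ℝ Φ X (dir i)) 2 volume := by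
    intro i
    refine MemLp.add ?_ (hrd i)
    by_cases hi : i = Fin.last n
    · simp only [if_pos hi, mul_assoc]
      exact haΦ.const_mul _
    · simp only [if_neg hi, zero_mul]
      exact MemLp.zero
  have hnS : ∀ X, X ∉ S → X ∉ tsupport Φ ∨ ¬ 0 ≤ σ * (X.2 - t) := fun X hX => by
    by_contra hn
    push Not at hn
    exact hX ⟨hn.1, hn.2⟩
  have htest := hP.sol.test (isOpen_halfSpace n σ) hA hrΦ hK2 hw hS hSΩ (fun X hX => by
      rcases hnS X hX with h | h
      · rw [hΦ0 X h, mul_zero]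
      · rw [hr0 X h, zero_mul])
    (fun i X hX => by
      rcases hnS X hX with h | h
      · rw [hΦ0 X h, hD0 X i h, mul_zero, mul_zero, add_zero]
      · rw [hr0 X h, ha0 X h]; simp)
  have e1 : ∀ X, ∑ i, (∑ j, A X.1 i j * G X j) *
      ((if i = Fin.last n then (σ : ℂ) * a X else 0) * Φ X + r X * fderiv ℝ Φ X (dir i))
      = r X * energy A G Φ X - σ * (a X * conormalField A G X * Φ X) := by
    intro X
    simp only [mul_add, Finset.sum_add_distrib]
    have h1 : ∑ i, (∑ j, A X.1 i j * G X j) * ((if i = Fin.last n then (σ : ℂ) * a X else 0) * Φ X)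
        = -(σ * (a X * conormalField A G X * Φ X)) := by
      rw [Finset.sum_eq_single (Fin.last n) (fun i _ hi => by rw [if_neg hi]; ring)
        (fun h => absurd (Finset.mem_univ _) h), if_pos rfl, conormalField]
      ring
    have h2 : ∑ i, (∑ j, A X.1 i j * G X j) * (r X * fderiv ℝ Φ X (dir i))
        = r X * energy A G Φ X := by
      rw [energy_eq, Finset.mul_sum]
      exact Finset.sum_congr rfl fun i _ => by ring
    rw [h1, h2]; ring
  have hEi : IntegrableOn (energy A G Φ) S := by
    have : energy A G Φ = fun X => ∑ i, (∑ j, A X.1 i j * G X j) * fderiv ℝ Φ X (dir i) := by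
      ext X; exact energy_eq A G Φ X
    rw [this]
    exact integrable_finsetSum _ fun i _ => (hrow i).integrable_mul ((hd2 i 2).restrict S)
  have hE : IntegrableOn (energy A G Φ) {X | 0 ≤ σ * (X.2 - t)} := by
    refine hEi.of_forall_sdiff_eq_zero hcl.measurableSet fun X hX => ?_
    have : X ∉ tsupport Φ := fun h => hX.2 ⟨h, hX.1⟩
    simp [energy, hD0 X _ this]
  refine ⟨hE, ?_⟩
  have hE1 : Integrable fun X => r X * energy A G Φ X := by
    have h1 : IntegrableOn (fun X => r X * energy A G Φ X) {X | 0 ≤ σ * (X.2 - t)} :=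
      Integrable.bdd_mul hE hrc.aestronglyMeasurable (.of_forall hr1)
    refine (integrableOn_iff_integrable_of_support_subset fun X hX => ?_).1 h1
    by_contra hn
    exact hX (by simp only [hr0 X hn, zero_mul])
  have hE2 : Integrable fun X => a X * conormalField A G X * Φ X := by
    have h1 : IntegrableOn (fun X => conormalField A G X * (a X * Φ X)) S :=
      ((hrow (Fin.last n)).neg).integrable_mul (haΦ.restrict S)
    have h2 := (integrableOn_iff_integrable_of_support_subset fun X hX => ?_).1 h1
    · exact h2.congr (.of_forall fun X => by ring)
    · by_contra hn
      rcases hnS X hn with h | h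
      · exact hX (by simp only [hΦ0 X h, mul_zero])
      · exact hX (by simp only [ha0 X h, zero_mul, mul_zero])
  simp only [e1] at htest
  rw [integral_sub hE1 (hE2.const_mul _), integral_const_mul, sub_eq_zero] at htest
  exact htest

/-- The co-normal derivative on the slice at height `t`. -/
lemma VerticalPair.integral_energy_above {u w : Rn1 n → ℂ} {G H : VF n}
    (hP : VerticalPair A σ u w G H) (hσ : σ = 1 ∨ σ = -1) (hA : Elliptic A Λ) {t δ₀ : ℝ}
    (ht : 0 < σ * t) (hδ₀ : 0 < δ₀) {Φ : Rn1 n → ℂ} (hΦ : ContDiff ℝ ∞ Φ)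
    (hc : HasCompactSupport Φ) :
    ∫ X in {X | 0 < σ * (X.2 - t)}, energy A G Φ X
      = σ * ∫ x, conormal A (sliceGrad σ t δ₀ G H) x * Φ (x, t) := by
  set cG := conormalField A G with hcG
  set cH := conormalField A H with hcH
  have hLG : LocL2 (halfSpace n σ) cG := hP.sol.gradLocL2.conormalField hA
  have hLH : LocL2 (halfSpace n σ) cH := hP.solT.gradLocL2.conormalField hA
  set B : Set (Rn n) := Prod.fst '' tsupport Φ with hB
  have hBc : IsCompact B := IsCompact.image hc continuous_fst
  have hΦB : ∀ X : Rn1 n, X.1 ∉ B → Φ X = 0 := fun X hX =>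
    image_eq_zero_of_notMem_tsupport fun h => hX ⟨X, h, rfl⟩
  set ψ : Rn n → ℂ := fun x => Φ (x, t) with hψd
  have hψ : Continuous ψ := hΦ.continuous.comp (by fun_prop)
  have hψB : ∀ x, x ∉ B → ψ x = 0 := fun x hx => hΦB (x, t) hx
  have hψc : HasCompactSupport ψ := HasCompactSupport.intro hBc hψB
  obtain ⟨L, hL⟩ := hΦ.lipschitzWith_of_hasCompactSupport hc (by simp)
  obtain ⟨M, hM⟩ := hψc.exists_bound_of_continuous hψ
  have hs1 : ‖(σ : ℂ)‖ = 1 := by rcases hσ with rfl | rfl <;> simp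
  set I : ℂ := ∫ x, conormal A (sliceGrad σ t δ₀ G H) x * ψ x with hI
  have hest : ∀ δ : ℝ, 0 < δ → ‖(∫ X, (ramp σ t δ X.2 : ℂ) * energy A G Φ X) - σ * I‖ₑ
      ≤ ofReal L * (∫⁻ X in B ×ˢ uIoc t (t + σ * δ), ‖cG X‖ₑ)
        + ofReal M * (∫⁻ X in B ×ˢ uIoc t (t + σ * δ), ‖cH X‖ₑ) := by
    intro δ hδ
    have hka := isKernel_avgKernel hσ ht hδ
    have hkc := isKernel_corKernel hσ ht hδ
    obtain ⟨hia, hea⟩ := hka.integral_slab_mul hLG hψ hψc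
    obtain ⟨hic, hec⟩ := hkc.integral_slab_mul hLH hψ hψc
    have hI2 : I = (∫ X, avgKernel σ t δ X.2 * cG X * ψ X.1)
        + ∫ X, corKernel σ t δ X.2 * cH X * ψ X.1 := by
      have h1 : ∀ᵐ x, conormal A (sliceGrad σ t δ₀ G H) x * ψ x
          = slab (avgKernel σ t δ) cG x * ψ x + slab (corKernel σ t δ) cH x * ψ x := by
        filter_upwards [(hP.isSliceGrad t δ₀ ht hδ₀).ae_eq (hP.isSliceGrad t δ ht hδ),
          conormal_slab (A := A) hka hP.sol.gradLocL2,
          conormal_slab (A := A) hkc hP.solT.gradLocL2] with x h1 h2 h3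
        rw [← hcG] at h2
        rw [← hcH] at h3
        rw [← h2, ← h3, ← add_mul]
        congr 1
        rw [conormal, h1]
        simp only [conormal, sliceGrad, PiLp.add_apply, mul_add, Finset.sum_add_distrib]
        ring
      have hsi : ∀ {k : ℝ → ℂ} {f : Rn1 n → ℂ}, IsKernel σ k → LocL2 (halfSpace n σ) f →
          Integrable fun x => slab k f x * ψ x := by
        intro k f hk hf
        have := (hk.locallyIntegrable hf).integrable_smul_right_of_hasCompactSupport hψ hψc
        exact this.congr (.of_forall fun x => by simp)
      rw [hI, integral_congr_ae h1, integral_add (hsi hka hLG) (hsi hkc hLH), hea, hec]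
    have hR := (hP.integral_ramp hσ hA ht hδ hΦ hc).2
    obtain ⟨Ca, hCa⟩ := hka.bdd
    set K := B ×ˢ uIcc t (t + σ * δ)
    have hKc : IsCompact K := hBc.prod isCompact_uIcc
    have hiΦ : Integrable fun X => avgKernel σ t δ X.2 * cG X * Φ X := by
      obtain ⟨C', hC'⟩ := hc.exists_bound_of_continuous hΦ.continuous
      have h1 : IntegrableOn (fun X : Rn1 n => avgKernel σ t δ X.2 • cG X * Φ X) (B ×ˢ univ) :=
        (hka.integrableOn hLG hBc).mul_bdd (c := C') hΦ.continuous.aestronglyMeasurable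
          (.of_forall hC')
      refine (integrableOn_iff_integrable_of_support_subset fun X hX => ?_).1 h1
      refine ⟨?_, mem_univ _⟩
      by_contra hn
      exact hX (by simp only [hΦB X hn, mul_zero])
    have hdiff : (∫ X, (ramp σ t δ X.2 : ℂ) * energy A G Φ X) - σ * I
        = σ * ((∫ X, avgKernel σ t δ X.2 * cG X * (Φ X - ψ X.1))
          - ∫ X, corKernel σ t δ X.2 * cH X * ψ X.1) := by
      have h1 : ∫ X, avgKernel σ t δ X.2 * cG X * (Φ X - ψ X.1)
          = (∫ X, avgKernel σ t δ X.2 * cG X * Φ X) - ∫ X, avgKernel σ t δ X.2 * cG X * ψ X.1 := by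
        rw [← integral_sub hiΦ hia]
        congr 1; ext X; ring
      rw [hR, hI2, h1]; ring
    rw [hdiff, enorm_mul]
    have : ‖(σ : ℂ)‖ₑ = 1 := by rw [← ofReal_norm, hs1, ofReal_one]
    rw [this, one_mul]
    refine (enorm_sub_le).trans (add_le_add ?_ ?_)
    · refine norm_integral_layer_le hBc (fun X hX => ?_) fun X hX => ?_
      · have h1 := mem_slabHeights hσ (uIoc_subset_uIcc hX.2) hδ
        have h2 : ‖Φ X - ψ X.1‖ ≤ L * δ := by
          have h3 := hL.dist_le_mul X (X.1, t)
          rw [dist_eq_norm] at h3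
          refine h3.trans ?_
          gcongr
          rw [Prod.dist_eq]
          simp only [dist_self]
          refine max_le hδ.le ?_
          rw [Real.dist_eq, abs_le]
          rcases hσ with rfl | rfl <;> constructor <;> linarith [h1.1, h1.2]
        rw [norm_mul, norm_mul]
        calc _ ≤ 1 / δ * ‖cG X‖ * (L * δ) := by
              gcongr
              exact norm_avgKernel_le t hδ _
          _ = _ := by field_simp
      · by_cases h1 : X.1 ∈ B
        · have : X.2 ∉ uIoc t (t + σ * δ) := fun h => hX ⟨h1, h⟩
          rw [avgKernel, indicator_of_notMem this, zero_mul, zero_mul]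
        · rw [hΦB X h1, hψB _ h1, sub_zero, mul_zero]
    · refine norm_integral_layer_le hBc (fun X hX => ?_) fun X hX => ?_
      · rw [norm_mul, norm_mul]
        calc _ ≤ 1 * ‖cH X‖ * M := by
              gcongr
              · exact norm_corKernel_le hσ t hδ _
              · exact hM _
          _ = _ := by ring
      · by_cases h1 : X.1 ∈ B
        · have : X.2 ∉ uIoc t (t + σ * δ) := fun h => hX ⟨h1, h⟩
          rw [corKernel, indicator_of_notMem this, zero_mul, zero_mul]
        · rw [hψB _ h1, mul_zero]
  have hlim1 : Tendsto (fun δ => ∫ X, (ramp σ t δ X.2 : ℂ) * energy A G Φ X) (𝓝[>] 0)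
      (𝓝 (σ * I)) := by
    rw [tendsto_iff_edist_tendsto_0]
    have h1 := ENNReal.Tendsto.const_mul (tendsto_lintegral_layer hσ ht hLG hBc)
      (Or.inr (ofReal_ne_top (r := L)))
    have h2 := ENNReal.Tendsto.const_mul (tendsto_lintegral_layer hσ ht hLH hBc)
      (Or.inr (ofReal_ne_top (r := M)))
    have h3 := h1.add h2
    rw [mul_zero, mul_zero, add_zero] at h3
    refine tendsto_of_tendsto_of_tendsto_of_le_of_le' tendsto_const_nhds h3
      (.of_forall fun _ => zero_le) ?_
    filter_upwards [self_mem_nhdsWithin] with δ hδ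
    rw [edist_eq_enorm_sub]
    exact hest δ hδ
  have hEint := (hP.integral_ramp hσ hA ht one_pos hΦ hc).1
  have hop : MeasurableSet {X : Rn1 n | 0 < σ * (X.2 - t)} :=
    (isOpen_lt continuous_const (by fun_prop)).measurableSet
  have hcl : MeasurableSet {X : Rn1 n | 0 ≤ σ * (X.2 - t)} :=
    (isClosed_le continuous_const (by fun_prop)).measurableSet
  have hlim2 : Tendsto (fun δ => ∫ X, (ramp σ t δ X.2 : ℂ) * energy A G Φ X) (𝓝[>] 0)
      (𝓝 (∫ X in {X | 0 < σ * (X.2 - t)}, energy A G Φ X)) := by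
    rw [← integral_indicator hop]
    have hEI := hEint.integrable_indicator hcl
    have heq : ∀ δ : ℝ, 0 < δ → ∀ X : Rn1 n, (ramp σ t δ X.2 : ℂ) * energy A G Φ X
        = (ramp σ t δ X.2 : ℂ) * {X : Rn1 n | 0 ≤ σ * (X.2 - t)}.indicator (energy A G Φ) X := by
      intro δ hδ X
      by_cases hX : 0 ≤ σ * (X.2 - t)
      · rw [indicator_of_mem (s := {X : Rn1 n | 0 ≤ σ * (X.2 - t)}) hX]
      · rw [ramp_of_nonpos hδ (not_le.1 hX).le, Complex.ofReal_zero, zero_mul, zero_mul]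
    refine tendsto_integral_filter_of_dominated_convergence
      (fun X => ‖{X : Rn1 n | 0 ≤ σ * (X.2 - t)}.indicator (energy A G Φ) X‖) ?_ ?_ hEI.norm ?_
    · filter_upwards [self_mem_nhdsWithin] with δ hδ
      have h1 : AEStronglyMeasurable (fun X : Rn1 n => (ramp σ t δ X.2 : ℂ)
          * {X : Rn1 n | 0 ≤ σ * (X.2 - t)}.indicator (energy A G Φ) X) volume :=
        (Complex.continuous_ofReal.comp
          (lipschitzWith_ramp hσ t hδ).continuous).aestronglyMeasurable.mul hEI.1
      exact h1.congr (.of_forall fun X => (heq δ hδ X).symm)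
    · filter_upwards [self_mem_nhdsWithin] with δ hδ
      refine .of_forall fun X => ?_
      rw [heq δ hδ, norm_mul, Complex.norm_real, Real.norm_of_nonneg (ramp_nonneg _ _ _ _)]
      exact mul_le_of_le_one_left (norm_nonneg _) (ramp_le_one _ _ _ _)
    · refine .of_forall fun X => ?_
      by_cases hX : 0 < σ * (X.2 - t)
      · rw [indicator_of_mem (s := {X : Rn1 n | 0 < σ * (X.2 - t)}) hX]
        refine tendsto_const_nhds.congr' ?_
        filter_upwards [Ioc_mem_nhdsGT hX] with δ hδ
        rw [ramp_of_ge hδ.1 hδ.2, Complex.ofReal_one, one_mul]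
      · rw [indicator_of_notMem (s := {X : Rn1 n | 0 < σ * (X.2 - t)}) hX]
        refine tendsto_const_nhds.congr' ?_
        filter_upwards [self_mem_nhdsWithin] with δ hδ
        rw [ramp_of_nonpos hδ (not_lt.1 hX), Complex.ofReal_zero, zero_mul]
  exact tendsto_nhds_unique hlim2 hlim1

/-! ### Weak limits of slices -/

lemma tendsto_mul_toZero (hσ : σ = 1 ∨ σ = -1) : Tendsto (fun s => σ * s) (𝓝[>] 0) (toZero σ) := by
  refine tendsto_nhdsWithin_iff.2 ⟨?_, ?_⟩
  · have : Continuous fun s : ℝ => σ * s := by fun_prop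
    have h := this.tendsto 0
    rw [mul_zero] at h
    exact h.mono_left nhdsWithin_le_nhds
  · filter_upwards [self_mem_nhdsWithin] with s hs
    rw [← mul_assoc, sign_mul_self hσ, one_mul]
    exact hs

lemma toZero_neBot (hσ : σ = 1 ∨ σ = -1) : NeBot (toZero σ) := (tendsto_mul_toZero hσ).neBot

lemma toZero_pos (σ : ℝ) : ∀ᶠ t in toZero σ, 0 < σ * t := eventually_mem_nhdsWithin

lemma tendsto_toZero (σ : ℝ) : Tendsto (fun t => σ * t) (toZero σ) (𝓝 0) := by
  have : Continuous fun s : ℝ => σ * s := by fun_prop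
  have h := this.tendsto 0
  rw [mul_zero] at h
  exact h.mono_left nhdsWithin_le_nhds

lemma toZero_lt (σ : ℝ) {δ : ℝ} (hδ : 0 < δ) : ∀ᶠ t in toZero σ, σ * t < δ :=
  (tendsto_toZero σ).eventually (gt_mem_nhds hδ)

lemma holderConjugate_ofReal {p : ℝ} (hp : 1 < p) :
    ENNReal.HolderConjugate (ofReal p) (ofReal (p / (p - 1))) :=
  (Real.HolderConjugate.conjExponent hp).ennrealOfReal

lemma enorm_integral_mul_le {α : Type*} [MeasurableSpace α] {μ : Measure α} {p q : ℝ≥0∞}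
    [ENNReal.HolderConjugate p q] {a b : α → ℂ} (ha : AEStronglyMeasurable a μ)
    (hb : AEStronglyMeasurable b μ) : ‖∫ x, a x * b x ∂μ‖ₑ ≤ eLpNorm a p μ * eLpNorm b q μ := by
  refine (enorm_integral_le_lintegral_enorm _).trans ?_
  have := eLpNorm_smul_le_mul_eLpNorm (p := p) (q := q) (r := 1) hb ha
  rwa [eLpNorm_one_eq_lintegral_enorm] at this

lemma testFun.memLp {φ : E → ℂ}
    (hφ : φ ∈ testFun E) (q : ℝ≥0∞) : MemLp φ q :=
  hφ.1.continuous.memLp_of_hasCompactSupport hφ.2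

/-- Bounded families in `L^p` that converge against test functions, with limits dominated by a
weight in `L^p`, converge weakly. -/
lemma exists_weakLp {p : ℝ} (hp : 1 < p) {M m : Rn n → ℝ} (hM : Measurable M)
    (hm : Continuous m) (hm0 : ∀ x, 0 < m x) (hmM : ∀ x, m x ≤ M x)
    (hMp : MemLp M (ofReal p)) {F : ℝ → Rn n → ℂ} {l : Filter ℝ} [NeBot l]
    {K : ℝ≥0∞} (hK : K ≠ ⊤)
    (hF : ∀ᶠ t in l, MemLp (F t) (ofReal p) ∧ eLpNorm (F t) (ofReal p) volume ≤ K)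
    (hlim : ∀ φ ∈ testFun (Rn n), ∃ c : ℂ, Tendsto (fun t => ∫ x, F t x * φ x) l (𝓝 c) ∧
      ‖c‖ ≤ ∫ x, M x * ‖φ x‖) :
    ∃ g : Rn n → ℂ, WeakLp p F l g := by
  have hconj := holderConjugate_ofReal hp
  have hp0 : 0 < p := by linarith
  have hM0 : ∀ x, 0 < M x := fun x => (hm0 x).trans_le (hmM x)
  choose! c hc hcM using hlim
  have hadd : ∀ φ ∈ testFun (Rn n), ∀ ψ ∈ testFun (Rn n), c (φ + ψ) = c φ + c ψ := by
    intro φ hφ ψ hψ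
    refine tendsto_nhds_unique (hc _ ((testFun _).add_mem hφ hψ)) ?_
    refine ((hc φ hφ).add (hc ψ hψ)).congr' ?_
    filter_upwards [hF] with t ht
    have hi : ∀ χ ∈ testFun (Rn n), Integrable fun x => F t x * χ x := fun χ hχ =>
      ht.1.integrable_mul (testFun.memLp hχ (ofReal (p / (p - 1))))
    rw [← integral_add (hi φ hφ) (hi ψ hψ)]
    congr 1; ext x
    simp [mul_add]
  have hsmul : ∀ (r : ℂ), ∀ φ ∈ testFun (Rn n), c (r • φ) = r * c φ := by
    intro r φ hφ
    refine tendsto_nhds_unique (hc _ ((testFun _).smul_mem r hφ)) ?_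
    refine ((hc φ hφ).const_mul r).congr fun t => ?_
    rw [← integral_const_mul]
    congr 1; ext x
    simp [mul_left_comm]
  set D : testFun (Rn n) →ₗ[ℂ] ℂ :=
    { toFun := fun φ => c φ
      map_add' := fun φ ψ => hadd φ φ.2 ψ ψ.2
      map_smul' := fun r φ => hsmul r φ φ.2 }
  have hint : Integrable fun x => M x ^ p := by
    have := hMp.integrable_norm_rpow (by simpa using hp0) ofReal_ne_top
    rw [toReal_ofReal hp0.le] at this
    refine this.congr (.of_forall fun x => ?_)
    simp only [Real.norm_of_nonneg (hM0 x).le]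
  obtain ⟨g, hgl, hgM, hg⟩ := exists_density hp.le hM hm hm0 hmM hint D fun φ => hcM φ φ.2
  have hgp : MemLp g (ofReal p) := hMp.of_le hgl.aestronglyMeasurable (hgM.mono fun x hx => by
    rwa [Real.norm_of_nonneg (hM0 x).le])
  refine ⟨g, hF.mono fun t ht => ht.1, hgp, fun ψ hψ => ?_⟩
  have hq1 : 1 ≤ ofReal (p / (p - 1)) := by
    rw [ENNReal.one_le_ofReal, one_le_div (by linarith)]; linarith
  set q := ofReal (p / (p - 1))
  set P := ofReal p
  set Γ : ℝ≥0∞ := K + eLpNorm g P volume + 1 with hΓ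
  have hΓt : Γ ≠ ⊤ := by
    have := hgp.2.ne
    finiteness
  have hΓ0 : Γ ≠ 0 := by simp [hΓ]
  have hΓ1 : 0 < Γ.toReal := ENNReal.toReal_pos hΓ0 hΓt
  rw [Metric.tendsto_nhds]
  intro ε hε
  obtain ⟨φ, hφc, hφd, hφ⟩ := hψ.exist_eLpNorm_sub_le ofReal_ne_top hq1
    (by positivity : 0 < ε / (3 * Γ.toReal))
  have hφt : φ ∈ testFun (Rn n) := ⟨hφd, hφc⟩
  have hφL := testFun.memLp hφt q
  have hcl : ∀ a : Rn n → ℂ, MemLp a P → eLpNorm a P volume ≤ Γ →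
      ‖(∫ x, a x * ψ x) - ∫ x, a x * φ x‖ ≤ ε / 3 := by
    intro a ha haΓ
    have e : (∫ x, a x * ψ x) - ∫ x, a x * φ x = ∫ x, a x * (ψ - φ) x := by
      have hi : ∀ χ, MemLp χ q volume → Integrable fun x => a x * χ x := fun χ hχ =>
        ha.integrable_mul hχ
      rw [← integral_sub (hi ψ hψ) (hi φ hφL)]
      congr 1; ext x; simp [mul_sub]
    rw [e]
    have h1 := enorm_integral_mul_le (p := P) (q := q) ha.1 (hψ.sub hφL).1
    have h2 : ‖∫ x, a x * (ψ - φ) x‖ₑ ≤ Γ * ofReal (ε / (3 * Γ.toReal)) := by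
      refine h1.trans ?_
      gcongr
    have h3 := ENNReal.toReal_mono (by finiteness) h2
    rw [toReal_enorm, toReal_mul, toReal_ofReal (by positivity)] at h3
    refine h3.trans_eq ?_
    field_simp
  have h1 := tendsto_nhds.1 (hc φ hφt) (ε / 3) (by positivity)
  filter_upwards [h1, hF] with t ht htF
  have e1 := hcl (F t) htF.1 (htF.2.trans (by rw [hΓ, add_assoc]; exact le_self_add))
  have e2 := hcl g hgp (by rw [hΓ, add_right_comm]; exact le_add_self)
  rw [dist_eq_norm] at ht ⊢
  have e3 : c φ = ∫ x, g x * φ x := hg ⟨φ, hφt⟩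
  rw [e3] at ht
  calc _ = ‖((∫ x, F t x * ψ x) - ∫ x, F t x * φ x) + ((∫ x, F t x * φ x) - ∫ x, g x * φ x)
        - ((∫ x, g x * ψ x) - ∫ x, g x * φ x)‖ := by congr 1; ring
    _ ≤ _ := norm_sub_le _ _
    _ ≤ _ := add_le_add_left (norm_add_le _ _) _
    _ < ε := by linarith

lemma iSup_closedBall_le {φ : Rn n → ℂ} (hφ : Continuous φ) (hc : HasCompactSupport φ) {ε : ℝ}
    (hε : 0 < ε) : ∃ δ : ℝ, 0 < δ ∧ ∀ r ≤ δ, ∀ y, (⨆ x ∈ cB y r, ‖φ x‖ₑ)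
      ≤ ‖φ y‖ₑ + (cthickening 1 (tsupport φ)).indicator (fun _ => ofReal ε) y := by
  obtain ⟨δ, hδ, h⟩ := uniformContinuous_iff.1 (hc.uniformContinuous_of_continuous hφ) ε hε
  refine ⟨min (δ / 2) 1, by positivity, fun r hr y => iSup₂_le fun x hx => ?_⟩
  have hd : dist x y ≤ min (δ / 2) 1 := (mem_closedBall.1 hx).trans hr
  by_cases hy : y ∈ cthickening 1 (tsupport φ)
  · rw [indicator_of_mem hy]
    have h1 := h ((hd.trans (min_le_left _ _)).trans_lt (half_lt_self hδ))
    calc ‖φ x‖ₑ = ‖φ y + (φ x - φ y)‖ₑ := by congr 1; ring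
      _ ≤ ‖φ y‖ₑ + ‖φ x - φ y‖ₑ := enorm_add_le _ _
      _ ≤ _ := by
        gcongr
        rw [← ofReal_norm, ← dist_eq_norm]
        exact ofReal_le_ofReal h1.le
  · have : x ∉ tsupport φ := fun hx' => hy (mem_cthickening_of_dist_le y x 1 _ hx' (by
      rw [dist_comm]; exact hd.trans (min_le_right _ _)))
    rw [image_eq_zero_of_notMem_tsupport this, enorm_zero]
    exact zero_le

/-- Limits of integrals of slices against test functions are dominated by the maximal function. -/
lemma enorm_limit_le (hσ : σ = 1 ∨ σ = -1) {N : Rn n → ℝ≥0∞} (hN : Measurable N)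
    (hNl : ∀ K : Set (Rn n), IsCompact K → ∫⁻ x in K, N x ≠ ⊤) {F : ℝ → Rn n → ℂ} {C : ℝ≥0}
    (hF : ∀ t, 0 < σ * t → ∀ ψ : Rn n → ℝ≥0∞, Measurable ψ →
      ∫⁻ x, ‖F t x‖ₑ * ψ x ≤ C * ∫⁻ y, N y * ⨆ x ∈ cB y (σ * t), ψ x)
    {φ : Rn n → ℂ} (hφ : φ ∈ testFun (Rn n)) {c : ℂ}
    (hc : Tendsto (fun t => ∫ x, F t x * φ x) (toZero σ) (𝓝 c)) :
    ‖c‖ₑ ≤ C * ∫⁻ y, N y * ‖φ y‖ₑ := by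
  have hne := toZero_neBot hσ
  set K' := cthickening 1 (tsupport φ)
  have hK' : IsCompact K' := IsCompact.cthickening hφ.2
  set d := ∫⁻ x in K', N x
  have hd : d ≠ ⊤ := hNl K' hK'
  have hmφ : Measurable fun x => ‖φ x‖ₑ := hφ.1.continuous.measurable.enorm
  have key : ∀ ε : ℝ, 0 < ε → ‖c‖ₑ ≤ C * ((∫⁻ y, N y * ‖φ y‖ₑ) + ofReal ε * d) := by
    intro ε hε
    obtain ⟨δ, hδ, h⟩ := iSup_closedBall_le hφ.1.continuous hφ.2 hε
    refine le_of_tendsto hc.enorm ?_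
    filter_upwards [toZero_pos σ, toZero_lt σ hδ] with t ht htδ
    calc ‖∫ x, F t x * φ x‖ₑ ≤ ∫⁻ x, ‖F t x‖ₑ * ‖φ x‖ₑ := by
          refine (enorm_integral_le_lintegral_enorm _).trans_eq ?_
          simp only [enorm_mul]
      _ ≤ C * ∫⁻ y, N y * ⨆ x ∈ cB y (σ * t), ‖φ x‖ₑ := hF t ht _ hmφ
      _ ≤ C * ∫⁻ y, (N y * ‖φ y‖ₑ + K'.indicator (fun z => ofReal ε * N z) y) := by
          gcongr with y
          refine (mul_le_mul_right (h _ htδ.le y) _).trans_eq ?_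
          rw [mul_add]
          congr 1
          by_cases hy : y ∈ K'
          · rw [indicator_of_mem hy, indicator_of_mem hy, mul_comm]
          · rw [indicator_of_notMem hy, indicator_of_notMem hy, mul_zero]
      _ = _ := by
          rw [lintegral_add_left (show Measurable fun y => N y * ‖φ y‖ₑ from hN.mul hmφ), lintegral_indicator hK'.isClosed.measurableSet,
            lintegral_const_mul' _ _ ofReal_ne_top]
  have hlim : Tendsto (fun ε : ℝ => (C : ℝ≥0∞) * ((∫⁻ y, N y * ‖φ y‖ₑ) + ofReal ε * d))
      (𝓝[>] 0) (𝓝 (C * ((∫⁻ y, N y * ‖φ y‖ₑ) + 0))) := by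
    refine ENNReal.Tendsto.const_mul (tendsto_const_nhds.add ?_) (Or.inr coe_ne_top)
    have h1 : Tendsto (fun ε : ℝ => ofReal ε) (𝓝[>] 0) (𝓝 0) := by
      have := ENNReal.continuous_ofReal.tendsto 0
      rw [ENNReal.ofReal_zero] at this
      exact this.mono_left nhdsWithin_le_nhds
    have h2 := ENNReal.Tendsto.mul_const h1 (Or.inr hd)
    rwa [zero_mul] at h2
  rw [add_zero] at hlim
  exact ge_of_tendsto hlim (by filter_upwards [self_mem_nhdsWithin] with ε hε using key ε hε)

/-- Real-valued version of an `L^p` function with values in `[0, ∞]`. -/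
lemma memLp_toReal {N : Rn n → ℝ≥0∞} (hN : Measurable N) {p : ℝ} (hp : 0 < p)
    (h : ∫⁻ x, N x ^ p ≠ ⊤) : (∀ᵐ x, N x ≠ ⊤) ∧ MemLp (fun x => (N x).toReal) (ofReal p) := by
  have hfin : ∀ᵐ x, N x ≠ ⊤ := by
    filter_upwards [ae_lt_top (hN.pow_const p) h] with x hx hx'
    rw [hx', ENNReal.top_rpow_of_pos hp] at hx
    exact lt_irrefl _ hx
  refine ⟨hfin, hN.ennreal_toReal.aestronglyMeasurable, ?_⟩
  rw [eLpNorm_lt_top_iff_lintegral_rpow_enorm_lt_top (by simpa using hp) ofReal_ne_top,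
    toReal_ofReal hp.le]
  refine lt_of_le_of_lt (lintegral_mono fun x => ?_) (lt_top_iff_ne_top.2 h)
  gcongr
  rw [Real.enorm_eq_ofReal toReal_nonneg]
  exact ENNReal.ofReal_toReal_le

lemma setLIntegral_ne_top_of_rpow {N : Rn n → ℝ≥0∞} {p : ℝ} (hp : 1 ≤ p)
    (h : ∫⁻ x, N x ^ p ≠ ⊤) {K : Set (Rn n)} (hK : IsCompact K) : ∫⁻ x in K, N x ≠ ⊤ := by
  have h1 : ∫⁻ x in K, N x ≤ ∫⁻ x in K, (1 + N x ^ p) := by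
    refine lintegral_mono fun x => ?_
    rcases le_total (N x) 1 with h | h
    · exact h.trans le_self_add
    · exact (ENNReal.le_rpow_self_of_one_le h hp).trans le_add_self
  refine ne_top_of_le_ne_top ?_ h1
  rw [lintegral_add_left measurable_const, setLIntegral_const, one_mul]
  exact ENNReal.add_ne_top.2 ⟨hK.measure_lt_top.ne, ne_top_of_le_ne_top h (setLIntegral_le_lintegral _ _)⟩

/-- A positive continuous function in `L^p`. -/
lemma exists_pos_memLp (n : ℕ) {p : ℝ} (hp : 1 ≤ p) : ∃ m : Rn n → ℝ, Continuous m ∧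
    (∀ x, 0 < m x) ∧ MemLp m (ofReal p) := by
  refine ⟨fun x => (1 + ‖x‖) ^ (-((n : ℝ) + 1)), ?_, fun x => by positivity, ?_⟩
  · refine Continuous.rpow_const (by fun_prop) fun x => Or.inl (by positivity)
  · have h1 : Integrable fun x : Rn n => (1 + ‖x‖) ^ (-((n : ℝ) + 1)) :=
      integrable_one_add_norm (by simp)
    have hp0 : 0 < p := by linarith
    refine ⟨h1.1, ?_⟩
    rw [eLpNorm_lt_top_iff_lintegral_rpow_enorm_lt_top (by simpa using hp0) ofReal_ne_top,
      toReal_ofReal hp0.le]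
    refine lt_of_le_of_lt (lintegral_mono fun x => ?_) h1.2
    refine ENNReal.rpow_le_self_of_le_one ?_ hp
    rw [Real.enorm_eq_ofReal (by positivity), ENNReal.ofReal_le_one]
    exact Real.rpow_le_one_of_one_le_of_nonpos (by linarith [norm_nonneg x]) (by linarith)

/-! ### Integrability up to the boundary and the co-normal derivative -/

/-- Heights comparable to `τ`. -/
def heightShell (σ τ : ℝ) : Set ℝ := {s | τ ≤ σ * s ∧ σ * s ≤ 9 / 8 * τ}

lemma measurableSet_heightShell (σ τ : ℝ) : MeasurableSet (heightShell σ τ) :=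
  (measurableSet_le (f := fun _ : ℝ => τ) (g := fun s : ℝ => σ * s) (by fun_prop)
    (by fun_prop)).inter (measurableSet_le (f := fun s : ℝ => σ * s) (g := fun _ : ℝ => 9 / 8 * τ)
    (by fun_prop) (by fun_prop))

lemma exists_shell_bound (n : ℕ) : ∃ C : ℝ≥0, ∀ σ : ℝ, σ = 1 ∨ σ = -1 →
    ∀ G : VF n, LocL2 (halfSpace n σ) G → ∀ B : Set (Rn n), IsCompact B →
    ∀ τ : ℝ, 0 < τ → τ ≤ 1 →
    ∫⁻ X in B ×ˢ heightShell σ τ, ‖G X‖ₑ ≤ C * ofReal τ * ∫⁻ y in cthickening 1 B, ntMax σ G y := by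
  set κ : ℝ≥0∞ := volume (cB (0 : Rn n) 1) with hκ
  have hκ0 : κ ≠ 0 := (measure_closedBall_pos volume _ one_pos).ne'
  have hκt : κ ≠ ⊤ := vol_cB_ne _ _
  obtain ⟨C, hC⟩ : ∃ C : ℝ≥0, (C : ℝ≥0∞) = κ⁻¹ * ofReal (vol1 n) * 8 ^ n :=
    ⟨_, ENNReal.coe_toNNReal (mul_ne_top (mul_ne_top
      (ENNReal.inv_ne_top.2 hκ0) ofReal_ne_top) (by finiteness))⟩
  refine ⟨C, fun σ hσ G hG B hB τ hτ hτ1 => ?_⟩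
  have hss := sign_mul_self hσ
  set J := heightShell σ τ
  have hJm : MeasurableSet J := measurableSet_heightShell σ τ
  have hpos : ∀ s ∈ J, 0 < σ * s := fun s hs => hτ.trans_le hs.1
  have hJd : ∀ s ∈ J, |s - σ * τ| ≤ τ / 8 := by
    intro s hs
    rw [abs_le]
    rcases hσ with rfl | rfl <;> constructor <;> linarith [hs.1, hs.2]
  have hrect : ∀ y : Rn n, cB y (τ / 8) ×ˢ J
      ⊆ cB (y, σ * τ) (τ / 8) := by
    intro y X hX
    rw [mem_closedBall, Prod.dist_eq]
    exact max_le hX.1 (by rw [Real.dist_eq]; exact hJd _ hX.2)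
  have hht : ∀ y : Rn n, σ * (y, σ * τ).2 = τ := fun y => by
    change σ * (σ * τ) = τ
    rw [← mul_assoc, hss, one_mul]
  have hsub : ∀ y : Rn n, cB (y, σ * τ) (τ / 8) ⊆ halfSpace n σ := fun y =>
    closedBall_subset_halfSpace hσ (by rw [hht]; linarith)
  have hGm : AEStronglyMeasurable G (volOn (halfSpace n σ)) :=
    (hG.locallyIntegrableOn (isOpen_halfSpace n σ)).aestronglyMeasurable
  have hunivJ : (univ : Set (Rn n)) ×ˢ J ⊆ halfSpace n σ := fun X hX => hpos _ hX.2
  have hGm' : AEMeasurable (fun X : Rn n × ℝ => ‖G X‖ₑ) (volume.prod (volOn J)) := by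
    have h1 := (hGm.mono_measure (Measure.restrict_mono hunivJ le_rfl)).enorm
    rwa [Measure.volume_eq_prod, ← Measure.prod_restrict, Measure.restrict_univ] at h1
  set f : Rn n → ℝ≥0∞ := fun x => ∫⁻ s in J, ‖G (x, s)‖ₑ
  have hf : AEMeasurable f := hGm'.lintegral_prod_right'
  have hfub : ∀ S : Set (Rn n), MeasurableSet S → ∫⁻ X in S ×ˢ J, ‖G X‖ₑ = ∫⁻ x in S, f x := by
    intro S hS
    rw [Measure.volume_eq_prod, ← Measure.prod_restrict, lintegral_prod]
    have h1 : (volOn S).prod (volOn J)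
        = ((volume : Measure (Rn n)).prod (volOn J)).restrict (S ×ˢ univ) := by
      rw [← Measure.prod_restrict, Measure.restrict_univ]
    rw [h1]
    exact hGm'.restrict
  have hBm := hB.isClosed.measurableSet
  have hB'm : MeasurableSet (cthickening 1 B) := isClosed_cthickening.measurableSet
  rw [hfub B hBm, ← lintegral_indicator hBm, ← lintegral_const_mul' _ _ (by finiteness),
    ← lintegral_indicator hB'm]
  have hr : 0 < τ / 8 := by positivity
  refine lintegral_le_of_forall_closedBall (hf.indicator hBm) hr fun y => ?_
  by_cases hy : y ∈ cthickening 1 B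
  · rw [indicator_of_mem hy]
    calc _ ≤ ∫⁻ x in cB y (τ / 8), f x :=
          lintegral_mono fun x => indicator_le_self _ _ x
      _ = ∫⁻ X in cB y (τ / 8) ×ˢ J, ‖G X‖ₑ :=
          (hfub _ measurableSet_closedBall).symm
      _ ≤ ∫⁻ X in cB (y, σ * τ) (τ / 8), ‖G X‖ₑ := lintegral_mono_set (hrect y)
      _ ≤ rms G (eball (y, σ * τ) (τ / 4)) * volume (cB (y, σ * τ) (τ / 4)) :=
          lintegral_enorm_le_rms hτ (hGm.mono_measure (Measure.restrict_mono (hsub y) le_rfl))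
      _ ≤ ntMax σ G y * volume (cB (y, σ * τ) (τ / 4)) := by
          gcongr
          have := rms_le_ntMax hσ G (x₀ := y) (y := y) (t := σ * τ) (by
            rw [← mul_assoc, hss, one_mul]; simpa using hτ)
          rwa [← mul_assoc, hss, one_mul] at this
      _ ≤ _ := by
          have h1 : volume (cB (0 : Rn n) (τ / 8)) = ofReal (τ / 8) ^ n * κ := by
            rw [Measure.addHaar_closedBall' _ _ hr.le, ofReal_pow hr.le]
            simp [hκ]
          have h2 : volume (cB (y, σ * τ) (τ / 4))
              ≤ 2 ^ n * ofReal (τ / 8) ^ n * ofReal τ * ofReal (vol1 n) := by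
            rw [volume_closedBall _ (by positivity), ofReal_mul (by positivity), pow_succ,
              ofReal_mul (by positivity), show τ / 4 = 2 * (τ / 8) by ring, mul_pow,
              ofReal_mul (by positivity), ofReal_pow (by positivity),
              ofReal_pow (by positivity)]
            gcongr
            · simp
            · linarith
          have h3 : (2 : ℝ≥0∞) ^ n ≤ 8 ^ n := by gcongr; norm_num
          rw [h1, hC]
          calc ntMax σ G y * volume (cB (y, σ * τ) (τ / 4))
              ≤ ntMax σ G y * (8 ^ n * ofReal (τ / 8) ^ n * ofReal τ
                * ofReal (vol1 n)) := by
                gcongr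
                refine h2.trans ?_
                gcongr
            _ = ntMax σ G y * (8 ^ n * ofReal (τ / 8) ^ n * ofReal τ
                * ofReal (vol1 n)) * (κ * κ⁻¹) := by
                rw [ENNReal.mul_inv_cancel hκ0 hκt, mul_one]
            _ = _ := by ring
  · rw [indicator_of_notMem hy, mul_zero]
    refine (setLIntegral_congr_fun measurableSet_closedBall
      (g := fun _ => 0) fun x hx => ?_).le.trans (by simp)
    refine indicator_of_notMem (fun hxB => hy ?_) _
    exact mem_cthickening_of_dist_le y x 1 _ hxB (by
      rw [dist_comm]; exact (mem_closedBall.1 hx).trans (by linarith))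

/-- The gradient is integrable near bounded parts of the boundary. -/
lemma lintegral_boundary_ne_top (hσ : σ = 1 ∨ σ = -1) {G : VF n}
    (hG : LocL2 (halfSpace n σ) G)
    (hN : ∀ K : Set (Rn n), IsCompact K → ∫⁻ x in K, ntMax σ G x ≠ ⊤) {K : Set (Rn1 n)}
    (hK : IsCompact K) : ∫⁻ X in halfSpace n σ ∩ K, ‖G X‖ₑ ≠ ⊤ := by
  obtain ⟨C, hC⟩ := exists_shell_bound n
  set B : Set (Rn n) := Prod.fst '' K
  have hB : IsCompact B := hK.image continuous_fst
  set ρ : ℝ := 8 / 9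
  set J : ℕ → Set (Rn1 n) := fun k => B ×ˢ heightShell σ (ρ ^ k)
  set K₁ : Set (Rn1 n) := K ∩ {X | 1 ≤ σ * X.2}
  have hK₁ : IsCompact K₁ := hK.inter_right (isClosed_le continuous_const (by fun_prop))
  have hcov : halfSpace n σ ∩ K ⊆ K₁ ∪ ⋃ k, J k := by
    intro X hX
    have hpos : 0 < σ * X.2 := hX.1
    by_cases h1 : 1 ≤ σ * X.2
    · exact Or.inl ⟨hX.2, h1⟩
    · refine Or.inr (mem_iUnion.2 ?_)
      push Not at h1
      obtain ⟨k, hk1, hk2⟩ := exists_nat_pow_near_of_lt_one hpos h1.le (y := ρ) (by norm_num [ρ])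
        (by norm_num [ρ])
      refine ⟨k + 1, ⟨X, hX.2, rfl⟩, hk1.le, ?_⟩
      refine hk2.trans_eq ?_
      rw [pow_succ]
      simp only [ρ]; ring
  set I := ∫⁻ y in cthickening 1 B, ntMax σ G y
  have hI : I ≠ ⊤ := hN _ hB.cthickening
  have hJ : ∀ k, ∫⁻ X in J k, ‖G X‖ₑ ≤ C * I * ofReal ρ ^ k := by
    intro k
    refine (hC σ hσ G hG B hB (ρ ^ k) (by positivity) (pow_le_one₀ (by norm_num [ρ])
      (by norm_num [ρ]))).trans_eq ?_
    rw [ofReal_pow (by norm_num [ρ])]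
    ring
  have hfin : IsFiniteMeasure ((volume : Measure (Rn1 n)).restrict K₁) :=
    ⟨by simpa using hK₁.measure_lt_top⟩
  have h1 : ∫⁻ X in K₁, ‖G X‖ₑ ≠ ⊤ :=
    ((hG K₁ hK₁ fun X hX => lt_of_lt_of_le one_pos (show 1 ≤ σ * X.2 from hX.2)).integrable one_le_two).2.ne
  refine ne_top_of_le_ne_top ?_ ((lintegral_mono_set hcov).trans (lintegral_union_le _ _ _))
  refine ENNReal.add_ne_top.2 ⟨h1, ?_⟩
  refine ne_top_of_le_ne_top ?_ ((lintegral_iUnion_le _ _).trans (ENNReal.tsum_le_tsum hJ))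
  rw [ENNReal.tsum_mul_left, ENNReal.tsum_geometric]
  refine mul_ne_top (mul_ne_top coe_ne_top hI) (ENNReal.inv_ne_top.2 ?_)
  have : ofReal ρ < 1 := by rw [ENNReal.ofReal_lt_one]; norm_num [ρ]
  exact (tsub_pos_of_lt this).ne'

lemma integrableOn_energy (hσ : σ = 1 ∨ σ = -1) (hA : Elliptic A Λ) {G : VF n}
    (hG : LocL2 (halfSpace n σ) G)
    (hN : ∀ K : Set (Rn n), IsCompact K → ∫⁻ x in K, ntMax σ G x ≠ ⊤) {Φ : Rn1 n → ℂ}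
    (hΦ : ContDiff ℝ ∞ Φ) (hc : HasCompactSupport Φ) :
    IntegrableOn (energy A G Φ) (halfSpace n σ) := by
  have hGm : AEStronglyMeasurable G (volOn (halfSpace n σ)) :=
    (hG.locallyIntegrableOn (isOpen_halfSpace n σ)).aestronglyMeasurable
  have hGi : IntegrableOn G (halfSpace n σ ∩ tsupport Φ) :=
    ⟨hGm.mono_measure (Measure.restrict_mono inter_subset_left le_rfl),
      lt_top_iff_ne_top.2 (lintegral_boundary_ne_top hσ hG hN hc)⟩
  have h1 : IntegrableOn (energy A G Φ) (halfSpace n σ ∩ tsupport Φ) := by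
    have : energy A G Φ = fun X => ∑ j, energyCoef A Φ j X * G X j := by
      ext X; exact energy_eq_sum A G Φ X
    rw [this]
    refine integrable_finsetSum _ fun j _ => ?_
    have h2 : MemLp (fun X => G X j) 1 (volOn (halfSpace n σ ∩ tsupport Φ)) :=
      memLp_one_iff_integrable.2 ((EuclideanSpace.proj (𝕜 := ℂ) j).integrable_comp hGi)
    exact ((hA.memLp_energyCoef hΦ hc j ⊤).restrict _).integrable_mul h2
  refine h1.of_forall_sdiff_eq_zero (isOpen_halfSpace n σ).measurableSet fun X hX => ?_
  have : X ∉ tsupport Φ := fun h => hX.2 ⟨hX.1, h⟩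
  simp [energy, fderiv_of_notMem_tsupport ℝ this]

lemma tendsto_integral_energy_above {f : Rn1 n → ℂ}
    (hf : IntegrableOn f (halfSpace n σ)) :
    Tendsto (fun t => ∫ X in {X | 0 < σ * (X.2 - t)}, f X) (toZero σ)
      (𝓝 (∫ X in halfSpace n σ, f X)) := by
  have hop : ∀ t, MeasurableSet {X : Rn1 n | 0 < σ * (X.2 - t)} := fun t =>
    (isOpen_lt continuous_const (by fun_prop)).measurableSet
  have hhm := (isOpen_halfSpace n σ).measurableSet
  have hsub : ∀ t, 0 < σ * t → {X : Rn1 n | 0 < σ * (X.2 - t)} ⊆ halfSpace n σ := fun t ht X hX => by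
    have : 0 < σ * (X.2 - t) := hX
    change 0 < σ * X.2
    linarith [mul_sub σ X.2 t]
  have key : Tendsto (fun t => ∫ X in halfSpace n σ, {X | 0 < σ * (X.2 - t)}.indicator f X)
      (toZero σ) (𝓝 (∫ X in halfSpace n σ, f X)) := by
    have : (toZero σ).IsCountablyGenerated := by unfold toZero; infer_instance
    refine tendsto_integral_filter_of_dominated_convergence (fun X => ‖f X‖) ?_ ?_ hf.norm ?_
    · exact .of_forall fun t => hf.1.indicator (hop t)
    · exact .of_forall fun t => .of_forall fun X => norm_indicator_le_norm_self _ _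
    · refine (ae_restrict_iff' hhm).2 (.of_forall fun X hX => ?_)
      refine tendsto_const_nhds.congr' ?_
      filter_upwards [toZero_lt σ hX] with t ht
      rw [indicator_of_mem]
      change 0 < σ * (X.2 - t)
      rw [mul_sub]; linarith
  refine key.congr' ?_
  filter_upwards [toZero_pos σ] with t ht
  rw [setIntegral_indicator (hop t), inter_eq_right.2 (hsub t ht)]

/-! ### Boundary values in `L^p`, `p > 1` -/

lemma lintegral_rpow_ne_top_of_pNorm {p : ℝ} (hp : 0 < p) {N : Rn n → ℝ≥0∞}
    (h : pNorm p N < ⊤) : ∫⁻ x, N x ^ p ≠ ⊤ := fun h' => by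
  rw [pNorm, h', ENNReal.top_rpow_of_pos (by positivity)] at h
  exact lt_irrefl _ h

lemma eLpNorm_eq_rpow {V : Type*} [NormedAddCommGroup V] {p : ℝ} (hp : 0 < p) (f : Rn n → V) :
    eLpNorm f (ofReal p) volume = (∫⁻ x, ‖f x‖ₑ ^ p) ^ (1 / p) := by
  rw [eLpNorm_eq_lintegral_rpow_enorm_toReal (by simpa using hp) ofReal_ne_top, toReal_ofReal hp.le]

/-- Bounds on slices by the maximal function. -/
structure SliceBound (σ p : ℝ) (C : ℝ≥0) (N : Rn n → ℝ≥0∞) (V : ℝ → Rn n → Cv (n + 1)) :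
    Prop where
  meas : ∀ t, 0 < σ * t → AEStronglyMeasurable (V t) volume
  lp : ∀ t, 0 < σ * t → ∫⁻ x, ‖V t x‖ₑ ^ p ≤ C * ∫⁻ x, N x ^ p
  test : ∀ t, 0 < σ * t → ∀ ψ : Rn n → ℝ≥0∞, Measurable ψ →
    ∫⁻ x, ‖V t x‖ₑ * ψ x ≤ C * ∫⁻ y, N y * ⨆ x ∈ cB y (σ * t), ψ x

lemma SliceBound.exists_weakLp (hσ : σ = 1 ∨ σ = -1) {p : ℝ} (hp : 1 < p) {C : ℝ≥0}
    {N : Rn n → ℝ≥0∞} {V : ℝ → Rn n → Cv (n + 1)} (hV : SliceBound σ p C N V) (hN : Measurable N)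
    (hNp : ∫⁻ x, N x ^ p ≠ ⊤) {F : ℝ → Rn n → ℂ} {b : ℝ≥0}
    (hFm : ∀ t, 0 < σ * t → AEStronglyMeasurable (F t) volume)
    (hFb : ∀ t, 0 < σ * t → ∀ᵐ x, ‖F t x‖ ≤ b * ‖V t x‖)
    (hlim : ∀ φ ∈ testFun (Rn n), ∃ c : ℂ, Tendsto (fun t => ∫ x, F t x * φ x) (toZero σ) (𝓝 c)) :
    ∃ g : Rn n → ℂ, WeakLp p F (toZero σ) g := by
  have hp0 : 0 < p := by linarith
  have hne := toZero_neBot hσ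
  obtain ⟨hfin, hNL⟩ := memLp_toReal hN hp0 hNp
  obtain ⟨m, hmc, hm0, hmL⟩ := exists_pos_memLp n hp.le
  have hFb' : ∀ t, 0 < σ * t → ∀ᵐ x, ‖F t x‖ₑ ≤ b * ‖V t x‖ₑ := fun t ht =>
    (hFb t ht).mono fun x hx => by
      rw [← ofReal_norm, ← ofReal_norm, ← ofReal_coe_nnreal, ← ofReal_mul (NNReal.coe_nonneg b)]
      exact ofReal_le_ofReal hx
  set M : Rn n → ℝ := fun x => (b * C : ℝ≥0) * (N x).toReal + m x
  have hMm : Measurable M := (hN.ennreal_toReal.const_mul _).add hmc.measurable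
  have hML : MemLp M (ofReal p) := (hNL.const_mul _).add hmL
  have hM0 : ∀ x, 0 ≤ M x := fun x => add_nonneg (mul_nonneg (NNReal.coe_nonneg (b * C)) toReal_nonneg)
    (hm0 x).le
  refine LayerPot.exists_weakLp hp (M := M) (m := m) (K := b * (C * ∫⁻ x, N x ^ p) ^ (1 / p))
    hMm hmc hm0 (fun x => le_add_of_nonneg_left (mul_nonneg (NNReal.coe_nonneg (b * C)) toReal_nonneg))
    hML ?_ ?_ ?_
  · exact mul_ne_top coe_ne_top (rpow_ne_top_of_nonneg (by positivity) (mul_ne_top coe_ne_top hNp))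
  · filter_upwards [toZero_pos σ] with t ht
    have h1 : eLpNorm (F t) (ofReal p) volume ≤ b * (C * ∫⁻ x, N x ^ p) ^ (1 / p) := by
      refine (eLpNorm_le_nnreal_smul_eLpNorm_of_ae_le_mul (hFb t ht) _).trans ?_
      rw [eLpNorm_eq_rpow hp0, ENNReal.smul_def, smul_eq_mul]
      gcongr
      exact hV.lp t ht
    refine ⟨⟨hFm t ht, h1.trans_lt ?_⟩, h1⟩
    exact lt_top_iff_ne_top.2 (mul_ne_top coe_ne_top
      (rpow_ne_top_of_nonneg (by positivity) (mul_ne_top coe_ne_top hNp)))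
  · intro φ hφ
    obtain ⟨c, hc⟩ := hlim φ hφ
    refine ⟨c, hc, ?_⟩
    have h1 := enorm_limit_le hσ hN (fun K hK => setLIntegral_ne_top_of_rpow hp.le hNp hK)
      (C := b * C) (F := F) (fun t ht ψ hψ => by
        calc ∫⁻ x, ‖F t x‖ₑ * ψ x ≤ ∫⁻ x, b * (‖V t x‖ₑ * ψ x) := by
              refine lintegral_mono_ae ((hFb' t ht).mono fun x hx => ?_)
              rw [← mul_assoc]
              gcongr
          _ = b * ∫⁻ x, ‖V t x‖ₑ * ψ x := lintegral_const_mul' _ _ coe_ne_top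
          _ ≤ b * (C * ∫⁻ y, N y * ⨆ x ∈ cB y (σ * t), ψ x) := by
              gcongr; exact hV.test t ht ψ hψ
          _ = _ := by push_cast; ring) hφ hc
    have hconj := holderConjugate_ofReal hp
    have hMφ : Integrable fun x => M x * ‖φ x‖ :=
      hML.integrable_mul (testFun.memLp hφ (ofReal (p / (p - 1)))).norm
    have h2 : ‖c‖ₑ ≤ ofReal (∫ x, M x * ‖φ x‖) := by
      rw [ofReal_integral_eq_lintegral_ofReal hMφ
        (.of_forall fun x => mul_nonneg (hM0 x) (norm_nonneg _))]
      refine h1.trans ?_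
      rw [← lintegral_const_mul' _ _ coe_ne_top]
      refine lintegral_mono_ae (hfin.mono fun x hx => ?_)
      rw [ofReal_mul (hM0 x), ofReal_norm, ← mul_assoc]
      gcongr
      calc ((b * C : ℝ≥0) : ℝ≥0∞) * N x = ofReal ((b * C : ℝ≥0) * (N x).toReal) := by
            rw [ofReal_mul (NNReal.coe_nonneg (b * C)), ofReal_toReal hx]
            congr 1
            exact (ofReal_coe_nnreal).symm
        _ ≤ _ := ofReal_le_ofReal (le_add_of_nonneg_right (hm0 x).le)
    rw [← ofReal_norm] at h2
    exact (ofReal_le_ofReal_iff (integral_nonneg fun x => mul_nonneg (hM0 x) (norm_nonneg _))).1 h2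

lemma SliceBound.setLIntegral_le {p : ℝ} {C : ℝ≥0}
    {N : Rn n → ℝ≥0∞} {V : ℝ → Rn n → Cv (n + 1)} (hV : SliceBound σ p C N V)
    {B : Set (Rn n)} (hB : IsCompact B) {t : ℝ} (ht : 0 < σ * t) (ht1 : σ * t ≤ 1) :
    ∫⁻ x in B, ‖V t x‖ₑ ≤ C * ∫⁻ y in cthickening 1 B, N y := by
  have hBm := hB.isClosed.measurableSet
  have h := hV.test t ht (B.indicator fun _ => 1) (measurable_const.indicator hBm)
  have e : ∫⁻ x, ‖V t x‖ₑ * B.indicator (fun _ => 1) x = ∫⁻ x in B, ‖V t x‖ₑ := by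
    rw [← lintegral_indicator hBm]
    congr 1; ext x
    by_cases hx : x ∈ B <;> simp [hx]
  rw [e] at h
  refine h.trans (mul_le_mul_right ?_ _)
  rw [← lintegral_indicator isClosed_cthickening.measurableSet]
  refine lintegral_mono fun y => ?_
  by_cases hy : y ∈ cthickening 1 B
  · rw [indicator_of_mem hy]
    refine mul_le_of_le_one_right zero_le (iSup₂_le fun x _ => ?_)
    exact indicator_le_self' (fun _ _ => zero_le) x
  · have : (⨆ x ∈ cB y (σ * t), B.indicator (fun _ => (1 : ℝ≥0∞)) x) = 0 := by
      refine le_antisymm (iSup₂_le fun x hx => ?_) zero_le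
      rw [indicator_of_notMem]
      exact fun hxB => hy (mem_cthickening_of_dist_le y x 1 _ hxB (by
        rw [dist_comm]; exact (mem_closedBall.1 hx).trans ht1))
    rw [this, mul_zero]
    exact zero_le

lemma Elliptic.norm_conormal_le (hA : Elliptic A Λ) (hΛ : 0 < Λ) :
    ∀ᵐ x : Rn n, ∀ V : Rn n → Cv (n + 1),
      ‖conormal A V x‖ ≤ (((n + 1) * Λ).toNNReal : ℝ≥0) * ‖V x‖ := by
  filter_upwards [hA.norm_entry_le] with x hx V
  rw [conormal, norm_neg, Real.coe_toNNReal _ (by positivity)]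
  refine (norm_sum_le _ _).trans ?_
  calc _ ≤ ∑ _j : Fin (n + 1), Λ * ‖V x‖ := by
        refine Finset.sum_le_sum fun j _ => ?_
        rw [norm_mul]
        exact mul_le_mul (hx _ _) (PiLp.norm_apply_le _ _) (norm_nonneg _) hΛ.le
    _ = _ := by simp; ring

lemma Elliptic.aestronglyMeasurable_conormal (hA : Elliptic A Λ) {V : Rn n → Cv (n + 1)}
    (hV : AEStronglyMeasurable V volume) : AEStronglyMeasurable (conormal A V) volume := by
  have h : AEStronglyMeasurable (fun x => ∑ j, A x (Fin.last n) j * V x j)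
      (volume : Measure (Rn n)) :=
    Finset.aestronglyMeasurable_fun_sum _ fun j _ => (hA.meas _ j).mul
      ((EuclideanSpace.proj (𝕜 := ℂ) j).continuous.comp_aestronglyMeasurable hV)
  exact h.neg

/-- The variational co-normal derivative as a weak limit. -/
lemma VerticalPair.exists_isVarConormal {u w : Rn1 n → ℂ} {G H : VF n}
    (hP : VerticalPair A σ u w G H) (hσ : σ = 1 ∨ σ = -1) (hA : Elliptic A Λ) (hΛ : 0 < Λ) {p : ℝ}
    (hp : 1 < p) {C : ℝ≥0} {V : ℝ → Rn n → Cv (n + 1)}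
    (hVd : V = fun t => sliceGrad σ t (σ * t / 64) G H)
    (hV : SliceBound σ p C (ntMax σ G) V) (hNp : ∫⁻ x, ntMax σ G x ^ p ≠ ⊤) :
    ∃ g, IsVarConormal A σ p G g ∧ WeakLp p (fun t => conormal A (V t)) (toZero σ) g := by
  have hne := toZero_neBot hσ
  have hss := sign_mul_self hσ
  have hssc : (σ : ℂ) * σ = 1 := by exact_mod_cast hss
  have hNl : ∀ K : Set (Rn n), IsCompact K → ∫⁻ x in K, ntMax σ G x ≠ ⊤ := fun K hK =>
    setLIntegral_ne_top_of_rpow hp.le hNp hK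
  have hEi := fun {Φ : Rn1 n → ℂ} (hΦ : ContDiff ℝ ∞ Φ) (hc : HasCompactSupport Φ) =>
    integrableOn_energy hσ hA hP.sol.gradLocL2 hNl hΦ hc
  set b : ℝ≥0 := ((n + 1) * Λ).toNNReal
  have hlevel : ∀ {Φ : Rn1 n → ℂ}, ContDiff ℝ ∞ Φ → HasCompactSupport Φ →
      Tendsto (fun t => ∫ x, conormal A (V t) x * Φ (x, t)) (toZero σ)
        (𝓝 (σ * ∫ X in halfSpace n σ, energy A G Φ X)) := by
    intro Φ hΦ hc
    refine ((tendsto_integral_energy_above (hEi hΦ hc)).const_mul (σ : ℂ)).congr' ?_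
    filter_upwards [toZero_pos σ] with t ht
    rw [hP.integral_energy_above hσ hA ht (by positivity : 0 < σ * t / 64) hΦ hc, ← mul_assoc, hssc,
      one_mul, hVd]
  obtain ⟨χ, hχd, hχc, hχ1⟩ : ∃ χ : ℝ → ℂ, ContDiff ℝ ∞ χ ∧ HasCompactSupport χ ∧
      ∀ᶠ s in 𝓝 (0 : ℝ), χ s = 1 := by
    set ρ : ContDiffBump (0 : ℝ) := default
    refine ⟨fun s => (ρ s : ℂ), Complex.ofRealCLM.contDiff.comp ρ.contDiff,
      ρ.hasCompactSupport.comp_left (g := fun r : ℝ => (r : ℂ)) (by simp), ?_⟩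
    filter_upwards [ρ.eventuallyEq_one] with s hs
    rw [hs]; simp
  have hFm : ∀ t, 0 < σ * t → AEStronglyMeasurable (conormal A (V t)) volume := fun t ht =>
    hA.aestronglyMeasurable_conormal (hV.meas t ht)
  obtain ⟨g, hg⟩ := hV.exists_weakLp hσ hp (measurable_ntMax σ G) hNp
    (F := fun t => conormal A (V t)) (b := b) hFm
    (fun t ht => (hA.norm_conormal_le hΛ).mono fun x hx => hx (V t)) (fun φ hφ => by
      have h1 : ContDiff ℝ ∞ fun X : Rn1 n => φ X.1 * χ X.2 :=
        (hφ.1.comp contDiff_fst).mul (hχd.comp contDiff_snd)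
      have h2 : HasCompactSupport fun X : Rn1 n => φ X.1 * χ X.2 :=
        IsCompact.of_isClosed_subset (IsCompact.prod hφ.2 hχc) (isClosed_tsupport _)
          (tsupport_mul_prod_subset φ χ)
      refine ⟨_, (hlevel h1 h2).congr' ?_⟩
      have h3 : ∀ᶠ t in toZero σ, χ t = 1 := hχ1.filter_mono nhdsWithin_le_nhds
      filter_upwards [h3] with t ht
      simp only [ht, mul_one])
  refine ⟨g, ⟨hg.memLp_lim, fun Φ hΦ hc => ⟨hEi hΦ hc, ?_⟩⟩, hg⟩
  set B : Set (Rn n) := Prod.fst '' tsupport Φ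
  have hBc : IsCompact B := IsCompact.image hc continuous_fst
  have hΦB : ∀ X : Rn1 n, X.1 ∉ B → Φ X = 0 := fun X hX =>
    image_eq_zero_of_notMem_tsupport fun h => hX ⟨X, h, rfl⟩
  have hslice : ∀ t, (fun x => Φ (x, t)) ∈ testFun (Rn n) := fun t =>
    ⟨hΦ.comp (by fun_prop), HasCompactSupport.intro hBc fun x hx => hΦB (x, t) hx⟩
  obtain ⟨L, hL⟩ := hΦ.lipschitzWith_of_hasCompactSupport hc (by simp)
  have hconj := holderConjugate_ofReal hp
  have h1 := hg.tendsto (fun x => Φ (x, 0)) (testFun.memLp (hslice 0) _)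
  have h2 := hlevel hΦ hc
  set I := ∫⁻ y in cthickening 1 B, ntMax σ G y
  have hI : I ≠ ⊤ := hNl _ hBc.cthickening
  have h3 : Tendsto (fun t => (∫ x, conormal A (V t) x * Φ (x, t))
      - ∫ x, conormal A (V t) x * Φ (x, 0)) (toZero σ) (𝓝 0) := by
    rw [tendsto_zero_iff_enorm_tendsto_zero]
    have hz : Tendsto (fun t => (b * L : ℝ≥0) * ofReal (σ * t) * (C * I)) (toZero σ)
        (𝓝 0) := by
      have h4 : Tendsto (fun t => ofReal (σ * t)) (toZero σ) (𝓝 0) := by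
        have := (ENNReal.continuous_ofReal.tendsto 0).comp (tendsto_toZero σ)
        rwa [ENNReal.ofReal_zero] at this
      have h5 := ENNReal.Tendsto.mul_const (ENNReal.Tendsto.const_mul (a := ((b * L : ℝ≥0) : ℝ≥0∞)) h4
        (Or.inr coe_ne_top)) (b := C * I) (Or.inr (mul_ne_top coe_ne_top hI))
      rwa [mul_zero, zero_mul] at h5
    refine tendsto_of_tendsto_of_tendsto_of_le_of_le' tendsto_const_nhds hz
      (.of_forall fun _ => zero_le) ?_
    filter_upwards [toZero_pos σ, toZero_lt σ one_pos, hg.memLp] with t ht ht1 htL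
    have hi : ∀ s, Integrable fun x => conormal A (V t) x * Φ (x, s) := fun s =>
      htL.integrable_mul (testFun.memLp (hslice s) (ofReal (p / (p - 1))))
    rw [← integral_sub (hi t) (hi 0)]
    refine (enorm_integral_le_lintegral_enorm _).trans ?_
    calc ∫⁻ x, ‖conormal A (V t) x * Φ (x, t) - conormal A (V t) x * Φ (x, 0)‖ₑ
        ≤ ∫⁻ x, B.indicator (fun x => (b * L : ℝ≥0) * ofReal (σ * t) * ‖V t x‖ₑ) x := by
          refine lintegral_mono_ae ((hA.norm_conormal_le hΛ).mono fun x hx => ?_)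
          by_cases hxB : x ∈ B
          · rw [indicator_of_mem hxB, ← mul_sub, ← ofReal_norm, ← ofReal_norm (V t x), norm_mul,
              ← ofReal_coe_nnreal, ← ofReal_mul NNReal.zero_le_coe,
              ← ofReal_mul (by positivity)]
            refine ofReal_le_ofReal ?_
            have h6 : ‖Φ (x, t) - Φ (x, 0)‖ ≤ L * (σ * t) := by
              have h7 := hL.dist_le_mul (x, t) (x, 0)
              rw [dist_eq_norm] at h7
              refine h7.trans_eq ?_
              rw [Prod.dist_eq]
              simp only [dist_self, Real.dist_eq, sub_zero]
              rw [max_eq_right (abs_nonneg _), abs_eq_sign_mul hσ ht]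
            calc _ ≤ (b * ‖V t x‖) * (L * (σ * t)) :=
                  mul_le_mul (hx (V t)) h6 (norm_nonneg _) (by positivity)
              _ = _ := by push_cast; ring
          · rw [indicator_of_notMem hxB, hΦB (x, t) hxB, hΦB (x, 0) hxB]
            simp
      _ = (b * L : ℝ≥0) * ofReal (σ * t) * ∫⁻ x in B, ‖V t x‖ₑ := by
          rw [lintegral_indicator hBc.isClosed.measurableSet, lintegral_const_mul' _ _
            (mul_ne_top coe_ne_top ofReal_ne_top)]
      _ ≤ _ := by
          gcongr
          exact hV.setLIntegral_le hBc ht ht1.le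
  have h4 := h3.add h1
  simp only [sub_add_cancel, zero_add] at h4
  have h5 := tendsto_nhds_unique h2 h4
  rw [← h5, ← mul_assoc, hssc, one_mul]

/-! ### Approximation of homogeneous Sobolev functions by test functions -/

lemma tendsto_lintegral_tail {h : Rn n → ℝ≥0∞} (hm : AEMeasurable h) (hf : ∫⁻ x, h x ≠ ⊤) :
    Tendsto (fun k : ℕ => ∫⁻ x in {x : Rn n | (k : ℝ) + 1 ≤ ‖x‖}, h x) atTop (𝓝 0) := by
  have hS : ∀ k : ℕ, MeasurableSet {x : Rn n | (k : ℝ) + 1 ≤ ‖x‖} := fun k =>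
    (isClosed_le continuous_const continuous_norm).measurableSet
  have h1 := tendsto_lintegral_of_dominated_convergence' (μ := (volume : Measure (Rn n)))
    (F := fun (k : ℕ) => {x : Rn n | (k : ℝ) + 1 ≤ ‖x‖}.indicator h) (f := fun _ => 0) h
    (fun k => hm.indicator (hS k))
    (fun k => .of_forall fun x => indicator_le_self _ _ x) hf
    (.of_forall fun x => by
      refine tendsto_const_nhds.congr' ?_
      obtain ⟨k₀, hk₀⟩ := exists_nat_ge ‖x‖
      filter_upwards [eventually_ge_atTop k₀] with k hk
      rw [indicator_of_notMem]
      intro hx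
      have h2 : (k : ℝ) + 1 ≤ ‖x‖ := hx
      have h3 : (k₀ : ℝ) ≤ k := by exact_mod_cast hk
      linarith)
  rw [lintegral_zero] at h1
  exact h1.congr fun k => lintegral_indicator (hS k) _

/-- Truncation of a function that satisfies a Hajłasz inequality. -/
lemma exists_truncation (hn : 1 ≤ n) {p : ℝ} (hp : 1 ≤ p) : ∃ D : ℝ≥0, ∀ (f : Rn n → ℂ)
    (F : Rn n → Cv n) (N : Rn n → ℝ≥0∞) (C : ℝ), 0 < C → LocallyIntegrable f →
    MemLp F (ofReal p) → (∀ i, HasWeakDeriv univ (dirX i) f fun x => F x i) →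
    Measurable N → ∫⁻ x, N x ^ p ≠ ⊤ →
    (∀ x y, N x ≠ ⊤ → N y ≠ ⊤ → ‖f x - f y‖ ≤ C * ‖x - y‖ * ((N x).toReal + (N y).toReal)) →
    ∀ R : ℝ, 0 < R → ∀ δ : ℝ≥0∞, δ ≠ 0 → ∃ φ ∈ testFun (Rn n), ∀ i,
      eLpNorm (fun x => fderiv ℝ φ x (dirX i) - F x i) (ofReal p) volume ≤
        ((∫⁻ x in {x : Rn n | R ≤ ‖x‖}, ‖F x‖ₑ ^ p) ^ (1 / p)
          + ((D * ofReal C) ^ p * ∫⁻ x in {x : Rn n | R ≤ ‖x‖}, N x ^ p) ^ (1 / p)) + δ := by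
  obtain ⟨c, hc, hcut⟩ := exists_cutoff (Rn n)
  have hp0 : 0 < p := by linarith
  refine ⟨2 * (4 * c).toNNReal, fun f F N C hC hf hF hw hN hNp hH R hR δ hδ => ?_⟩
  have : Nontrivial (Rn n) := by
    have : Nonempty (Fin n) := ⟨⟨0, hn⟩⟩
    infer_instance
  obtain ⟨η, hηd, hηs, hηc, hη1, hη0, hηle, hηD⟩ := hcut 0 R hR
  set S : Set (Rn n) := {x | R ≤ ‖x‖} with hSd
  have hSm : MeasurableSet S := (isClosed_le continuous_const continuous_norm).measurableSet
  set Q : Set (Rn n) := {x | R ≤ ‖x‖ ∧ ‖x‖ ≤ 2 * R} with hQd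
  have hQm : MeasurableSet Q := ((isClosed_le continuous_const continuous_norm).inter
    (isClosed_le continuous_norm continuous_const)).measurableSet
  have hQS : Q ⊆ S := fun x hx => hx.1
  have hQ0 : volume Q ≠ 0 := by
    obtain ⟨z, hz⟩ := exists_norm_eq (Rn n) (by positivity : 0 ≤ 3 / 2 * R)
    have ho : IsOpen {x : Rn n | R < ‖x‖ ∧ ‖x‖ < 2 * R} :=
      (isOpen_lt continuous_const continuous_norm).inter
        (isOpen_lt continuous_norm continuous_const)
    have hs : {x : Rn n | R < ‖x‖ ∧ ‖x‖ < 2 * R} ⊆ Q := fun x hx => ⟨hx.1.le, hx.2.le⟩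
    exact ((ho.measure_pos volume ⟨z, by constructor <;> linarith⟩).trans_le (measure_mono hs)).ne'
  have hQt : volume Q ≠ ⊤ := ne_top_of_le_ne_top (vol_cB_ne (0 : Rn n) (2 * R))
    (measure_mono fun x hx => by simpa using hx.2)
  have hfin : ∀ᵐ x, N x ≠ ⊤ := (memLp_toReal hN hp0 hNp).1
  have hnull : (volOn Q) ({x | N x = ⊤} ∪ Qᶜ) = 0 := by
    refine measure_union_null ?_ ?_
    · exact le_antisymm ((Measure.restrict_apply_le _ _).trans (by
        simpa [ae_iff] using hfin)) zero_le
    · rw [Measure.restrict_apply hQm.compl]; simp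
  have : IsFiniteMeasure (volOn Q) := ⟨by simpa using lt_top_iff_ne_top.2 hQt⟩
  obtain ⟨y, hy, hyN⟩ := exists_notMem_null_le_laverage (μ := volOn Q)
    (f := fun x => N x ^ p) (by rwa [ne_eq, Measure.restrict_eq_zero])
    (hN.pow_const p).aemeasurable hnull
  have hyt : N y ≠ ⊤ := fun h => hy (Or.inl h)
  have hyQ : y ∈ Q := by by_contra h; exact hy (Or.inr h)
  set T := ∫⁻ x in S, N x ^ p
  have hyT : N y ^ p * volume Q ≤ T := by
    calc _ ≤ (⨍⁻ x in Q, N x ^ p ∂volume) * volume Q := by gcongr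
      _ = ∫⁻ x in Q, N x ^ p := by rw [setLAverage_eq, ENNReal.div_mul_cancel hQ0 hQt]
      _ ≤ T := lintegral_mono_set hQS
  set χ : Rn n → ℂ := fun x => (η x : ℂ)
  have hχd : ContDiff ℝ ∞ χ := Complex.ofRealCLM.contDiff.comp hηd
  have hχc : HasCompactSupport χ := hηc.comp_left (g := fun r : ℝ => (r : ℂ)) (by simp)
  have hχf : ∀ x i, fderiv ℝ χ x (dirX i) = ((fderiv ℝ η x (dirX i) : ℝ) : ℂ) := fun x i => by
    have : HasFDerivAt χ (Complex.ofRealCLM ∘L fderiv ℝ η x) x :=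
      Complex.ofRealCLM.hasFDerivAt.comp x (hηd.differentiable (by simp) x).hasFDerivAt
    rw [this.fderiv]; rfl
  have hχ0 : ∀ x i, x ∉ Q → fderiv ℝ χ x (dirX i) = 0 := by
    intro x i hx
    rw [hχf]
    by_cases h1 : R ≤ ‖x‖
    · have h2 : x ∉ tsupport η := fun h => hx ⟨h1, by simpa using hηs h⟩
      rw [fderiv_of_notMem_tsupport ℝ h2]; simp
    · have h2 : η =ᶠ[𝓝 x] fun _ => 1 := by
        have : ball (0 : Rn n) R ∈ 𝓝 x := isOpen_ball.mem_nhds (by simpa using h1)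
        filter_upwards [this] with z hz
        exact hη1 z (ball_subset_closedBall hz)
      rw [h2.fderiv_eq]; simp
  have hχb : ∀ x i, ‖fderiv ℝ χ x (dirX i)‖ ≤ c / R := by
    intro x i
    rw [hχf, Complex.norm_real]
    refine ((fderiv ℝ η x).le_opNorm _).trans ?_
    have : ‖(dirX i : Rn n)‖ = 1 := by simp [dirX]
    rw [this, mul_one]; exact hηD x
  set g : Rn n → ℂ := fun x => (f x - f y) * χ x
  have hF1 : 1 ≤ ofReal p := ENNReal.one_le_ofReal.2 hp
  have hFi : ∀ i, MemLp (fun x => F x i) (ofReal p) volume := fun i => memLp_piLp_iff.1 hF i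
  have hFl : ∀ i, LocallyIntegrable fun x => F x i := fun i => (hFi i).locallyIntegrable hF1
  have hfl : LocallyIntegrable fun x => f x - f y := hf.sub (locallyIntegrable_const _)
  have hw1 : ∀ i, HasWeakDeriv univ (dirX i) (fun x => f x - f y) fun x => F x i := by
    intro i
    have := (hw i).sub (hf.locallyIntegrableOn _)
      ((locallyIntegrable_const (f y)).locallyIntegrableOn _) ((hFl i).locallyIntegrableOn _)
      ((locallyIntegrable_const (0 : ℂ)).locallyIntegrableOn _) (hasWeakDeriv_const (f y))
    simpa using this
  set W : Fin n → Rn n → ℂ := fun i x => F x i * χ x + (f x - f y) * fderiv ℝ χ x (dirX i)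
  have hgW : ∀ i, HasWeakDeriv univ (dirX i) g (W i) := fun i =>
    (hw1 i).mul_cutoff (hfl.locallyIntegrableOn _) ((hFl i).locallyIntegrableOn _) hχd hχc
      (subset_univ _)
  have hgl : LocallyIntegrable g :=
    (hfl.integrable_smul_right_of_hasCompactSupport hχd.continuous hχc).locallyIntegrable.congr
      (.of_forall fun x => rfl)
  set a₁ := (∫⁻ x in S, ‖F x‖ₑ ^ p) ^ (1 / p)
  set D : ℝ≥0 := (4 * c).toNNReal
  have e1 : ∀ i, eLpNorm (fun x => F x i * (χ x - 1)) (ofReal p) volume ≤ a₁ := by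
    intro i
    rw [eLpNorm_eq_rpow hp0]
    refine rpow_le_rpow ?_ (by positivity)
    rw [← lintegral_indicator hSm]
    refine lintegral_mono fun x => ?_
    by_cases hx : x ∈ S
    · rw [indicator_of_mem hx]
      refine rpow_le_rpow ?_ hp0.le
      rw [enorm_mul]
      have h1 : ‖χ x - 1‖ₑ ≤ 1 := by
        rw [← ofReal_norm, ENNReal.ofReal_le_one]
        have : χ x - 1 = ((η x - 1 : ℝ) : ℂ) := by simp [χ]
        rw [this, Complex.norm_real, Real.norm_eq_abs, abs_le]
        constructor <;> linarith [hη0 x, hηle x]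
      have h2 : ‖F x i‖ₑ ≤ ‖F x‖ₑ := by
        rw [← ofReal_norm, ← ofReal_norm]
        exact ofReal_le_ofReal (PiLp.norm_apply_le (F x) i)
      calc _ ≤ ‖F x‖ₑ * 1 := by gcongr
        _ = _ := mul_one _
    · have : η x = 1 := hη1 x (by
        have : ¬ R ≤ ‖x‖ := hx
        simpa using (not_le.1 this).le)
      simp [χ, this, hp0]
  have e2 : ∀ i, eLpNorm (fun x => (f x - f y) * fderiv ℝ χ x (dirX i)) (ofReal p) volume
      ≤ (((2 * D : ℝ≥0) * ofReal C) ^ p * T) ^ (1 / p) := by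
    intro i
    rw [eLpNorm_eq_rpow hp0]
    refine rpow_le_rpow ?_ (by positivity)
    have hDe : (D : ℝ≥0∞) = ofReal (4 * c) := rfl
    have h1 : ∀ᵐ x, ‖(f x - f y) * fderiv ℝ χ x (dirX i)‖ₑ ^ p ≤
        Q.indicator (fun x => (D * ofReal C) ^ p * (2 ^ (p - 1) * (N x ^ p + N y ^ p))) x := by
      filter_upwards [hfin] with x hx
      by_cases hxQ : x ∈ Q
      · rw [indicator_of_mem hxQ]
        have h2 : ‖(f x - f y) * fderiv ℝ χ x (dirX i)‖ₑ ≤ (D * ofReal C) * (N x + N y) := by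
          have h3 : ‖x - y‖ ≤ 4 * R := (norm_sub_le _ _).trans (by linarith [hxQ.2, hyQ.2])
          have h4 : ‖(f x - f y) * fderiv ℝ χ x (dirX i)‖
              ≤ 4 * c * C * ((N x).toReal + (N y).toReal) := by
            rw [norm_mul]
            calc _ ≤ (C * (4 * R) * ((N x).toReal + (N y).toReal)) * (c / R) := by
                  refine mul_le_mul ((hH x y hx hyt).trans ?_) (hχb x i) (norm_nonneg _)
                    (by positivity)
                  gcongr
              _ = _ := by field_simp
          rw [← ofReal_norm, hDe, ← ofReal_mul (by positivity)]
          refine (ofReal_le_ofReal h4).trans_eq ?_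
          rw [ofReal_mul (by positivity), ENNReal.ofReal_add toReal_nonneg
            toReal_nonneg, ofReal_toReal hx, ofReal_toReal hyt]
        calc _ ≤ ((D * ofReal C) * (N x + N y)) ^ p := by gcongr
          _ = (D * ofReal C) ^ p * (N x + N y) ^ p := mul_rpow_of_nonneg _ _ hp0.le
          _ ≤ _ := by
            gcongr
            exact ENNReal.rpow_add_le_mul_rpow_add_rpow _ _ hp
      · rw [hχ0 x i hxQ, mul_zero, enorm_zero, ENNReal.zero_rpow_of_pos hp0]
        exact zero_le
    refine (lintegral_mono_ae h1).trans ?_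
    have hDC : (D * ofReal C) ^ p ≠ ⊤ := rpow_ne_top_of_nonneg hp0.le (by finiteness)
    have h2t : (2 : ℝ≥0∞) ^ (p - 1) ≠ ⊤ := rpow_ne_top_of_nonneg (by linarith) (by simp)
    rw [lintegral_indicator hQm, lintegral_const_mul' _ _ hDC, lintegral_const_mul' _ _ h2t,
      lintegral_add_right _ measurable_const, setLIntegral_const]
    calc _ ≤ (D * ofReal C) ^ p * (2 ^ (p - 1) * (T + T)) := by
          gcongr
          exact lintegral_mono_set hQS
      _ = (D * ofReal C) ^ p * (2 ^ (p - 1) * 2 ^ (1 : ℝ)) * T := by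
          rw [rpow_one]; ring
      _ = _ := by
          rw [← ENNReal.rpow_add _ _ (by simp) (by simp), sub_add_cancel,
            ← mul_rpow_of_nonneg _ _ hp0.le]
          push_cast
          congr 2
          ring
  have hm1 : ∀ i, AEStronglyMeasurable (fun x => F x i * (χ x - 1)) (volume : Measure (Rn n)) :=
    fun i => (hFi i).1.mul (hχd.continuous.sub continuous_const).aestronglyMeasurable
  have hm2 : ∀ i, AEStronglyMeasurable (fun x => (f x - f y) * fderiv ℝ χ x (dirX i))
      (volume : Measure (Rn n)) := fun i =>
    hfl.aestronglyMeasurable.mul (cont_fderiv hχd _).aestronglyMeasurable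
  have hWd : ∀ i, (fun x => W i x - F x i) = (fun x => F x i * (χ x - 1))
      + fun x => (f x - f y) * fderiv ℝ χ x (dirX i) := fun i => by
    ext x; simp only [W, Pi.add_apply]; ring
  have hWF : ∀ i, eLpNorm (fun x => W i x - F x i) (ofReal p) volume ≤
      a₁ + (((2 * D : ℝ≥0) * ofReal C) ^ p * T) ^ (1 / p) := by
    intro i
    rw [hWd]
    exact (eLpNorm_add_le (hm1 i) (hm2 i) hF1).trans (add_le_add (e1 i) (e2 i))
  have hT : T ≠ ⊤ := ne_top_of_le_ne_top hNp (setLIntegral_le_lintegral _ _)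
  have ha₁ : a₁ ≠ ⊤ := by
    have h1 := hF.2.ne
    rw [eLpNorm_eq_rpow hp0] at h1
    exact ne_top_of_le_ne_top h1 (rpow_le_rpow (setLIntegral_le_lintegral _ _) (by positivity))
  have hWL : ∀ i, MemLp (W i) (ofReal p) volume := by
    intro i
    have h1 : MemLp (fun x => W i x - F x i) (ofReal p) volume := by
      refine ⟨?_, (hWF i).trans_lt (lt_top_iff_ne_top.2 (ENNReal.add_ne_top.2 ⟨ha₁, ?_⟩))⟩
      · rw [hWd]; exact (hm1 i).add (hm2 i)
      · exact rpow_ne_top_of_nonneg (by positivity) (mul_ne_top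
          (rpow_ne_top_of_nonneg hp0.le (by finiteness)) hT)
    have h2 := h1.add (hFi i)
    refine (memLp_congr_ae (.of_forall fun x => ?_)).1 h2
    simp
  have hev : ∀ i, ∀ᶠ k in atTop, eLpNorm (fun x => moll (bump (Rn n) k) (W i) x - W i x)
      (ofReal p) volume ≤ δ := fun i =>
    ((tendsto_moll hF1 ofReal_ne_top (hWL i)).eventually
      (gt_mem_nhds (pos_iff_ne_zero.2 hδ))).mono fun _ h => h.le
  obtain ⟨k, hk⟩ := (eventually_all.2 hev).exists
  have hmc := fun i => moll_contDiff (bump (Rn n) k) ((hWL i).locallyIntegrable hF1)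
  refine ⟨moll (bump (Rn n) k) g, ⟨moll_contDiff _ hgl, moll_hasCompactSupport _ hχc fun x hx => by
    simp only [g, image_eq_zero_of_notMem_tsupport hx, mul_zero]⟩, fun i => ?_⟩
  have e3 : (fun x => fderiv ℝ (moll (bump (Rn n) k) g) x (dirX i) - F x i)
      = (fun x => W i x - F x i) + fun x => moll (bump (Rn n) k) (W i) x - W i x := by
    ext x
    rw [moll_fderiv _ hgl (hgW i) x]
    simp
  rw [e3]
  have hmi := (hmc i).continuous.aestronglyMeasurable (μ := (volume : Measure (Rn n)))
  specialize hk i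
  generalize moll (bump (Rn n) k) (W i) = Y at hk hmi ⊢
  exact (eLpNorm_add_le ((hWL i).1.sub (hFi i).1) (hmi.sub (hWL i).1) hF1).trans
    (add_le_add (hWF i) hk)

lemma exists_testFun_approx (hn : 1 ≤ n) {p : ℝ} (hp : 1 ≤ p) {f : Rn n → ℂ}
    {F : Rn n → Cv n} {N : Rn n → ℝ≥0∞} {C : ℝ} (hC : 0 < C) (hf : LocallyIntegrable f)
    (hF : MemLp F (ofReal p)) (hw : ∀ i, HasWeakDeriv univ (dirX i) f fun x => F x i)
    (hN : Measurable N) (hNp : ∫⁻ x, N x ^ p ≠ ⊤)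
    (hH : ∀ x y, N x ≠ ⊤ → N y ≠ ⊤ → ‖f x - f y‖ ≤ C * ‖x - y‖ * ((N x).toReal + (N y).toReal)) :
    HomSobolev (ofReal p) f F := by
  have hp0 : 0 < p := by linarith
  refine ⟨hf, hF, hw, ?_⟩
  obtain ⟨D, hD⟩ := exists_truncation hn hp
  choose φ hφ hφb using fun k : ℕ => hD f F N C hC hf hF hw hN hNp hH ((k : ℝ) + 1)
    (by positivity) (((k : ℝ≥0∞) + 1)⁻¹) (by simp)
  refine ⟨φ, hφ, fun i => ?_⟩
  have hFp : ∫⁻ x, ‖F x‖ₑ ^ p ≠ ⊤ := by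
    have h1 := hF.2
    rw [eLpNorm_lt_top_iff_lintegral_rpow_enorm_lt_top (by simpa using hp0) ofReal_ne_top,
      toReal_ofReal hp0.le] at h1
    exact h1.ne
  have hr : Tendsto (fun x : ℝ≥0∞ => x ^ (1 / p)) (𝓝 0) (𝓝 0) := by
    have := (ENNReal.continuous_rpow_const (y := 1 / p)).tendsto 0
    rwa [ENNReal.zero_rpow_of_pos (by positivity)] at this
  have h1 := hr.comp (tendsto_lintegral_tail (hF.1.enorm.pow_const p) hFp)
  have h2 := ENNReal.Tendsto.const_mul (tendsto_lintegral_tail (hN.pow_const p).aemeasurable hNp)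
    (Or.inr (rpow_ne_top_of_nonneg hp0.le
      (mul_ne_top (coe_ne_top (r := D)) (ofReal_ne_top (r := C)))))
  rw [mul_zero] at h2
  have h3 : Tendsto (fun k : ℕ => ((k : ℝ≥0∞) + 1)⁻¹) atTop (𝓝 0) := by
    have := ENNReal.tendsto_inv_nat_nhds_zero.comp (tendsto_add_atTop_nat 1)
    refine this.congr fun k => ?_
    simp
  have h4 := (h1.add (hr.comp h2)).add h3
  rw [add_zero, add_zero] at h4
  exact tendsto_of_tendsto_of_tendsto_of_le_of_le tendsto_const_nhds h4 (fun _ => zero_le)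
    fun k => hφb k i

/-! ### Boundary behaviour for `p > 1` -/

section

variable {u : Rn1 n → ℂ} {f : Rn n → ℂ} {M : Rn n → ℝ} {θ : ℝ}

lemma continuous_slice (hc : ContinuousOn u (halfSpace n σ)) {t : ℝ} (ht : 0 < σ * t) :
    Continuous fun x : Rn n => u (x, t) :=
  hc.comp_continuous (by fun_prop) fun _ => ht

lemma locallyIntegrable_trace (hσ : σ = 1 ∨ σ = -1) (hc : ContinuousOn u (halfSpace n σ))
    (hf : AEStronglyMeasurable f)
    (h : ∀ᵐ x, ∀ t, 0 < σ * t → ‖u (x, t) - f x‖ ≤ M x * (σ * t) ^ θ)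
    (hM : LocallyIntegrable M) : LocallyIntegrable f := by
  have h1 : 0 < σ * σ := by rw [sign_mul_self hσ]; exact one_pos
  have hu := continuous_slice hc h1
  have h2 : LocallyIntegrable fun x => u (x, σ) - f x :=
    hM.mono (hu.aestronglyMeasurable.sub hf) (h.mono fun x hx => by
      have := hx σ h1
      rw [sign_mul_self hσ, Real.one_rpow, mul_one] at this
      exact this.trans (le_abs_self _))
  refine (hu.locallyIntegrable.sub h2).congr (.of_forall fun x => ?_)
  simp

lemma tendsto_integral_slice (hc : ContinuousOn u (halfSpace n σ)) (hθ : 0 < θ)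
    (hf : AEStronglyMeasurable f)
    (h : ∀ᵐ x, ∀ t, 0 < σ * t → ‖u (x, t) - f x‖ ≤ M x * (σ * t) ^ θ) {ψ : Rn n → ℂ}
    (hψ : AEStronglyMeasurable ψ) (hM : Integrable fun x => M x * ‖ψ x‖)
    (hfψ : Integrable fun x => f x * ψ x) :
    Tendsto (fun t => ∫ x, u (x, t) * ψ x) (toZero σ) (𝓝 (∫ x, f x * ψ x)) := by
  rw [tendsto_iff_norm_sub_tendsto_zero]
  have hlim : Tendsto (fun t => (σ * t) ^ θ * ∫ x, M x * ‖ψ x‖) (toZero σ) (𝓝 0) := by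
    have := ((Real.continuous_rpow_const hθ.le).tendsto 0).comp (tendsto_toZero σ)
    simpa [Function.comp_def, Real.zero_rpow hθ.ne'] using this.mul_const (∫ x, M x * ‖ψ x‖)
  refine squeeze_zero' (.of_forall fun _ => norm_nonneg _) ?_ hlim
  filter_upwards [toZero_pos σ] with t ht
  have hb : ∀ᵐ x, ‖(u (x, t) - f x) * ψ x‖ ≤ (σ * t) ^ θ * (M x * ‖ψ x‖) := by
    filter_upwards [h] with x hx
    rw [norm_mul, ← mul_assoc, mul_comm _ (M x)]
    gcongr
    exact hx t ht
  have hd : Integrable fun x => (u (x, t) - f x) * ψ x :=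
    (hM.const_mul _).mono' (((continuous_slice hc ht).aestronglyMeasurable.sub hf).mul hψ) hb
  have e : (fun x => u (x, t) * ψ x) = fun x => (u (x, t) - f x) * ψ x + f x * ψ x := by ext x; ring
  rw [e, integral_add hd hfψ, add_sub_cancel_right, ← integral_const_mul]
  exact norm_integral_le_of_norm_le (hM.const_mul _) hb

end

lemma boundary_behaviour (n : ℕ) (hn : 1 ≤ n) {Λ C₀ : ℝ} (hΛ : 0 < Λ) (hC₀ : 0 < C₀) :
    ∃ ε : ℝ, 0 < ε ∧ ∀ p : ℝ, 1 < p → p < 2 + ε → ∃ C : ℝ≥0, ∀ (A : Coeff n) (α : ℝ), 0 < α →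
      Standard A Λ C₀ α → ∀ σ : ℝ, σ = 1 ∨ σ = -1 → ∀ (u : Rn1 n → ℂ) (G : VF n),
      IsSolution A (halfSpace n σ) u G → ContinuousOn u (halfSpace n σ) →
      pNorm p (ntMax σ G) < ⊤ →
      ∃ (V : ℝ → Rn n → Cv (n + 1)) (g f : Rn n → ℂ) (F : Rn n → Cv n),
        (∀ t : ℝ, 0 < σ * t → IsSliceGrad u t (V t)) ∧ IsVarConormal A σ p G g ∧
        HomSobolev (ofReal p) f F ∧ NTLimit σ u f ∧
        (⨆ (t : ℝ) (_ : 0 < σ * t), eLpNorm (V t) (ofReal p) volume) ≤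
          (C : ℝ≥0∞) * pNorm p (ntMax σ G) ∧
        WeakLp p (fun t => conormal A (V t)) (toZero σ) g ∧
        ∀ i : Fin n, WeakLp p (fun t x => V t x i.castSucc) (toZero σ) (fun x => F x i) := by
  obtain ⟨ε, hε, hs⟩ := exists_slice_estimates n hC₀ hΛ
  obtain ⟨C₁, hC₁, htr⟩ := exists_trace_estimate n hC₀
  obtain ⟨C₂, hC₂, hlip⟩ := exists_trace_lipschitz n hC₀
  refine ⟨ε, hε, fun p hp hpε => ?_⟩
  have hp0 : 0 < p := by linarith
  obtain ⟨C, hC⟩ := hs p hp0 hpε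
  refine ⟨C ^ (1 / p), fun A α hα hA σ hσ u G hu hc hN => ?_⟩
  have hNp := lintegral_rpow_ne_top_of_pNorm hp0 hN
  have hne := toZero_neBot hσ
  have hNm := measurable_ntMax σ G
  obtain ⟨hNf, hNL⟩ := memLp_toReal hNm hp0 hNp
  obtain ⟨w, H, hP⟩ := hA.exists_verticalPair hΛ hα hσ hu hc
  set V : ℝ → Rn n → Cv (n + 1) := fun t => sliceGrad σ t (σ * t / 64) G H with hV
  have hVs : ∀ t : ℝ, 0 < σ * t → IsSliceGrad u t (V t) := fun t ht =>
    hP.isSliceGrad t _ ht (by positivity)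
  have hSB : SliceBound σ p C (ntMax σ G) V := ⟨fun t ht => (hVs t ht).locInt.aestronglyMeasurable,
      fun t ht => (hC A α hA σ hσ u w G H hP t ht).1,
      fun t ht => (hC A α hA σ hσ u w G H hP t ht).2⟩
  obtain ⟨g, hg, hgw⟩ := hP.exists_isVarConormal hσ hA.elliptic hΛ hp hV hSB hNp
  set f := trace σ u
  have hest : ∀ᵐ x, ∀ Z ∈ cone σ x,
      ‖u Z - f x‖ ≤ (C₁ * (ntMax σ G x).toReal) * (σ * Z.2) ^ (1 : ℝ) := by
    filter_upwards [hNf] with x hx Z hZ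
    rw [Real.rpow_one]
    exact htr ⟨hσ, A, α, hA.dgnm, hu, hc⟩ x hx Z hZ
  have hnt : NTLimit σ u f := hest.mono fun x hx => tendsto_cone_of_norm_sub_le one_pos hx
  have hfm : AEStronglyMeasurable f := aestronglyMeasurable_trace hσ hc hnt
  have hest' : ∀ᵐ x, ∀ t, 0 < σ * t →
      ‖u (x, t) - f x‖ ≤ (C₁ * (ntMax σ G x).toReal) * (σ * t) ^ (1 : ℝ) :=
    hest.mono fun x hx t ht => hx (x, t) (by simpa [cone] using ht)
  have hp1 : 1 ≤ ofReal p := ENNReal.one_le_ofReal.2 hp.le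
  have hMl : LocallyIntegrable fun x => C₁ * (ntMax σ G x).toReal :=
    (hNL.const_mul C₁).locallyIntegrable hp1
  have hfl := locallyIntegrable_trace hσ hc hfm hest' hMl
  have hlim : ∀ ψ ∈ testFun (Rn n),
      Tendsto (fun t => ∫ x, u (x, t) * ψ x) (toZero σ) (𝓝 (∫ x, f x * ψ x)) := fun ψ hψ =>
    tendsto_integral_slice hc one_pos hfm hest' hψ.1.continuous.aestronglyMeasurable
      (hMl.integrable_smul_right_of_hasCompactSupport hψ.1.continuous.norm hψ.2.norm)
      (hfl.integrable_smul_right_of_hasCompactSupport hψ.1.continuous hψ.2)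
  have hlimi : ∀ i : Fin n, ∀ φ ∈ testFun (Rn n),
      Tendsto (fun t => ∫ x, V t x i.castSucc * φ x) (toZero σ)
        (𝓝 (-∫ x, f x * fderiv ℝ φ x (dirX i))) := by
    intro i φ hφ
    refine (hlim (fun x => fderiv ℝ φ x (dirX i)) ⟨smooth_fderiv hφ.1 _,
      hcs_fderiv hφ.2 _⟩).neg.congr' ?_
    filter_upwards [toZero_pos σ] with t ht
    rw [(hVs t ht).tangential i φ hφ.1 hφ.2 (subset_univ _), neg_neg]
  have hcomp : ∀ i : Fin n, ∃ F : Rn n → ℂ,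
      WeakLp p (fun t x => V t x i.castSucc) (toZero σ) F := fun i =>
    hSB.exists_weakLp hσ hp hNm hNp (b := 1)
      (fun t ht => (EuclideanSpace.proj (𝕜 := ℂ) i.castSucc).continuous.comp_aestronglyMeasurable
        (hSB.meas t ht))
      (fun t _ => .of_forall fun x => by simpa using PiLp.norm_apply_le (V t x) i.castSucc)
      fun φ hφ => ⟨_, hlimi i φ hφ⟩
  choose F hF using hcomp
  refine ⟨V, g, f, fun x => WithLp.toLp 2 fun i => F i x, hVs, hg, ?_, hnt, ?_, hgw, hF⟩
  · refine exists_testFun_approx hn hp.le hC₂ hfl (memLp_piLp_iff.2 fun i => (hF i).memLp_lim)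
      (fun i φ hφ hφc _ => ?_) hNm hNp (hlip ⟨hσ, A, α, hA.dgnm, hu, hc⟩)
    have := tendsto_nhds_unique ((hF i).tendsto φ (testFun.memLp ⟨hφ, hφc⟩ _)) (hlimi i φ ⟨hφ, hφc⟩)
    rw [this, neg_neg]
  · refine iSup₂_le fun t ht => ?_
    rw [eLpNorm_eq_rpow hp0, pNorm, coe_rpow_of_nonneg _ (by positivity),
      ← mul_rpow_of_nonneg _ _ (by positivity)]
    exact rpow_le_rpow (hSB.lp t ht) (by positivity)

/-! ### Superpositions of translates of Schwartz functions, and constants in `S'` -/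

section

variable {E Y : Type} [NormedAddCommGroup E] [NormedSpace ℝ E] [MeasurableSpace E] [BorelSpace E]
  [FiniteDimensional ℝ E] [MeasurableSpace Y] {μ : Measure Y} {k : Y → ℂ} {m : Y → E}

lemma hasFDerivAt_superposition {F : Type} [NormedAddCommGroup F] [NormedSpace ℝ F]
    [NormedSpace ℂ F] [SMulCommClass ℝ ℂ F] (hm : Measurable m) (hk : Integrable k μ) (φ : 𝓢(E, F))
    (x : E) : HasFDerivAt (fun x => ∫ y, k y • φ (x - m y) ∂μ)
      (∫ y, k y • fderiv ℝ φ (x - m y) ∂μ) x := by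
  have hmeas : ∀ {F : Type} [NormedAddCommGroup F] [NormedSpace ℝ F] [NormedSpace ℂ F]
      (g : E → F), Continuous g → ∀ x, AEStronglyMeasurable (fun y => k y • g (x - m y)) μ :=
    fun g hg x => hk.1.smul
      (hg.comp_stronglyMeasurable (measurable_const.sub hm).stronglyMeasurable).aestronglyMeasurable
  have hb : ∀ {F : Type} [NormedAddCommGroup F] [NormedSpace ℝ F] [NormedSpace ℂ F]
      [SMulCommClass ℝ ℂ F] (g : 𝓢(E, F)) (x : E) (y : Y),
      ‖k y • g (x - m y)‖ ≤ ‖k y‖ * SchwartzMap.seminorm ℝ 0 0 g := fun g x y => by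
    rw [norm_smul]
    gcongr
    exact SchwartzMap.norm_le_seminorm ℝ g _
  exact hasFDerivAt_integral_of_dominated_of_fderiv_le univ_mem
    (.of_forall fun x => hmeas φ φ.continuous x)
    ((hk.norm.mul_const _).mono' (hmeas φ φ.continuous x) (.of_forall (hb φ x)))
    (hmeas _ (SchwartzMap.fderivCLM ℝ E F φ).continuous x)
    (.of_forall fun y x _ => hb (SchwartzMap.fderivCLM ℝ E F φ) x y)
    (hk.norm.mul_const _)
    (.of_forall fun y x _ =>
      ((φ.hasFDerivAt (x - m y)).comp x ((hasFDerivAt_id x).sub_const (m y))).const_smul (k y))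

lemma superposition_decay (hm : Measurable m)
    (hk : ∀ j : ℕ, Integrable (fun y => ‖m y‖ ^ j * ‖k y‖) μ) (hk0 : Integrable k μ) (l : ℕ) :
    ∀ {F : Type} [NormedAddCommGroup F] [NormedSpace ℝ F] [NormedSpace ℂ F] [SMulCommClass ℝ ℂ F]
      (φ : 𝓢(E, F)), ContDiff ℝ l (fun x => ∫ y, k y • φ (x - m y) ∂μ) ∧
      ∀ j : ℕ, ∃ C, ∀ x, ‖x‖ ^ j *
        ‖iteratedFDeriv ℝ l (fun x => ∫ y, k y • φ (x - m y) ∂μ) x‖ ≤ C := by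
  induction l with
  | zero =>
    intro F _ _ _ _ φ
    refine ⟨contDiff_zero.2 (continuous_iff_continuousAt.2 fun x =>
      (hasFDerivAt_superposition hm hk0 φ x).continuousAt), fun j => ?_⟩
    set a := SchwartzMap.seminorm ℝ j 0 φ
    set b := SchwartzMap.seminorm ℝ 0 0 φ
    have hi : Integrable (fun y => 2 ^ (j - 1) * (‖k y‖ * a + ‖m y‖ ^ j * ‖k y‖ * b)) μ :=
      ((hk0.norm.mul_const a).add ((hk j).mul_const b)).const_mul _
    refine ⟨∫ y, 2 ^ (j - 1) * (‖k y‖ * a + ‖m y‖ ^ j * ‖k y‖ * b) ∂μ, fun x => ?_⟩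
    rw [norm_iteratedFDeriv_zero, ← Real.norm_of_nonneg (by positivity : 0 ≤ ‖x‖ ^ j),
      ← norm_smul, ← integral_smul]
    refine norm_integral_le_of_norm_le hi (.of_forall fun y => ?_)
    rw [norm_smul, norm_smul, Real.norm_of_nonneg (by positivity)]
    have h1 : ‖x‖ ^ j ≤ 2 ^ (j - 1) * (‖x - m y‖ ^ j + ‖m y‖ ^ j) :=
      (pow_le_pow_left₀ (norm_nonneg _) (by simpa using norm_add_le (x - m y) (m y)) j).trans
        (add_pow_le (norm_nonneg _) (norm_nonneg _) j)
    calc _ ≤ 2 ^ (j - 1) * (‖x - m y‖ ^ j + ‖m y‖ ^ j) * (‖k y‖ * ‖φ (x - m y)‖) := by gcongr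
      _ = 2 ^ (j - 1) * (‖k y‖ * (‖x - m y‖ ^ j * ‖φ (x - m y)‖)
          + ‖m y‖ ^ j * ‖k y‖ * ‖φ (x - m y)‖) := by ring
      _ ≤ _ := by
        gcongr
        · exact SchwartzMap.norm_pow_mul_le_seminorm ℝ φ j _
        · exact SchwartzMap.norm_le_seminorm ℝ φ _
  | succ l ih =>
    intro F _ _ _ _ φ
    have h := fun x => hasFDerivAt_superposition hm hk0 φ x
    have hf : fderiv ℝ (fun x => ∫ y, k y • φ (x - m y) ∂μ)
        = fun x => ∫ y, k y • SchwartzMap.fderivCLM ℝ E F φ (x - m y) ∂μ :=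
      funext fun x => (h x).fderiv
    obtain ⟨h1, h2⟩ := ih (SchwartzMap.fderivCLM ℝ E F φ)
    refine ⟨?_, fun j => ?_⟩
    · push_cast
      refine contDiff_succ_iff_fderiv.2 ⟨fun x => (h x).differentiableAt, by simp, ?_⟩
      rwa [hf]
    · obtain ⟨C, hC⟩ := h2 j
      refine ⟨C, fun x => ?_⟩
      rw [← norm_iteratedFDeriv_fderiv, hf]
      exact hC x

lemma exists_superposition (hm : Measurable m)
    (hk : ∀ j : ℕ, Integrable (fun y => ‖m y‖ ^ j * ‖k y‖) μ) (hkm : AEStronglyMeasurable k μ)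
    (φ : 𝓢(E, ℂ)) : ∃ Φ : 𝓢(E, ℂ), (∀ x, Φ x = ∫ y, k y * φ (x - m y) ∂μ) ∧
      ∀ x, fderiv ℝ Φ x = ∫ y, k y • fderiv ℝ φ (x - m y) ∂μ := by
  have hk0 : Integrable k μ := (integrable_norm_iff hkm).1 (by simpa using hk 0)
  refine ⟨⟨fun x => ∫ y, k y • φ (x - m y) ∂μ, contDiff_infty.2 fun l =>
    (superposition_decay hm hk hk0 l φ).1, fun j l => (superposition_decay hm hk hk0 l φ).2 j⟩,
    fun x => rfl, fun x => (hasFDerivAt_superposition hm hk0 φ x).fderiv⟩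

end

lemma integral_fderiv_segment (φ : 𝓢(Rn n, ℂ)) (x y : Rn n) :
    ∫ s in Icc (0 : ℝ) 1, fderiv ℝ φ (x - s • y) y = φ x - φ (x - y) := by
  have hd : ∀ s : ℝ, HasDerivAt (fun s : ℝ => -φ (x - s • y)) (fderiv ℝ φ (x - s • y) y) s := by
    intro s
    have h1 : HasDerivAt (fun s : ℝ => x - s • y) (-y) s := by
      simpa using ((hasDerivAt_id s).smul_const y).const_sub x
    have h2 := ((φ.hasFDerivAt (x - s • y)).comp_hasDerivAt s h1).neg
    rw [map_neg, neg_neg] at h2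
    exact h2
  have hc : Continuous fun s : ℝ => fderiv ℝ φ (x - s • y) y := by
    have := (SchwartzMap.fderivCLM ℝ (Rn n) ℂ φ).continuous
    exact (this.comp (by fun_prop)).clm_apply continuous_const
  rw [integral_Icc_eq_integral_Ioc, ← intervalIntegral.integral_of_le zero_le_one,
    intervalIntegral.integral_eq_sub_of_hasDerivAt (fun s _ => hd s) (hc.intervalIntegrable _ _)]
  simp
  ring

lemma sum_coord_smul_dirX (y : Rn n) : ∑ i, y i • dirX i = y := by
  have := (EuclideanSpace.basisFun (Fin n) ℝ).sum_repr y
  simpa [dirX] using this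

/-- A tempered distribution that annihilates derivatives has a symmetric pairing with
convolutions, hence is a constant. -/
lemma exists_conv {D : 𝓢'(Rn n, ℂ)} (hD : ∀ (i : Fin n) (φ : 𝓢(Rn n, ℂ)), D (∂_{dirX i} φ) = 0)
    (φ ρ : 𝓢(Rn n, ℂ)) : ∃ c : 𝓢(Rn n, ℂ), (∀ x, c x = ∫ y, ρ y * φ (x - y)) ∧
      D c = (∫ y, ρ y) * D φ := by
  have hρ : ∀ j : ℕ, Integrable fun y => ‖y‖ ^ j * ‖ρ y‖ := fun j => ρ.integrable_pow_mul volume j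
  obtain ⟨c, hc, -⟩ := exists_superposition (μ := (volume : Measure (Rn n))) (m := id)
    measurable_id hρ ρ.continuous.aestronglyMeasurable φ
  refine ⟨c, hc, ?_⟩
  set μ : Measure (ℝ × Rn n) := (volOn (Icc (0 : ℝ) 1)).prod volume
  have hμ : ∀ᵐ z ∂μ, z.1 ∈ Icc (0 : ℝ) 1 :=
    Measure.quasiMeasurePreserving_fst.ae (ae_restrict_mem measurableSet_Icc)
  have hkm : ∀ i, AEStronglyMeasurable (fun z : ℝ × Rn n => ((z.2 i : ℝ) : ℂ) * ρ z.2) μ :=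
    fun i => (Continuous.mul (by fun_prop) (ρ.continuous.comp continuous_snd)).aestronglyMeasurable
  have hms : Measurable fun z : ℝ × Rn n => z.1 • z.2 := by fun_prop
  have hk : ∀ i, ∀ j : ℕ, Integrable (fun z : ℝ × Rn n =>
      ‖z.1 • z.2‖ ^ j * ‖((z.2 i : ℝ) : ℂ) * ρ z.2‖) μ := by
    intro i j
    refine ((hρ (j + 1)).comp_snd (volOn (Icc (0 : ℝ) 1))).mono'
      ((hms.norm.pow_const j).aestronglyMeasurable.mul (hkm i).norm) ?_
    filter_upwards [hμ] with z hz
    rw [Real.norm_of_nonneg (by positivity), norm_mul, Complex.norm_real, norm_smul, pow_succ,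
      mul_assoc]
    have h1 : ‖z.1‖ ≤ 1 := by rw [Real.norm_of_nonneg hz.1]; exact hz.2
    gcongr
    · exact mul_le_of_le_one_left (norm_nonneg _) h1
    · exact PiLp.norm_apply_le z.2 i
  choose Φ hΦ hΦd using fun i => exists_superposition hms (hk i) (hkm i) φ
  have hfb : Continuous (fderiv ℝ φ) := (SchwartzMap.fderivCLM ℝ (Rn n) ℂ φ).continuous
  have hfm : ∀ x, Continuous fun z : ℝ × Rn n => fderiv ℝ φ (x - z.1 • z.2) := fun x =>
    hfb.comp (by fun_prop)
  set B := SchwartzMap.seminorm ℝ 0 0 (SchwartzMap.fderivCLM ℝ (Rn n) ℂ φ)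
  have hB : ∀ x, ‖fderiv ℝ φ x‖ ≤ B := fun x =>
    SchwartzMap.norm_le_seminorm ℝ (SchwartzMap.fderivCLM ℝ (Rn n) ℂ φ) x
  have hi : ∀ x i, Integrable (fun z : ℝ × Rn n =>
      (((z.2 i : ℝ) : ℂ) * ρ z.2) • fderiv ℝ φ (x - z.1 • z.2)) μ := by
    intro x i
    refine ((hk i 0).mul_const B).mono' ((hkm i).smul (hfm x).aestronglyMeasurable)
      (.of_forall fun z => ?_)
    rw [norm_smul, pow_zero, one_mul]
    gcongr
    exact hB _
  have hsum : ∑ i, ∂_{dirX i} (Φ i) = (∫ y, ρ y) • φ - c := by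
    ext x
    have e1 : (∑ i, ∂_{dirX i} (Φ i)) x = ∑ i, fderiv ℝ (Φ i) x (dirX i) := by
      simp only [← SchwartzMap.toBoundedContinuousFunctionCLM_apply ℝ, map_sum,
        BoundedContinuousFunction.sum_apply]
      rfl
    have e2 : ∀ i, fderiv ℝ (Φ i) x (dirX i)
        = ∫ z, ((((z.2 i : ℝ) : ℂ) * ρ z.2) • fderiv ℝ φ (x - z.1 • z.2)) (dirX i) ∂μ := fun i => by
      rw [hΦd, ContinuousLinearMap.integral_apply (hi x i)]
    have e3 : ∀ z : ℝ × Rn n, ∑ i, ((((z.2 i : ℝ) : ℂ) * ρ z.2) • fderiv ℝ φ (x - z.1 • z.2))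
        (dirX i) = ρ z.2 * fderiv ℝ φ (x - z.1 • z.2) z.2 := by
      intro z
      have h : fderiv ℝ φ (x - z.1 • z.2) z.2
          = ∑ i, fderiv ℝ φ (x - z.1 • z.2) (z.2 i • dirX i) := by
        rw [← map_sum, sum_coord_smul_dirX]
      rw [h, Finset.mul_sum]
      refine Finset.sum_congr rfl fun i _ => ?_
      simp only [_root_.smul_apply, map_smul, smul_eq_mul, Complex.real_smul]
      ring
    have hint : Integrable (fun z : ℝ × Rn n => ρ z.2 * fderiv ℝ φ (x - z.1 • z.2) z.2) μ := by
      have := integrable_finsetSum Finset.univ fun i _ => (hi x i).apply_continuousLinearMap (dirX i)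
      simpa only [e3] using this
    rw [e1, Finset.sum_congr rfl fun i _ => e2 i, ← integral_finsetSum _ fun i _ =>
      (hi x i).apply_continuousLinearMap (dirX i)]
    simp only [e3]
    rw [integral_prod_symm _ hint]
    simp only [integral_const_mul, integral_fderiv_segment, mul_sub]
    have hρi : Integrable fun y => ρ y * φ (x - y) := by
      refine (ρ.integrable.norm.mul_const (SchwartzMap.seminorm ℝ 0 0 φ)).mono'
        (ρ.continuous.mul (φ.continuous.comp (by fun_prop))).aestronglyMeasurable
        (.of_forall fun y => ?_)
      rw [norm_mul]
      gcongr
      exact SchwartzMap.norm_le_seminorm ℝ φ _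
    rw [integral_sub (ρ.integrable.mul_const _) hρi, integral_mul_const]
    exact congrArg (_ - ·) (hc x).symm
  have h0 : D (∑ i, ∂_{dirX i} (Φ i)) = 0 := by
    rw [map_sum]
    exact Finset.sum_eq_zero fun i _ => hD i (Φ i)
  rw [hsum, map_sub, map_smul, smul_eq_mul, sub_eq_zero] at h0
  exact h0.symm

lemma exists_eq_const_mul_integral {D : 𝓢'(Rn n, ℂ)}
    (hD : ∀ (i : Fin n) (φ : 𝓢(Rn n, ℂ)), D (∂_{dirX i} φ) = 0) : ∃ c : ℂ, ∀ φ : 𝓢(Rn n, ℂ),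
      D φ = c * ∫ x, φ x := by
  set b : Rn n → ℂ := fun x => (((bump (Rn n) 0).normed volume x : ℝ) : ℂ)
  have hbc : HasCompactSupport b :=
    (bump (Rn n) 0).hasCompactSupport_normed.comp_left (g := fun r : ℝ => (r : ℂ)) (by simp)
  set ρ : 𝓢(Rn n, ℂ) := hbc.toSchwartzMap
    (Complex.ofRealCLM.contDiff.comp (bump (Rn n) 0).contDiff_normed)
  have hρ : ∫ y, ρ y = 1 := by
    change ∫ y, (((bump (Rn n) 0).normed volume y : ℝ) : ℂ) = 1
    rw [integral_complex_ofReal, (bump (Rn n) 0).integral_normed]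
    simp
  refine ⟨D ρ, fun φ => ?_⟩
  obtain ⟨c₁, h1, h1'⟩ := exists_conv hD φ ρ
  obtain ⟨c₂, h2, h2'⟩ := exists_conv hD ρ φ
  have : c₁ = c₂ := by
    ext x
    rw [h1, h2, ← integral_sub_left_eq_self _ volume x]
    simp only [sub_sub_cancel]
    exact integral_congr_ae (.of_forall fun y => mul_comm _ _)
  rw [hρ, one_mul] at h1'
  rw [← h1', this, h2', mul_comm]

/-- A function with a polynomially weighted integral is a tempered distribution. -/
lemma exists_represents {f : Rn n → ℂ} (hf : AEStronglyMeasurable f) (k : ℕ)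
    (h : Integrable fun x => ‖f x‖ * ((1 + ‖x‖) ^ k)⁻¹) :
    ∃ T : 𝓢'(Rn n, ℂ), Represents f T := by
  set S := fun φ : 𝓢(Rn n, ℂ) => 2 ^ k *
    (Finset.Iic (k, 0)).sup (fun m => SchwartzMap.seminorm ℂ m.1 m.2) φ
  have hb : ∀ (φ : 𝓢(Rn n, ℂ)) x, ‖f x * φ x‖ ≤ ‖f x‖ * ((1 + ‖x‖) ^ k)⁻¹ * S φ := by
    intro φ x
    have h1 := SchwartzMap.one_add_le_sup_seminorm_apply (𝕜 := ℂ) (m := (k, 0)) le_rfl le_rfl φ x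
    rw [norm_iteratedFDeriv_zero] at h1
    rw [norm_mul, mul_assoc]
    gcongr
    rw [inv_mul_eq_div, le_div_iff₀ (by positivity), mul_comm]
    exact h1
  have hi : ∀ φ : 𝓢(Rn n, ℂ), Integrable fun x => f x * φ x := fun φ =>
    (h.mul_const (S φ)).mono' (hf.mul φ.continuous.aestronglyMeasurable) (.of_forall (hb φ))
  set I := ∫ x, ‖f x‖ * ((1 + ‖x‖) ^ k)⁻¹
  have hI : 0 ≤ I := integral_nonneg fun x => by positivity
  refine ⟨ContinuousLinearMap.toPointwiseConvergenceCLM _ _ _ _ (SchwartzMap.mkCLMtoNormedSpace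
    (fun φ => ∫ x, f x * φ x) (fun φ ψ => ?_) (fun a φ => ?_)
    ⟨Finset.Iic (k, 0), I * 2 ^ k, by positivity, fun φ => ?_⟩), fun φ => ⟨hi φ, rfl⟩⟩
  · rw [← integral_add (hi φ) (hi ψ)]
    simp [mul_add]
  · rw [RingHom.id_apply, smul_eq_mul, ← integral_const_mul]
    simp [mul_left_comm]
  · rw [mul_assoc, ← integral_mul_const]
    exact norm_integral_le_of_norm_le (h.mul_const (S φ)) (.of_forall (hb φ))

/-! ### Boundary behaviour for `p ≤ 1` -/

section

variable {C₀ p : ℝ} {u : Rn1 n → ℂ} {G : VF n}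

lemma exists_rms_rpow_le (hσ : σ = 1 ∨ σ = -1) (hp : 0 < p) (G : VF n)
    (hN : ∫⁻ x, ntMax σ G x ^ p ≠ ⊤) : ∃ κ : ℝ, 0 < κ ∧ ∀ X ∈ halfSpace n σ,
      rms G (eball X (σ * X.2 / 4)) ^ p ≤ ofReal (κ * (σ * X.2) ^ (-(n : ℝ))) := by
  set I := ∫⁻ x, ntMax σ G x ^ p
  set v := (volume (ball (0 : Rn n) 1))
  have hv0 : v ≠ 0 := (measure_ball_pos volume _ one_pos).ne'
  have hvt : v ≠ ⊤ := measure_ball_lt_top.ne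
  have hv : 0 < v.toReal := ENNReal.toReal_pos hv0 hvt
  refine ⟨(I.toReal + 1) * 2 ^ n / v.toReal, by positivity, fun X hX => ?_⟩
  have hs : 0 < σ * X.2 := hX
  have hB : volume (cB X.1 (σ * X.2 / 2))
      = ofReal ((σ * X.2 / 2) ^ n * v.toReal) := by
    rw [Measure.addHaar_closedBall _ _ (by positivity), finrank_euclideanSpace_fin,
      ofReal_mul (by positivity), ofReal_toReal hvt]
  have h1 : rms G (eball X (σ * X.2 / 4)) ^ p * volume (cB X.1 (σ * X.2 / 2))
      ≤ I := by
    rw [← setLIntegral_const]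
    refine (setLIntegral_mono (measurable_ntMax σ G |>.pow_const p) fun y hy => ?_).trans
      (setLIntegral_le_lintegral (cB X.1 (σ * X.2 / 2)) _)
    refine rpow_le_rpow (rms_le_ntMax hσ G (x₀ := X.1) (t := X.2) ?_) hp.le
    rw [← dist_eq_norm]
    exact (mem_closedBall.1 hy).trans_lt (by linarith)
  rw [hB] at h1
  have h2 : 0 < (σ * X.2 / 2) ^ n * v.toReal := by positivity
  calc _ ≤ I / ofReal ((σ * X.2 / 2) ^ n * v.toReal) :=
        (ENNReal.le_div_iff_mul_le (Or.inl (by simpa using h2)) (Or.inl ofReal_ne_top)).2 h1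
    _ ≤ ofReal (I.toReal + 1) / ofReal ((σ * X.2 / 2) ^ n * v.toReal) := by
        gcongr
        rw [← ofReal_toReal hN]
        exact ofReal_le_ofReal (by simp [I])
    _ = _ := by
        rw [← ofReal_div_of_pos h2, Real.rpow_neg hs.le, Real.rpow_natCast, div_pow]
        congr 1
        field_simp

lemma exists_holder_trace (hC₀ : 0 < C₀) (hs : HalfSol C₀ σ u G)
    (hp : (n : ℝ) / (n + 1) < p) (hp1 : p ≤ 1) (hN : ∫⁻ x, ntMax σ G x ^ p ≠ ⊤) :
    ∃ θ D : ℝ, 0 < θ ∧ ∀ y, ntMax σ G y ≠ ⊤ → ∀ Z ∈ cone σ y,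
      ‖u Z - trace σ u y‖ ≤ D * (ntMax σ G y ^ p).toReal * (σ * Z.2) ^ θ := by
  have hp0 : 0 < p := lt_of_le_of_lt (by positivity) hp
  obtain ⟨κ, hκ, hr⟩ := exists_rms_rpow_le hs.1 hp0 G hN
  obtain ⟨C, hC⟩ := exists_cone_oscillation n hC₀
  set q := 1 / p - 1 with hq
  have hq0 : 0 ≤ q := by
    have := (one_le_div hp0).2 hp1
    linarith
  have hθ : 0 < 1 - n * q := by
    rw [div_lt_iff₀ (by positivity)] at hp
    have : 1 - n * q = (p * (n + 1) - n) / p := by rw [hq]; field_simp; ring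
    rw [this]
    exact div_pos (by linarith) hp0
  refine ⟨1 - n * q, C * κ ^ q / (1 - 2⁻¹ ^ (1 - n * q)), hθ, fun y hy Z hZ => ?_⟩
  have hNy : ntMax σ G y ^ p ≠ ⊤ := rpow_ne_top_of_nonneg hp0.le hy
  have h1 := trace_spec hs.1 (u := u) (y := y) (K := C * κ ^ q * (ntMax σ G y ^ p).toReal) hθ (by
    intro τ hτ Z hZ Z' hZ' h1 h2 h3 h4
    have hM : ∀ X ∈ cone σ y, τ ≤ σ * X.2 → rms G (eball X (σ * X.2 / 4)) ≤
        ntMax σ G y ^ p * ofReal (κ * τ ^ (-(n : ℝ))) ^ q := by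
      intro X hX hτX
      have hX' : ‖y - X.1‖ < σ * X.2 := hX
      have e : rms G (eball X (σ * X.2 / 4)) = rms G (eball X (σ * X.2 / 4)) ^ p
          * (rms G (eball X (σ * X.2 / 4)) ^ p) ^ q := by
        rw [← rpow_mul, ← ENNReal.rpow_add_of_nonneg _ _ hp0.le (by positivity),
          show p + p * q = 1 by rw [hq]; field_simp; ring, rpow_one]
      rw [e]
      have hX0 : X ∈ halfSpace n σ := hτ.trans_le hτX
      gcongr
      · exact rms_le_ntMax hs.1 G hX'
      · refine (hr X hX0).trans (ofReal_le_ofReal ?_)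
        gcongr κ * ?_
        exact Real.rpow_le_rpow_of_nonpos hτ hτX (by simp)
    have h5 := hC hs y τ _ hτ hM Z hZ Z' hZ' h1 h2 h3 h4
    rw [← ofReal_toReal hNy, ENNReal.ofReal_rpow_of_nonneg (by positivity) hq0,
      ← ofReal_mul toReal_nonneg, ← ofReal_coe_nnreal,
      ← ofReal_mul (by positivity), ← ofReal_mul (by positivity),
      ← ofReal_norm, ofReal_le_ofReal_iff (by positivity),
      Real.mul_rpow hκ.le (by positivity), ← Real.rpow_mul hτ.le] at h5
    refine h5.trans_eq ?_
    rw [sub_eq_add_neg, Real.rpow_add hτ, Real.rpow_one, neg_mul]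
    ring) Z hZ
  refine h1.trans_eq ?_
  ring

lemma exists_linear_growth (hC₀ : 0 < C₀) (hs : HalfSol C₀ σ u G) (hp : 0 < p)
    (hN : ∫⁻ x, ntMax σ G x ^ p ≠ ⊤) : ∃ D : ℝ, 0 ≤ D ∧ ∀ x, ‖u (x, σ)‖ ≤ D * (1 + ‖x‖) := by
  obtain ⟨κ, hκ, hr⟩ := exists_rms_rpow_le hs.1 hp G hN
  obtain ⟨C, hC⟩ := exists_local_oscillation n hC₀
  have hss := sign_mul_self hs.1
  set d : ℝ := C * κ ^ (1 / p)
  have hd : 0 ≤ d := by positivity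
  have hloc : ∀ x ∈ univ, ∀ y ∈ univ, dist y x ≤ 1 / 16 →
      ‖u (y, σ) - u (x, σ)‖ₑ ≤ ofReal d := by
    intro x _ y _ hxy
    have hX : ((x, σ) : Rn1 n) ∈ halfSpace n σ := by
      change 0 < σ * σ
      rw [hss]; exact one_pos
    have h1 := hC hs (x, σ) hX (y, σ) (by
      rw [mem_closedBall, Prod.dist_eq, dist_self, hss]
      exact max_le hxy (by norm_num))
    have h2 := hr (x, σ) hX
    simp only [hss, ofReal_one, mul_one, Real.one_rpow] at h1 h2
    refine h1.trans ?_
    rw [ofReal_mul (by positivity), ofReal_coe_nnreal, ← ENNReal.ofReal_rpow_of_pos hκ]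
    refine mul_le_mul_right ?_ _
    rwa [one_div p, ENNReal.le_rpow_inv_iff hp]
  have hch := fun m : ℕ => enorm_sub_le_of_chain (u := fun x : Rn n => u (x, σ)) convex_univ hloc m
  refine ⟨‖u (0, σ)‖ + 16 * d + d, by positivity, fun x => ?_⟩
  have h1 := hch ⌈16 * ‖x‖⌉₊ x trivial 0 trivial (by
    rw [dist_zero_right]
    linarith [Nat.le_ceil (16 * ‖x‖)])
  rw [← ENNReal.ofReal_natCast, ← ofReal_mul (by positivity), ← ofReal_norm,
    ofReal_le_ofReal_iff (by positivity)] at h1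
  have h2 := (Nat.ceil_lt_add_one (by positivity : 0 ≤ 16 * ‖x‖)).le
  have h3 : (⌈16 * ‖x‖⌉₊ : ℝ) * d ≤ (16 * ‖x‖ + 1) * d := by gcongr
  have h4 := norm_le_norm_add_norm_sub' (u (x, σ)) (u (0, σ))
  nlinarith [norm_nonneg x, norm_nonneg (u (0, σ)), mul_nonneg (norm_nonneg x) hd,
    mul_nonneg (norm_nonneg x) (norm_nonneg (u (0, σ)))]

lemma exists_trace_eq_modConst (hC₀ : 0 < C₀) (hs : HalfSol C₀ σ u G)
    (hp : (n : ℝ) / (n + 1) < p) (hp1 : p ≤ 1) (hN : pNorm p (ntMax σ G) < ⊤) {h : 𝓢'(Rn n, ℂ)}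
    (hh : HardySobolev p h) (hlim : SliceGradTendsto σ u h) :
    ∃ (f : Rn n → ℂ) (T : 𝓢'(Rn n, ℂ)),
      NTLimit σ u f ∧ Represents f T ∧ HardySobolev p T ∧ EqModConst T h := by
  have ⟨hσ, _, _, _, _, hc⟩ := hs
  have hp0 : 0 < p := lt_of_le_of_lt (by positivity) hp
  have hNp := lintegral_rpow_ne_top_of_pNorm hp0 hN
  have hne := toZero_neBot hσ
  have hNm := measurable_ntMax σ G
  have hNf := (memLp_toReal hNm hp0 hNp).1
  obtain ⟨θ, D, hθ, hest⟩ := exists_holder_trace hC₀ hs hp hp1 hNp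
  obtain ⟨D', hD', hgr⟩ := exists_linear_growth hC₀ hs hp0 hNp
  set f := trace σ u
  set M : Rn n → ℝ := fun x => D * (ntMax σ G x ^ p).toReal
  have hM : Integrable M :=
    (integrable_toReal_of_lintegral_ne_top (hNm.pow_const p).aemeasurable hNp).const_mul D
  have hnt : NTLimit σ u f := hNf.mono fun y hy => tendsto_cone_of_norm_sub_le hθ (hest y hy)
  have hfm : AEStronglyMeasurable f := aestronglyMeasurable_trace hσ hc hnt
  have hest' : ∀ᵐ x, ∀ t, 0 < σ * t → ‖u (x, t) - f x‖ ≤ M x * (σ * t) ^ θ :=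
    hNf.mono fun x hx t ht => hest x hx (x, t) (by simpa [cone] using ht)
  have hw : Integrable fun x => ‖f x‖ * ((1 + ‖x‖) ^ (n + 2))⁻¹ := by
    have h1 : Integrable fun x : Rn n => (1 + ‖x‖) ^ (-((n : ℝ) + 1)) :=
      integrable_one_add_norm (by simp)
    refine ((h1.const_mul D').add hM).mono' (by
      refine hfm.norm.mul (Continuous.aestronglyMeasurable ?_)
      exact Continuous.inv₀ (by fun_prop) fun x => by positivity) ?_
    filter_upwards [hest'] with x hx
    have h2 := hx σ (by rw [sign_mul_self hσ]; exact one_pos)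
    rw [sign_mul_self hσ, Real.one_rpow, mul_one] at h2
    have hM0 : 0 ≤ M x := (norm_nonneg _).trans h2
    have h3 : ‖f x‖ ≤ D' * (1 + ‖x‖) + M x := by
      have := norm_le_norm_add_norm_sub (u (x, σ)) (f x)
      linarith [hgr x]
    have h4 : (1 : ℝ) ≤ (1 + ‖x‖) ^ (n + 2) := one_le_pow₀ (by linarith [norm_nonneg x])
    rw [Real.norm_of_nonneg (by positivity), Pi.add_apply, Real.rpow_neg (by positivity),
      show (n : ℝ) + 1 = ((n + 1 : ℕ) : ℝ) by push_cast; rfl, Real.rpow_natCast]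
    calc _ ≤ (D' * (1 + ‖x‖) + M x) * ((1 + ‖x‖) ^ (n + 2))⁻¹ := by gcongr
      _ = D' * ((1 + ‖x‖) ^ (n + 1))⁻¹ + M x * ((1 + ‖x‖) ^ (n + 2))⁻¹ := by
        have : 1 + ‖x‖ ≠ 0 := by positivity
        field_simp
        ring
      _ ≤ _ := by
        gcongr
        exact mul_le_of_le_one_right hM0 (inv_le_one_of_one_le₀ h4)
  obtain ⟨T, hT⟩ := exists_represents hfm (n + 2) hw
  have hTh : ∀ (i : Fin n) (φ : 𝓢(Rn n, ℂ)), T (∂_{dirX i} φ) = h (∂_{dirX i} φ) := by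
    intro i φ
    set ψ : 𝓢(Rn n, ℂ) := ∂_{dirX i} φ
    have h1 := tendsto_integral_slice hc hθ hfm hest' ψ.continuous.aestronglyMeasurable
      (hM.mul_bdd (c := SchwartzMap.seminorm ℝ 0 0 ψ) ψ.continuous.norm.aestronglyMeasurable
        (.of_forall fun x => by rw [norm_norm]; exact SchwartzMap.norm_le_seminorm ℝ ψ x)) (hT ψ).1
    have h2 := (hlim i φ).neg
    simp only [neg_neg] at h2
    rw [(hT ψ).2]
    exact tendsto_nhds_unique h1 h2
  refine ⟨f, T, hnt, hT, ?_, ?_⟩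
  · obtain ⟨lam, a, F, h1, h2, h3⟩ := hh
    exact ⟨lam, a, F, h1, h2, fun i => by simpa only [hTh i] using h3 i⟩
  · obtain ⟨c, hc⟩ := exists_eq_const_mul_integral (D := T - h) fun i φ => by
      rw [_root_.sub_apply, hTh, sub_self]
    exact ⟨c, fun φ => by rw [← hc φ, _root_.sub_apply]; ring⟩

end

end LayerPot

end

theorem lemma5p2 (n : ℕ) (hn : 2 ≤ n) (Λ C₀ α : ℝ) (hΛ : 0 < Λ) (hC₀ : 0 < C₀)
    (hα : 0 < α) (hα1 : α ≤ 1) :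
    ∃ ε : ℝ, 0 < ε ∧
      (∀ p : ℝ, 1 < p → p < 2 + ε → ∃ C : ℝ≥0,
        ∀ (A : LayerPot.Coeff n), LayerPot.Standard A Λ C₀ α →
          LayerPot.Standard (LayerPot.adjCoeff A) Λ C₀ α →
        ∀ σ : ℝ, σ = 1 ∨ σ = -1 →
        ∀ (u : LayerPot.Rn1 n → ℂ) (G : LayerPot.Rn1 n → LayerPot.Cv (n + 1)),
          LayerPot.IsSolution A (LayerPot.halfSpace n σ) u G →
          ContinuousOn u (LayerPot.halfSpace n σ) →
          LayerPot.pNorm p (LayerPot.ntMax σ G) < ⊤ →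
          ∃ (V : ℝ → LayerPot.Rn n → LayerPot.Cv (n + 1))
            (g f : LayerPot.Rn n → ℂ) (F : LayerPot.Rn n → LayerPot.Cv n),
            (∀ t : ℝ, 0 < σ * t → LayerPot.IsSliceGrad u t (V t)) ∧
            LayerPot.IsVarConormal A σ p G g ∧
            LayerPot.HomSobolev (ENNReal.ofReal p) f F ∧
            LayerPot.NTLimit σ u f ∧
            (⨆ (t : ℝ) (_ : 0 < σ * t), eLpNorm (V t) (ENNReal.ofReal p) volume) ≤
              (C : ℝ≥0∞) * LayerPot.pNorm p (LayerPot.ntMax σ G) ∧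
            LayerPot.WeakLp p (fun t => LayerPot.conormal A (V t)) (LayerPot.toZero σ) g ∧
            ∀ i : Fin n, LayerPot.WeakLp p (fun t x => V t x i.castSucc)
              (LayerPot.toZero σ) (fun x => F x i)) ∧
      (∀ p : ℝ, (n : ℝ) / (n + 1) < p → p ≤ 1 →
        ∀ (A : LayerPot.Coeff n), LayerPot.Standard A Λ C₀ α →
          LayerPot.Standard (LayerPot.adjCoeff A) Λ C₀ α →
        ∀ σ : ℝ, σ = 1 ∨ σ = -1 →
        ∀ (u : LayerPot.Rn1 n → ℂ) (G : LayerPot.Rn1 n → LayerPot.Cv (n + 1)),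
          LayerPot.IsSolution A (LayerPot.halfSpace n σ) u G →
          ContinuousOn u (LayerPot.halfSpace n σ) →
          LayerPot.pNorm p (LayerPot.ntMax σ G) < ⊤ →
        ∀ h : 𝓢'(LayerPot.Rn n, ℂ), LayerPot.HardySobolev p h →
          LayerPot.SliceGradTendsto σ u h →
          ∃ (f : LayerPot.Rn n → ℂ) (T : 𝓢'(LayerPot.Rn n, ℂ)),
            LayerPot.NTLimit σ u f ∧ LayerPot.Represents f T ∧
            LayerPot.HardySobolev p T ∧ LayerPot.EqModConst T h) := by
  obtain ⟨ε, hε, h⟩ := LayerPot.boundary_behaviour n (by omega) hΛ hC₀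
  refine ⟨ε, hε, fun p hp hpε => ?_, fun p hp hp1 A hA _ σ hσ u G hu hc hN θ hh hlim =>
    LayerPot.exists_trace_eq_modConst hC₀ ⟨hσ, A, α, hA.dgnm, hu, hc⟩ hp hp1 hN hh hlim⟩
  obtain ⟨C, hC⟩ := h p hp hpε
  exact ⟨C, fun A hA _ σ hσ u G hu hc hN => hC A α hα hA σ hσ u G hu hc hN⟩
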